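/- Let $f:\mathbb{R}^n\times\mathbb{R}^d\to\mathbb{R}^n$ and $\Lambda:\mathbb{R}\to\mathbb{R}^d$ be $C^1$, let $\lambda^\pm=\lim_{\tau\to\pm\infty}\Lambda(\tau)$, and suppose that for some $\rho>0$ the limits $\lim_{\tau\to\pm\infty}\Lambda'(\tau)/e^{\mp\rho\tau}$ exist. Fix $0<\alpha<\rho$. For a rate $r>0$ consider the nonautonomous system $$x'=f(x,\Lambda(\tau))/r,\qquad(1)$$ and, with $g_\alpha(\tau)=\tanh(\alpha\tau/2)$, $\Lambda_\alpha(s)=\Lambda(g_\alpha^{-1}(s))$ for $|s|<1$ and $\Lambda_\alpha(\pm1)=\lambda^\pm$, the compactified system on $\mathbb{R}^n\times[-1,1]$ $$x'=f(x,\Lambda_\alpha(s))/r,\qquad s'=\alpha(1-s^2)/2.\qquad(2)$$ (a) Let $e^-$ be a hyperbolic sink of $\dot x=f(x,\lambda^-)$. Then there is $\tau_0\in\mathbb{R}$, independent of $r$, such that for every $r>0$ system (1) has on $(-\infty,\tau_0)$ a solution $x^{[r]}(\tau,e^-)$ that tends to $e^-$ as $\tau\to-\infty$ and is a local pullback attractor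 (for some bounded open set $U$ it lies in $U$ for all sufficiently negative $\tau$, and, for each fixed sufficiently negative $\tau$, the value at time $\tau$ of the solution started from $y\in U$ at time $s$ exists for $s$ sufficiently negative and tends to $x^{[r]}(\tau,e^-)$ as $s\to-\infty$, uniformly in $y\in U$). It is unique: every solution of (1) on some $(-\infty,\tau_1)$, $\tau_1\le\tau_0$, that tends to $e^-$ as $\tau\to-\infty$ agrees with it there. Moreover, $\tilde e^-=(e^-,-1)$ is a hyperbolic equilibrium of (2) with one unstable and $n$ stable directions (a saddle), its unstable manifold $W^{u,[r]}_\alpha(\tilde e^-)$ in $\mathbb{R}^n\times[-1,1]$ is a one-dimensional $C^1$ curve, the graph of a $C^1$ function of $s\in[-1,b)$ for some $b\in(-1,1]$, and for every $\tau<\tau_0$ its section at $s=g_\alpha(\tau)$ is exactly $\{x^{[r]}(\tau,e^-)\}$. (b) Let $\eta^+$ be an equilibrium regular edge state of $\dot x=f(x,\lambda^+)$, that is, a hyperbolic equilibrium with exactly one unstable direction, and let $\tilde\eta^+=(\eta^+,1)$. (b1) There is $\tau_0\in\mathbb{R}$, independent of $r$, such that for every $r>0$ there is a regular R-tipping threshold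 $\Theta^{[r]}(\tau)$, $\tau>\tau_0$, anchored at infinity by $\eta^+$: each $\Theta^{[r]}(\tau)$ is a nonempty embedded orientable codimension-one $C^1$ submanifold of $\mathbb{R}^n$, and each solution of (1) with $x(\tau_1)\in\Theta^{[r]}(\tau_1)$, $\tau_1>\tau_0$, exists and satisfies $x(\tau)\in\Theta^{[r]}(\tau)$ for all $\tau>\tau_1$, and tends to $\eta^+$ as $\tau\to+\infty$. It can be chosen so that, for all $\tau>\tau_0$, $\Theta^{[r]}(\tau)$ is the section at $s=g_\alpha(\tau)$ of a local stable manifold of $\tilde\eta^+$ (the points whose forward trajectory under (2) stays in a certain open neighbourhood of $\tilde\eta^+$ and converges to $\tilde\eta^+$), which is an embedded orientable codimension-one $C^1$ submanifold of $\mathbb{R}^n\times[-1,1]$ transverse to the slices $s=\mathrm{const}$. (b2) For every $r>0$, $\tilde\eta^+$ is a hyperbolic equilibrium of (2) with one unstable and $n$ stable directions (a saddle), its unstable manifold consists of $\tilde\eta^+$ and exactly two nontrivial orbits (branches), and for every regular R-tipping threshold $\Theta^{[r]}(\tau)$, $\tau>\tau_1$, anchored at infinity by $\eta^+$, $$\{(x,g_\alpha(\tau)):x\in\Theta^{[r]}(\tau),\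 \tau>\tau_1\}\subset W^{s,[r]}_\alpha(\tilde\eta^+).$$ (b3) For $r>0$ let $x^{[r]}(\tau)$ be either the solution of (1) from a fixed $(x_0,\tau_0)$, or the solution of (1) that tends to a fixed hyperbolic sink $e^-$ of $\dot x=f(x,\lambda^-)$ as $\tau\to-\infty$. Suppose that $r_c>0$ is a critical rate: $x^{[r_c]}(\tau)\to\eta^+$ as $\tau\to+\infty$, while for some $\delta>0$ this fails for all $r>0$ with $0<|r-r_c|<\delta$. Then each of the edge tails $$x^{[r_c^+]}=\bigcap_{T,\delta>0}\overline{\{x^{[r]}(\tau):\tau>T,\ r_c<r<r_c+\delta\}},\qquad x^{[r_c^-]}=\bigcap_{T,\delta>0}\overline{\{x^{[r]}(\tau):\tau>T,\ r_c-\delta<r<r_c\}}$$ (over those $\tau$ for which the solution exists), embedded in $\mathbb{R}^n\times\{1\}$, contains a branch of the unstable manifold of $\tilde\eta^+$ for (2). -/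

import Mathlib

open Set Filter Topology

noncomputable section

namespace RTip

/-- The Euclidean space `ℝᵏ`. -/
abbrev Vec (k : ℕ) : Type := EuclideanSpace ℝ (Fin k)

variable {n d : ℕ}

/-! ### External inputs and the nonautonomous system -/

/-- `Λ` is exponentially bi-asymptotically constant with decay coefficient `ρ`, past limit `lm`
and future limit `lp`: `Λ'(τ) / exp (∓ρτ)` has a (finite) limit as `τ → ±∞`. -/
structure IsExpBiAsymptoticallyConstant (Λ : ℝ → Vec d) (ρ : ℝ) (lm lp : Vec d) : Prop where
  rho_pos : 0 < ρ
  tendsto_past : Tendsto Λ atBot (𝓝 lm)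
  tendsto_future : Tendsto Λ atTop (𝓝 lp)
  decay_past : ∃ v, Tendsto (fun τ => (Real.exp (ρ * τ))⁻¹ • deriv Λ τ) atBot (𝓝 v)
  decay_future : ∃ v, Tendsto (fun τ => (Real.exp (-ρ * τ))⁻¹ • deriv Λ τ) atTop (𝓝 v)

/-- `x` solves `x' = f(x, Λ(τ)) / r` on the time set `I`. -/
def IsSol (f : Vec n → Vec d → Vec n) (Λ : ℝ → Vec d) (r : ℝ) (I : Set ℝ) (x : ℝ → Vec n) :
    Prop :=
  ∀ τ ∈ I, HasDerivWithinAt x (r⁻¹ • f (x τ) (Λ τ)) I τ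

/-! ### Equilibria of the frozen system -/

/-- The complex eigenvalues of a real linear map, with algebraic multiplicity. -/
def eigs {V : Type*} [NormedAddCommGroup V] [NormedSpace ℝ V] [FiniteDimensional ℝ V]
    (A : V →L[ℝ] V) : Multiset ℂ :=
  (LinearMap.charpoly (A : V →ₗ[ℝ] V)).aroots ℂ

/-- The number of eigenvalues with positive real part (with multiplicity). -/
def unstableIndex {V : Type*} [NormedAddCommGroup V] [NormedSpace ℝ V] [FiniteDimensional ℝ V]
    (A : V →L[ℝ] V) : ℕ :=
  ((eigs A).filter (fun z => 0 < z.re)).card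

/-- The number of eigenvalues with negative real part (with multiplicity). -/
def stableIndex {V : Type*} [NormedAddCommGroup V] [NormedSpace ℝ V] [FiniteDimensional ℝ V]
    (A : V →L[ℝ] V) : ℕ :=
  ((eigs A).filter (fun z => z.re < 0)).card

/-- `e` is a hyperbolic (linearly stable) sink of the frozen system `ẋ = f(x, l)`. -/
def IsHyperbolicSink (f : Vec n → Vec d → Vec n) (l : Vec d) (e : Vec n) : Prop :=
  f e l = 0 ∧ ∀ z ∈ eigs (fderiv ℝ (fun x => f x l) e), z.re < 0

/-- `η` is an equilibrium regular edge state of the frozen system `ẋ = f(x, l)`: a hyperbolic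
equilibrium with precisely one unstable direction. -/
def IsEquilibriumRegularEdgeState (f : Vec n → Vec d → Vec n) (l : Vec d) (η : Vec n) : Prop :=
  f η l = 0 ∧ (∀ z ∈ eigs (fderiv ℝ (fun x => f x l) η), z.re ≠ 0) ∧
    unstableIndex (fderiv ℝ (fun x => f x l) η) = 1

/-! ### Local pullback attractors -/

/-- The solution `x` on `(-∞, τ₀)` is a local pullback attractor: it lies for all sufficiently
negative times in a bounded open set `U`, and solutions started in `U` at time `s` converge
(uniformly in the starting point) to `x τ` at the fixed time `τ` as `s → -∞`. -/
def IsLocalPullbackAttractor (f : Vec n → Vec d → Vec n) (Λ : ℝ → Vec d) (r τ₀ : ℝ)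
    (x : ℝ → Vec n) : Prop :=
  IsSol f Λ r (Iio τ₀) x ∧
  ∃ U : Set (Vec n), IsOpen U ∧ Bornology.IsBounded U ∧ ∃ T ≤ τ₀, (∀ τ < T, x τ ∈ U) ∧
    ∀ τ < T, ∀ ε > 0, ∃ s₀ < τ, ∀ s ≤ s₀, ∀ y ∈ U,
      ∃ z : ℝ → Vec n, IsSol f Λ r (Icc s τ) z ∧ z s = y ∧ dist (z τ) (x τ) < ε

/-! ### R-tipping thresholds -/

/-- `S ⊆ ℝⁿ` is an embedded orientable codimension-one `C¹` manifold: near each of its points it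
is a regular level set of a `C¹` function, and it has a continuous unit normal field `ν`. -/
def IsEmbeddedOrientableHypersurface (S : Set (Vec n)) : Prop :=
  ∃ ν : Vec n → Vec n, ContinuousOn ν S ∧ ∀ x ∈ S, ‖ν x‖ = 1 ∧
    ∃ U : Set (Vec n), IsOpen U ∧ x ∈ U ∧ ∃ h : Vec n → ℝ, ContDiffOn ℝ 1 h U ∧
      fderiv ℝ h x ≠ 0 ∧ S ∩ U = {y ∈ U | h y = 0} ∧
      ∀ v, fderiv ℝ h x v = 0 → inner ℝ (ν x) v = 0

/-- `Θ τ`, `τ > τ₀`, is a regular R-tipping threshold anchored at infinity by `η`, at rate `r`: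
a family of (nonempty) codimension-one embedded orientable sets that is forward invariant as a
nonautonomous set and consists of initial states of solutions converging to `η`. -/
structure IsRTippingThreshold (f : Vec n → Vec d → Vec n) (Λ : ℝ → Vec d) (r : ℝ) (η : Vec n)
    (τ₀ : ℝ) (Θ : ℝ → Set (Vec n)) : Prop where
  nonempty : ∀ τ > τ₀, (Θ τ).Nonempty
  hypersurface : ∀ τ > τ₀, IsEmbeddedOrientableHypersurface (Θ τ)
  invariant_and_stable : ∀ τ₁ > τ₀, ∀ x₀ ∈ Θ τ₁, ∃ z : ℝ → Vec n,
    IsSol f Λ r (Ici τ₁) z ∧ z τ₁ = x₀ ∧ (∀ τ > τ₁, z τ ∈ Θ τ) ∧ Tendsto z atTop (𝓝 η)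

/-! ### Rate-dependent solutions, critical rates and edge tails -/

/-- The two kinds of rate-dependent solutions `x^[r]`: those started from a fixed `(x₀, τ₀)`, and
those limiting to a sink `e` as `τ → -∞`. -/
inductive Origin (n : ℕ) : Type
  | point (x₀ : Vec n) (τ₀ : ℝ) : Origin n
  | past (e : Vec n) : Origin n

/-- In the second case `e` has to be a hyperbolic sink of the past limit system. -/
def Origin.Admissible (f : Vec n → Vec d → Vec n) (lm : Vec d) : Origin n → Prop
  | .point _ _ => True
  | .past e => IsHyperbolicSink f lm e

/-- The times at which the solution is considered. -/
def Origin.times : Origin n → Set ℝ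
  | .point _ τ₀ => Ici τ₀
  | .past _ => univ

/-- `x` satisfies the initial condition (at `τ₀` or at `-∞`). -/
def Origin.Starts : Origin n → (ℝ → Vec n) → Prop
  | .point x₀ τ₀, x => x τ₀ = x₀
  | .past e, x => Tendsto x atBot (𝓝 e)

/-- `y = x^[r](τ)`; in particular the solution exists up to time `τ`. -/
def Origin.Value (f : Vec n → Vec d → Vec n) (Λ : ℝ → Vec d) (o : Origin n) (r τ : ℝ)
    (y : Vec n) : Prop :=
  τ ∈ o.times ∧ ∃ x : ℝ → Vec n, IsSol f Λ r (o.times ∩ Iic τ) x ∧ o.Starts x ∧ x τ = y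

/-- `x^[r]` exists for all future times and `x^[r](τ) → η` as `τ → +∞`. -/
def Origin.Converges (f : Vec n → Vec d → Vec n) (Λ : ℝ → Vec d) (o : Origin n) (r : ℝ)
    (η : Vec n) : Prop :=
  ∃ x : ℝ → Vec n, IsSol f Λ r o.times x ∧ o.Starts x ∧ Tendsto x atTop (𝓝 η)

/-- `rc` is a critical rate for R-tipping to `η`. -/
def IsCriticalRate (f : Vec n → Vec d → Vec n) (Λ : ℝ → Vec d) (o : Origin n) (η : Vec n)
    (rc : ℝ) : Prop :=
  0 < rc ∧ o.Converges f Λ rc η ∧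
    ∃ δ > 0, ∀ r > 0, 0 < |r - rc| → |r - rc| < δ → ¬ o.Converges f Λ r η

/-- The upper edge tail `x^[rc⁺]`. -/
def upperEdgeTail (f : Vec n → Vec d → Vec n) (Λ : ℝ → Vec d) (o : Origin n) (rc : ℝ) :
    Set (Vec n) :=
  ⋂ (T : ℝ) (_ : 0 < T) (δ : ℝ) (_ : 0 < δ),
    closure {y | ∃ τ > T, ∃ r ∈ Ioo rc (rc + δ), o.Value f Λ r τ y}

/-- The lower edge tail `x^[rc⁻]`. -/
def lowerEdgeTail (f : Vec n → Vec d → Vec n) (Λ : ℝ → Vec d) (o : Origin n) (rc : ℝ) :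
    Set (Vec n) :=
  ⋂ (T : ℝ) (_ : 0 < T) (δ : ℝ) (_ : 0 < δ),
    closure {y | ∃ τ > T, ∃ r ∈ Ioo (rc - δ) rc, o.Value f Λ r τ y}

/-! ### The compactified system -/

/-- The time transformation `s = g_α(τ)`. -/
def compTime (α τ : ℝ) : ℝ := Real.tanh (α / 2 * τ)

/-- Its inverse `τ = h_α(s)` for `s ∈ (-1,1)`. -/
def compTimeInv (α s : ℝ) : ℝ := 1 / α * Real.log ((1 + s) / (1 - s))

/-- The input `Λ_α(s)`, with the limits `lm`, `lp` glued in at `s = -1`, `s = 1`. (The values for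
`s ∉ [-1,1]` play no role.) -/
def compInput (Λ : ℝ → Vec d) (lm lp : Vec d) (α s : ℝ) : Vec d :=
  if 1 ≤ s then lp else if s ≤ -1 then lm else Λ (compTimeInv α s)

/-- The extended phase space `ℝⁿ × [-1,1]`. -/
def extPhase (n : ℕ) : Set (Vec n × ℝ) := {p | p.2 ∈ Icc (-1) 1}

/-- The vector field of the compactified system,
`x' = f(x, Λ_α(s)) / r`, `s' = α (1 - s²) / 2`. -/
def compField (f : Vec n → Vec d → Vec n) (Λ : ℝ → Vec d) (lm lp : Vec d) (α r : ℝ) :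
    Vec n × ℝ → Vec n × ℝ :=
  fun p => (r⁻¹ • f p.1 (compInput Λ lm lp α p.2), α * (1 - p.2 ^ 2) / 2)

/-- `γ` is a trajectory in `ℝⁿ × [-1,1]` of the autonomous system `p' = F(p)` on `I`. -/
def IsTrajectory (F : Vec n × ℝ → Vec n × ℝ) (I : Set ℝ) (γ : ℝ → Vec n × ℝ) : Prop :=
  ∀ t ∈ I, γ t ∈ extPhase n ∧ HasDerivWithinAt γ (F (γ t)) I t

/-- The orbit of `q`, forwards and backwards for as long as the trajectory exists. -/
def orbit (F : Vec n × ℝ → Vec n × ℝ) (q : Vec n × ℝ) : Set (Vec n × ℝ) :=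
  {q' | ∃ (t : ℝ) (γ : ℝ → Vec n × ℝ), IsTrajectory F (uIcc 0 t) γ ∧ γ 0 = q ∧ γ t = q'}

/-- The unstable manifold of `p`. -/
def unstableManifold (F : Vec n × ℝ → Vec n × ℝ) (p : Vec n × ℝ) : Set (Vec n × ℝ) :=
  {q | ∃ γ, IsTrajectory F (Iic 0) γ ∧ γ 0 = q ∧ Tendsto γ atBot (𝓝 p)}

/-- The stable manifold of `p`. -/
def stableManifold (F : Vec n × ℝ → Vec n × ℝ) (p : Vec n × ℝ) : Set (Vec n × ℝ) :=
  {q | ∃ γ, IsTrajectory F (Ici 0) γ ∧ γ 0 = q ∧ Tendsto γ atTop (𝓝 p)}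

/-- The local stable manifold of `p` in the neighbourhood `N`: the points whose forward trajectory
stays in `N` and converges to `p`. -/
def localStableManifold (F : Vec n × ℝ → Vec n × ℝ) (p : Vec n × ℝ) (N : Set (Vec n × ℝ)) :
    Set (Vec n × ℝ) :=
  {q | ∃ γ, IsTrajectory F (Ici 0) γ ∧ γ 0 = q ∧ (∀ t ≥ 0, γ t ∈ N) ∧ Tendsto γ atTop (𝓝 p)}

/-- The branches of the unstable manifold of `p`: the nontrivial orbits it consists of. -/
def IsUnstableBranch (F : Vec n × ℝ → Vec n × ℝ) (p : Vec n × ℝ) (B : Set (Vec n × ℝ)) : Prop :=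
  ∃ q ∈ unstableManifold F p, q ≠ p ∧ B = orbit F q

/-- `p` is a hyperbolic equilibrium in `ℝⁿ × [-1,1]` with precisely one unstable direction and
`n` stable directions (a saddle, as `n ≥ 1`). -/
def IsSaddle (F : Vec n × ℝ → Vec n × ℝ) (p : Vec n × ℝ) : Prop :=
  p ∈ extPhase n ∧ F p = 0 ∧ DifferentiableWithinAt ℝ F (extPhase n) p ∧
    stableIndex (fderivWithin ℝ F (extPhase n) p) = n ∧
    unstableIndex (fderivWithin ℝ F (extPhase n) p) = 1

/-- `W` is a one-dimensional `C¹` manifold in `ℝⁿ × [-1,1]` that is a graph over `s ∈ [-1,b)`. -/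
def IsCurveOverTime (W : Set (Vec n × ℝ)) : Prop :=
  ∃ b ∈ Ioc (-1 : ℝ) 1, ∃ X : ℝ → Vec n, ContDiffOn ℝ 1 X (Ico (-1) b) ∧
    W = (fun s => (X s, s)) '' Ico (-1) b

/-- `W` is an embedded orientable codimension-one `C¹` manifold in `ℝⁿ × [-1,1]` (with boundary in
`s = ±1`), transverse to every slice `s = const`: near each of its points it is a regular level
set of a `C¹` function, and it has a continuous unit normal field `ν` that is nowhere normal to
the slices. -/
def IsTransverseHypersurface (W : Set (Vec n × ℝ)) : Prop :=
  ∃ ν : Vec n × ℝ → Vec n × ℝ, ContinuousOn ν W ∧ ∀ p ∈ W,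
    ‖(ν p).1‖ ^ 2 + (ν p).2 ^ 2 = 1 ∧ (ν p).1 ≠ 0 ∧
    ∃ U : Set (Vec n × ℝ), IsOpen U ∧ p ∈ U ∧ ∃ h : Vec n × ℝ → ℝ, ContDiffOn ℝ 1 h U ∧
      fderiv ℝ h p ≠ 0 ∧ W ∩ U = {q ∈ U | q ∈ extPhase n ∧ h q = 0} ∧
      ∀ v, fderiv ℝ h p v = 0 → inner ℝ (ν p).1 v.1 + (ν p).2 * v.2 = 0

/-- A family `Θ τ`, `τ > τ₀`, of subsets of `ℝⁿ` embedded in the extended phase space. -/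
def embedThreshold (α τ₀ : ℝ) (Θ : ℝ → Set (Vec n)) : Set (Vec n × ℝ) :=
  {p | ∃ τ > τ₀, p.1 ∈ Θ τ ∧ p.2 = compTime α τ}

/-- A subset of `ℝⁿ` embedded in the slice `s = 1`. -/
def embedFuture (S : Set (Vec n)) : Set (Vec n × ℝ) := {p | p.1 ∈ S ∧ p.2 = 1}

end RTip

end

/-!
The proof rests on cone estimates near the two equilibria that are stable under the rate, because
`r` enters only through the time scale. At a hyperbolic equilibrium of a frozen system there are two
positive semidefinite quadratic forms, `p` for the unstable and `b` for the stable direction, which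
together are coercive and which along differences of solutions satisfy `p' ≥ k (2 p - b)` and
`b' ≤ k (p - 2 b)` up to the factor `2 / r` (`IsDichotomy`, `IsLocalDichotomy`). They come from a
Lyapunov form of the linearization, for an edge state after the one unstable eigenvalue `μ` has been
replaced by `-μ` (`exists_lyapunov_form`, `exists_unstable_splitting`). Sublevel sets of the forms
are blocks whose size, and the time from which on the input is close enough to its limit, do not
depend on `r`.

In the variable `σ = exp (-α τ)`, equivalently in the compactified time, the input extends to a `C¹`
function with derivative zero at the infinite end, because `α < ρ` (`hasDerivAt_glueInput`). Hence
the linearizations of the compactified system at `(e, -1)` and `(η, 1)` are block diagonal, and their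
indices can be read off (`isSaddle_of_sink`, `isSaddle_of_edge`).

For a sink `p = 0`, and the block `b ≤ q` is forward invariant for times before `τ₀`. Solutions
started in it at times going to `-∞` converge to one that stays in it
(`IsPastBlock.exists_isSol`); any two solutions with that property coincide, since their difference
contracts forwards and is bounded backwards (`IsLocalDichotomy.eq_of_past`). This solution
approaches `e` faster than `exp (α τ)` (`IsLocalDichotomy.isLittleO_past`), which makes it `C¹` in
the compactified time up to `s = -1` (`contDiff_glue_past`). Its graph is the unstable manifold.

At an edge state, the states whose solution stays in the block form the graph of a `C¹` function
`φ` of the stable component and of `σ`. It is obtained by the Lyapunov–Perron method: the equation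
is solved for bounded continuous functions on the half-line, and the implicit function theorem in
that space gives the smoothness (`IsEdgeSplitting.exists_stableGraph`). The cone estimates show that
such solutions converge to `η` and stay in the interior of the block (`IsLocalDichotomy.cone_bounds`,
`IsLocalDichotomy.tendsto`), so that the zero set of `ℓ - φ` is a local stable manifold whose slices
are the threshold (`exists_threshold`).

A solution that does not stay in the block leaves it through the face `p = q`
(`IsLocalDichotomy.exists_exit`). If solutions do so at later and later times, the exit points
accumulate at states of the unstable manifold of `η` under the future limit system
(`IsLocalDichotomy.exists_exit_limit`). Applied to solutions starting on the unstable axis close to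
`η`, this yields the two branches (`IsLocalDichotomy.exists_branch`); the backward cone estimate
shows that there are no others. Applied to `x^[r]` as `r → rc`, where the solutions follow the
critical one into the block but do not converge, it yields a point of the unstable manifold in the
edge tail, and continuous dependence on the rate and the input spreads this over its whole orbit
(`exists_value_near`, `exists_branch_subset_closure`).
-/

noncomputable section

namespace RTip

variable {n d : ℕ}

/-! ### Scalar differential inequalities -/

lemma antitoneOn_exp_mul {I : Set ℝ} (hI : Convex ℝ I) {w w' : ℝ → ℝ} {k : ℝ}
    (hw : ∀ t ∈ I, HasDerivWithinAt w (w' t) I t) (h : ∀ t ∈ I, w' t ≤ -k * w t) :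
    AntitoneOn (fun t => Real.exp (k * t) * w t) I := by
  have hd : ∀ t ∈ I, HasDerivWithinAt (fun t => Real.exp (k * t) * w t)
      (Real.exp (k * t) * k * w t + Real.exp (k * t) * w' t) I t := by
    intro t ht
    have h1 : HasDerivWithinAt (fun t => Real.exp (k * t)) (Real.exp (k * t) * k) I t := by
      have := ((hasDerivAt_id t).const_mul k).exp
      simpa using this.hasDerivWithinAt
    exact h1.mul (hw t ht)
  refine antitoneOn_of_hasDerivWithinAt_nonpos hI (fun t ht => (hd t ht).continuousWithinAt)
    (fun t ht => (hd t (interior_subset ht)).mono interior_subset) fun t ht => ?_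
  have h2 := h t (interior_subset ht)
  have h3 := Real.exp_pos (k * t)
  nlinarith

lemma le_exp_mul_of_deriv_le {I : Set ℝ} (hI : Convex ℝ I) {w w' : ℝ → ℝ} {k : ℝ}
    (hw : ∀ t ∈ I, HasDerivWithinAt w (w' t) I t) (h : ∀ t ∈ I, w' t ≤ -k * w t)
    {s t : ℝ} (hs : s ∈ I) (ht : t ∈ I) (hst : s ≤ t) :
    w t ≤ Real.exp (-(k * (t - s))) * w s := by
  have h1 := antitoneOn_exp_mul hI hw h hs ht hst
  simp only at h1
  have h2 : Real.exp (-(k * (t - s))) = Real.exp (k * s) * Real.exp (-(k * t)) := by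
    rw [← Real.exp_add]; ring_nf
  have h3 : Real.exp (-(k * t)) * Real.exp (k * t) = 1 := by rw [← Real.exp_add]; simp
  have h4 := Real.exp_pos (-(k * t))
  calc w t = Real.exp (-(k * t)) * (Real.exp (k * t) * w t) := by rw [← mul_assoc, h3, one_mul]
    _ ≤ Real.exp (-(k * t)) * (Real.exp (k * s) * w s) := by gcongr
    _ = _ := by rw [h2]; ring

/-- A function with `w' ≤ -k w` that is bounded above on a left half-line is nonpositive: positive
values would have to blow up backwards in time. -/
lemma nonpos_of_deriv_le_of_bddAbove {T k M : ℝ} (hk : 0 < k) {w w' : ℝ → ℝ}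
    (hw : ∀ t ∈ Iic T, HasDerivWithinAt w (w' t) (Iic T) t) (h : ∀ t ∈ Iic T, w' t ≤ -k * w t)
    (hM : ∀ t ∈ Iic T, w t ≤ M) : ∀ t ∈ Iic T, w t ≤ 0 := by
  intro t ht
  have hlim : Tendsto (fun s => Real.exp (-(k * (t - s))) * |M|) atBot (𝓝 (0 * |M|)) := by
    refine Tendsto.mul_const _ (Real.tendsto_exp_atBot.comp ?_)
    have : (fun s => -(k * (t - s))) = fun s => k * s + -(k * t) := by ext; ring
    rw [this]
    exact tendsto_atBot_add_const_right _ _ (tendsto_id.const_mul_atBot hk)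
  rw [zero_mul] at hlim
  refine ge_of_tendsto hlim ?_
  filter_upwards [eventually_le_atBot t] with s hs
  have hsT : s ∈ Iic T := le_trans hs ht
  refine (le_exp_mul_of_deriv_le (convex_Iic T) hw h hsT ht hs).trans ?_
  gcongr
  exact (hM s hsT).trans (le_abs_self M)

/-- The time-reversed statement: a function with `k w ≤ w'` that is bounded above on a right
half-line is nonpositive. -/
lemma nonpos_of_le_deriv_of_bddAbove {T k M : ℝ} (hk : 0 < k) {w w' : ℝ → ℝ}
    (hw : ∀ t ∈ Ici T, HasDerivWithinAt w (w' t) (Ici T) t) (h : ∀ t ∈ Ici T, k * w t ≤ w' t)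
    (hM : ∀ t ∈ Ici T, w t ≤ M) : ∀ t ∈ Ici T, w t ≤ 0 := by
  have key := nonpos_of_deriv_le_of_bddAbove (T := -T) (M := M) hk (w := fun t => w (-t))
    (w' := fun t => -w' (-t)) ?_ ?_ ?_
  · intro t ht
    have := key (-t) (by simpa using ht)
    simpa using this
  · intro t ht
    have h1 : -t ∈ Ici T := by simp only [mem_Iic, mem_Ici] at *; linarith
    have h2 := (hw (-t) h1).scomp t (hasDerivAt_neg t).hasDerivWithinAt
      (s := Iic (-T)) (fun s hs => by simp only [mem_Iic, mem_Ici] at *; linarith)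
    simpa [Function.comp_def] using h2
  · intro t ht
    have h1 : -t ∈ Ici T := by simp only [mem_Iic, mem_Ici] at *; linarith
    have := h _ h1
    linarith
  · intro t ht
    exact hM _ (by simp only [mem_Iic, mem_Ici] at *; linarith)

/-- The decoupled estimates that follow from the cone inequalities for a pair `p, b` of squared
unstable and stable coordinates. -/
lemma eventually_le_of_cone_ineq {T k M : ℝ} (hk : 0 < k) {p p' b b' β : ℝ → ℝ}
    (hp : ∀ t ∈ Ici T, HasDerivWithinAt p (p' t) (Ici T) t)
    (hb : ∀ t ∈ Ici T, HasDerivWithinAt b (b' t) (Ici T) t)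
    (hp0 : ∀ t ∈ Ici T, 0 ≤ p t) (hb0 : ∀ t ∈ Ici T, 0 ≤ b t)
    (hpM : ∀ t ∈ Ici T, p t ≤ M)
    (h1 : ∀ t ∈ Ici T, k * (2 * p t - b t) - β t ≤ p' t)
    (h2 : ∀ t ∈ Ici T, b' t ≤ k * (p t - 2 * b t) + β t)
    {β₀ : ℝ} (hβ : ∀ t ∈ Ici T, β t ≤ β₀) :
    (∀ t ∈ Ici T, p t ≤ b t / 2 + β₀ / k) ∧
    ∀ t ∈ Ici T, b t ≤ 4 * β₀ / (3 * k) + Real.exp (-(3 * k / 2 * (t - T))) * (b T - 4 * β₀ / (3 * k)) := by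
  have hJ : ∀ t ∈ Ici T, p t ≤ b t / 2 + β₀ / k := by
    -- the combination `2 p - b - 2 β₀ / k` grows exponentially while it is positive, but it is
    -- bounded above
    have := nonpos_of_le_deriv_of_bddAbove (T := T) (k := 3 * k / 2) (M := 2 * M + 2 * |β₀| / k)
      (by positivity) (w := fun t => 2 * p t - b t - 2 * β₀ / k) (w' := fun t => 2 * p' t - b' t)
      ?_ ?_ ?_
    · intro t ht
      have h := this t ht
      have : 2 * β₀ / k = 2 * (β₀ / k) := by ring
      linarith
    · intro t ht
      exact (((hp t ht).const_mul 2).sub (hb t ht)).sub_const _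
    · intro t ht
      have e1 := h1 t ht
      have e2 := h2 t ht
      have e3 := hβ t ht
      have e4 := hb0 t ht
      have e5 : k * (2 * β₀ / k) = 2 * β₀ := by field_simp
      have e6 : 0 ≤ k * b t := by positivity
      have e7 : 0 ≤ k * p t := mul_nonneg hk.le (hp0 t ht)
      nlinarith
    · intro t ht
      have e1 := hpM t ht
      have e2 := hb0 t ht
      have e3 : -(2 * β₀ / k) ≤ 2 * |β₀| / k := by
        rw [← neg_div]; gcongr; have := neg_abs_le β₀; linarith
      linarith
  refine ⟨hJ, fun t ht => ?_⟩
  -- inserting this bound on `p` into the inequality for `b` leaves decay at rate `3 k / 2`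
  have := le_exp_mul_of_deriv_le (convex_Ici T) (w := fun t => b t - 4 * β₀ / (3 * k)) (w' := b')
    (k := 3 * k / 2) (fun t ht => (hb t ht).sub_const _) ?_ self_mem_Ici ht ht
  · linarith
  · intro t ht
    have e1 := hJ t ht
    have e2 := h2 t ht
    have e3 := hβ t ht
    have e4 : k * (4 * β₀ / (3 * k)) = 4 * β₀ / 3 := by field_simp
    have e5 : k * (b t / 2 + β₀ / k) = k * b t / 2 + β₀ := by field_simp
    have e6 : k * p t ≤ k * (b t / 2 + β₀ / k) := by gcongr
    nlinarith

/-- If the inhomogeneity `β` tends to zero, so do both coordinates of a solution that is bounded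
in the unstable direction: the decoupled estimates are applied from later and later starting
times. -/
lemma tendsto_zero_of_cone_ineq {T k M : ℝ} (hk : 0 < k) {p p' b b' β : ℝ → ℝ}
    (hp : ∀ t ∈ Ici T, HasDerivWithinAt p (p' t) (Ici T) t)
    (hb : ∀ t ∈ Ici T, HasDerivWithinAt b (b' t) (Ici T) t)
    (hp0 : ∀ t ∈ Ici T, 0 ≤ p t) (hb0 : ∀ t ∈ Ici T, 0 ≤ b t)
    (hpM : ∀ t ∈ Ici T, p t ≤ M)
    (h1 : ∀ t ∈ Ici T, k * (2 * p t - b t) - β t ≤ p' t)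
    (h2 : ∀ t ∈ Ici T, b' t ≤ k * (p t - 2 * b t) + β t)
    (hβ : Tendsto β atTop (𝓝 0)) : Tendsto p atTop (𝓝 0) ∧ Tendsto b atTop (𝓝 0) := by
  have key : ∀ ε > 0, ∀ᶠ t in atTop, p t ≤ ε ∧ b t ≤ ε := by
    intro ε hε
    obtain ⟨S, hS⟩ := eventually_atTop.1 (hβ.eventually (gt_mem_nhds (show (0:ℝ) < ε * k / 4 by positivity)))
    set T' := max S T
    have hsub : Ici T' ⊆ Ici T := Ici_subset_Ici.2 (le_max_right _ _)
    obtain ⟨c1, c2⟩ := eventually_le_of_cone_ineq (T := T') (M := M) hk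
      (fun t ht => (hp t (hsub ht)).mono hsub) (fun t ht => (hb t (hsub ht)).mono hsub)
      (fun t ht => hp0 t (hsub ht)) (fun t ht => hb0 t (hsub ht)) (fun t ht => hpM t (hsub ht))
      (fun t ht => h1 t (hsub ht)) (fun t ht => h2 t (hsub ht)) (β₀ := ε * k / 4)
      (fun t ht => (hS t (le_trans (le_max_left _ _) ht)).le)
    have e1 : 4 * (ε * k / 4) / (3 * k) = ε / 3 := by field_simp
    have e2 : ε * k / 4 / k = ε / 4 := by field_simp
    rw [e1] at c2
    rw [e2] at c1
    have hlim : Tendsto (fun t => Real.exp (-(3 * k / 2 * (t - T'))) * (b T' - ε / 3)) atTop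
        (𝓝 (0 * (b T' - ε / 3))) := by
      refine Tendsto.mul_const _ (Real.tendsto_exp_atBot.comp ?_)
      refine tendsto_neg_atTop_atBot.comp ?_
      exact (tendsto_atTop_add_const_right _ (-T') tendsto_id).const_mul_atTop (by positivity)
    rw [zero_mul] at hlim
    filter_upwards [eventually_ge_atTop T', hlim.eventually (gt_mem_nhds (show (0:ℝ) < ε / 3 by positivity))]
      with t ht hlt
    have a1 := c1 t ht
    have a2 := c2 t ht
    constructor <;> linarith
  constructor
  · rw [Metric.tendsto_nhds]
    intro ε hε
    filter_upwards [key (ε / 2) (by positivity), eventually_ge_atTop T] with t ht htT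
    rw [Real.dist_eq, sub_zero, abs_of_nonneg (hp0 t htT)]
    linarith [ht.1]
  · rw [Metric.tendsto_nhds]
    intro ε hε
    filter_upwards [key (ε / 2) (by positivity), eventually_ge_atTop T] with t ht htT
    rw [Real.dist_eq, sub_zero, abs_of_nonneg (hb0 t htT)]
    linarith [ht.2]

lemma gronwallBound_le_of_one_le {δ K ε x : ℝ} (hK : 1 ≤ K) (hε : 0 ≤ ε) (hx : 0 ≤ x) :
    gronwallBound δ K ε x ≤ (δ + ε) * Real.exp (K * x) := by
  rw [gronwallBound_of_K_ne_0 (by linarith)]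
  have h1 : 1 ≤ Real.exp (K * x) := Real.one_le_exp (by positivity)
  have h2 : ε / K ≤ ε := div_le_self hε hK
  have h3 : 0 ≤ ε / K := by positivity
  simp only
  nlinarith

/-! ### Solutions of the nonautonomous system -/

variable {f : Vec n → Vec d → Vec n} {Λ : ℝ → Vec d} {r : ℝ} {I J : Set ℝ} {x y : ℝ → Vec n}

lemma IsSol.mono (h : IsSol f Λ r I x) (hJ : J ⊆ I) : IsSol f Λ r J x :=
  fun t ht => (h t (hJ ht)).mono hJ

lemma IsSol.continuousOn (h : IsSol f Λ r I x) : ContinuousOn x I :=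
  fun t ht => (h t ht).continuousWithinAt

lemma IsSol.congr (h : IsSol f Λ r I x) (hxy : EqOn y x I) : IsSol f Λ r I y := by
  intro t ht
  rw [hxy ht]
  exact (h t ht).congr_of_mem hxy ht

lemma IsSol.congr_input {Λ' : ℝ → Vec d} (h : IsSol f Λ r I x) (hΛ : EqOn Λ' Λ I) :
    IsSol f Λ' r I x := by
  intro t ht
  rw [hΛ ht]
  exact h t ht

lemma IsSol.congr_field {F : Vec n → Vec d → Vec n} (h : IsSol f Λ r I x)
    (hF : ∀ t ∈ I, F (x t) (Λ t) = f (x t) (Λ t)) : IsSol F Λ r I x := by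
  intro t ht
  rw [hF t ht]
  exact h t ht

lemma IsSol.comp_affine (h : IsSol f Λ r I x) (c a : ℝ) :
    IsSol f (fun t => Λ (c * t + a)) (r / c) ((fun t => c * t + a) ⁻¹' I)
      (fun t => x (c * t + a)) := by
  intro t ht
  have h1 : HasDerivWithinAt (fun t => c * t + a) c ((fun t => c * t + a) ⁻¹' I) t := by
    simpa using (((hasDerivAt_id t).const_mul c).add_const a).hasDerivWithinAt
  have h2 := (h (c * t + a) ht).scomp t h1 (fun s hs => hs)
  simpa [Function.comp_def, inv_div, div_eq_mul_inv, smul_smul] using h2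

lemma IsSol.comp_add (h : IsSol f Λ r I x) (a : ℝ) :
    IsSol f (fun t => Λ (t + a)) r ((fun t => t + a) ⁻¹' I) (fun t => x (t + a)) := by
  simpa using h.comp_affine 1 a

lemma IsSol.comp_neg (h : IsSol f Λ r I x) :
    IsSol f (fun t => Λ (-t)) (-r) ((fun t => -t) ⁻¹' I) (fun t => x (-t)) := by
  simpa [div_neg] using h.comp_affine (-1) 0

lemma IsSol.hasDerivAt (h : IsSol f Λ r I x) {t : ℝ} (ht : I ∈ 𝓝 t) :
    HasDerivAt x (r⁻¹ • f (x t) (Λ t)) t :=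
  (h t (mem_of_mem_nhds ht)).hasDerivAt ht

/-- A function that solves the equation on either side of the common time `b` solves it across
`b`. -/
lemma isSol_union {b : ℝ} (hI : I ⊆ Iic b) (hJ : J ⊆ Ici b) (hbI : b ∈ I) (hbJ : b ∈ J)
    (hx : IsSol f Λ r I x) (hy : IsSol f Λ r J x) : IsSol f Λ r (I ∪ J) x := by
  intro t ht
  rcases lt_trichotomy t b with h | rfl | h
  · have htI : t ∈ I := ht.resolve_right fun h' => absurd (hJ h') (not_le.2 h)
    refine (hx t htI).mono_of_mem_nhdsWithin ?_
    filter_upwards [self_mem_nhdsWithin, mem_nhdsWithin_of_mem_nhds (Iio_mem_nhds h)] with s hs hsb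
    exact hs.resolve_right fun h' => absurd (mem_Ici.1 (hJ h')) (not_le.2 hsb)
  · exact (hx t hbI).union (hy t hbJ)
  · have htJ : t ∈ J := ht.resolve_left fun h' => absurd (hI h') (not_le.2 h)
    refine (hy t htJ).mono_of_mem_nhdsWithin ?_
    filter_upwards [self_mem_nhdsWithin, mem_nhdsWithin_of_mem_nhds (Ioi_mem_nhds h)] with s hs hsb
    exact hs.resolve_left fun h' => absurd (mem_Iic.1 (hI h')) (not_le.2 hsb)

/-- Concatenation of two solutions that agree at the common endpoint `b`. -/
lemma IsSol.glue {b : ℝ} (hI : I ⊆ Iic b) (hJ : J ⊆ Ici b) (hbI : b ∈ I) (hbJ : b ∈ J)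
    (hx : IsSol f Λ r I x) (hy : IsSol f Λ r J y) (hxy : x b = y b) :
    ∃ z, IsSol f Λ r (I ∪ J) z ∧ EqOn z x I ∧ EqOn z y J := by
  classical
  have e1 : EqOn (fun t => if t ≤ b then x t else y t) x I := fun t ht => if_pos (hI ht)
  have e2 : EqOn (fun t => if t ≤ b then x t else y t) y J := by
    intro t ht
    rcases eq_or_lt_of_le (show b ≤ t from hJ ht) with rfl | h
    · simpa using hxy
    · exact if_neg (not_le.2 h)
  exact ⟨_, isSol_union hI hJ hbI hbJ (hx.congr e1) (hy.congr e2), e1, e2⟩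

lemma IsSol.hasDerivWithinAt_Ici {a b : ℝ} (h : IsSol f Λ r (Icc a b) x) {t : ℝ}
    (ht : t ∈ Ico a b) : HasDerivWithinAt x (r⁻¹ • f (x t) (Λ t)) (Ici t) t :=
  (h t (Ico_subset_Icc_self ht)).mono_of_mem_nhdsWithin (Icc_mem_nhdsGE_of_mem ht)

lemma exists_lipschitzOnWith (hf : ContDiff ℝ 1 (fun p : Vec n × Vec d => f p.1 p.2))
    {S : Set (Vec n × Vec d)} (hS : IsCompact S) :
    ∃ K, LipschitzOnWith K (fun p : Vec n × Vec d => f p.1 p.2) S :=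
  LocallyLipschitzOn.exists_lipschitzOnWith_of_compact hS
    (hf.locallyLipschitz.locallyLipschitzOn)

/-- The joint Lipschitz constant serves for every frozen input. -/
lemma lipschitzOnWith_section {K : NNReal} {S : Set (Vec n × Vec d)}
    (h : LipschitzOnWith K (fun p : Vec n × Vec d => f p.1 p.2) S) (l : Vec d) :
    LipschitzOnWith K (fun x => f x l) {x | (x, l) ∈ S} := by
  intro x hx y hy
  simpa [Prod.edist_eq] using h hx hy

lemma IsSol.eqOn_Icc (hf : ContDiff ℝ 1 (fun p : Vec n × Vec d => f p.1 p.2)) {a b : ℝ}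
    (hΛ : Continuous Λ)
    (hx : IsSol f Λ r (Icc a b) x) (hy : IsSol f Λ r (Icc a b) y) (h : x a = y a) :
    EqOn x y (Icc a b) := by
  set S : Set (Vec n × Vec d) := (x '' Icc a b ∪ y '' Icc a b) ×ˢ (Λ '' Icc a b)
  have hS : IsCompact S := ((isCompact_Icc.image_of_continuousOn hx.continuousOn).union
    (isCompact_Icc.image_of_continuousOn hy.continuousOn)).prod (isCompact_Icc.image hΛ)
  obtain ⟨K, hK⟩ := exists_lipschitzOnWith hf hS
  refine ODE_solution_unique_of_mem_Icc_right (v := fun t x => r⁻¹ • f x (Λ t))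
    (s := fun t => {x | (x, Λ t) ∈ S}) (K := ‖r⁻¹‖₊ * K) (fun t ht => ?_) hx.continuousOn
    (fun t ht => hx.hasDerivWithinAt_Ici ht)
    (fun t ht => ⟨Or.inl (mem_image_of_mem _ (Ico_subset_Icc_self ht)),
      mem_image_of_mem _ (Ico_subset_Icc_self ht)⟩)
    hy.continuousOn (fun t ht => hy.hasDerivWithinAt_Ici ht)
    (fun t ht => ⟨Or.inr (mem_image_of_mem _ (Ico_subset_Icc_self ht)),
      mem_image_of_mem _ (Ico_subset_Icc_self ht)⟩) h
  exact (lipschitzWith_smul r⁻¹).comp_lipschitzOnWith (lipschitzOnWith_section hK (Λ t))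

/-- Two solutions on an interval that agree at one time agree throughout. -/
lemma IsSol.eqOn (hf : ContDiff ℝ 1 (fun p : Vec n × Vec d => f p.1 p.2)) (hΛ : Continuous Λ)
    (hI : I.OrdConnected) (hx : IsSol f Λ r I x) (hy : IsSol f Λ r I y) {a : ℝ} (ha : a ∈ I)
    (h : x a = y a) : EqOn x y I := by
  intro t ht
  rcases le_total a t with hat | hat
  · exact IsSol.eqOn_Icc hf hΛ (hx.mono (hI.out ha ht)) (hy.mono (hI.out ha ht)) h
      (right_mem_Icc.2 hat)
  · have hsub : Icc (-a) (-t) ⊆ (fun t => -t) ⁻¹' I := fun s hs =>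
      hI.out ht ha ⟨by linarith [hs.2], by linarith [hs.1]⟩
    have := IsSol.eqOn_Icc hf (hΛ.comp continuous_neg) ((hx.comp_neg).mono hsub)
      ((hy.comp_neg).mono hsub) (by simpa using h) (right_mem_Icc.2 (neg_le_neg hat))
    simpa using this

/-- A field with all the properties needed for global solvability: `F` is jointly Lipschitz and
bounded for inputs in the ball of radius `L`. -/
structure IsTame (F : Vec n → Vec d → Vec n) (L : ℝ) (K M : NNReal) : Prop where
  contDiff : ContDiff ℝ 1 (fun p : Vec n × Vec d => F p.1 p.2)
  lipschitz : LipschitzOnWith K (fun p : Vec n × Vec d => F p.1 p.2)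
    (univ ×ˢ Metric.closedBall 0 L)
  bound : ∀ x l, ‖l‖ ≤ L → ‖F x l‖ ≤ M

/-- Cutting off `f` outside a ball gives a tame field. -/
lemma exists_tame (hf : ContDiff ℝ 1 (fun p : Vec n × Vec d => f p.1 p.2)) (R L : ℝ) :
    ∃ F : Vec n → Vec d → Vec n, (∀ x l, ‖x‖ ≤ R → F x l = f x l) ∧
      ∃ K M, IsTame F L K M := by
  have hR : 0 < |R| + 1 := by positivity
  let χ : ContDiffBump (0 : Vec n) := ⟨|R| + 1, |R| + 2, hR, by linarith⟩
  let F : Vec n → Vec d → Vec n := fun x l => χ x • f x l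
  have hF : ContDiff ℝ 1 (fun p : Vec n × Vec d => F p.1 p.2) :=
    (χ.contDiff.comp contDiff_fst).smul hf
  have hzero : ∀ p : Vec n × Vec d, |R| + 2 ≤ ‖p.1‖ → F p.1 p.2 = 0 := by
    intro p hp
    have : χ p.1 = 0 := χ.zero_of_le_dist (by simpa using hp)
    simp [F, this]
  set S : Set (Vec n × Vec d) := Metric.closedBall 0 (|R| + 2) ×ˢ Metric.closedBall 0 L
  have hS : IsCompact S := (isCompact_closedBall _ _).prod (isCompact_closedBall _ _)
  obtain ⟨M, hM⟩ := hS.exists_bound_of_continuousOn hF.continuous.continuousOn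
  obtain ⟨K, hK⟩ := hS.exists_bound_of_continuousOn
    (hF.continuous_fderiv one_ne_zero).continuousOn
  refine ⟨F, fun x l hx => ?_, K.toNNReal, M.toNNReal, hF, ?_, ?_⟩
  · have : χ x = 1 := χ.one_of_mem_closedBall (by
      simp only [Metric.mem_closedBall, dist_zero_right, χ]
      linarith [le_abs_self R])
    simp [F, this]
  · refine Convex.lipschitzOnWith_of_nnnorm_fderiv_le (𝕜 := ℝ)
      (fun p _ => hF.differentiable one_ne_zero p) (fun p hp => ?_)
      (convex_univ.prod (convex_closedBall _ _))
    by_cases h : ‖p.1‖ ≤ |R| + 2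
    · rw [← norm_toNNReal]
      exact Real.toNNReal_le_toNNReal (hK p ⟨by simpa using h, hp.2⟩)
    · push Not at h
      have : (fun p : Vec n × Vec d => F p.1 p.2) =ᶠ[𝓝 p] fun _ => 0 := by
        filter_upwards [(isOpen_lt continuous_const (continuous_fst.norm)).mem_nhds h] with q hq
        exact hzero q (le_of_lt hq)
      rw [this.fderiv_eq]
      simp
  · intro x l hl
    by_cases h : ‖x‖ ≤ |R| + 2
    · exact (hM (x, l) ⟨by simpa using h, by simpa using hl⟩).trans (Real.le_coe_toNNReal M)
    · rw [hzero (x, l) (not_le.1 h).le]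
      simp

lemma IsTame.lipschitzWith {F : Vec n → Vec d → Vec n} {L : ℝ} {K M : NNReal}
    (h : IsTame F L K M) {l : Vec d} (hl : ‖l‖ ≤ L) (r : ℝ) :
    LipschitzWith (‖r⁻¹‖₊ * K) (fun x => r⁻¹ • F x l) := by
  have := lipschitzOnWith_section h.lipschitz l
  rw [show {x : Vec n | (x, l) ∈ (univ : Set (Vec n)) ×ˢ Metric.closedBall 0 L} = univ by
    ext; simpa using hl, lipschitzOnWith_univ] at this
  exact (lipschitzWith_smul r⁻¹).comp this

lemma IsTame.exists_isSol_Icc {F : Vec n → Vec d → Vec n} {L : ℝ} {K M : NNReal}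
    (h : IsTame F L K M) (hΛ : Continuous Λ) (hL : ∀ t, ‖Λ t‖ ≤ L) (r a T : ℝ) (hT : 0 ≤ T)
    (x₀ : Vec n) : ∃ x, IsSol F Λ r (Icc (a - T) (a + T)) x ∧ x a = x₀ := by
  have ha : a ∈ Icc (a - T) (a + T) := ⟨by linarith, by linarith⟩
  have hPL : IsPicardLindelof (fun t x => r⁻¹ • F x (Λ t)) (⟨a, ha⟩ : Icc (a - T) (a + T)) x₀
      (‖r⁻¹‖₊ * M * T.toNNReal) 0 (‖r⁻¹‖₊ * M) (‖r⁻¹‖₊ * K) := by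
    refine ⟨fun t _ => (h.lipschitzWith (hL t) r).lipschitzOnWith, fun x _ => ?_, ?_, ?_⟩
    · exact ((h.contDiff.continuous.comp (continuous_const.prodMk hΛ)).const_smul r⁻¹).continuousOn
    · intro t _ x _
      rw [norm_smul]
      push_cast
      gcongr
      exact h.bound _ _ (hL t)
    · simp [hT]
  obtain ⟨x, h1, h2⟩ := hPL.exists_eq_forall_mem_Icc_hasDerivWithinAt₀
  exact ⟨x, h2, h1⟩

/-- Global solvability of tame systems. -/
lemma IsTame.exists_isSol {F : Vec n → Vec d → Vec n} {L : ℝ} {K M : NNReal}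
    (h : IsTame F L K M) (hΛ : Continuous Λ) (hL : ∀ t, ‖Λ t‖ ≤ L) (r a : ℝ)
    (x₀ : Vec n) : ∃ x, IsSol F Λ r univ x ∧ x a = x₀ := by
  choose z hz hza using fun k : ℕ => h.exists_isSol_Icc hΛ hL r a (k + 1) (by positivity) x₀
  have hmono : ∀ k m : ℕ, k ≤ m → EqOn (z m) (z k) (Icc (a - (k + 1)) (a + (k + 1))) := by
    intro k m hkm
    have hkm' : (k : ℝ) ≤ m := by exact_mod_cast hkm
    refine IsSol.eqOn h.contDiff hΛ ordConnected_Icc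
      ((hz m).mono (Icc_subset_Icc (by linarith) (by linarith))) (hz k)
      (a := a) ⟨by linarith [k.cast_nonneg (α := ℝ)], by linarith [k.cast_nonneg (α := ℝ)]⟩ ?_
    rw [hza, hza]
  let x : ℝ → Vec n := fun t => z ⌈|t - a|⌉₊ t
  have hx : ∀ k : ℕ, EqOn x (z k) (Icc (a - (k + 1)) (a + (k + 1))) := by
    intro k t ht
    rcases le_total ⌈|t - a|⌉₊ k with hle | hle
    · refine (hmono _ _ hle ?_).symm
      have h1 := Nat.le_ceil |t - a|
      have h2 := abs_le.1 h1
      constructor <;> linarith [h2.1, h2.2]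
    · exact hmono _ _ hle ht
  refine ⟨x, fun t _ => ?_, ?_⟩
  · obtain ⟨k, hk⟩ := exists_nat_gt |t - a|
    have h2 := abs_lt.1 hk
    have hnhds : Icc (a - (k + 1)) (a + (k + 1)) ∈ 𝓝 t :=
      Icc_mem_nhds (by linarith [h2.1]) (by linarith [h2.2])
    exact ((((hz k).congr (hx k)).hasDerivAt hnhds)).hasDerivWithinAt
  · simp [x, hza]

variable {f : Vec n → Vec d → Vec n} {Λ : ℝ → Vec d} {r : ℝ} {I J : Set ℝ} {x y : ℝ → Vec n}

/-- Local solvability forward in time. -/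
lemma exists_isSol_local (hf : ContDiff ℝ 1 (fun p : Vec n × Vec d => f p.1 p.2))
    (hΛ : Continuous Λ) {L : ℝ} (hL : ∀ t, ‖Λ t‖ ≤ L) (r b : ℝ) (x₀ : Vec n) :
    ∃ c > b, ∃ z, IsSol f Λ r (Icc b c) z ∧ z b = x₀ := by
  obtain ⟨F, hF, K, M, hT⟩ := exists_tame hf (‖x₀‖ + 1) L
  obtain ⟨z, hz, hzb⟩ := hT.exists_isSol hΛ hL r b x₀
  have hc : ContinuousAt (fun t => ‖z t‖) b :=
    ((hz.hasDerivAt (t := b) univ_mem).continuousAt).norm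
  have : ∀ᶠ t in 𝓝 b, ‖z t‖ < ‖x₀‖ + 1 := by
    refine hc.eventually (gt_mem_nhds ?_)
    show ‖z b‖ < _
    rw [hzb]; linarith
  obtain ⟨ε, hε, h⟩ := Metric.eventually_nhds_iff.1 this
  refine ⟨b + ε / 2, by linarith, z, ?_, hzb⟩
  refine (hz.mono (subset_univ _)).congr_field fun t ht => (hF _ _ (h ?_).le).symm
  rw [Real.dist_eq, abs_of_nonneg (by linarith [ht.1])]
  linarith [ht.2]

/-- Continuous dependence of solutions on the initial value, the input and the rate; nearby
solutions exist on the whole compact interval. -/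
lemma IsSol.exists_near (hf : ContDiff ℝ 1 (fun p : Vec n × Vec d => f p.1 p.2))
    (hΛ : Continuous Λ) {a b : ℝ} (hab : a ≤ b) (hx : IsSol f Λ r (Icc a b) x)
    {ε : ℝ} (hε : 0 < ε) :
    ∃ δ > 0, ∀ (r' : ℝ) (Λ' : ℝ → Vec d) (p : Vec n), Continuous Λ' → |r'⁻¹ - r⁻¹| < δ →
      (∀ t ∈ Icc a b, ‖Λ' t - Λ t‖ < δ) → ‖p - x a‖ < δ →
      ∃ z, IsSol f Λ' r' (Icc a b) z ∧ z a = p ∧ ∀ t ∈ Icc a b, ‖z t - x t‖ < ε := by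
  obtain ⟨R, hR⟩ := isCompact_Icc.exists_bound_of_continuousOn hx.continuousOn
  obtain ⟨L, hL⟩ := isCompact_Icc.exists_bound_of_continuousOn (hΛ.continuousOn (s := Icc a b))
  obtain ⟨F, hF, K, M, hT⟩ := exists_tame hf (R + 1) (L + 1)
  set K' : ℝ := (‖r⁻¹‖ + 1) * K + 1 with hK'
  set C : ℝ := Real.exp (K' * (b - a)) with hC
  set A : ℝ := 1 + M + ‖r⁻¹‖ * K with hA
  have hK'1 : 1 ≤ K' := by
    have : 0 ≤ (‖r⁻¹‖ + 1) * K := by positivity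
    linarith
  have hC0 : 0 < C := Real.exp_pos _
  have hA0 : 0 < A := by positivity
  set ε' := min ε 1 with hε'
  have hε'0 : 0 < ε' := lt_min hε one_pos
  refine ⟨min 1 (ε' / (2 * A * C)), by positivity, fun r' Λ' p hΛ' hr hl hp => ?_⟩
  set δ := min 1 (ε' / (2 * A * C)) with hδ
  have hδ0 : 0 < δ := by positivity
  have hδ1 : δ ≤ 1 := min_le_left _ _
  have hδA : δ * A * C < ε' := by
    have h1 : δ ≤ ε' / (2 * A * C) := min_le_right _ _
    calc δ * A * C ≤ ε' / (2 * A * C) * A * C := by gcongr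
      _ = ε' / 2 := by field_simp
      _ < ε' := by linarith
  -- only the values of the input on `[a, b]` matter, so it is made constant outside
  set Λ'' : ℝ → Vec d := fun t => Λ' (max a (min t b)) with hΛ''
  have hΛ''c : Continuous Λ'' :=
    hΛ'.comp (continuous_const.max (continuous_id.min continuous_const))
  have hmem : ∀ t, max a (min t b) ∈ Icc a b := fun t =>
    ⟨le_max_left _ _, max_le hab (min_le_right _ _)⟩
  have heq : EqOn Λ' Λ'' (Icc a b) := by
    intro t ht
    simp [hΛ'', ht.1, ht.2]
  have hL'' : ∀ t, ‖Λ'' t‖ ≤ L + 1 := by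
    intro t
    have h1 := hl _ (hmem t)
    have h2 := hL _ (hmem t)
    calc ‖Λ'' t‖ = ‖(Λ'' t - Λ (max a (min t b))) + Λ (max a (min t b))‖ := by congr 1; abel
      _ ≤ _ := norm_add_le _ _
      _ ≤ L + 1 := by linarith
  obtain ⟨z, hz, hza⟩ := hT.exists_isSol hΛ''c hL'' r' a p
  have hxF : IsSol F Λ r (Icc a b) x := hx.congr_field fun t ht => hF _ _ (by linarith [hR t ht])
  have hlip : ∀ t, LipschitzWith K'.toNNReal (fun x => r'⁻¹ • F x (Λ'' t)) := by
    intro t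
    refine (hT.lipschitzWith (hL'' t) r').weaken ?_
    rw [← NNReal.coe_le_coe, Real.coe_toNNReal _ (by linarith)]
    push_cast
    have : ‖r'⁻¹‖ ≤ ‖r⁻¹‖ + 1 := by
      have h1 : ‖r'⁻¹ - r⁻¹‖ ≤ 1 := by rw [Real.norm_eq_abs]; linarith
      calc ‖r'⁻¹‖ = ‖(r'⁻¹ - r⁻¹) + r⁻¹‖ := by congr 1; ring
        _ ≤ _ := norm_add_le _ _
        _ ≤ _ := by linarith
    have h2 : ‖r'⁻¹‖ * (K : ℝ) ≤ (‖r⁻¹‖ + 1) * K := by gcongr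
    linarith
  have hgr := dist_le_of_approx_trajectories_ODE (v := fun t x => r'⁻¹ • F x (Λ'' t))
    (f := z) (g := x) (a := a) (b := b) (εf := 0) (εg := δ * M + ‖r⁻¹‖ * (K * δ)) (δ := δ)
    (f' := fun t => r'⁻¹ • F (z t) (Λ'' t)) (g' := fun t => r⁻¹ • F (x t) (Λ t)) hlip
    (hz.continuousOn.mono (subset_univ _))
    (fun t _ => (hz.hasDerivAt univ_mem).hasDerivWithinAt) (fun t _ => by simp)
    hx.continuousOn (fun t ht => hxF.hasDerivWithinAt_Ici ht) ?_
    (by rw [hza, dist_eq_norm]; exact hp.le)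
  swap
  · intro t ht
    have ht' := Ico_subset_Icc_self ht
    rw [dist_eq_norm]
    have h1 : r⁻¹ • F (x t) (Λ t) - r'⁻¹ • F (x t) (Λ'' t) =
        (r⁻¹ - r'⁻¹) • F (x t) (Λ'' t) + r⁻¹ • (F (x t) (Λ t) - F (x t) (Λ'' t)) := by
      rw [sub_smul, smul_sub]; abel
    rw [h1]
    refine (norm_add_le _ _).trans ?_
    rw [norm_smul, norm_smul]
    have h2 : ‖r⁻¹ - r'⁻¹‖ ≤ δ := by rw [norm_sub_rev, Real.norm_eq_abs]; exact hr.le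
    have h3 : ‖F (x t) (Λ t) - F (x t) (Λ'' t)‖ ≤ K * δ := by
      have := hT.lipschitz.dist_le_mul (x t, Λ t) ⟨mem_univ _, by
        simpa using (hL t ht').trans (by linarith)⟩ (x t, Λ'' t) ⟨mem_univ _, by
        simpa using hL'' t⟩
      rw [dist_eq_norm, Prod.dist_eq, dist_self, max_eq_right dist_nonneg, dist_eq_norm] at this
      refine this.trans ?_
      gcongr
      rw [norm_sub_rev, ← heq ht']
      exact (hl t ht').le
    gcongr
    exact hT.bound _ _ (hL'' t)
  have hnear : ∀ t ∈ Icc a b, ‖z t - x t‖ < ε' := by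
    intro t ht
    have h1 := hgr t ht
    rw [dist_eq_norm, Real.coe_toNNReal _ (by linarith)] at h1
    refine h1.trans_lt (lt_of_le_of_lt (gronwallBound_le_of_one_le hK'1 (by positivity)
      (by linarith [ht.1])) ?_)
    refine lt_of_le_of_lt ?_ hδA
    have h2 : Real.exp (K' * (t - a)) ≤ C := by
      refine Real.exp_le_exp.2 ?_
      gcongr
      exact ht.2
    have h3 : δ + (0 + (δ * M + ‖r⁻¹‖ * (K * δ))) = δ * A := by rw [hA]; ring
    rw [h3]
    gcongr
  refine ⟨z, ?_, hza, fun t ht => (hnear t ht).trans_le (min_le_left _ _)⟩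
  refine ((hz.mono (subset_univ _)).congr_field fun t ht => (hF _ _ ?_).symm).congr_input heq
  have h1 := (hnear t ht).trans_le (min_le_right _ _)
  have h2 := hR t ht
  calc ‖z t‖ = ‖(z t - x t) + x t‖ := by congr 1; abel
    _ ≤ _ := norm_add_le _ _
    _ ≤ R + 1 := by linarith

/-- The version of `IsSol.exists_near` with the value prescribed at the right endpoint. -/
lemma IsSol.exists_near_left (hf : ContDiff ℝ 1 (fun p : Vec n × Vec d => f p.1 p.2))
    (hΛ : Continuous Λ) {a b : ℝ} (hab : a ≤ b) (hx : IsSol f Λ r (Icc a b) x)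
    {ε : ℝ} (hε : 0 < ε) :
    ∃ δ > 0, ∀ (r' : ℝ) (Λ' : ℝ → Vec d) (p : Vec n), Continuous Λ' → |r'⁻¹ - r⁻¹| < δ →
      (∀ t ∈ Icc a b, ‖Λ' t - Λ t‖ < δ) → ‖p - x b‖ < δ →
      ∃ z, IsSol f Λ' r' (Icc a b) z ∧ z b = p ∧ ∀ t ∈ Icc a b, ‖z t - x t‖ < ε := by
  have hpre : ∀ a b : ℝ, (fun t : ℝ => -t) ⁻¹' Icc a b = Icc (-b) (-a) := by
    intro a b; ext t; simp only [mem_preimage, mem_Icc]; constructor <;> rintro ⟨h1, h2⟩ <;>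
      constructor <;> linarith
  have h := hx.comp_neg
  rw [hpre] at h
  obtain ⟨δ, hδ, H⟩ := h.exists_near hf (hΛ.comp continuous_neg) (neg_le_neg hab) hε
  refine ⟨δ, hδ, fun r' Λ' p hΛ' hr hl hp => ?_⟩
  obtain ⟨z, hz, hzb, hzx⟩ := H (-r') (fun t => Λ' (-t)) p (hΛ'.comp continuous_neg)
    (by rw [inv_neg, inv_neg, ← neg_sub', abs_neg]; exact hr)
    (fun t ht => hl (-t) ⟨by linarith [ht.2], by linarith [ht.1]⟩) (by simpa using hp)
  have h' := hz.comp_neg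
  rw [hpre] at h'
  refine ⟨fun t => z (-t), by simpa using h', hzb, fun t ht => ?_⟩
  have := hzx (-t) ⟨by linarith [ht.2], by linarith [ht.1]⟩
  simpa using this

/-! ### Lyapunov forms of stable linear maps -/

/-- A real inner product on a complex vector space, given by its underlying function. -/
structure IsRealForm {W : Type*} [AddCommGroup W] [Module ℂ W] (b : W → W → ℝ) : Prop where
  symm : ∀ x y, b x y = b y x
  add_left : ∀ x y z, b (x + y) z = b x z + b y z
  smul_left : ∀ (t : ℝ) x y, b ((t : ℂ) • x) y = t * b x y
  pos : ∀ x, x ≠ 0 → 0 < b x x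

namespace IsRealForm

variable {W : Type*} [AddCommGroup W] [Module ℂ W] {b : W → W → ℝ}

lemma add_right (h : IsRealForm b) (x y z : W) : b x (y + z) = b x y + b x z := by
  rw [h.symm, h.add_left, h.symm y, h.symm z]

lemma smul_right (h : IsRealForm b) (t : ℝ) (x y : W) : b x ((t : ℂ) • y) = t * b x y := by
  rw [h.symm, h.smul_left, h.symm]

lemma zero_left (h : IsRealForm b) (x : W) : b 0 x = 0 := by
  have := h.smul_left 0 0 x
  simpa using this

lemma nonneg (h : IsRealForm b) (x : W) : 0 ≤ b x x := by
  by_cases hx : x = 0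
  · rw [hx, h.zero_left]
  · exact (h.pos x hx).le

lemma two_mul_le (h : IsRealForm b) {c : ℝ} (hc : 0 < c) (u v : W) :
    2 * b u v ≤ c * b v v + b u u / c := by
  have h1 := h.nonneg ((c : ℂ) • v + ((-1 : ℝ) : ℂ) • u)
  simp only [h.add_left, h.add_right, h.smul_left, h.smul_right] at h1
  rw [h.symm v u] at h1
  have h2 : c * (2 * b u v) ≤ c * (c * b v v + b u u / c) := by
    rw [mul_add, mul_div_cancel₀ _ hc.ne']
    linarith
  exact le_of_mul_le_mul_left h2 hc

lemma smul_self_le (h : IsRealForm b) (z : ℂ) (k : W) :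
    b (z • k) (z • k) ≤ 2 * (b k k + b (Complex.I • k) (Complex.I • k)) * ‖z‖ ^ 2 := by
  have e : z • k = (z.re : ℂ) • k + (z.im : ℂ) • (Complex.I • k) := by
    rw [smul_smul, ← add_smul, Complex.re_add_im]
  have h1 := h.two_mul_le one_pos ((z.re : ℂ) • k) ((z.im : ℂ) • (Complex.I • k))
  have h2 : ‖z‖ ^ 2 = z.re ^ 2 + z.im ^ 2 := by
    rw [Complex.sq_norm, Complex.normSq_apply]; ring
  rw [e, h2]
  simp only [h.add_left, h.add_right, h.smul_left, h.smul_right] at h1 ⊢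
  have h3 := h.nonneg k
  have h4 := h.nonneg (Complex.I • k)
  rw [h.symm (Complex.I • k) k]
  nlinarith [mul_nonneg (sq_nonneg z.re) h4, mul_nonneg (sq_nonneg z.im) h3]

end IsRealForm

/-- Every complex linear map with spectrum in the open left half-plane is strictly dissipative for
some inner product. Induction on the dimension: for an eigenvector `φ` of the transpose, an inner
product on the invariant hyperplane `ker φ` is extended by a large multiple of `|φ|²`. -/
theorem exists_isRealForm_dissipative (N : ℕ) : ∀ {W : Type*} [AddCommGroup W] [Module ℂ W]
    [FiniteDimensional ℂ W], Module.finrank ℂ W = N → ∀ T : Module.End ℂ W,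
    (∀ z, T.HasEigenvalue z → z.re < 0) →
    ∃ c > 0, ∃ b : W → W → ℝ, IsRealForm b ∧ ∀ x, b (T x) x ≤ -c * b x x := by
  induction N using Nat.strong_induction_on with
  | _ N ih =>
  intro W _ _ _ hN T hT
  rcases subsingleton_or_nontrivial W with hW | hW
  · refine ⟨1, one_pos, fun _ _ => 0, ⟨by simp, by simp, by simp, fun x hx => ?_⟩, by simp⟩
    exact absurd (Subsingleton.elim x 0) hx
  obtain ⟨z, hz⟩ := Module.End.exists_eigenvalue (LinearMap.dualMap T : Module.End ℂ (Module.Dual ℂ W))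
  obtain ⟨φ, hφ⟩ := hz.exists_hasEigenvector
  have hφT : ∀ x, φ (T x) = z * φ x := by
    intro x
    have := LinearMap.congr_fun hφ.apply_eq_smul x
    simpa using this
  have hφ0 : φ ≠ 0 := hφ.2
  obtain ⟨w₀, hw₀⟩ : ∃ w, φ w ≠ 0 := by
    by_contra! h
    exact hφ0 (LinearMap.ext h)
  set w := (φ w₀)⁻¹ • w₀ with hw
  have hφw : φ w = 1 := by simp [hw, hw₀]
  -- an eigenvalue of the transpose is one of `T`: the range of `T - z` lies in `ker φ`
  have hzre : z.re < 0 := by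
    apply hT
    rw [Module.End.hasEigenvalue_iff_mem_spectrum, spectrum.mem_iff]
    intro hu
    have hsurj := ((Module.End.isUnit_iff _).1 hu).2
    obtain ⟨y, hy⟩ := hsurj w
    have := congrArg φ hy
    simp [hφT, Algebra.algebraMap_eq_smul_one, hφw] at this
  set K := LinearMap.ker φ
  have hK : K ≠ ⊤ := by
    intro h
    exact hφ0 (LinearMap.ker_eq_top.1 h)
  have hTK : ∀ x ∈ K, T x ∈ K := by
    intro x hx
    rw [LinearMap.mem_ker] at hx ⊢
    rw [hφT, hx, mul_zero]
  obtain ⟨c, hc, b, hb, hbT⟩ := ih (Module.finrank ℂ K) (hN ▸ Submodule.finrank_lt hK) rfl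
    (T.restrict hTK) (by
      intro y hy
      obtain ⟨v, hv⟩ := hy.exists_hasEigenvector
      refine hT y (Module.End.hasEigenvalue_of_hasEigenvector (x := (v : W)) ⟨?_, ?_⟩)
      · rw [Module.End.mem_eigenspace_iff]
        exact congrArg Subtype.val hv.apply_eq_smul
      · exact fun h => hv.2 (Subtype.ext h))
  -- the projection onto `ker φ` along `w`
  have hmem : ∀ x, x - φ x • w ∈ K := by
    intro x; rw [LinearMap.mem_ker]; simp [hφw]
  let π : W → K := fun x => ⟨x - φ x • w, hmem x⟩
  have hπ_add : ∀ x y, π (x + y) = π x + π y := by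
    intro x y; apply Subtype.ext; simp [π, add_smul]; abel
  have hπ_smul : ∀ (t : ℂ) x, π (t • x) = t • π x := by
    intro t x; apply Subtype.ext; simp [π, smul_sub, smul_smul]
  have hkmem : T w - z • w ∈ K := by rw [LinearMap.mem_ker]; simp [hφT, hφw]
  let k : K := ⟨T w - z • w, hkmem⟩
  have hπT : ∀ x, π (T x) = T.restrict hTK (π x) + φ x • k := by
    intro x; apply Subtype.ext
    simp [π, k, hφT, smul_sub, smul_smul, mul_comm]
  set C := 2 * (b k k + b (Complex.I • k) (Complex.I • k)) with hC
  have hC0 : 0 ≤ C := by have := hb.nonneg k; have := hb.nonneg (Complex.I • k); positivity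
  -- the multiple of `|φ|²` is large enough to absorb the coupling `φ x • k` between `w` and `ker
  -- φ`
  set M := C / (c * |z.re|) + 1 with hM
  have hre : |z.re| = -z.re := abs_of_neg hzre
  have hM0 : 0 < M := by have : 0 ≤ C / (c * |z.re|) := by positivity
                         linarith
  set c' := min (c / 2) (|z.re| / 2) with hc'
  refine ⟨c', lt_min (by positivity) (by rw [hre]; linarith), fun x y => b (π x) (π y) + M * (φ x * (starRingEnd ℂ) (φ y)).re,
    ⟨?_, ?_, ?_, ?_⟩, ?_⟩
  · intro x y
    have e : (φ x * (starRingEnd ℂ) (φ y)).re = (φ y * (starRingEnd ℂ) (φ x)).re := by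
      simp only [Complex.mul_re, Complex.conj_re, Complex.conj_im]; ring
    rw [hb.symm, e]
  · intro x y z
    rw [hπ_add, hb.add_left]
    simp [Complex.mul_re]; ring
  · intro t x y
    rw [hπ_smul, hb.smul_left]
    simp [Complex.mul_re]; ring
  · intro x hx
    have e : (φ x * (starRingEnd ℂ) (φ x)).re = ‖φ x‖ ^ 2 := by
      rw [Complex.mul_conj, Complex.sq_norm, Complex.ofReal_re]
    rw [e]
    by_cases h : φ x = 0
    · have : π x ≠ 0 := by
        intro h'
        apply hx
        have := congrArg Subtype.val h'
        simpa [π, h] using this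
      have := hb.pos _ this
      positivity
    · have := hb.nonneg (π x)
      positivity
  · intro x
    have e : (φ x * (starRingEnd ℂ) (φ x)).re = ‖φ x‖ ^ 2 := by
      rw [Complex.mul_conj, Complex.sq_norm, Complex.ofReal_re]
    have e' : (φ (T x) * (starRingEnd ℂ) (φ x)).re = z.re * ‖φ x‖ ^ 2 := by
      rw [hφT, mul_assoc, Complex.mul_conj, Complex.sq_norm, mul_comm, Complex.re_ofReal_mul, mul_comm]
    simp only [e, e']
    rw [hπT, hb.add_left]
    have h1 := hbT (π x)
    have h2 := hb.two_mul_le hc (φ x • k) (π x)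
    have h3 := hb.smul_self_le (φ x) k
    rw [← hC] at h3
    have h4 := hb.nonneg (π x)
    have h5 : 0 ≤ ‖φ x‖ ^ 2 := by positivity
    have h6 : b (φ x • k) (φ x • k) / c ≤ C / c * ‖φ x‖ ^ 2 := by
      rw [div_mul_eq_mul_div]; gcongr
    have h7 : C / c ≤ M * |z.re| := by
      have hz0 : |z.re| ≠ 0 := by rw [hre]; linarith
      have : C / c = C / (c * |z.re|) * |z.re| := by field_simp
      rw [this]; gcongr; linarith
    have h8 : C / c * ‖φ x‖ ^ 2 ≤ M * |z.re| * ‖φ x‖ ^ 2 := by gcongr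
    have h9 : c' ≤ c / 2 := min_le_left _ _
    have h10 : c' ≤ |z.re| / 2 := min_le_right _ _
    have h11 : c' * b (π x) (π x) ≤ c / 2 * b (π x) (π x) := by gcongr
    have h12 : c' * (M * ‖φ x‖ ^ 2) ≤ |z.re| / 2 * (M * ‖φ x‖ ^ 2) := by gcongr
    rw [hre] at h8 h12
    nlinarith

/-- The real version: a stable real linear map is strictly dissipative for some inner product. -/
theorem exists_lyapunov_form {V : Type*} [NormedAddCommGroup V] [NormedSpace ℝ V]
    [FiniteDimensional ℝ V] (A : V →L[ℝ] V) (hA : ∀ z ∈ eigs A, z.re < 0) :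
    ∃ c > 0, ∃ B : V →L[ℝ] V →L[ℝ] ℝ, (∀ x y, B x y = B y x) ∧ (∀ x, x ≠ 0 → 0 < B x x) ∧
      ∀ x, B (A x) x ≤ -c * B x x := by
  obtain ⟨c, hc, b, hb, hbT⟩ := exists_isRealForm_dissipative _ (W := TensorProduct ℝ ℂ V) rfl
    (LinearMap.baseChange ℂ (A : V →ₗ[ℝ] V)) (by
      intro z hz
      apply hA
      rw [Module.End.hasEigenvalue_iff_isRoot_charpoly, LinearMap.charpoly_baseChange] at hz
      rw [eigs, Polynomial.mem_aroots]
      refine ⟨(LinearMap.charpoly_monic _).ne_zero, ?_⟩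
      rwa [Polynomial.aeval_def, ← Polynomial.eval_map])
  let ι : V → TensorProduct ℝ ℂ V := fun x => TensorProduct.tmul ℝ (1 : ℂ) x
  have hι_add : ∀ x y, ι (x + y) = ι x + ι y := fun x y => TensorProduct.tmul_add _ _ _
  have hι_smul : ∀ (t : ℝ) x, ι (t • x) = (t : ℂ) • ι x := by
    intro t x
    simp only [ι]
    rw [TensorProduct.tmul_smul, TensorProduct.smul_tmul', TensorProduct.smul_tmul']
    simp
  have hι_ne : ∀ x, x ≠ 0 → ι x ≠ 0 := by
    intro x hx h
    apply hx
    have hinj : Function.Injective (TensorProduct.mk ℝ ℂ V 1) :=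
      Module.FaithfullyFlat.tensorProduct_mk_injective V
    exact hinj (by simpa [ι] using h)
  let B₀ : V →ₗ[ℝ] V →ₗ[ℝ] ℝ := LinearMap.mk₂ ℝ (fun x y => b (ι x) (ι y))
    (fun x y z => by rw [hι_add, hb.add_left]) (fun t x y => by rw [hι_smul, hb.smul_left]; rfl)
    (fun x y z => by rw [hι_add, hb.add_right]) (fun t x y => by rw [hι_smul, hb.smul_right]; rfl)
  refine ⟨c, hc, B₀.toContinuousBilinearMap, fun x y => hb.symm _ _,
    fun x hx => hb.pos _ (hι_ne x hx), fun x => ?_⟩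
  have := hbT (ι x)
  simpa [ι, B₀] using this

section Forms

variable {V : Type*} [NormedAddCommGroup V] [NormedSpace ℝ V]

/-- The projection along `w` onto `ker ℓ`. -/
def projKer (ℓ : V →L[ℝ] ℝ) (w : V) : V →L[ℝ] V :=
  ContinuousLinearMap.id ℝ V - ℓ.smulRight w

@[simp] lemma projKer_apply (ℓ : V →L[ℝ] ℝ) (w x : V) : projKer ℓ w x = x - ℓ x • w := by
  simp [projKer]

/-- The form `B (P x) (P y)`, `P` the projection onto `ker ℓ` along `w`. -/
def stableForm (ℓ : V →L[ℝ] ℝ) (w : V) (B : V →L[ℝ] V →L[ℝ] ℝ) : V →L[ℝ] V →L[ℝ] ℝ :=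
  B.bilinearComp (projKer ℓ w) (projKer ℓ w)

/-- The form `ℓ x * ℓ y`. -/
def unstableForm (ℓ : V →L[ℝ] ℝ) : V →L[ℝ] V →L[ℝ] ℝ :=
  (ContinuousLinearMap.mul ℝ ℝ).bilinearComp ℓ ℓ

@[simp] lemma stableForm_apply (ℓ : V →L[ℝ] ℝ) (w : V) (B : V →L[ℝ] V →L[ℝ] ℝ) (x y : V) :
    stableForm ℓ w B x y = B (projKer ℓ w x) (projKer ℓ w y) := rfl

@[simp] lemma unstableForm_apply (ℓ : V →L[ℝ] ℝ) (x y : V) :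
    unstableForm ℓ x y = ℓ x * ℓ y := rfl

end Forms

section LinearAlgebra

variable {V : Type*} [NormedAddCommGroup V] [NormedSpace ℝ V] [FiniteDimensional ℝ V]

/-! ### Splitting off a simple unstable eigenvalue, and index counts -/

lemma mem_eigs_iff {A : V →L[ℝ] V} {z : ℂ} :
    z ∈ eigs A ↔ Polynomial.aeval z (LinearMap.charpoly (A : V →ₗ[ℝ] V)) = 0 := by
  rw [eigs, Polynomial.mem_aroots]
  exact and_iff_right (LinearMap.charpoly_monic _).ne_zero

lemma charpoly_smul (A : V →ₗ[ℝ] V) {c : ℝ} (hc : c ≠ 0) :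
    (c • A).charpoly = (A.charpoly).scaleRoots c := by
  refine Polynomial.funext fun t => ?_
  obtain ⟨s, rfl⟩ : ∃ s, t = c * s := ⟨c⁻¹ * t, by field_simp⟩
  rw [Polynomial.scaleRoots_eval_mul, LinearMap.eval_charpoly, LinearMap.eval_charpoly,
    LinearMap.charpoly_natDegree, ← LinearMap.det_smul]
  congr 1
  ext x
  simp [smul_sub, smul_smul, mul_comm]

lemma eigs_smul (A : V →L[ℝ] V) {c : ℝ} (hc : c ≠ 0) :
    eigs (c • A) = (eigs A).map (fun z => (c : ℂ) * z) := by
  have h : ((c • A : V →L[ℝ] V) : V →ₗ[ℝ] V) = c • (A : V →ₗ[ℝ] V) := rfl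
  rw [eigs, h, charpoly_smul _ hc, Polynomial.aroots_def, Polynomial.map_scaleRoots,
    Polynomial.roots_scaleRoots]
  · rfl
  · simpa using hc
  · simp [(LinearMap.charpoly_monic (A : V →ₗ[ℝ] V)).leadingCoeff]

lemma card_eigs (A : V →L[ℝ] V) : (eigs A).card = Module.finrank ℝ V := by
  rw [eigs, IsAlgClosed.card_aroots_eq_natDegree, LinearMap.charpoly_natDegree]

lemma charpoly_smul_id (ν : ℝ) :
    LinearMap.charpoly (ν • (LinearMap.id : ℝ →ₗ[ℝ] ℝ)) = Polynomial.X - Polynomial.C ν := by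
  refine Polynomial.funext fun t => ?_
  rw [LinearMap.eval_charpoly]
  have : (algebraMap ℝ (Module.End ℝ ℝ)) t - ν • LinearMap.id = (t - ν) • LinearMap.id := by
    ext; simp
  rw [this, LinearMap.det_smul]
  simp

lemma eigs_prodMap (A : V →L[ℝ] V) (ν : ℝ) :
    eigs (A.prodMap (ν • ContinuousLinearMap.id ℝ ℝ)) = eigs A + {(ν : ℂ)} := by
  have h : ((A.prodMap (ν • ContinuousLinearMap.id ℝ ℝ) : V × ℝ →L[ℝ] V × ℝ) : V × ℝ →ₗ[ℝ] V × ℝ)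
      = (A : V →ₗ[ℝ] V).prodMap (ν • LinearMap.id) := rfl
  rw [eigs, h, LinearMap.charpoly_prodMap, charpoly_smul_id, Polynomial.aroots_mul,
    Polynomial.aroots_X_sub_C]
  · rfl
  · exact mul_ne_zero (LinearMap.charpoly_monic _).ne_zero (Polynomial.X_sub_C_ne_zero ν)

lemma unstableIndex_smul (A : V →L[ℝ] V) {c : ℝ} (hc : 0 < c) :
    unstableIndex (c • A) = unstableIndex A := by
  rw [unstableIndex, unstableIndex, eigs_smul A hc.ne', Multiset.filter_map, Multiset.card_map]
  congr 1
  refine Multiset.filter_congr fun z _ => ?_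
  simp [mul_pos_iff_of_pos_left hc]

lemma stableIndex_smul (A : V →L[ℝ] V) {c : ℝ} (hc : 0 < c) :
    stableIndex (c • A) = stableIndex A := by
  rw [stableIndex, stableIndex, eigs_smul A hc.ne', Multiset.filter_map, Multiset.card_map]
  congr 1
  refine Multiset.filter_congr fun z _ => ?_
  simp only [Function.comp_def, Complex.mul_re, Complex.ofReal_re, Complex.ofReal_im, zero_mul,
    sub_zero]
  constructor
  · intro h; by_contra h'; push Not at h'; nlinarith
  · intro h; nlinarith

lemma stableIndex_add_unstableIndex (A : V →L[ℝ] V) (h : ∀ z ∈ eigs A, z.re ≠ 0) :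
    stableIndex A + unstableIndex A = Module.finrank ℝ V := by
  rw [← card_eigs A, stableIndex, unstableIndex, ← Multiset.card_add]
  congr 1
  rw [← Multiset.filter_add_not (fun z : ℂ => z.re < 0) (eigs A)]
  congr 1
  · simp [Multiset.filter_add, Multiset.filter_filter]
  · rw [Multiset.filter_add_not]
    refine Multiset.filter_congr fun z hz => ?_
    have := h z hz
    constructor
    · intro h'; linarith
    · intro h'; push Not at h'; exact lt_of_le_of_ne h' (Ne.symm this)

/-- For a left eigenvector `ℓ` and a right eigenvector `w` to the same eigenvalue `ν`, with `ℓ w =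
1`, the eigenvalue splits off the characteristic polynomial. -/
lemma charpoly_of_invariant_splitting (T : V →ₗ[ℝ] V) (ℓ : V →ₗ[ℝ] ℝ) (w : V) (ν : ℝ)
    (hℓw : ℓ w = 1) (hℓT : ∀ x, ℓ (T x) = ν * ℓ x) (hTw : T w = ν • w)
    (hK : ∀ x ∈ LinearMap.ker ℓ, T x ∈ LinearMap.ker ℓ) :
    T.charpoly = (T.restrict hK).charpoly * (Polynomial.X - Polynomial.C ν) := by
  let e : V ≃ₗ[ℝ] LinearMap.ker ℓ × ℝ :=
    { toFun := fun x => (⟨x - ℓ x • w, by rw [LinearMap.mem_ker]; simp [hℓw]⟩, ℓ x)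
      invFun := fun q => q.1 + q.2 • w
      map_add' := fun x y => by
        ext
        · simp [add_smul]; abel
        · simp
      map_smul' := fun t x => by
        ext
        · simp [smul_sub, smul_smul]
        · simp
      left_inv := fun x => by simp
      right_inv := fun q => by
        have := LinearMap.mem_ker.1 q.1.2
        ext <;> simp [this, hℓw] }
  rw [← charpoly_smul_id ν, ← LinearMap.charpoly_prodMap, ← e.charpoly_conj T]
  congr 1
  have happ : ∀ q, e.conj T q = e (T (e.symm q)) := fun q => by simp [LinearEquiv.conj_apply]
  refine LinearMap.ext fun q => ?_
  have h0 := LinearMap.mem_ker.1 q.1.2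
  rw [happ]
  have e1 : e.symm q = q.1 + q.2 • w := rfl
  have e2 : ∀ x, e x = (⟨x - ℓ x • w, by rw [LinearMap.mem_ker]; simp [hℓw]⟩, ℓ x) := fun x => rfl
  rw [e1, e2]
  ext
  · simp [hℓT, h0, hTw, hℓw, smul_smul, mul_comm]
  · simp [hℓT, h0, hℓw, mul_comm]

/-- For a hyperbolic `A` with exactly one unstable eigenvalue `μ`: left and right eigenvectors
`ℓ`, `w` with `ℓ w = 1`, such that reflecting `μ` to `-μ` gives a stable map. -/
lemma exists_unstable_splitting (A : V →L[ℝ] V) (h0 : ∀ z ∈ eigs A, z.re ≠ 0)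
    (h1 : unstableIndex A = 1) :
    ∃ μ > 0, ∃ (ℓ : V →L[ℝ] ℝ) (w : V), ℓ w = 1 ∧ (∀ x, ℓ (A x) = μ * ℓ x) ∧ A w = μ • w ∧
      ∀ z ∈ eigs (A - (2 * μ) • ℓ.smulRight w), z.re < 0 := by
  classical
  rw [unstableIndex, Multiset.card_eq_one] at h1
  obtain ⟨z, hz⟩ := h1
  have hzm : z ∈ eigs A ∧ 0 < z.re := by
    have : z ∈ (eigs A).filter (fun z => 0 < z.re) := by rw [hz]; simp
    exact Multiset.mem_filter.1 this
  -- the unstable eigenvalue is real, as its conjugate is an unstable eigenvalue as well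
  have hreal : (starRingEnd ℂ) z = z := by
    have : (starRingEnd ℂ) z ∈ (eigs A).filter (fun z => 0 < z.re) := by
      rw [Multiset.mem_filter, mem_eigs_iff, Polynomial.aeval_conj, mem_eigs_iff.1 hzm.1]
      simpa using hzm.2
    rw [hz] at this
    simpa using this
  obtain ⟨μ, rfl⟩ := Complex.conj_eq_iff_real.1 hreal
  have hμ : 0 < μ := by simpa using hzm.2
  have hmult : (LinearMap.charpoly (A : V →ₗ[ℝ] V)).rootMultiplicity μ = 1 := by
    have e1 : (eigs A).count (μ : ℂ) = 1 := by
      have := congrArg (Multiset.count (μ : ℂ)) hz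
      rw [Multiset.count_filter_of_pos (by simpa using hμ)] at this
      simpa using this
    rw [eigs, Polynomial.aroots_def, Polynomial.count_roots] at e1
    rw [Polynomial.eq_rootMultiplicity_map (f := algebraMap ℝ ℂ) (algebraMap ℝ ℂ).injective]
    exact e1
  set T : Module.End ℝ V := (A : V →ₗ[ℝ] V) with hTdef
  have hfin : Module.finrank ℝ (T.maxGenEigenspace μ) = 1 := by
    rw [LinearMap.finrank_maxGenEigenspace_eq, hmult]
  have hev : T.HasEigenvalue μ := by
    rw [Module.End.hasEigenvalue_iff_isRoot_charpoly]
    refine (Polynomial.rootMultiplicity_pos (LinearMap.charpoly_monic _).ne_zero).1 ?_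
    rw [hmult]; exact one_pos
  obtain ⟨w₀, hw₀⟩ := hev.exists_hasEigenvector
  have hw₀T : T w₀ = μ • w₀ := hw₀.apply_eq_smul
  have hw₀mem : w₀ ∈ T.maxGenEigenspace μ := by
    rw [Module.End.mem_maxGenEigenspace]
    exact ⟨1, by simp [hw₀T]⟩
  -- the eigenvalue is simple, so that the generalized eigenspace is spanned by `w₀`, and `w₀`
  -- cannot be in the range of `T - μ`; a functional that vanishes on this range but not at `w₀`
  -- is a left eigenvector
  have hnot : w₀ ∉ LinearMap.range (T - algebraMap ℝ (Module.End ℝ V) μ) := by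
    rintro ⟨u, hu⟩
    have humem : u ∈ T.maxGenEigenspace μ := by
      rw [Module.End.mem_maxGenEigenspace]
      refine ⟨2, ?_⟩
      have e : (T - μ • (1 : Module.End ℝ V)) = T - algebraMap ℝ (Module.End ℝ V) μ := by
        rw [Algebra.algebraMap_eq_smul_one]
      rw [e, pow_two, Module.End.mul_apply, hu]
      simp [hw₀T]
    obtain ⟨c, hc⟩ := (finrank_eq_one_iff_of_nonzero' (⟨w₀, hw₀mem⟩ : T.maxGenEigenspace μ)
      (by intro h; exact hw₀.2 (congrArg Subtype.val h))).1 hfin ⟨u, humem⟩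
    have hc' : c • w₀ = u := congrArg Subtype.val hc
    rw [← hc'] at hu
    apply hw₀.2
    rw [← hu]
    simp [hw₀T]
  obtain ⟨ℓ₀, hℓ₀, hker⟩ := Submodule.exists_le_ker_of_notMem hnot
  have hℓ₀T : ∀ x, ℓ₀ (T x) = μ * ℓ₀ x := by
    intro x
    have : ℓ₀ ((T - algebraMap ℝ (Module.End ℝ V) μ) x) = 0 := hker ⟨x, rfl⟩
    simpa [sub_eq_zero] using this
  set w := (ℓ₀ w₀)⁻¹ • w₀ with hw
  have hℓw : ℓ₀ w = 1 := by simp [hw, hℓ₀]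
  have hTw : T w = μ • w := by rw [hw, map_smul, hw₀T, smul_comm]
  refine ⟨μ, hμ, LinearMap.toContinuousLinearMap ℓ₀, w, hℓw, hℓ₀T, hTw, fun z hz' => ?_⟩
  have hK : ∀ x ∈ LinearMap.ker ℓ₀, T x ∈ LinearMap.ker ℓ₀ := by
    intro x hx
    rw [LinearMap.mem_ker] at hx ⊢
    rw [hℓ₀T, hx, mul_zero]
  set T' : Module.End ℝ V :=
    ((A - (2 * μ) • (LinearMap.toContinuousLinearMap ℓ₀).smulRight w : V →L[ℝ] V) : V →ₗ[ℝ] V)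
    with hT'def
  have hT'x : ∀ x, T' x = T x - (2 * μ * ℓ₀ x) • w := by
    intro x; simp [hT'def, hTdef, smul_smul]
  have hK' : ∀ x ∈ LinearMap.ker ℓ₀, T' x ∈ LinearMap.ker ℓ₀ := by
    intro x hx
    rw [hT'x, LinearMap.mem_ker.1 hx]
    simpa using hK x hx
  have c1 := charpoly_of_invariant_splitting T ℓ₀ w μ hℓw hℓ₀T hTw hK
  have c2 := charpoly_of_invariant_splitting T' ℓ₀ w (-μ) hℓw
    (fun x => by rw [hT'x, map_sub, map_smul, hℓw, hℓ₀T]; simp; ring)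
    (by rw [hT'x, hTw, hℓw, ← sub_smul]; congr 1; ring) hK'
  -- the reflection changes nothing on `ker ℓ₀`, so that all other eigenvalues are kept
  have c3 : T'.restrict hK' = T.restrict hK := by
    ext x
    have := LinearMap.mem_ker.1 x.2
    simp [hT'x, this]
  rw [c3] at c2
  set q := (T.restrict hK).charpoly with hq
  have hq0 : q ≠ 0 := (LinearMap.charpoly_monic _).ne_zero
  have hA : eigs A = q.aroots ℂ + {(μ : ℂ)} := by
    rw [eigs, ← hTdef, c1, Polynomial.aroots_mul
      (mul_ne_zero hq0 (Polynomial.X_sub_C_ne_zero _)), Polynomial.aroots_X_sub_C]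
    rfl
  rw [eigs, ← hT'def, c2, Polynomial.aroots_mul
      (mul_ne_zero hq0 (Polynomial.X_sub_C_ne_zero _)), Polynomial.aroots_X_sub_C,
      Multiset.mem_add] at hz'
  rcases hz' with hz' | hz'
  · have hne := h0 z (by rw [hA]; exact Multiset.mem_add.2 (Or.inl hz'))
    by_contra hge
    have hpos : 0 < z.re := lt_of_le_of_ne (not_lt.1 hge) (Ne.symm hne)
    rw [hA, Multiset.filter_add, Multiset.filter_singleton,
      if_pos (by simpa using hμ)] at hz
    have hcard := congrArg Multiset.card hz
    rw [Multiset.card_add] at hcard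
    have : z ∈ (q.aroots ℂ).filter (fun z => 0 < z.re) := Multiset.mem_filter.2 ⟨hz', hpos⟩
    have := Multiset.card_pos_iff_exists_mem.2 ⟨z, this⟩
    rw [Multiset.card_singleton] at hcard
    omega
  · have : z = ((-μ : ℝ) : ℂ) := by simpa using hz'
    rw [this]
    simpa using hμ

/-! ### Dichotomies -/

/-- An exponential dichotomy of `A` expressed by two positive semidefinite forms: `p` measures the
unstable component and `b` the stable one, and together they are coercive. -/
structure IsDichotomy (A : V →L[ℝ] V) (p b : V →L[ℝ] V →L[ℝ] ℝ) (k m : ℝ) : Prop where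
  k_pos : 0 < k
  m_pos : 0 < m
  p_symm : ∀ x y, p x y = p y x
  b_symm : ∀ x y, b x y = b y x
  p_nonneg : ∀ x, 0 ≤ p x x
  b_nonneg : ∀ x, 0 ≤ b x x
  p_le : ∀ x, 4 * k * p x x ≤ p (A x) x
  b_le : ∀ x, b (A x) x ≤ -(4 * k) * b x x
  coercive : ∀ x, m * ‖x‖ ^ 2 ≤ p x x + b x x

/-- A continuous function, homogeneous of degree two and positive off zero, dominates a multiple
of the square of the norm. -/
lemma exists_coercive (E : V → ℝ) (hE : Continuous E) (hsmul : ∀ (t : ℝ) x, E (t • x) = t ^ 2 * E x)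
    (hpos : ∀ x, x ≠ 0 → 0 < E x) : ∃ m > 0, ∀ x, m * ‖x‖ ^ 2 ≤ E x := by
  rcases (Metric.sphere (0 : V) 1).eq_empty_or_nonempty with hS | hS
  · refine ⟨1, one_pos, fun x => ?_⟩
    have hx : x = 0 := by
      by_contra hx
      have : ‖x‖⁻¹ • x ∈ Metric.sphere (0 : V) 1 := by
        simp [norm_smul, inv_mul_cancel₀ (norm_ne_zero_iff.2 hx)]
      rw [hS] at this
      exact this
    have := hsmul 0 0
    simp at this
    simp [hx, this]
  · obtain ⟨y, hy, hmin⟩ := (isCompact_sphere (0 : V) 1).exists_isMinOn hS hE.continuousOn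
    have hy0 : y ≠ 0 := by
      intro h; rw [h] at hy; simp at hy
    refine ⟨E y, hpos y hy0, fun x => ?_⟩
    by_cases hx : x = 0
    · have := hsmul 0 0
      simp at this
      simp [hx, this]
    · have hx' : ‖x‖ ≠ 0 := norm_ne_zero_iff.2 hx
      have : ‖x‖⁻¹ • x ∈ Metric.sphere (0 : V) 1 := by
        simp [norm_smul, inv_mul_cancel₀ hx']
      have h2 := hmin this
      simp only [mem_ofPred_eq, hsmul] at h2
      have h3 : 0 < ‖x‖ ^ 2 := by positivity
      calc E y * ‖x‖ ^ 2 ≤ (‖x‖⁻¹ ^ 2 * E x) * ‖x‖ ^ 2 := by gcongr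
        _ = E x := by field_simp

/-- For a stable map the unstable form can be taken to be zero. -/
lemma exists_isDichotomy_of_sink (A : V →L[ℝ] V) (hA : ∀ z ∈ eigs A, z.re < 0) :
    ∃ b : V →L[ℝ] V →L[ℝ] ℝ, ∃ k m, IsDichotomy A 0 b k m := by
  obtain ⟨c, hc, B, hsymm, hpos, hB⟩ := exists_lyapunov_form A hA
  obtain ⟨m, hm, hm'⟩ := exists_coercive (fun x => B x x) (by fun_prop)
    (fun t x => by simp; ring) hpos
  refine ⟨B, c / 4, m, by positivity, hm, by simp, hsymm, by simp, fun x => ?_, by simp,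
    fun x => by have := hB x; linarith, fun x => by simpa using hm' x⟩
  by_cases hx : x = 0
  · simp [hx]
  · exact (hpos x hx).le

/-- The data of a linear saddle with one unstable direction: the unstable eigenvalue `μ` with left
and right eigenvectors, a form `B` in which the map with `μ` reflected to `-μ` is dissipative, and
the resulting dichotomy. -/
structure IsEdgeSplitting (A : V →L[ℝ] V) (μ c : ℝ) (ℓ : V →L[ℝ] ℝ) (w : V)
    (B : V →L[ℝ] V →L[ℝ] ℝ) (m : ℝ) : Prop where
  mu_pos : 0 < μ
  c_pos : 0 < c
  m_pos : 0 < m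
  ell_w : ℓ w = 1
  ell_A : ∀ x, ℓ (A x) = μ * ℓ x
  A_w : A w = μ • w
  B_symm : ∀ x y, B x y = B y x
  B_coercive : ∀ x, m * ‖x‖ ^ 2 ≤ B x x
  B_le : ∀ x, B (A x - (2 * μ * ℓ x) • w) x ≤ -c * B x x

lemma exists_isEdgeSplitting (A : V →L[ℝ] V) (h0 : ∀ z ∈ eigs A, z.re ≠ 0)
    (h1 : unstableIndex A = 1) : ∃ μ c ℓ w B m, IsEdgeSplitting A μ c ℓ w B m := by
  obtain ⟨μ, hμ, ℓ, w, hℓw, hℓA, hAw, hA'⟩ := exists_unstable_splitting A h0 h1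
  obtain ⟨c, hc, B, hsymm, hpos, hB⟩ := exists_lyapunov_form _ hA'
  obtain ⟨m, hm, hm'⟩ := exists_coercive (fun x => B x x) (by fun_prop)
    (fun t x => by simp; ring) hpos
  refine ⟨μ, c, ℓ, w, B, m, hμ, hc, hm, hℓw, hℓA, hAw, hsymm, hm', fun x => ?_⟩
  have := hB x
  simpa [smul_smul] using this

/-- With `p = ℓ ⊗ ℓ` and `b = B` on the component in `ker ℓ`: on `ker ℓ` the reflected map agrees
with `A`, so that `A` is dissipative there. -/
lemma IsEdgeSplitting.exists_isDichotomy {A : V →L[ℝ] V} {μ c : ℝ} {ℓ : V →L[ℝ] ℝ} {w : V}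
    {B : V →L[ℝ] V →L[ℝ] ℝ} {m : ℝ} (h : IsEdgeSplitting A μ c ℓ w B m) :
    ∃ k m', IsDichotomy A (unstableForm ℓ) (stableForm ℓ w B) k m' := by
  have hB0 : ∀ x, 0 ≤ B x x := fun x =>
    le_trans (mul_nonneg h.m_pos.le (sq_nonneg _)) (h.B_coercive x)
  obtain ⟨m', hm', hco⟩ := exists_coercive
    (fun x => unstableForm ℓ x x + stableForm ℓ w B x x) (by fun_prop) (fun t x => by
      simp only [map_smul, unstableForm_apply, stableForm_apply, smul_apply, smul_eq_mul]; ring)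
    (fun x hx => by
      rw [unstableForm_apply, stableForm_apply]
      by_cases hℓ : ℓ x = 0
      · have hP : projKer ℓ w x = x := by simp [hℓ]
        rw [hP, hℓ]
        have := h.B_coercive x
        have h2 : 0 < m * ‖x‖ ^ 2 := mul_pos h.m_pos (by positivity)
        linarith
      · have := hB0 (projKer ℓ w x)
        have h2 : 0 < ℓ x * ℓ x := mul_self_pos.2 hℓ
        linarith)
  refine ⟨min μ c / 4, m', by have := lt_min h.mu_pos h.c_pos; positivity, hm',
    fun x y => mul_comm _ _, fun x y => h.B_symm _ _, fun x => mul_self_nonneg _,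
    fun x => hB0 _, fun x => ?_, fun x => ?_, hco⟩
  · rw [unstableForm_apply, unstableForm_apply, h.ell_A]
    have h1 : min μ c ≤ μ := min_le_left _ _
    have h2 : 0 ≤ ℓ x * ℓ x := mul_self_nonneg _
    nlinarith
  · rw [stableForm_apply, stableForm_apply]
    have hP : projKer ℓ w (A x) = A (projKer ℓ w x) - (2 * μ * ℓ (projKer ℓ w x)) • w := by
      simp [h.ell_w, h.ell_A, h.A_w, smul_smul, mul_comm]
    rw [hP]
    have h1 := h.B_le (projKer ℓ w x)
    have h2 : min μ c ≤ c := min_le_right _ _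
    have h3 := hB0 (projKer ℓ w x)
    nlinarith

end LinearAlgebra

/-! ### The compactified input -/

/-- The input near an infinite time end, as a function of `σ = exp (-α τ)`, extended by the limit
value to `σ ≤ 0`. -/
def glueInput (Λ : ℝ → Vec d) (l : Vec d) (α σ : ℝ) : Vec d :=
  if σ ≤ 0 then l else Λ (-Real.log σ / α)

lemma continuous_ite_le_zero {E : Type*} [TopologicalSpace E] {h : ℝ → E} {c : E}
    (hc : ContinuousOn h (Ioi 0)) (hlim : Tendsto h (𝓝[>] 0) (𝓝 c)) :
    Continuous (fun σ => if σ ≤ 0 then c else h σ) := by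
  rw [continuous_iff_continuousAt]
  intro σ
  rcases lt_trichotomy σ 0 with hσ | rfl | hσ
  · have : (fun σ => if σ ≤ 0 then c else h σ) =ᶠ[𝓝 σ] fun _ => c := by
      filter_upwards [Iio_mem_nhds hσ] with s hs
      exact if_pos (le_of_lt hs)
    exact continuousAt_const.congr this.symm
  · rw [continuousAt_iff_continuous_left'_right']
    constructor
    · have : Tendsto (fun σ => if σ ≤ 0 then c else h σ) (𝓝[<] 0) (𝓝 c) := by
        refine tendsto_const_nhds.congr' ?_
        filter_upwards [self_mem_nhdsWithin] with s hs
        exact (if_pos (le_of_lt hs)).symm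
      simpa [ContinuousWithinAt] using this
    · have : Tendsto (fun σ => if σ ≤ 0 then c else h σ) (𝓝[>] 0) (𝓝 c) := by
        refine hlim.congr' ?_
        filter_upwards [self_mem_nhdsWithin] with s hs
        exact (if_neg (not_le.2 hs)).symm
      simpa [ContinuousWithinAt] using this
  · have : (fun σ => if σ ≤ 0 then c else h σ) =ᶠ[𝓝 σ] h := by
      filter_upwards [Ioi_mem_nhds hσ] with s hs
      exact if_neg (not_le.2 hs)
    exact (hc.continuousAt (Ioi_mem_nhds hσ)).congr this.symm

section GlueInput

variable {Λ : ℝ → Vec d} {l : Vec d} {α : ℝ}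

lemma tendsto_neg_log_div (hα : 0 < α) :
    Tendsto (fun σ => -Real.log σ / α) (𝓝[>] 0) atTop :=
  (tendsto_neg_atBot_atTop.comp Real.tendsto_log_nhdsGT_zero).atTop_div_const hα

lemma continuous_glueInput (hΛ : Continuous Λ) (hα : 0 < α) (hl : Tendsto Λ atTop (𝓝 l)) :
    Continuous (glueInput Λ l α) := by
  refine continuous_ite_le_zero (h := fun σ => Λ (-Real.log σ / α)) ?_
    (hl.comp (tendsto_neg_log_div hα))
  exact hΛ.comp_continuousOn
    ((Real.continuousOn_log.mono fun s hs => ne_of_gt hs).neg.div_const α)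

/-- The extended input is `C¹` with derivative zero for `σ ≤ 0`: its derivative for `σ > 0` is a
multiple of `exp (α τ) deriv Λ τ` at `τ = -log σ / α`, which tends to zero as `σ → 0`. -/
lemma hasDerivAt_glueInput (hΛ : ContDiff ℝ 1 Λ) (hα : 0 < α) (hl : Tendsto Λ atTop (𝓝 l))
    (hd : Tendsto (fun τ => Real.exp (α * τ) • deriv Λ τ) atTop (𝓝 0)) :
    ∃ D : ℝ → Vec d, Continuous D ∧ (∀ σ ≤ 0, D σ = 0) ∧
      ∀ σ, HasDerivAt (glueInput Λ l α) (D σ) σ := by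
  set G : ℝ → Vec d := fun τ => Real.exp (α * τ) • deriv Λ τ with hG
  have hGc : Continuous G := (by fun_prop : Continuous fun τ => Real.exp (α * τ)).smul
    (hΛ.continuous_deriv le_rfl)
  set D : ℝ → Vec d := fun σ => if σ ≤ 0 then 0 else (-(1 / α)) • G (-Real.log σ / α) with hD
  have hDc : Continuous D := by
    refine continuous_ite_le_zero (h := fun σ => (-(1 / α)) • G (-Real.log σ / α)) ?_ ?_
    · exact ContinuousOn.const_smul (hGc.comp_continuousOn
        ((Real.continuousOn_log.mono fun s hs => ne_of_gt hs).neg.div_const α)) (-(1 / α))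
    · simpa using (hd.comp (tendsto_neg_log_div hα)).const_smul (-(1 / α))
  have hne : ∀ σ, σ ≠ 0 → HasDerivAt (glueInput Λ l α) (D σ) σ := by
    intro σ hσ
    rcases lt_or_gt_of_ne hσ with hσ | hσ
    · have e : glueInput Λ l α =ᶠ[𝓝 σ] fun _ => l := by
        filter_upwards [Iio_mem_nhds hσ] with s hs
        exact if_pos (le_of_lt hs)
      have e2 : D σ = 0 := if_pos hσ.le
      rw [e2]
      exact (hasDerivAt_const σ l).congr_of_eventuallyEq e
    · have e : glueInput Λ l α =ᶠ[𝓝 σ] fun σ => Λ (-Real.log σ / α) := by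
        filter_upwards [Ioi_mem_nhds hσ] with s hs
        exact if_neg (not_le.2 hs)
      have e2 : D σ = (-(1 / α)) • G (-Real.log σ / α) := if_neg (not_le.2 hσ)
      have h1 : HasDerivAt (fun σ => -Real.log σ / α) (-σ⁻¹ / α) σ :=
        ((Real.hasDerivAt_log hσ.ne').neg).div_const α
      have h2 := ((hΛ.differentiable one_ne_zero (-Real.log σ / α)).hasDerivAt).scomp σ h1
      have e3 : D σ = (-σ⁻¹ / α) • deriv Λ (-Real.log σ / α) := by
        rw [e2, hG]
        simp only
        rw [mul_div_cancel₀ _ hα.ne', Real.exp_neg, Real.exp_log hσ, smul_smul]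
        congr 1
        field_simp
      rw [e3]
      exact h2.congr_of_eventuallyEq e
  refine ⟨D, hDc, fun σ hσ => if_pos hσ, fun σ => ?_⟩
  by_cases hσ : σ = 0
  · subst hσ
    exact hasDerivAt_of_hasDerivAt_of_ne hne
      (continuous_glueInput hΛ.continuous hα hl).continuousAt hDc.continuousAt
  · exact hne σ hσ

/-- The input is `C¹` as a function of `σ = exp (-α τ)`, up to and across `σ = 0`. -/
lemma contDiff_glueInput (hΛ : ContDiff ℝ 1 Λ) (hα : 0 < α) (hl : Tendsto Λ atTop (𝓝 l))
    (hd : Tendsto (fun τ => Real.exp (α * τ) • deriv Λ τ) atTop (𝓝 0)) :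
    ContDiff ℝ 1 (glueInput Λ l α) := by
  obtain ⟨D, hD, -, h⟩ := hasDerivAt_glueInput hΛ hα hl hd
  rw [contDiff_one_iff_deriv]
  refine ⟨fun σ => (h σ).differentiableAt, ?_⟩
  rw [show deriv (glueInput Λ l α) = D from funext fun σ => (h σ).deriv]
  exact hD

lemma glueInput_exp (hα : 0 < α) (τ : ℝ) : glueInput Λ l α (Real.exp (-(α * τ))) = Λ τ := by
  rw [glueInput, if_neg (not_le.2 (Real.exp_pos _)), Real.log_exp, neg_neg,
    mul_div_cancel_left₀ _ hα.ne']

end GlueInput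

section CompInput

variable {Λ : ℝ → Vec d} {lm lp : Vec d} {ρ α : ℝ}

/-- This is where the assumption `α < ρ` on the compactification enters. -/
lemma IsExpBiAsymptoticallyConstant.tendsto_exp_smul_deriv
    (h : IsExpBiAsymptoticallyConstant Λ ρ lm lp) (hαρ : α < ρ) :
    Tendsto (fun τ => Real.exp (α * τ) • deriv Λ τ) atTop (𝓝 0) := by
  obtain ⟨v, hv⟩ := h.decay_future
  have h1 : Tendsto (fun τ => Real.exp (-(ρ - α) * τ)) atTop (𝓝 0) := by
    refine Real.tendsto_exp_atBot.comp ?_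
    exact tendsto_id.const_mul_atTop_of_neg (by linarith)
  have h2 := h1.smul hv
  rw [zero_smul] at h2
  refine h2.congr fun τ => ?_
  rw [smul_smul, ← Real.exp_neg, ← Real.exp_add]
  congr 2
  ring

/-- Time reversal swaps the past and future limits. -/
lemma IsExpBiAsymptoticallyConstant.comp_neg
    (h : IsExpBiAsymptoticallyConstant Λ ρ lm lp) :
    IsExpBiAsymptoticallyConstant (fun t => Λ (-t)) ρ lp lm := by
  refine ⟨h.rho_pos, h.tendsto_future.comp tendsto_neg_atBot_atTop,
    h.tendsto_past.comp tendsto_neg_atTop_atBot, ?_, ?_⟩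
  · obtain ⟨v, hv⟩ := h.decay_future
    refine ⟨-v, (hv.comp tendsto_neg_atBot_atTop).neg.congr fun τ => ?_⟩
    simp only [Function.comp_apply, deriv_comp_neg, smul_neg]
    congr 4
    ring
  · obtain ⟨v, hv⟩ := h.decay_past
    refine ⟨-v, (hv.comp tendsto_neg_atTop_atBot).neg.congr fun τ => ?_⟩
    simp only [Function.comp_apply, deriv_comp_neg, smul_neg]
    congr 4
    ring

lemma IsExpBiAsymptoticallyConstant.exists_bound
    (h : IsExpBiAsymptoticallyConstant Λ ρ lm lp) (hΛ : Continuous Λ) : ∃ L, ∀ t, ‖Λ t‖ ≤ L := by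
  have h1 := h.tendsto_past.norm.eventually (gt_mem_nhds (lt_add_one _))
  have h2 := h.tendsto_future.norm.eventually (gt_mem_nhds (lt_add_one _))
  obtain ⟨a, ha⟩ := eventually_atBot.1 h1
  obtain ⟨b, hb⟩ := eventually_atTop.1 h2
  obtain ⟨C, hC⟩ := isCompact_Icc.exists_bound_of_continuousOn (hΛ.continuousOn (s := Icc a b))
  refine ⟨max C (max (‖lm‖ + 1) (‖lp‖ + 1)), fun t => ?_⟩
  rcases le_total t a with hta | hta
  · exact ((ha t hta).le.trans (le_max_left _ _)).trans (le_max_right _ _)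
  · rcases le_total t b with htb | htb
    · exact (hC t ⟨hta, htb⟩).trans (le_max_left _ _)
    · exact ((hb t htb).le.trans (le_max_right _ _)).trans (le_max_right _ _)

/-- Since `exp (-α τ) = (1 - s) / (1 + s)` at `s = compTime α τ`, the compactified input is near
the future end a rational reparametrization of the input as a function of `σ`. -/
lemma compInput_eq_glueInput_future {s : ℝ} (hs : -1 < s) :
    compInput Λ lm lp α s = glueInput Λ lp α ((1 - s) / (1 + s)) := by
  have h1 : 0 < 1 + s := by linarith
  rw [compInput, glueInput]
  by_cases h : 1 ≤ s
  · rw [if_pos h, if_pos (div_nonpos_of_nonpos_of_nonneg (by linarith) h1.le)]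
  · push Not at h
    rw [if_neg (not_le.2 h), if_neg (not_le.2 hs),
      if_neg (not_le.2 (div_pos (by linarith) h1)), compTimeInv]
    congr 1
    rw [← Real.log_inv, inv_div]
    ring

/-- The corresponding description near the past end, with time reversed. -/
lemma compInput_eq_glueInput_past {s : ℝ} (hs : s < 1) :
    compInput Λ lm lp α s = glueInput (fun t => Λ (-t)) lm α ((1 + s) / (1 - s)) := by
  have h1 : 0 < 1 - s := by linarith
  rw [compInput, glueInput, if_neg (not_le.2 hs)]
  by_cases h : s ≤ -1
  · rw [if_pos h, if_pos (div_nonpos_of_nonpos_of_nonneg (by linarith) h1.le)]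
  · push Not at h
    rw [if_neg (not_le.2 h), if_neg (not_le.2 (div_pos (by linarith) h1)), compTimeInv]
    congr 1
    ring

/-! ### The compactified time -/

lemma compTime_eq (α τ : ℝ) :
    compTime α τ = (1 - Real.exp (-(α * τ))) / (1 + Real.exp (-(α * τ))) := by
  rw [compTime, Real.tanh_eq]
  have e1 : Real.exp (-(α * τ)) = Real.exp (-(α / 2 * τ)) * Real.exp (-(α / 2 * τ)) := by
    rw [← Real.exp_add]; congr 1; ring
  have e2 : Real.exp (α / 2 * τ) * Real.exp (-(α / 2 * τ)) = 1 := by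
    rw [← Real.exp_add]; simp
  have h1 := Real.exp_pos (α / 2 * τ)
  have h2 := Real.exp_pos (-(α / 2 * τ))
  rw [e1, div_eq_div_iff (by positivity) (by positivity)]
  linear_combination (2 * Real.exp (-(α / 2 * τ))) * e2

lemma one_sub_compTime_div (α τ : ℝ) :
    (1 - compTime α τ) / (1 + compTime α τ) = Real.exp (-(α * τ)) := by
  have h := Real.exp_pos (-(α * τ))
  rw [compTime_eq]
  field_simp
  ring

lemma one_add_compTime_div (α τ : ℝ) :
    (1 + compTime α τ) / (1 - compTime α τ) = Real.exp (α * τ) := by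
  rw [← inv_div, one_sub_compTime_div, ← Real.exp_neg, neg_neg]

lemma compTime_mem (α τ : ℝ) : compTime α τ ∈ Ioo (-1 : ℝ) 1 :=
  ⟨Real.neg_one_lt_tanh _, Real.tanh_lt_one _⟩

lemma hasDerivAt_compTime (α τ : ℝ) :
    HasDerivAt (compTime α) (α * (1 - compTime α τ ^ 2) / 2) τ := by
  have h := Real.exp_pos (-(α * τ))
  have h1 : HasDerivAt (fun τ => Real.exp (-(α * τ))) (Real.exp (-(α * τ)) * (-α)) τ := by
    simpa using (((hasDerivAt_id τ).const_mul α).neg).exp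
  have h2 := (h1.const_sub 1).div (h1.const_add 1) (by positivity)
  have e : compTime α = fun τ => (1 - Real.exp (-(α * τ))) / (1 + Real.exp (-(α * τ))) :=
    funext (compTime_eq α)
  rw [e]
  refine h2.congr_deriv ?_
  field_simp
  ring

lemma compTimeInv_compTime (hα : 0 < α) (τ : ℝ) : compTimeInv α (compTime α τ) = τ := by
  rw [compTimeInv, one_add_compTime_div, Real.log_exp]
  field_simp

lemma compTime_compTimeInv (hα : 0 < α) {s : ℝ} (hs : s ∈ Ioo (-1 : ℝ) 1) :
    compTime α (compTimeInv α s) = s := by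
  have h1 : 0 < 1 + s := by linarith [hs.1]
  have h2 : 0 < 1 - s := by linarith [hs.2]
  have e : Real.exp (-(α * compTimeInv α s)) = (1 - s) / (1 + s) := by
    rw [compTimeInv, ← mul_assoc, mul_one_div_cancel hα.ne', one_mul, ← Real.log_inv, inv_div,
      Real.exp_log (by positivity)]
  rw [compTime_eq, e]
  field_simp
  ring

lemma compTime_strictMono (hα : 0 < α) : StrictMono (compTime α) := by
  refine strictMono_of_deriv_pos fun τ => ?_
  rw [(hasDerivAt_compTime α τ).deriv]
  have h := compTime_mem α τ
  have : 0 < 1 - compTime α τ ^ 2 := by nlinarith [h.1, h.2]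
  positivity

lemma tendsto_compTime_atTop (hα : 0 < α) : Tendsto (compTime α) atTop (𝓝 1) := by
  have h : Tendsto (fun τ => Real.exp (-(α * τ))) atTop (𝓝 0) :=
    Real.tendsto_exp_atBot.comp
      (tendsto_neg_atTop_atBot.comp (tendsto_id.const_mul_atTop hα))
  have h2 := (h.const_sub 1).div (h.const_add 1) (by norm_num)
  rw [show ((1 : ℝ) - 0) / (1 + 0) = 1 by norm_num] at h2
  exact h2.congr fun τ => (compTime_eq α τ).symm

lemma compTime_neg (α τ : ℝ) : compTime α (-τ) = -compTime α τ := by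
  rw [compTime, compTime, mul_neg, Real.tanh_neg]

lemma tendsto_compTime_atBot (hα : 0 < α) : Tendsto (compTime α) atBot (𝓝 (-1)) := by
  refine ((tendsto_compTime_atTop hα).comp tendsto_neg_atBot_atTop).neg.congr fun τ => ?_
  simp [compTime_neg]

lemma compInput_compTime (hα : 0 < α) (τ : ℝ) :
    compInput Λ lm lp α (compTime α τ) = Λ τ := by
  rw [compInput_eq_glueInput_future (compTime_mem α τ).1, one_sub_compTime_div, glueInput_exp hα]

lemma compInput_one : compInput Λ lm lp α 1 = lp := by simp [compInput]

lemma compInput_neg_one : compInput Λ lm lp α (-1) = lm := by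
  rw [compInput, if_neg (by norm_num), if_pos le_rfl]

/-- The compactified input is flat at the infinite end: this is where `α < ρ` enters, and it makes
the linearization at `s = 1` block diagonal. -/
lemma hasDerivAt_compInput_one (hΛ : ContDiff ℝ 1 Λ)
    (h : IsExpBiAsymptoticallyConstant Λ ρ lm lp) (hα : 0 < α) (hαρ : α < ρ) :
    HasDerivAt (compInput Λ lm lp α) 0 1 := by
  obtain ⟨D, -, hD0, hD⟩ := hasDerivAt_glueInput hΛ hα h.tendsto_future
    (h.tendsto_exp_smul_deriv hαρ)
  have h1 : HasDerivAt (fun s : ℝ => (1 - s) / (1 + s)) (-(1 / 2)) 1 := by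
    have := ((hasDerivAt_id (1 : ℝ)).const_sub 1).div ((hasDerivAt_id (1 : ℝ)).const_add 1)
      (by norm_num)
    refine this.congr_deriv (by norm_num)
  have h2 := (hD ((1 - 1) / (1 + 1))).scomp 1 h1
  rw [hD0 _ (by norm_num), smul_zero] at h2
  refine h2.congr_of_eventuallyEq ?_
  filter_upwards [Ioi_mem_nhds (show (-1 : ℝ) < 1 by norm_num)] with s hs
  exact compInput_eq_glueInput_future hs

lemma hasDerivAt_compInput_neg_one (hΛ : ContDiff ℝ 1 Λ)
    (h : IsExpBiAsymptoticallyConstant Λ ρ lm lp) (hα : 0 < α) (hαρ : α < ρ) :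
    HasDerivAt (compInput Λ lm lp α) 0 (-1) := by
  obtain ⟨D, -, hD0, hD⟩ := hasDerivAt_glueInput (Λ := fun t => Λ (-t))
    (hΛ.comp contDiff_neg) hα h.comp_neg.tendsto_future (h.comp_neg.tendsto_exp_smul_deriv hαρ)
  have h1 : HasDerivAt (fun s : ℝ => (1 + s) / (1 - s)) (1 / 2) (-1) := by
    have := ((hasDerivAt_id (-1 : ℝ)).const_add 1).div ((hasDerivAt_id (-1 : ℝ)).const_sub 1)
      (by norm_num)
    refine this.congr_deriv (by norm_num)
  have h2 := (hD ((1 + -1) / (1 - -1))).scomp (-1) h1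
  rw [hD0 _ (by norm_num), smul_zero] at h2
  refine h2.congr_of_eventuallyEq ?_
  filter_upwards [Iio_mem_nhds (show (-1 : ℝ) < 1 by norm_num)] with s hs
  exact compInput_eq_glueInput_past hs

end CompInput

/-! ### Equilibria of the compactified system -/

section Saddle

variable {f : Vec n → Vec d → Vec n} {Λ : ℝ → Vec d} {lm lp l : Vec d} {α r s₀ : ℝ} {e : Vec n}

lemma hasFDerivAt_section (hf : ContDiff ℝ 1 (fun p : Vec n × Vec d => f p.1 p.2)) (l : Vec d)
    (e : Vec n) : HasFDerivAt (fun x => f x l)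
      ((fderiv ℝ (fun p : Vec n × Vec d => f p.1 p.2) (e, l)).comp
        (ContinuousLinearMap.inl ℝ (Vec n) (Vec d))) e := by
  have h1 := (hf.differentiable one_ne_zero (e, l)).hasFDerivAt
  exact HasFDerivAt.comp (g := fun p : Vec n × Vec d => f p.1 p.2) (f := fun x => (x, l)) e h1
    (hasFDerivAt_prodMk_left e l)

/-- Where the compactified input has derivative zero, the linearization of the compactified system
is block diagonal. -/
lemma hasFDerivAt_compField (hf : ContDiff ℝ 1 (fun p : Vec n × Vec d => f p.1 p.2))
    (hl : compInput Λ lm lp α s₀ = l) (hd : HasDerivAt (compInput Λ lm lp α) 0 s₀) :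
    HasFDerivAt (compField f Λ lm lp α r)
      ((r⁻¹ • fderiv ℝ (fun x => f x l) e).prodMap
        ((-(α * s₀)) • ContinuousLinearMap.id ℝ ℝ)) (e, s₀) := by
  have h1 : HasFDerivAt (fun p : Vec n × Vec d => f p.1 p.2)
      (fderiv ℝ (fun p : Vec n × Vec d => f p.1 p.2) (e, l)) (e, compInput Λ lm lp α s₀) := by
    rw [hl]; exact (hf.differentiable one_ne_zero (e, l)).hasFDerivAt
  have h2 : HasFDerivAt (fun p : Vec n × ℝ => (p.1, compInput Λ lm lp α p.2))
      ((ContinuousLinearMap.fst ℝ (Vec n) ℝ).prod 0) (e, s₀) := by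
    refine hasFDerivAt_fst.prodMk ?_
    have := hd.hasFDerivAt.comp (e, s₀) (hasFDerivAt_snd (𝕜 := ℝ) (E := Vec n) (F := ℝ) (p := (e, s₀)))
    refine this.congr_fderiv ?_
    ext <;> simp
  have h3 := (h1.comp (e, s₀) h2).const_smul r⁻¹
  have h4 : HasDerivAt (fun s : ℝ => α * (1 - s ^ 2) / 2) (-(α * s₀)) s₀ := by
    have := ((((hasDerivAt_id s₀).pow 2).const_sub 1).const_mul α).div_const 2
    refine this.congr_deriv ?_
    simp; ring
  have h5 := h4.hasFDerivAt.comp (e, s₀)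
    (hasFDerivAt_snd (𝕜 := ℝ) (E := Vec n) (F := ℝ) (p := (e, s₀)))
  refine (h3.prodMk h5).congr_fderiv ?_
  rw [(hasFDerivAt_section hf l e).fderiv]
  ext <;> simp

lemma uniqueDiffWithinAt_extPhase (hs : s₀ ∈ Icc (-1 : ℝ) 1) :
    UniqueDiffWithinAt ℝ (extPhase n) (e, s₀) := by
  have : extPhase n = (univ : Set (Vec n)) ×ˢ Icc (-1 : ℝ) 1 := by
    ext; simp [extPhase]
  rw [this]
  exact uniqueDiffWithinAt_univ.prod (uniqueDiffOn_Icc (by norm_num) s₀ hs)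

/-- The sink contributes the `n` stable directions, and the time component the unstable one, with
eigenvalue `α`. -/
lemma isSaddle_of_sink (hf : ContDiff ℝ 1 (fun p : Vec n × Vec d => f p.1 p.2))
    (hd : HasDerivAt (compInput Λ lm lp α) 0 (-1)) (hα : 0 < α) (hr : 0 < r)
    (he : IsHyperbolicSink f lm e) : IsSaddle (compField f Λ lm lp α r) (e, -1) := by
  have hs : (-1 : ℝ) ∈ Icc (-1 : ℝ) 1 := by norm_num
  have hD := hasFDerivAt_compField (r := r) (e := e) hf compInput_neg_one hd
  refine ⟨hs, ?_, hD.differentiableAt.differentiableWithinAt, ?_⟩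
  · ext1
    · simp [compField, compInput_neg_one, he.1]
    · simp [compField]
  rw [hD.hasFDerivWithinAt.fderivWithin (uniqueDiffWithinAt_extPhase hs)]
  set A := fderiv ℝ (fun x => f x lm) e
  have h1 : stableIndex A = n := by
    rw [stableIndex, Multiset.filter_eq_self.2 he.2, card_eigs, finrank_euclideanSpace,
      Fintype.card_fin]
  have h2 : unstableIndex A = 0 := by
    rw [unstableIndex, Multiset.card_eq_zero, Multiset.filter_eq_nil]
    intro z hz
    exact not_lt.2 (he.2 z hz).le
  rw [← stableIndex_smul A (inv_pos.2 hr)] at h1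
  rw [← unstableIndex_smul A (inv_pos.2 hr)] at h2
  rw [stableIndex] at h1 ⊢
  rw [unstableIndex] at h2 ⊢
  rw [eigs_prodMap, Multiset.filter_add, Multiset.filter_add, Multiset.card_add,
    Multiset.card_add, h1, h2, Multiset.filter_singleton, Multiset.filter_singleton]
  simp [hα, hα.le]

/-- The edge state contributes one unstable and `n - 1` stable directions, and the time component
a further stable one, with eigenvalue `-α`. -/
lemma isSaddle_of_edge (hf : ContDiff ℝ 1 (fun p : Vec n × Vec d => f p.1 p.2))
    (hd : HasDerivAt (compInput Λ lm lp α) 0 1) (hα : 0 < α) (hr : 0 < r)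
    (he : IsEquilibriumRegularEdgeState f lp e) :
    IsSaddle (compField f Λ lm lp α r) (e, 1) := by
  have hs : (1 : ℝ) ∈ Icc (-1 : ℝ) 1 := by norm_num
  have hD := hasFDerivAt_compField (r := r) (e := e) hf compInput_one hd
  refine ⟨hs, ?_, hD.differentiableAt.differentiableWithinAt, ?_⟩
  · ext1
    · simp [compField, compInput_one, he.1]
    · simp [compField]
  rw [hD.hasFDerivWithinAt.fderivWithin (uniqueDiffWithinAt_extPhase hs)]
  set A := fderiv ℝ (fun x => f x lp) e
  have h2 : unstableIndex A = 1 := he.2.2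
  have h1 := stableIndex_add_unstableIndex A he.2.1
  rw [h2, finrank_euclideanSpace, Fintype.card_fin] at h1
  rw [← stableIndex_smul A (inv_pos.2 hr)] at h1
  rw [← unstableIndex_smul A (inv_pos.2 hr)] at h2
  rw [stableIndex] at h1 ⊢
  rw [unstableIndex] at h2 ⊢
  rw [eigs_prodMap, Multiset.filter_add, Multiset.filter_add, Multiset.card_add,
    Multiset.card_add, h2, Multiset.filter_singleton, Multiset.filter_singleton]
  have e1 : (((-(α * 1) : ℝ) : ℂ)).re = -α := by simp
  rw [e1, if_pos (by linarith), if_neg (by linarith)]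
  simpa using h1

end Saddle

/-! ### Trajectories of the compactified system and solutions of the original one -/

section Trajectories

variable {f : Vec n → Vec d → Vec n} {Λ : ℝ → Vec d} {lm lp : Vec d} {α r : ℝ} {I : Set ℝ}
  {γ : ℝ → Vec n × ℝ}

/-- Uniqueness for the time component of the compactified system. -/
lemma eqOn_of_logistic {I : Set ℝ} (hI : I.OrdConnected) {u v : ℝ → ℝ}
    (hu : ∀ t ∈ I, HasDerivWithinAt u (α * (1 - u t ^ 2) / 2) I t)
    (hv : ∀ t ∈ I, HasDerivWithinAt v (α * (1 - v t ^ 2) / 2) I t)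
    {a : ℝ} (ha : a ∈ I) (h : u a = v a) : EqOn u v I := by
  -- a scalar equation is a special case of the vector-valued one
  let f₁ : Vec 1 → Vec 1 → Vec 1 := fun x _ => WithLp.toLp 2 fun _ => α * (1 - x 0 ^ 2) / 2
  have hf₁ : ContDiff ℝ 1 (fun p : Vec 1 × Vec 1 => f₁ p.1 p.2) := by
    rw [contDiff_euclidean]
    intro i
    have : ContDiff ℝ 1 fun p : Vec 1 × Vec 1 => p.1 0 :=
      (EuclideanSpace.proj (𝕜 := ℝ) (0 : Fin 1)).contDiff.comp contDiff_fst
    exact ((contDiff_const.mul (contDiff_const.sub (this.pow 2))).div_const 2)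
  have key : ∀ w : ℝ → ℝ, (∀ t ∈ I, HasDerivWithinAt w (α * (1 - w t ^ 2) / 2) I t) →
      IsSol f₁ (fun _ => 0) 1 I (fun t => (WithLp.toLp 2 fun _ => w t : Vec 1)) := by
    intro w hw t ht
    have e : ∀ c : ℝ, (WithLp.toLp 2 fun _ => c : Vec 1) = c • (WithLp.toLp 2 fun _ => 1) := by
      intro c; ext i; simp
    have := (hw t ht).smul_const (WithLp.toLp 2 fun _ => 1 : Vec 1)
    simpa only [f₁, ← e, inv_one, one_smul] using this
  intro t ht
  have := IsSol.eqOn hf₁ continuous_const hI (key u hu) (key v hv) ha (by simp [h]) ht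
  simpa using congrArg (fun x : Vec 1 => x 0) this

/-- Once the time component `s` of a trajectory is known, its space component solves the
nonautonomous system with input `compInput Λ lm lp α (s t)`. -/
lemma IsTrajectory.fst_isSol (hI : I.OrdConnected)
    (h : IsTrajectory (compField f Λ lm lp α r) I γ) {s : ℝ → ℝ}
    (hs : ∀ t ∈ I, HasDerivWithinAt s (α * (1 - s t ^ 2) / 2) I t) {a : ℝ} (ha : a ∈ I)
    (h0 : (γ a).2 = s a) :
    EqOn (fun t => (γ t).2) s I ∧
      IsSol f (fun t => compInput Λ lm lp α (s t)) r I (fun t => (γ t).1) := by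
  have h2 : EqOn (fun t => (γ t).2) s I := by
    refine eqOn_of_logistic hI (fun t ht => ?_) hs ha h0
    have := (h t ht).2
    rw [hasDerivWithinAt_iff_hasFDerivWithinAt] at this
    exact this.snd.hasDerivWithinAt.congr_deriv (by simp [compField])
  refine ⟨h2, fun t ht => ?_⟩
  have := (h t ht).2
  rw [hasDerivWithinAt_iff_hasFDerivWithinAt] at this
  refine this.fst.hasDerivWithinAt.congr_deriv ?_
  have h2' : (γ t).2 = s t := h2 ht
  simp [compField, h2']

lemma isTrajectory_of_isSol {x : ℝ → Vec n} {s : ℝ → ℝ} (hsm : ∀ t ∈ I, s t ∈ Icc (-1 : ℝ) 1)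
    (hs : ∀ t ∈ I, HasDerivWithinAt s (α * (1 - s t ^ 2) / 2) I t)
    (hx : IsSol f (fun t => compInput Λ lm lp α (s t)) r I x) :
    IsTrajectory (compField f Λ lm lp α r) I (fun t => (x t, s t)) :=
  fun t ht => ⟨hsm t ht, (hx t ht).prodMk (hs t ht)⟩

lemma hasDerivWithinAt_compTime_add (τ t : ℝ) :
    HasDerivWithinAt (fun t => compTime α (t + τ)) (α * (1 - compTime α (t + τ) ^ 2) / 2) I t := by
  simpa using ((hasDerivAt_compTime α (t + τ)).comp_add_const t τ).hasDerivWithinAt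

/-- Trajectories through a slice `s = compTime α τ` are solutions of the nonautonomous system,
shifted by `τ`. -/
lemma IsTrajectory.isSol_of_compTime (hα : 0 < α) (hI : I.OrdConnected)
    (h : IsTrajectory (compField f Λ lm lp α r) I γ) {τ : ℝ} (ha : (0 : ℝ) ∈ I)
    (h0 : (γ 0).2 = compTime α τ) :
    (∀ t ∈ I, (γ t).2 = compTime α (t + τ)) ∧
      IsSol f (fun t => Λ (t + τ)) r I (fun t => (γ t).1) := by
  have := h.fst_isSol hI (s := fun t => compTime α (t + τ))
    (fun t _ => hasDerivWithinAt_compTime_add τ t) ha (by simpa using h0)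
  refine ⟨this.1, ?_⟩
  simpa [compInput_compTime hα] using this.2

lemma isTrajectory_compTime (hα : 0 < α) {x : ℝ → Vec n} {τ : ℝ}
    (hx : IsSol f (fun t => Λ (t + τ)) r I x) :
    IsTrajectory (compField f Λ lm lp α r) I (fun t => (x t, compTime α (t + τ))) := by
  refine isTrajectory_of_isSol (fun t _ => Ioo_subset_Icc_self (compTime_mem α _))
    (fun t _ => hasDerivWithinAt_compTime_add τ t) ?_
  simpa [compInput_compTime hα] using hx

/-- The slice `s = 1` is invariant and carries the future limit system. -/
lemma IsTrajectory.isSol_of_one (hI : I.OrdConnected)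
    (h : IsTrajectory (compField f Λ lm lp α r) I γ) (ha : (0 : ℝ) ∈ I) (h0 : (γ 0).2 = 1) :
    (∀ t ∈ I, (γ t).2 = 1) ∧ IsSol f (fun _ => lp) r I (fun t => (γ t).1) := by
  have := h.fst_isSol hI (s := fun _ => 1)
    (fun t _ => by simpa using hasDerivWithinAt_const t I (1 : ℝ)) ha h0
  exact ⟨this.1, by simpa [compInput_one] using this.2⟩

lemma isTrajectory_one {x : ℝ → Vec n} (hx : IsSol f (fun _ => lp) r I x) :
    IsTrajectory (compField f Λ lm lp α r) I (fun t => (x t, 1)) :=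
  isTrajectory_of_isSol (s := fun _ => 1) (fun t _ => by norm_num)
    (fun t _ => by simpa using hasDerivWithinAt_const t I (1 : ℝ))
    (by simpa [compInput_one] using hx)

/-- The slice `s = -1` is invariant and carries the past limit system. -/
lemma IsTrajectory.isSol_of_neg_one (hI : I.OrdConnected)
    (h : IsTrajectory (compField f Λ lm lp α r) I γ) (ha : (0 : ℝ) ∈ I) (h0 : (γ 0).2 = -1) :
    (∀ t ∈ I, (γ t).2 = -1) ∧ IsSol f (fun _ => lm) r I (fun t => (γ t).1) := by
  have := h.fst_isSol hI (s := fun _ => -1)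
    (fun t _ => by simpa using hasDerivWithinAt_const t I (-1 : ℝ)) ha h0
  exact ⟨this.1, by simpa [compInput_neg_one] using this.2⟩

lemma isTrajectory_neg_one {x : ℝ → Vec n} (hx : IsSol f (fun _ => lm) r I x) :
    IsTrajectory (compField f Λ lm lp α r) I (fun t => (x t, -1)) :=
  isTrajectory_of_isSol (s := fun _ => -1) (fun t _ => by norm_num)
    (fun t _ => by simpa using hasDerivWithinAt_const t I (-1 : ℝ))
    (by simpa [compInput_neg_one] using hx)

lemma eq_endpoint_or_compTime (hα : 0 < α) {s : ℝ} (hs : s ∈ Icc (-1 : ℝ) 1) :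
    s = -1 ∨ s = 1 ∨ ∃ τ, s = compTime α τ := by
  rcases eq_or_lt_of_le hs.1 with h | h
  · exact Or.inl h.symm
  · rcases eq_or_lt_of_le hs.2 with h' | h'
    · exact Or.inr (Or.inl h')
    · exact Or.inr (Or.inr ⟨_, (compTime_compTimeInv hα ⟨h, h'⟩).symm⟩)

end Trajectories

/-! ### Limits of solutions -/

section Limits

variable {f : Vec n → Vec d → Vec n} {Λ : ℝ → Vec d} {r : ℝ} {x : ℝ → Vec n} {ι : Type*}
  {𝓕 : Filter ι} {z : ι → ℝ → Vec n} {Λ' : ι → ℝ → Vec d} {r' : ι → ℝ} {a b : ℝ}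

/-- Solutions that converge at the right endpoint of a compact interval, with converging rates and
uniformly converging inputs, converge on the whole interval. -/
lemma IsSol.tendsto_left (hf : ContDiff ℝ 1 (fun p : Vec n × Vec d => f p.1 p.2))
    (hΛ : Continuous Λ) (hab : a ≤ b) (hx : IsSol f Λ r (Icc a b) x)
    (hz : ∀ᶠ i in 𝓕, IsSol f (Λ' i) (r' i) (Icc a b) (z i)) (hΛ' : ∀ i, Continuous (Λ' i))
    (hr : Tendsto (fun i => (r' i)⁻¹) 𝓕 (𝓝 r⁻¹)) (hl : TendstoUniformlyOn Λ' Λ 𝓕 (Icc a b))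
    (hb : Tendsto (fun i => z i b) 𝓕 (𝓝 (x b))) {t : ℝ} (ht : t ∈ Icc a b) :
    Tendsto (fun i => z i t) 𝓕 (𝓝 (x t)) := by
  rw [Metric.tendsto_nhds]
  intro ε hε
  obtain ⟨δ, hδ, H⟩ := hx.exists_near_left hf hΛ hab hε
  filter_upwards [hz, Metric.tendsto_nhds.1 hr δ hδ, Metric.tendstoUniformlyOn_iff.1 hl δ hδ,
    Metric.tendsto_nhds.1 hb δ hδ] with i h1 h2 h3 h4
  obtain ⟨w, hw, hwa, hwx⟩ := H (r' i) (Λ' i) (z i b) (hΛ' i) (by simpa [Real.dist_eq] using h2)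
    (fun t ht => by rw [← dist_eq_norm, dist_comm]; exact h3 t ht) (by rwa [← dist_eq_norm])
  rw [IsSol.eqOn hf (hΛ' i) ordConnected_Icc h1 hw (right_mem_Icc.2 hab) hwa.symm ht, dist_eq_norm]
  exact hwx t ht

end Limits

/-! ### Cone estimates near a hyperbolic equilibrium -/

lemma hasDerivWithinAt_form {V : Type*} [NormedAddCommGroup V] [NormedSpace ℝ V]
    {p : V →L[ℝ] V →L[ℝ] ℝ} (hp : ∀ x y, p x y = p y x) {z : ℝ → V} {z' : V} {I : Set ℝ} {t : ℝ}
    (hz : HasDerivWithinAt z z' I t) :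
    HasDerivWithinAt (fun t => p (z t) (z t)) (2 * p z' (z t)) I t := by
  have h1 : HasDerivWithinAt (fun t => p (z t)) (p z') I t :=
    p.hasFDerivAt.comp_hasDerivWithinAt t hz
  have h2 := h1.clm_apply hz
  refine h2.congr_deriv ?_
  rw [hp (z t) z', two_mul]

/-- The nonlinear form of a dichotomy at the equilibrium `e` of `f (·, l)`: in the balls of radius
`ε` differences of two states driven by the same input satisfy the cone estimates. -/
structure IsLocalDichotomy (f : Vec n → Vec d → Vec n) (l : Vec d) (e : Vec n)
    (p b : Vec n →L[ℝ] Vec n →L[ℝ] ℝ) (k m ε C : ℝ) : Prop where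
  k_pos : 0 < k
  m_pos : 0 < m
  ε_pos : 0 < ε
  C_nonneg : 0 ≤ C
  p_symm : ∀ x y, p x y = p y x
  b_symm : ∀ x y, b x y = b y x
  p_nonneg : ∀ x, 0 ≤ p x x
  b_nonneg : ∀ x, 0 ≤ b x x
  coercive : ∀ x, m * ‖x‖ ^ 2 ≤ p x x + b x x
  p_le : ∀ x y l', ‖x - e‖ ≤ ε → ‖y - e‖ ≤ ε → ‖l' - l‖ ≤ ε →
    k * (2 * p (x - y) (x - y) - b (x - y) (x - y)) ≤ p (f x l' - f y l') (x - y)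
  b_le : ∀ x y l', ‖x - e‖ ≤ ε → ‖y - e‖ ≤ ε → ‖l' - l‖ ≤ ε →
    b (f x l' - f y l') (x - y) ≤ k * (p (x - y) (x - y) - 2 * b (x - y) (x - y))
  p_le_equilibrium : ∀ x l', ‖x - e‖ ≤ ε → ‖l' - l‖ ≤ ε →
    k * (2 * p (x - e) (x - e) - b (x - e) (x - e)) - C * ‖f e l'‖ ^ 2 ≤ p (f x l') (x - e)
  b_le_equilibrium : ∀ x l', ‖x - e‖ ≤ ε → ‖l' - l‖ ≤ ε →
    b (f x l') (x - e) ≤ k * (p (x - e) (x - e) - 2 * b (x - e) (x - e)) + C * ‖f e l'‖ ^ 2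

/-- Near `(e, l)` the field differs from its linearization at `(e, l)` by a map with small
Lipschitz constant, for every frozen input near `l`. -/
lemma exists_norm_remainder_le {f : Vec n → Vec d → Vec n}
    (hf : ContDiff ℝ 1 (fun p : Vec n × Vec d => f p.1 p.2)) (l : Vec d) (e : Vec n) {c : ℝ}
    (hc : 0 < c) : ∃ ε > 0, ∀ x y l', ‖x - e‖ ≤ ε → ‖y - e‖ ≤ ε → ‖l' - l‖ ≤ ε →
      ‖f x l' - f y l' - fderiv ℝ (fun x => f x l) e (x - y)‖ ≤ c * ‖x - y‖ := by
  have h1 := (hf.contDiffAt (x := (e, l))).hasStrictFDerivAt one_ne_zero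
  have h2 := h1.isLittleO.def hc
  obtain ⟨ε, hε, h3⟩ := Metric.eventually_nhds_iff.1 h2
  refine ⟨ε / 2, by positivity, fun x y l' hx hy hl => ?_⟩
  have h4 := h3 (y := ((x, l'), (y, l'))) (by
    rw [Prod.dist_eq, Prod.dist_eq, Prod.dist_eq]
    simp only [dist_eq_norm]
    refine max_lt (max_lt ?_ ?_) (max_lt ?_ ?_) <;> linarith)
  rw [(hasFDerivAt_section hf l e).fderiv]
  simpa [Prod.norm_def] using h4

/-- The cone estimates of the linearization persist in a small ball, at the price of a factor: the
nonlinear remainder is absorbed by coercivity of `p + b`, and the drift `f e` of the equilibrium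
by completing a square, which gives the constant `C`. -/
theorem IsDichotomy.exists_isLocalDichotomy {f : Vec n → Vec d → Vec n}
    (hf : ContDiff ℝ 1 (fun p : Vec n × Vec d => f p.1 p.2)) {l : Vec d} {e : Vec n}
    {p b : Vec n →L[ℝ] Vec n →L[ℝ] ℝ} {k m : ℝ}
    (h : IsDichotomy (fderiv ℝ (fun x => f x l) e) p b k m) :
    ∃ ε₀ > 0, ∃ C, ∀ ε, 0 < ε → ε ≤ ε₀ → IsLocalDichotomy f l e p b k m ε C := by
  have hk := h.k_pos
  have hm := h.m_pos
  set S := ‖p‖ + ‖b‖ + 1 with hS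
  have hS0 : 0 < S := by positivity
  obtain ⟨ε, hε, hrem⟩ := exists_norm_remainder_le hf l e (c := k * m / (2 * S)) (by positivity)
  set A := fderiv ℝ (fun x => f x l) e
  have bound : ∀ (g : Vec n →L[ℝ] Vec n →L[ℝ] ℝ), ‖g‖ ≤ S → ∀ v z : Vec n, |g v z| ≤ S * ‖v‖ * ‖z‖ := by
    intro g hg v z
    calc |g v z| = ‖g v z‖ := rfl
      _ ≤ ‖g‖ * ‖v‖ * ‖z‖ := g.le_opNorm₂ v z
      _ ≤ _ := by gcongr
  have hpS : ‖p‖ ≤ S := by have := norm_nonneg b; linarith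
  have hbS : ‖b‖ ≤ S := by have := norm_nonneg p; linarith
  have e1 : ∀ (g : Vec n →L[ℝ] Vec n →L[ℝ] ℝ), ‖g‖ ≤ S → ∀ x y l', ‖x - e‖ ≤ ε → ‖y - e‖ ≤ ε →
      ‖l' - l‖ ≤ ε → |g (f x l' - f y l') (x - y) - g (A (x - y)) (x - y)| ≤
        k / 2 * (p (x - y) (x - y) + b (x - y) (x - y)) := by
    intro g hg x y l' hx hy hl
    rw [← sub_apply, ← map_sub]
    refine (bound g hg _ _).trans ?_
    have h1 := hrem x y l' hx hy hl
    have h2 := h.coercive (x - y)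
    calc S * ‖f x l' - f y l' - A (x - y)‖ * ‖x - y‖
        ≤ S * (k * m / (2 * S) * ‖x - y‖) * ‖x - y‖ := by gcongr
      _ = k / 2 * (m * ‖x - y‖ ^ 2) := by field_simp
      _ ≤ _ := by gcongr
  have e2 : ∀ (g : Vec n →L[ℝ] Vec n →L[ℝ] ℝ), ‖g‖ ≤ S → ∀ v z : Vec n,
      |g v z| ≤ k / 2 * (p z z + b z z) + S ^ 2 / (2 * k * m) * ‖v‖ ^ 2 := by
    intro g hg v z
    refine (bound g hg v z).trans ?_
    have h2 := h.coercive z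
    have h3 : S * ‖v‖ * ‖z‖ ≤ k / 2 * (m * ‖z‖ ^ 2) + S ^ 2 / (2 * k * m) * ‖v‖ ^ 2 := by
      have h4 : 0 ≤ (k * m * ‖z‖ - S * ‖v‖) ^ 2 / (2 * k * m) := by positivity
      have h5 : (k * m * ‖z‖ - S * ‖v‖) ^ 2 / (2 * k * m) =
          k / 2 * (m * ‖z‖ ^ 2) + S ^ 2 / (2 * k * m) * ‖v‖ ^ 2 - S * ‖v‖ * ‖z‖ := by
        field_simp; ring
      linarith
    refine h3.trans ?_
    gcongr
  refine ⟨ε, hε, S ^ 2 / (2 * k * m), fun ε' hε' hle => ⟨hk, hm, hε', by positivity, h.p_symm,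
    h.b_symm, h.p_nonneg, h.b_nonneg, h.coercive, ?_, ?_, ?_, ?_⟩⟩
  · intro x y l' hx hy hl
    have h1 := (abs_le.1 (e1 p hpS x y l' (hx.trans hle) (hy.trans hle) (hl.trans hle))).1
    have h2 := h.p_le (x - y)
    have h3 := mul_nonneg hk.le (h.p_nonneg (x - y))
    have h4 := mul_nonneg hk.le (h.b_nonneg (x - y))
    linarith
  · intro x y l' hx hy hl
    have h1 := (abs_le.1 (e1 b hbS x y l' (hx.trans hle) (hy.trans hle) (hl.trans hle))).2
    have h2 := h.b_le (x - y)
    have h3 := mul_nonneg hk.le (h.p_nonneg (x - y))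
    have h4 := mul_nonneg hk.le (h.b_nonneg (x - y))
    linarith
  · intro x l' hx hl
    have h0 : ‖e - e‖ ≤ ε := by simpa using hε.le
    have h1 := (abs_le.1 (e1 p hpS x e l' (hx.trans hle) h0 (hl.trans hle))).1
    have h2 := h.p_le (x - e)
    have h3 := mul_nonneg hk.le (h.p_nonneg (x - e))
    have h4 := mul_nonneg hk.le (h.b_nonneg (x - e))
    have h5 := (abs_le.1 (e2 p hpS (f e l') (x - e))).1
    have h6 : p (f x l' - f e l') (x - e) = p (f x l') (x - e) - p (f e l') (x - e) := by
      rw [map_sub p]; rfl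
    linarith
  · intro x l' hx hl
    have h0 : ‖e - e‖ ≤ ε := by simpa using hε.le
    have h1 := (abs_le.1 (e1 b hbS x e l' (hx.trans hle) h0 (hl.trans hle))).2
    have h2 := h.b_le (x - e)
    have h3 := mul_nonneg hk.le (h.p_nonneg (x - e))
    have h4 := mul_nonneg hk.le (h.b_nonneg (x - e))
    have h5 := (abs_le.1 (e2 b hbS (f e l') (x - e))).2
    have h6 : b (f x l' - f e l') (x - e) = b (f x l') (x - e) - b (f e l') (x - e) := by
      rw [map_sub b]; rfl
    linarith

section LocalDichotomy

variable {f : Vec n → Vec d → Vec n} {Λ : ℝ → Vec d} {l : Vec d} {e : Vec n}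
  {p b : Vec n →L[ℝ] Vec n →L[ℝ] ℝ} {k m ε C r : ℝ} {I : Set ℝ} {x y : ℝ → Vec n} {t : ℝ}

/-- The block `{p ≤ q, b ≤ q}` lies in the ball in which the cone estimates hold. -/
lemma IsLocalDichotomy.norm_le (h : IsLocalDichotomy f l e p b k m ε C) {q : ℝ}
    (hq : 2 * q ≤ m * ε ^ 2) {z : Vec n} (hp : p z z ≤ q) (hb : b z z ≤ q) : ‖z‖ ≤ ε := by
  have h1 := h.coercive z
  have h2 : m * ‖z‖ ^ 2 ≤ m * ε ^ 2 := by linarith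
  exact (sq_le_sq₀ (norm_nonneg z) h.ε_pos.le).1 (le_of_mul_le_mul_left h2 h.m_pos)

lemma IsSol.hasDerivWithinAt_form_sub {g : Vec n →L[ℝ] Vec n →L[ℝ] ℝ}
    (hg : ∀ x y, g x y = g y x) (hx : IsSol f Λ r I x) (hy : IsSol f Λ r I y) (ht : t ∈ I) :
    HasDerivWithinAt (fun t => g (x t - y t) (x t - y t))
      (2 * r⁻¹ * g (f (x t) (Λ t) - f (y t) (Λ t)) (x t - y t)) I t := by
  refine (hasDerivWithinAt_form hg ((hx t ht).sub (hy t ht))).congr_deriv ?_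
  rw [← smul_sub, map_smul, smul_apply, smul_eq_mul, mul_assoc]
  rfl

lemma IsSol.hasDerivWithinAt_form_sub_const {g : Vec n →L[ℝ] Vec n →L[ℝ] ℝ}
    (hg : ∀ x y, g x y = g y x) (hx : IsSol f Λ r I x) (e : Vec n) (ht : t ∈ I) :
    HasDerivWithinAt (fun t => g (x t - e) (x t - e))
      (2 * r⁻¹ * g (f (x t) (Λ t)) (x t - e)) I t := by
  refine (hasDerivWithinAt_form hg ((hx t ht).sub_const e)).congr_deriv ?_
  rw [map_smul, smul_apply, smul_eq_mul, mul_assoc]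

/-- The cone estimates for the derivatives along solutions at rate `r`, which carry the factor `2
/ r`. -/
lemma IsLocalDichotomy.p_rate (h : IsLocalDichotomy f l e p b k m ε C) (hr : 0 < r) {x y : Vec n}
    {l' : Vec d} (hx : ‖x - e‖ ≤ ε) (hy : ‖y - e‖ ≤ ε) (hl : ‖l' - l‖ ≤ ε) :
    2 * r⁻¹ * k * (2 * p (x - y) (x - y) - b (x - y) (x - y)) ≤
      2 * r⁻¹ * p (f x l' - f y l') (x - y) := by
  rw [mul_assoc]
  exact mul_le_mul_of_nonneg_left (h.p_le x y l' hx hy hl) (by positivity)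

lemma IsLocalDichotomy.b_rate (h : IsLocalDichotomy f l e p b k m ε C) (hr : 0 < r) {x y : Vec n}
    {l' : Vec d} (hx : ‖x - e‖ ≤ ε) (hy : ‖y - e‖ ≤ ε) (hl : ‖l' - l‖ ≤ ε) :
    2 * r⁻¹ * b (f x l' - f y l') (x - y) ≤
      2 * r⁻¹ * k * (p (x - y) (x - y) - 2 * b (x - y) (x - y)) := by
  rw [mul_assoc _ k]
  exact mul_le_mul_of_nonneg_left (h.b_le x y l' hx hy hl) (by positivity)

lemma IsLocalDichotomy.p_rate_equilibrium (h : IsLocalDichotomy f l e p b k m ε C) (hr : 0 < r)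
    {x : Vec n} {l' : Vec d} (hx : ‖x - e‖ ≤ ε) (hl : ‖l' - l‖ ≤ ε) :
    2 * r⁻¹ * k * (2 * p (x - e) (x - e) - b (x - e) (x - e)) - 2 * r⁻¹ * C * ‖f e l'‖ ^ 2 ≤
      2 * r⁻¹ * p (f x l') (x - e) := by
  rw [mul_assoc _ k, mul_assoc _ C, ← mul_sub]
  exact mul_le_mul_of_nonneg_left (h.p_le_equilibrium x l' hx hl) (by positivity)

lemma IsLocalDichotomy.b_rate_equilibrium (h : IsLocalDichotomy f l e p b k m ε C) (hr : 0 < r)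
    {x : Vec n} {l' : Vec d} (hx : ‖x - e‖ ≤ ε) (hl : ‖l' - l‖ ≤ ε) :
    2 * r⁻¹ * b (f x l') (x - e) ≤
      2 * r⁻¹ * k * (p (x - e) (x - e) - 2 * b (x - e) (x - e)) + 2 * r⁻¹ * C * ‖f e l'‖ ^ 2 := by
  rw [mul_assoc _ k, mul_assoc _ C, ← mul_add]
  exact mul_le_mul_of_nonneg_left (h.b_le_equilibrium x l' hx hl) (by positivity)

end LocalDichotomy

/-! ### Solutions emanating from a hyperbolic sink in the past -/

section Past

variable {f : Vec n → Vec d → Vec n} {Λ : ℝ → Vec d} {l : Vec d} {e : Vec n}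
  {p b : Vec n →L[ℝ] Vec n →L[ℝ] ℝ} {k m ε C q r τ₀ : ℝ} {I : Set ℝ} {x y : ℝ → Vec n} {t : ℝ}

/-- The cone estimates involve the field in the ball of radius `ε` only. -/
lemma IsLocalDichotomy.congr {F : Vec n → Vec d → Vec n}
    (h : IsLocalDichotomy f l e p b k m ε C)
    (hF : ∀ x l', ‖x - e‖ ≤ ε → F x l' = f x l') : IsLocalDichotomy F l e p b k m ε C := by
  have he : ∀ l', F e l' = f e l' := fun l' => hF e l' (by simpa using h.ε_pos.le)
  refine ⟨h.k_pos, h.m_pos, h.ε_pos, h.C_nonneg, h.p_symm, h.b_symm, h.p_nonneg, h.b_nonneg,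
    h.coercive, fun x y l' hx hy => ?_, fun x y l' hx hy => ?_, fun x l' hx => ?_,
    fun x l' hx => ?_⟩
  · rw [hF x l' hx, hF y l' hy]; exact h.p_le x y l' hx hy
  · rw [hF x l' hx, hF y l' hy]; exact h.b_le x y l' hx hy
  · rw [hF x l' hx, he]; exact h.p_le_equilibrium x l' hx
  · rw [hF x l' hx, he]; exact h.b_le_equilibrium x l' hx

lemma IsLocalDichotomy.sq_le (h : IsLocalDichotomy f l e 0 b k m ε C) (z : Vec n) :
    m * ‖z‖ ^ 2 ≤ b z z := by
  simpa using h.coercive z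

lemma form_le (b : Vec n →L[ℝ] Vec n →L[ℝ] ℝ) (z : Vec n) : b z z ≤ ‖b‖ * ‖z‖ ^ 2 := by
  have := b.le_opNorm₂ z z
  rw [Real.norm_eq_abs] at this
  calc b z z ≤ _ := (le_abs_self _).trans this
    _ = _ := by ring

/-- Near a sink the difference of two solutions contracts exponentially, at a rate independent of
the solutions. -/
lemma IsLocalDichotomy.contract (h : IsLocalDichotomy f l e 0 b k m ε C) (hr : 0 < r)
    (hI : Convex ℝ I) (hx : IsSol f Λ r I x) (hy : IsSol f Λ r I y)
    (hxe : ∀ t ∈ I, ‖x t - e‖ ≤ ε) (hye : ∀ t ∈ I, ‖y t - e‖ ≤ ε) (hl : ∀ t ∈ I, ‖Λ t - l‖ ≤ ε)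
    {s : ℝ} (hs : s ∈ I) (ht : t ∈ I) (hst : s ≤ t) :
    b (x t - y t) (x t - y t) ≤
      Real.exp (-(4 * r⁻¹ * k * (t - s))) * b (x s - y s) (x s - y s) := by
  refine le_exp_mul_of_deriv_le hI (k := 4 * r⁻¹ * k)
    (w := fun t => b (x t - y t) (x t - y t))
    (fun t ht => IsSol.hasDerivWithinAt_form_sub h.b_symm hx hy ht) (fun t ht => ?_) hs ht hst
  have := h.b_rate hr (hxe t ht) (hye t ht) (hl t ht)
  simp only [zero_apply] at this
  linarith

/-- Two solutions that stay near a sink in the past coincide: their difference contracts forwards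
and is bounded backwards. -/
lemma IsLocalDichotomy.eq_of_past (h : IsLocalDichotomy f l e 0 b k m ε C) (hr : 0 < r) {T : ℝ}
    (hx : IsSol f Λ r (Iic T) x) (hy : IsSol f Λ r (Iic T) y)
    (hxe : ∀ t ∈ Iic T, ‖x t - e‖ ≤ ε) (hye : ∀ t ∈ Iic T, ‖y t - e‖ ≤ ε)
    (hl : ∀ t ∈ Iic T, ‖Λ t - l‖ ≤ ε) : x T = y T := by
  have hk := h.k_pos
  have h1 := nonpos_of_deriv_le_of_bddAbove (T := T) (k := 4 * r⁻¹ * k) (M := ‖b‖ * (2 * ε) ^ 2)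
    (by positivity) (w := fun t => b (x t - y t) (x t - y t))
    (fun t ht => IsSol.hasDerivWithinAt_form_sub h.b_symm hx hy ht) (fun t ht => ?_)
    (fun t ht => ?_) T self_mem_Iic
  · have h2 := h.sq_le (x T - y T)
    have h3 : m * ‖x T - y T‖ ^ 2 ≤ 0 := h2.trans h1
    have h4 : ‖x T - y T‖ ^ 2 ≤ 0 := by
      by_contra h5
      have := mul_pos h.m_pos (not_le.1 h5)
      linarith
    rw [← sub_eq_zero, ← norm_eq_zero]
    exact pow_eq_zero_iff two_ne_zero |>.1 (le_antisymm h4 (sq_nonneg _))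
  · have := h.b_rate hr (hxe t ht) (hye t ht) (hl t ht)
    simp only [zero_apply] at this
    linarith
  · refine (form_le b _).trans ?_
    gcongr
    calc ‖x t - y t‖ = ‖(x t - e) - (y t - e)‖ := by congr 1; abel
      _ ≤ ‖x t - e‖ + ‖y t - e‖ := norm_sub_le _ _
      _ ≤ 2 * ε := by linarith [hxe t ht, hye t ht]

lemma IsHyperbolicSink.exists_isLocalDichotomy
    (hf : ContDiff ℝ 1 (fun p : Vec n × Vec d => f p.1 p.2)) (he : IsHyperbolicSink f l e) :
    ∃ b k m ε C, IsLocalDichotomy f l e 0 b k m ε C := by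
  obtain ⟨b, k, m, h⟩ := exists_isDichotomy_of_sink _ he.2
  obtain ⟨ε, hε, C, hC⟩ := h.exists_isLocalDichotomy hf
  exact ⟨b, k, m, ε, C, hC ε hε le_rfl⟩

lemma eventually_norm_sub_le {ι : Type*} {F : Filter ι} {E : Type*} [NormedAddCommGroup E]
    {u : ι → E} {a : E} (h : Tendsto u F (𝓝 a)) (hε : 0 < ε) : ∀ᶠ i in F, ‖u i - a‖ ≤ ε := by
  filter_upwards [Metric.tendsto_nhds.1 h ε hε] with i hi
  rw [← dist_eq_norm]
  exact hi.le

/-- A solution is determined by tending to a given hyperbolic sink as `τ → -∞`. -/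
lemma IsSol.eqOn_of_tendsto_sink (hf : ContDiff ℝ 1 (fun p : Vec n × Vec d => f p.1 p.2))
    (hΛ : Continuous Λ) (hl : Tendsto Λ atBot (𝓝 l)) (hr : 0 < r) (he : IsHyperbolicSink f l e)
    (hI : I.OrdConnected) {T : ℝ} (hT : Iio T ⊆ I) (hx : IsSol f Λ r I x) (hy : IsSol f Λ r I y)
    (hxe : Tendsto x atBot (𝓝 e)) (hye : Tendsto y atBot (𝓝 e)) : EqOn x y I := by
  obtain ⟨b, k, m, ε, C, h⟩ := he.exists_isLocalDichotomy hf
  obtain ⟨S, hS⟩ := eventually_atBot.1 (((eventually_norm_sub_le hxe h.ε_pos).and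
    (eventually_norm_sub_le hye h.ε_pos)).and ((eventually_norm_sub_le hl h.ε_pos).and
      (eventually_lt_atBot T)))
  have hSI : Iic S ⊆ I := fun t ht => hT (hS t ht).2.2
  refine IsSol.eqOn hf hΛ hI hx hy (hSI self_mem_Iic) ?_
  exact h.eq_of_past hr (hx.mono hSI) (hy.mono hSI) (fun t ht => (hS t ht).1.1)
    (fun t ht => (hS t ht).1.2) (fun t ht => (hS t ht).2.1)

/-- The input is so close to its past limit on `(-∞, τ₀]` that the block `{b (x - e) ≤ q}` is
forward invariant there, at every rate. -/
structure IsPastBlock (f : Vec n → Vec d → Vec n) (Λ : ℝ → Vec d) (l : Vec d) (e : Vec n)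
    (b : Vec n →L[ℝ] Vec n →L[ℝ] ℝ) (k m ε C q τ₀ : ℝ) : Prop where
  dich : IsLocalDichotomy f l e 0 b k m ε C
  q_pos : 0 < q
  q_le : 2 * q ≤ m * ε ^ 2
  input : ∀ t ≤ τ₀, ‖Λ t - l‖ ≤ ε
  drift : ∀ t ≤ τ₀, C * ‖f e (Λ t)‖ ^ 2 < k * q

/-- Here `τ₀` depends on the input only through its distance to the past limit, hence not on the
rate. -/
lemma IsHyperbolicSink.exists_isPastBlock
    (hf : ContDiff ℝ 1 (fun p : Vec n × Vec d => f p.1 p.2)) (he : IsHyperbolicSink f l e)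
    (hl : Tendsto Λ atBot (𝓝 l)) :
    ∃ b k m ε C q τ₀, IsPastBlock f Λ l e b k m ε C q τ₀ := by
  obtain ⟨b, k, m, ε, C, h⟩ := he.exists_isLocalDichotomy hf
  have hm := h.m_pos
  have hε := h.ε_pos
  have hk := h.k_pos
  have hc : Tendsto (fun t => C * ‖f e (Λ t)‖ ^ 2) atBot (𝓝 0) := by
    have h1 : Tendsto (fun t => f e (Λ t)) atBot (𝓝 (f e l)) :=
      ((hf.continuous.comp (Continuous.prodMk_right e)).tendsto l).comp hl
    have := (h1.norm.pow 2).const_mul C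
    simpa [he.1] using this
  have hq : 0 < k * (m * ε ^ 2 / 2) := by positivity
  obtain ⟨S, hS⟩ := eventually_atBot.1 ((eventually_norm_sub_le hl h.ε_pos).and
    (hc.eventually_lt_const hq))
  exact ⟨b, k, m, ε, C, m * ε ^ 2 / 2, S, h, by positivity, by linarith, fun t ht => (hS t ht).1,
    fun t ht => (hS t ht).2⟩

namespace IsPastBlock

lemma congr {F : Vec n → Vec d → Vec n} (h : IsPastBlock f Λ l e b k m ε C q τ₀)
    (hF : ∀ x l', ‖x - e‖ ≤ ε → F x l' = f x l') : IsPastBlock F Λ l e b k m ε C q τ₀ :=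
  ⟨h.dich.congr hF, h.q_pos, h.q_le, h.input, fun t ht => by
    rw [hF e _ (by simpa using h.dich.ε_pos.le)]; exact h.drift t ht⟩

lemma norm_le (h : IsPastBlock f Λ l e b k m ε C q τ₀) {z : Vec n} (hz : b z z ≤ q) :
    ‖z‖ ≤ ε :=
  h.dich.norm_le h.q_le (by simpa using h.q_pos.le) hz

/-- On the face `b = q` the drift bound makes `b` strictly decreasing, so solutions cannot leave
the block forwards in time. -/
lemma forward_invariant (h : IsPastBlock f Λ l e b k m ε C q τ₀) (hr : 0 < r) {a c : ℝ}
    (hc : c ≤ τ₀) (hx : IsSol f Λ r (Icc a c) x) (h0 : b (x a - e) (x a - e) ≤ q) :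
    ∀ t ∈ Icc a c, b (x t - e) (x t - e) ≤ q := by
  have hd : ∀ t ∈ Icc a c, HasDerivWithinAt (fun t => b (x t - e) (x t - e))
      (2 * r⁻¹ * b (f (x t) (Λ t)) (x t - e)) (Icc a c) t :=
    fun t ht => hx.hasDerivWithinAt_form_sub_const h.dich.b_symm e ht
  refine image_le_of_deriv_right_lt_deriv_boundary (B := fun _ => q) (B' := fun _ => 0)
    (fun t ht => (hd t ht).continuousWithinAt)
    (fun t ht => (hd t (Ico_subset_Icc_self ht)).mono_of_mem_nhdsWithin
      (Icc_mem_nhdsGE_of_mem ht)) h0 (fun t => hasDerivAt_const _ _) (fun t ht htq => ?_)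
  have h1 := h.dich.b_rate_equilibrium hr (h.norm_le htq.le) (h.input t (ht.2.le.trans hc))
  simp only [zero_apply, htq] at h1
  have h2 := h.drift t (ht.2.le.trans hc)
  have h3 := mul_pos h.dich.k_pos h.q_pos
  have h4 : 0 < 2 * r⁻¹ * (2 * (k * q) - C * ‖f e (Λ t)‖ ^ 2) :=
    mul_pos (by positivity) (by linarith)
  linarith

/-- The pullback construction: a global solution (of a tame field) that lies in the block at all
times before `τ₀`. -/
lemma exists_isSol {L : ℝ} {K M : NNReal} (hF : IsTame f L K M) (hΛ : Continuous Λ)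
    (hL : ∀ t, ‖Λ t‖ ≤ L) (h : IsPastBlock f Λ l e b k m ε C q τ₀) (hr : 0 < r) :
    ∃ x, IsSol f Λ r univ x ∧ ∀ t ≤ τ₀, b (x t - e) (x t - e) ≤ q := by
  -- solutions started from `e` at the times `τ₀ - j`; they stay in the block, and their values at
  -- `τ₀` have a limit point
  choose z hz hz0 using fun j : ℕ => hF.exists_isSol hΛ hL r (τ₀ - j) e
  have hin : ∀ j : ℕ, ∀ t ∈ Icc (τ₀ - j) τ₀, b (z j t - e) (z j t - e) ≤ q := by
    intro j
    refine h.forward_invariant hr le_rfl ((hz j).mono (subset_univ _)) ?_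
    rw [hz0]
    simpa using h.q_pos.le
  obtain ⟨y, -, φ, hφ, hy⟩ := (isCompact_closedBall e ε).tendsto_subseq (x := fun j => z j τ₀)
    (fun j => by
      rw [mem_closedBall_iff_norm]
      exact h.norm_le (hin j τ₀ ⟨by linarith [(Nat.cast_nonneg j : (0 : ℝ) ≤ j)], le_rfl⟩))
  obtain ⟨x, hx, hx0⟩ := hF.exists_isSol hΛ hL r τ₀ y
  refine ⟨x, hx, fun t ht => ?_⟩
  have hlim : Tendsto (fun j => z (φ j) t) atTop (𝓝 (x t)) := by
    refine IsSol.tendsto_left hF.contDiff hΛ ht (hx.mono (subset_univ _)) (r' := fun _ => r)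
      (Λ' := fun _ => Λ) (.of_forall fun j => (hz (φ j)).mono (subset_univ _)) (fun _ => hΛ)
      tendsto_const_nhds ?_ ?_ (left_mem_Icc.2 ht)
    · exact Metric.tendstoUniformlyOn_iff.2 fun ε hε => .of_forall fun _ _ _ => by simpa using hε
    · rw [hx0]; exact hy
  have hlim2 : Tendsto (fun j => b (z (φ j) t - e) (z (φ j) t - e)) atTop
      (𝓝 (b (x t - e) (x t - e))) := by
    have hc : Continuous fun v : Vec n => b (v - e) (v - e) := by fun_prop
    exact (hc.tendsto _).comp hlim
  refine le_of_tendsto hlim2 ?_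
  filter_upwards [(tendsto_natCast_atTop_atTop.comp hφ.tendsto_atTop).eventually_ge_atTop (τ₀ - t)]
    with j hj
  exact hin _ t ⟨by simp only [Function.comp] at hj; linarith, ht⟩

end IsPastBlock

/-- Solutions that stay near a sink in the past approach it as fast as the drift `f e Λ`
allows. -/
lemma IsLocalDichotomy.isLittleO_past (h : IsLocalDichotomy f l e 0 b k m ε C) (hr : 0 < r)
    {α T : ℝ} (hα : 0 < α) (hx : IsSol f Λ r (Iic T) x) (hxe : ∀ t ≤ T, ‖x t - e‖ ≤ ε)
    (hl : ∀ t ≤ T, ‖Λ t - l‖ ≤ ε)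
    (ho : (fun t => f e (Λ t)) =o[atBot] fun t => Real.exp (α * t)) :
    (fun t => x t - e) =o[atBot] fun t => Real.exp (α * t) := by
  have hk := h.k_pos
  have hm := h.m_pos
  have hC := h.C_nonneg
  rw [Asymptotics.isLittleO_iff]
  intro c hc
  -- chosen such that a drift bounded by `c' exp (α t)` is compensated by `m c² exp (2 α t)`
  set c' := c * √(2 * k * m / (C + 1)) with hc'
  have hc'0 : 0 < c' := by positivity
  have hsq : C * c' ^ 2 ≤ 2 * k * (m * c ^ 2) := by
    rw [hc', mul_pow, Real.sq_sqrt (by positivity)]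
    have : C / (C + 1) ≤ 1 := by rw [div_le_one (by positivity)]; linarith
    calc C * (c ^ 2 * (2 * k * m / (C + 1))) = C / (C + 1) * (2 * k * (m * c ^ 2)) := by
          field_simp
      _ ≤ 1 * (2 * k * (m * c ^ 2)) := by gcongr
      _ = _ := one_mul _
  obtain ⟨S, hS⟩ := eventually_atBot.1 ((ho.def hc'0).and (eventually_le_atBot T))
  have hST : Iic S ⊆ Iic T := fun t ht => (hS t ht).2
  -- `b (x - e) - m c² exp (2 α t)` contracts forwards and is bounded backwards, hence is
  -- nonpositive
  have key := nonpos_of_deriv_le_of_bddAbove (T := S) (k := 4 * r⁻¹ * k) (M := ‖b‖ * ε ^ 2)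
    (by positivity)
    (w := fun t => b (x t - e) (x t - e) - m * c ^ 2 * Real.exp (α * t) ^ 2)
    (w' := fun t => 2 * r⁻¹ * b (f (x t) (Λ t)) (x t - e) -
      m * c ^ 2 * (2 * Real.exp (α * t) * (Real.exp (α * t) * α)))
    (fun t ht => ?_) (fun t ht => ?_) (fun t ht => ?_)
  · filter_upwards [eventually_le_atBot S] with t ht
    have h1 := key t ht
    have h2 := h.sq_le (x t - e)
    have h3 : m * ‖x t - e‖ ^ 2 ≤ m * (c * Real.exp (α * t)) ^ 2 := by
      rw [mul_pow]; linarith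
    rw [Real.norm_eq_abs, Real.abs_exp]
    exact (sq_le_sq₀ (norm_nonneg _) (by positivity)).1 (le_of_mul_le_mul_left h3 hm)
  · refine ((hx.mono hST).hasDerivWithinAt_form_sub_const h.b_symm e ht).sub ?_
    have h1 : HasDerivAt (fun t => Real.exp (α * t)) (Real.exp (α * t) * α) t := by
      simpa using ((hasDerivAt_id t).const_mul α).exp
    have := ((h1.pow 2).const_mul (m * c ^ 2)).hasDerivWithinAt (s := Iic S)
    simpa using this
  · have h1 := h.b_rate_equilibrium hr (hxe t (hST ht)) (hl t (hST ht))
    simp only [zero_apply] at h1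
    have h2 := (hS t ht).1
    rw [Real.norm_eq_abs, Real.abs_exp] at h2
    set E := Real.exp (α * t)
    have hE : 0 < E := Real.exp_pos _
    have h3 : C * ‖f e (Λ t)‖ ^ 2 ≤ 2 * k * (m * c ^ 2) * E ^ 2 := by
      calc C * ‖f e (Λ t)‖ ^ 2 ≤ C * (c' * E) ^ 2 := by gcongr
        _ = C * c' ^ 2 * E ^ 2 := by ring
        _ ≤ _ := by gcongr
    have h4 : 2 * r⁻¹ * C * ‖f e (Λ t)‖ ^ 2 ≤ 2 * r⁻¹ * (2 * k * (m * c ^ 2) * E ^ 2) := by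
      rw [mul_assoc]; gcongr
    have h5 : 0 ≤ m * c ^ 2 * (2 * E * (E * α)) := by positivity
    linarith
  · have h1 := form_le b (x t - e)
    have h2 : ‖b‖ * ‖x t - e‖ ^ 2 ≤ ‖b‖ * ε ^ 2 := by
      have := hxe t (hST ht)
      gcongr
    have h3 : 0 ≤ m * c ^ 2 * Real.exp (α * t) ^ 2 := by positivity
    linarith

/-- The drift at the sink is `f e` composed with the extended input, a `C¹` function of `σ` whose
value and derivative vanish at `σ = 0`. -/
lemma isLittleO_drift {α : ℝ} (hf : ContDiff ℝ 1 (fun p : Vec n × Vec d => f p.1 p.2))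
    (hΛ : ContDiff ℝ 1 Λ) (hα : 0 < α) (hl : Tendsto Λ atBot (𝓝 l))
    (hd : Tendsto (fun τ => Real.exp (α * τ) • deriv (fun t => Λ (-t)) τ) atTop (𝓝 0))
    (he : f e l = 0) : (fun t => f e (Λ t)) =o[atBot] fun t => Real.exp (α * t) := by
  obtain ⟨D, -, hD0, hD⟩ := hasDerivAt_glueInput (hΛ.comp contDiff_neg) hα
    (hl.comp tendsto_neg_atTop_atBot) hd
  have h0 : glueInput (Λ ∘ fun t => -t) l α 0 = l := by simp [glueInput]
  have h1 : HasDerivAt (fun σ => f e (glueInput (Λ ∘ fun t => -t) l α σ)) 0 0 := by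
    have h2 := (hf.differentiable one_ne_zero (e, glueInput (Λ ∘ fun t => -t) l α 0)).hasFDerivAt
    have h3 := hD 0
    rw [hD0 0 le_rfl] at h3
    have h4 := h2.comp_hasDerivAt (0 : ℝ) ((hasDerivAt_const (0 : ℝ) e).prodMk h3)
    exact h4.congr_deriv (map_zero _)
  have h2 := h1.isLittleO
  simp only [h0, he, sub_zero, smul_zero] at h2
  have h3 : Tendsto (fun t => Real.exp (α * t)) atBot (𝓝 0) :=
    Real.tendsto_exp_atBot.comp (tendsto_id.const_mul_atBot hα)
  refine (h2.comp_tendsto h3).congr_left fun t => ?_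
  have := glueInput_exp (Λ := Λ ∘ fun t => -t) (l := l) hα (-t)
  simp only [mul_neg, neg_neg] at this
  simp [Function.comp_def] at this ⊢
  rw [this]

end Past

section PastManifold

variable {f : Vec n → Vec d → Vec n} {Λ : ℝ → Vec d} {lm lp : Vec d} {e : Vec n}
  {b : Vec n →L[ℝ] Vec n →L[ℝ] ℝ} {k m ε C q r τ₀ α ρ : ℝ} {I : Set ℝ} {x y : ℝ → Vec n} {t : ℝ}

/-- The interior of the block serves as the set of initial states: solutions from it stay in the
block, and there they contract towards `x`. -/
lemma IsPastBlock.isLocalPullbackAttractor {F : Vec n → Vec d → Vec n} {L : ℝ} {K M : NNReal}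
    (hF : IsTame F L K M) (hFf : ∀ x l', ‖x - e‖ ≤ ε → F x l' = f x l') (hΛ : Continuous Λ)
    (hL : ∀ t, ‖Λ t‖ ≤ L) (h : IsPastBlock F Λ lm e b k m ε C q τ₀) (hr : 0 < r)
    (hx : IsSol F Λ r univ x) (hxq : ∀ t ≤ τ₀, b (x t - e) (x t - e) ≤ q)
    (hxe : Tendsto x atBot (𝓝 e)) : IsLocalPullbackAttractor f Λ r τ₀ x := by
  have hk := h.dich.k_pos
  have hm := h.dich.m_pos
  have hε := h.dich.ε_pos
  have hbc : Continuous fun v : Vec n => b (v - e) (v - e) := by fun_prop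
  refine ⟨(hx.mono (subset_univ _)).congr_field fun t ht =>
    (hFf _ _ (h.norm_le (hxq t (mem_Iio.1 ht).le))).symm, {v | b (v - e) (v - e) < q},
    isOpen_lt hbc continuous_const, ?_, ?_⟩
  · refine (Metric.isBounded_closedBall (x := e) (r := ε)).subset fun v hv => ?_
    rw [mem_closedBall_iff_norm]
    exact h.norm_le (le_of_lt hv)
  have h0 : Tendsto (fun t => b (x t - e) (x t - e)) atBot (𝓝 0) := by
    have := (hbc.tendsto e).comp hxe
    simpa [Function.comp_def] using this
  obtain ⟨T, hT⟩ := eventually_atBot.1 ((h0.eventually_lt_const h.q_pos).and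
    (eventually_le_atBot τ₀))
  refine ⟨T, (hT T le_rfl).2, fun τ hτ => (hT τ hτ.le).1, fun τ hτ δ hδ => ?_⟩
  have hττ : τ ≤ τ₀ := (hT τ hτ.le).2
  have hlim : Tendsto (fun s => Real.exp (-(4 * r⁻¹ * k * (τ - s))) * (‖b‖ * (2 * ε) ^ 2)) atBot
      (𝓝 (0 * (‖b‖ * (2 * ε) ^ 2))) := by
    refine Tendsto.mul_const _ (Real.tendsto_exp_atBot.comp ?_)
    have : (fun s => -(4 * r⁻¹ * k * (τ - s))) = fun s => 4 * r⁻¹ * k * s + -(4 * r⁻¹ * k * τ) := by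
      ext; ring
    rw [this]
    exact tendsto_atBot_add_const_right _ _ (tendsto_id.const_mul_atBot (by positivity))
  rw [zero_mul] at hlim
  have hδ' : 0 < m * δ ^ 2 := by positivity
  obtain ⟨s₀, hs₀⟩ := eventually_atBot.1 ((hlim.eventually_lt_const hδ').and
    (eventually_lt_atBot τ))
  refine ⟨s₀, (hs₀ s₀ le_rfl).2, fun s hs v hv => ?_⟩
  have hsτ : s ≤ τ := (hs₀ s hs).2.le
  obtain ⟨z, hz, hzs⟩ := hF.exists_isSol hΛ hL r s v
  have hzq := h.forward_invariant hr hττ (hz.mono (subset_univ (Icc s τ)))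
    (by rw [hzs]; exact le_of_lt hv)
  refine ⟨z, (hz.mono (subset_univ _)).congr_field fun t ht => (hFf _ _ (h.norm_le (hzq t ht))).symm,
    hzs, ?_⟩
  have hze : ∀ t ∈ Icc s τ, ‖z t - e‖ ≤ ε := fun t ht => h.norm_le (hzq t ht)
  have hxe' : ∀ t ∈ Icc s τ, ‖x t - e‖ ≤ ε := fun t ht => h.norm_le (hxq t (ht.2.trans hττ))
  have h1 := h.dich.contract hr (convex_Icc s τ) (hz.mono (subset_univ _))
    (hx.mono (subset_univ _)) hze hxe' (fun t ht => h.input t (ht.2.trans hττ))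
    (left_mem_Icc.2 hsτ) (right_mem_Icc.2 hsτ) hsτ
  have h2 := h.dich.sq_le (z τ - x τ)
  have h3 : b (z s - x s) (z s - x s) ≤ ‖b‖ * (2 * ε) ^ 2 := by
    refine (form_le b _).trans ?_
    gcongr
    calc ‖z s - x s‖ = ‖(z s - e) - (x s - e)‖ := by congr 1; abel
      _ ≤ ‖z s - e‖ + ‖x s - e‖ := norm_sub_le _ _
      _ ≤ 2 * ε := by linarith [hze s (left_mem_Icc.2 hsτ), hxe' s (left_mem_Icc.2 hsτ)]
  have h4 : Real.exp (-(4 * r⁻¹ * k * (τ - s))) * b (z s - x s) (z s - x s) ≤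
      Real.exp (-(4 * r⁻¹ * k * (τ - s))) * (‖b‖ * (2 * ε) ^ 2) := by gcongr
  have h5 := (hs₀ s hs).1
  have h6 : m * ‖z τ - x τ‖ ^ 2 < m * δ ^ 2 := by linarith
  rw [dist_eq_norm]
  exact lt_of_pow_lt_pow_left₀ 2 hδ.le (lt_of_mul_lt_mul_left h6 hm.le)

/-- A global solution tending to a hyperbolic sink in the past is `C¹` as a function of the
compactified time, up to and including the endpoint. -/
lemma contDiff_glue_past (hf : ContDiff ℝ 1 (fun p : Vec n × Vec d => f p.1 p.2))
    (hΛ : ContDiff ℝ 1 Λ) (hexp : IsExpBiAsymptoticallyConstant Λ ρ lm lp) (hα : 0 < α)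
    (hαρ : α < ρ) (hr : 0 < r) (he : IsHyperbolicSink f lm e) {L : ℝ} {K M : NNReal}
    (hF : IsTame f L K M) (hL : ∀ t, ‖Λ t‖ ≤ L)
    (hx : IsSol f Λ r univ x) (hxe : Tendsto x atBot (𝓝 e)) :
    ContDiff ℝ 1 (glueInput (fun t => x (-t)) e α) := by
  have hxd : ∀ t, HasDerivAt x (r⁻¹ • f (x t) (Λ t)) t := fun t => hx.hasDerivAt univ_mem
  have hxd' : deriv x = fun t => r⁻¹ • f (x t) (Λ t) := funext fun t => (hxd t).deriv
  have hxc : Continuous x := continuous_iff_continuousAt.2 fun t => (hxd t).continuousAt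
  have hx1 : ContDiff ℝ 1 x := by
    rw [contDiff_one_iff_deriv]
    refine ⟨fun t => (hxd t).differentiableAt, ?_⟩
    rw [hxd']
    exact (hf.continuous.comp (hxc.prodMk hΛ.continuous)).const_smul r⁻¹
  have ho := isLittleO_drift hf hΛ hα hexp.tendsto_past
    (hexp.comp_neg.tendsto_exp_smul_deriv hαρ) he.1
  have hxo : (fun t => x t - e) =o[atBot] fun t => Real.exp (α * t) := by
    obtain ⟨b, k, m, ε, C, h⟩ := he.exists_isLocalDichotomy hf
    obtain ⟨S, hS⟩ := eventually_atBot.1 ((eventually_norm_sub_le hxe h.ε_pos).and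
      (eventually_norm_sub_le hexp.tendsto_past h.ε_pos))
    exact h.isLittleO_past hr hα (hx.mono (subset_univ _)) (fun t ht => (hS t ht).1)
      (fun t ht => (hS t ht).2) ho
  have hdo : (deriv x) =o[atBot] fun t => Real.exp (α * t) := by
    have h1 : (fun t => r⁻¹ • f (x t) (Λ t) - r⁻¹ • f e (Λ t)) =O[atBot] fun t => x t - e := by
      refine Asymptotics.IsBigO.of_bound (‖r⁻¹‖₊ * K : NNReal) (.of_forall fun t => ?_)
      have := (hF.lipschitzWith (hL t) r).dist_le_mul (x t) e
      rwa [dist_eq_norm, dist_eq_norm] at this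
    have h2 := (h1.trans_isLittleO hxo).add (ho.const_smul_left r⁻¹)
    rw [hxd']
    refine h2.congr_left fun t => ?_
    simp
  refine contDiff_glueInput (hx1.comp contDiff_neg) hα (hxe.comp tendsto_neg_atTop_atBot) ?_
  have h3 := (Asymptotics.isBigO_refl (fun t => Real.exp (α * t)) atTop).smul_isLittleO
    (hdo.comp_tendsto tendsto_neg_atTop_atBot).neg_left
  refine (Asymptotics.isLittleO_one_iff ℝ).1 (h3.congr (fun t => ?_) (fun t => ?_))
  · rw [deriv_comp_neg]; rfl
  · simp only [Function.comp, smul_eq_mul, ← Real.exp_add]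
    simp

/-- The section of the unstable manifold of `(e, -1)` at a finite time consists of the values of
the solutions that tend to `e` in the past. -/
lemma mem_unstableManifold_past_iff (hα : 0 < α) {τ : ℝ} {v : Vec n} :
    (v, compTime α τ) ∈ unstableManifold (compField f Λ lm lp α r) (e, -1) ↔
      ∃ x, IsSol f Λ r (Iic τ) x ∧ Tendsto x atBot (𝓝 e) ∧ x τ = v := by
  constructor
  · rintro ⟨γ, hγ, h0, hlim⟩
    obtain ⟨-, h1⟩ := hγ.isSol_of_compTime hα ordConnected_Iic self_mem_Iic (by rw [h0])
    refine ⟨fun t => (γ (t + -τ)).1, ?_, ?_, by simp [h0]⟩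
    · have := h1.comp_add (-τ)
      simp only [neg_add_cancel_right] at this
      refine this.mono fun t ht => ?_
      simpa using ht
    · exact ((continuous_fst.tendsto _).comp hlim).comp (tendsto_atBot_add_const_right _ _ tendsto_id)
  · rintro ⟨x, hx, hxe, rfl⟩
    refine ⟨fun t => (x (t + τ), compTime α (t + τ)), isTrajectory_compTime hα
      ((hx.comp_add τ).mono fun t ht => ?_), by simp, ?_⟩
    · simpa using ht
    · have : Tendsto (fun t => t + τ) atBot atBot := tendsto_atBot_add_const_right _ _ tendsto_id
      exact (hxe.comp this).prodMk_nhds ((tendsto_compTime_atBot hα).comp this)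

/-- In the slice `s = -1` the unstable manifold reduces to the equilibrium, since a sink has no
nontrivial backward asymptotic orbits. -/
lemma mem_unstableManifold_past_endpoint (hf : ContDiff ℝ 1 (fun p : Vec n × Vec d => f p.1 p.2))
    (hr : 0 < r) (he : IsHyperbolicSink f lm e) {v : Vec n} :
    (v, -1) ∈ unstableManifold (compField f Λ lm lp α r) (e, -1) ↔ v = e := by
  have hc : IsSol f (fun _ => lm) r (Iic 0) fun _ => e := fun t _ => by
    simpa [he.1] using hasDerivWithinAt_const t (Iic 0) e
  constructor
  · rintro ⟨γ, hγ, h0, hlim⟩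
    obtain ⟨-, h1⟩ := hγ.isSol_of_neg_one ordConnected_Iic self_mem_Iic (by rw [h0])
    have := IsSol.eqOn_of_tendsto_sink hf continuous_const tendsto_const_nhds hr he
      ordConnected_Iic Iio_subset_Iic_self h1 hc ((continuous_fst.tendsto _).comp hlim)
      tendsto_const_nhds (self_mem_Iic)
    simpa [h0] using this
  · rintro rfl
    exact ⟨fun _ => (v, -1), isTrajectory_neg_one hc, rfl, tendsto_const_nhds⟩

lemma not_mem_unstableManifold_past_future {v : Vec n} :
    (v, 1) ∉ unstableManifold (compField f Λ lm lp α r) (e, -1) := by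
  rintro ⟨γ, hγ, h0, hlim⟩
  obtain ⟨h1, -⟩ := hγ.isSol_of_one ordConnected_Iic self_mem_Iic (by rw [h0])
  have h2 : Tendsto (fun t => (γ t).2) atBot (𝓝 (-1)) := (continuous_snd.tendsto _).comp hlim
  have h3 : Tendsto (fun t => (γ t).2) atBot (𝓝 1) :=
    tendsto_const_nhds.congr' (by
      filter_upwards [eventually_le_atBot 0] with t ht using (h1 t ht).symm)
  have := tendsto_nhds_unique h2 h3
  norm_num at this

/-- A solution tending to a sink in the past agrees, on a given half-line, with a global solution
for a tame field. -/
lemma IsSol.exists_tame_extension (hf : ContDiff ℝ 1 (fun p : Vec n × Vec d => f p.1 p.2))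
    (hΛ : Continuous Λ) {L : ℝ} (hL : ∀ t, ‖Λ t‖ ≤ L) {τ : ℝ} (hx : IsSol f Λ r (Iic τ) x)
    (hxe : Tendsto x atBot (𝓝 e)) :
    ∃ F K M y, IsTame F L K M ∧ (∀ v l, ‖v - e‖ < 1 → F v l = f v l) ∧
      IsSol F Λ r univ y ∧ EqOn x y (Iic τ) := by
  obtain ⟨S, hS⟩ := eventually_atBot.1 (eventually_norm_sub_le hxe one_pos)
  obtain ⟨R, hR⟩ := ((isCompact_Icc (a := S) (b := τ)).image_of_continuousOn
    (hx.continuousOn.mono Icc_subset_Iic_self)).isBounded.exists_norm_le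
  obtain ⟨F, hF, K, M, hT⟩ := exists_tame hf (max R (‖e‖ + 1)) L
  have hnear : ∀ v l, ‖v - e‖ ≤ 1 → F v l = f v l := fun v l hv => hF v l (le_max_of_le_right (by
    calc ‖v‖ = ‖e + (v - e)‖ := by congr 1; abel
      _ ≤ ‖e‖ + ‖v - e‖ := norm_add_le _ _
      _ ≤ _ := by linarith))
  obtain ⟨y, hy, hyτ⟩ := hT.exists_isSol hΛ hL r τ (x τ)
  refine ⟨F, K, M, y, hT, fun v l hv => hnear v l hv.le, hy, ?_⟩
  have hxF : IsSol F Λ r (Iic τ) x := hx.congr_field fun t ht => by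
    rcases le_total t S with h | h
    · exact hnear _ _ (hS t h)
    · exact hF _ _ (le_max_of_le_left (hR _ ⟨t, ⟨h, ht⟩, rfl⟩))
  exact IsSol.eqOn hT.contDiff hΛ ordConnected_Iic hxF (hy.mono (subset_univ _)) self_mem_Iic
    hyτ.symm

/-- Being a hyperbolic sink is a local property of the field. -/
lemma IsHyperbolicSink.congr {F : Vec n → Vec d → Vec n} {l : Vec d}
    (he : IsHyperbolicSink f l e) {δ : ℝ} (hδ : 0 < δ) (hF : ∀ v l, ‖v - e‖ < δ → F v l = f v l) :
    IsHyperbolicSink F l e := by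
  have h1 : fderiv ℝ (fun x => F x l) e = fderiv ℝ (fun x => f x l) e := by
    refine Filter.EventuallyEq.fderiv_eq ?_
    filter_upwards [Metric.ball_mem_nhds e hδ] with v hv
    exact hF v l (by rwa [← dist_eq_norm])
  refine ⟨by rw [hF e l (by simpa using hδ)]; exact he.1, ?_⟩
  rw [h1]
  exact he.2

/-- The unstable manifold is the graph of the solution that tends to the sink in the past, up to
the time at which this solution ceases to exist; `compTime` of that time is the endpoint `b` of
the graph. -/
lemma isCurveOverTime_unstableManifold (hf : ContDiff ℝ 1 (fun p : Vec n × Vec d => f p.1 p.2))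
    (hΛ : ContDiff ℝ 1 Λ) (hexp : IsExpBiAsymptoticallyConstant Λ ρ lm lp) (hα : 0 < α)
    (hαρ : α < ρ) (hr : 0 < r) (he : IsHyperbolicSink f lm e)
    (hne : ∃ τ x, IsSol f Λ r (Iic τ) x ∧ Tendsto x atBot (𝓝 e)) :
    IsCurveOverTime (unstableManifold (compField f Λ lm lp α r) (e, -1)) := by
  classical
  obtain ⟨L, hL⟩ := hexp.exists_bound hΛ.continuous
  -- the times up to which the solution exists
  set S : Set ℝ := {τ | ∃ x, IsSol f Λ r (Iic τ) x ∧ Tendsto x atBot (𝓝 e)} with hS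
  have hdown : ∀ τ ∈ S, ∀ t ≤ τ, t ∈ S := fun τ ⟨x, hx, hxe⟩ t ht =>
    ⟨x, hx.mono (Iic_subset_Iic.2 ht), hxe⟩
  have hopen : ∀ τ ∈ S, ∃ t ∈ S, τ < t := by
    rintro τ ⟨x, hx, hxe⟩
    obtain ⟨c, hc, z, hz, hz0⟩ := exists_isSol_local hf hΛ.continuous hL r τ (x τ)
    obtain ⟨w, hw, hwx, -⟩ := hx.glue (J := Icc τ c) subset_rfl (fun t ht => ht.1) self_mem_Iic
      (left_mem_Icc.2 hc.le) hz hz0.symm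
    refine ⟨c, ⟨w, ?_, ?_⟩, hc⟩
    · rwa [Iic_union_Icc_eq_Iic hc.le] at hw
    · exact hxe.congr' (by filter_upwards [eventually_le_atBot τ] with t ht using (hwx ht).symm)
  obtain ⟨b, hb, hbS⟩ : ∃ b ∈ Ioc (-1 : ℝ) 1, ∀ τ, τ ∈ S ↔ compTime α τ < b := by
    by_cases hbd : BddAbove S
    · have hlub := isLUB_csSup hne hbd
      refine ⟨compTime α (sSup S), ⟨(compTime_mem _ _).1, (compTime_mem _ _).2.le⟩, fun τ => ?_⟩
      rw [(compTime_strictMono hα).lt_iff_lt]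
      constructor
      · intro hτ
        obtain ⟨t, ht, hτt⟩ := hopen τ hτ
        exact hτt.trans_le (hlub.1 ht)
      · intro hτ
        obtain ⟨t, ht, hτt⟩ := exists_lt_of_lt_csSup hne hτ
        exact hdown t ht τ hτt.le
    · refine ⟨1, ⟨by norm_num, le_rfl⟩, fun τ => iff_of_true ?_ (compTime_mem _ _).2⟩
      rw [not_bddAbove_iff] at hbd
      obtain ⟨t, ht, hτt⟩ := hbd τ
      exact hdown t ht τ hτt.le
  choose! z hz hze using (fun τ (h : τ ∈ S) => h)
  have huniq : ∀ τ ∈ S, ∀ t ≤ τ, ∀ x, IsSol f Λ r (Iic τ) x → Tendsto x atBot (𝓝 e) →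
      z t t = x t := fun τ hτ t ht x hx hxe =>
    IsSol.eqOn_of_tendsto_sink hf hΛ.continuous hexp.tendsto_past hr he ordConnected_Iic
      Iio_subset_Iic_self (hz t (hdown τ hτ t ht)) (hx.mono (Iic_subset_Iic.2 ht))
      (hze t (hdown τ hτ t ht)) hxe self_mem_Iic
  let X : ℝ → Vec n := fun s => if s = -1 then e else z (compTimeInv α s) (compTimeInv α s)
  have hXe : X (-1) = e := if_pos rfl
  have hXt : ∀ τ, X (compTime α τ) = z τ τ := fun τ => by
    simp only [X, if_neg (compTime_mem α τ).1.ne', compTimeInv_compTime hα]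
  refine ⟨b, hb, X, fun s hs => ?_, ?_⟩
  · obtain ⟨τ, hτ, hsτ⟩ : ∃ τ ∈ S, s < compTime α τ := by
      have hs1 : s < 1 := hs.2.trans_le hb.2
      rcases eq_or_lt_of_le hs.1 with rfl | h
      · obtain ⟨τ, hτ⟩ := hne
        exact ⟨τ, hτ, (compTime_mem _ _).1⟩
      · have h1 := compTime_compTimeInv hα ⟨h, hs1⟩
        obtain ⟨t, ht, hlt⟩ := hopen (compTimeInv α s) ((hbS _).2 (by rw [h1]; exact hs.2))
        refine ⟨t, ht, ?_⟩
        have := compTime_strictMono hα hlt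
        rwa [h1] at this
    -- smoothness near `s` is inherited from a global solution for a tame field
    obtain ⟨F, K, M, y, hT, hFf, hy, hxy⟩ :=
      (hz τ hτ).exists_tame_extension hf hΛ.continuous hL (hze τ hτ)
    have hye : Tendsto y atBot (𝓝 e) := (hze τ hτ).congr' (by
      filter_upwards [eventually_le_atBot τ] with t ht using hxy ht)
    have hc := contDiff_glue_past hT.contDiff hΛ hexp hα hαρ hr (he.congr one_pos hFf) hT hL hy hye
    have hXy : ∀ s' ∈ Ico (-1) (compTime α τ),
        X s' = glueInput (fun t => y (-t)) e α ((1 + s') / (1 - s')) := by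
      intro s' hs'
      rcases eq_or_lt_of_le hs'.1 with rfl | h
      · simp [hXe, glueInput]
      · obtain ⟨t, rfl⟩ : ∃ t, s' = compTime α t :=
          ⟨_, (compTime_compTimeInv hα ⟨h, hs'.2.trans (compTime_mem _ _).2⟩).symm⟩
        have ht : t ≤ τ := ((compTime_strictMono hα).lt_iff_lt.1 hs'.2).le
        rw [hXt, one_add_compTime_div, huniq τ hτ t ht _ (hz τ hτ) (hze τ hτ), hxy ht]
        have := glueInput_exp (Λ := fun t => y (-t)) (l := e) hα (-t)
        simp only [mul_neg, neg_neg] at this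
        exact this.symm
    have hs1 : 1 - s ≠ 0 := by have := hs.2.trans_le hb.2; linarith
    have h1 : ContDiffAt ℝ 1 (fun s' => glueInput (fun t => y (-t)) e α ((1 + s') / (1 - s'))) s :=
      hc.contDiffAt.comp s ((contDiffAt_const.add contDiffAt_id).div
        (contDiffAt_const.sub contDiffAt_id) hs1)
    refine h1.contDiffWithinAt.congr_of_eventuallyEq ?_ (hXy s ⟨hs.1, hsτ⟩)
    filter_upwards [self_mem_nhdsWithin, mem_nhdsWithin_of_mem_nhds (Iio_mem_nhds hsτ)] with s' h1 h2
    exact hXy s' ⟨h1.1, h2⟩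
  · ext ⟨v, s⟩
    constructor
    · intro hvs
      have hs : s ∈ Icc (-1 : ℝ) 1 := by
        obtain ⟨γ, hγ, h0, -⟩ := hvs
        have := (hγ 0 self_mem_Iic).1
        rwa [h0] at this
      rcases eq_endpoint_or_compTime hα hs with rfl | rfl | ⟨τ, rfl⟩
      · rw [mem_unstableManifold_past_endpoint hf hr he] at hvs
        exact ⟨-1, ⟨le_rfl, hb.1⟩, by simp only [hXe, hvs]⟩
      · exact absurd hvs not_mem_unstableManifold_past_future
      · obtain ⟨x, hx, hxe, rfl⟩ := (mem_unstableManifold_past_iff hα).1 hvs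
        have hτ : τ ∈ S := ⟨x, hx, hxe⟩
        exact ⟨_, ⟨(compTime_mem _ _).1.le, (hbS τ).1 hτ⟩, by
          simp only [hXt, huniq τ hτ τ le_rfl x hx hxe]⟩
    · rintro ⟨s', hs', h⟩
      obtain ⟨rfl, rfl⟩ := Prod.mk.inj h
      rcases eq_or_lt_of_le hs'.1 with rfl | h
      · exact (mem_unstableManifold_past_endpoint hf hr he).2 hXe
      · obtain ⟨t, rfl⟩ : ∃ t, s' = compTime α t :=
          ⟨_, (compTime_compTimeInv hα ⟨h, hs'.2.trans_le hb.2⟩).symm⟩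
        rw [mem_unstableManifold_past_iff hα]
        exact ⟨z t, hz t ((hbS t).2 hs'.2), hze t ((hbS t).2 hs'.2), (hXt t).symm⟩

/-- Solutions that stay in the block in the past tend to the sink. -/
lemma IsPastBlock.tendsto {b : Vec n →L[ℝ] Vec n →L[ℝ] ℝ} {k m ε C q τ₀ : ℝ} {x : ℝ → Vec n}
    (h : IsPastBlock f Λ lm e b k m ε C q τ₀)
    (hf : ContDiff ℝ 1 (fun p : Vec n × Vec d => f p.1 p.2)) (hΛ : ContDiff ℝ 1 Λ)
    (hexp : IsExpBiAsymptoticallyConstant Λ ρ lm lp) (hα : 0 < α) (hαρ : α < ρ) (he : f e lm = 0)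
    (hr : 0 < r) (hx : IsSol f Λ r (Iic τ₀) x) (hxq : ∀ t ≤ τ₀, b (x t - e) (x t - e) ≤ q) :
    Tendsto x atBot (𝓝 e) := by
  have ho := isLittleO_drift hf hΛ hα hexp.tendsto_past
    (hexp.comp_neg.tendsto_exp_smul_deriv hαρ) he
  have h1 := h.dich.isLittleO_past hr hα hx (fun t ht => h.norm_le (hxq t ht)) h.input ho
  have h2 : Tendsto (fun t => Real.exp (α * t)) atBot (𝓝 0) :=
    Real.tendsto_exp_atBot.comp (tendsto_id.const_mul_atBot hα)
  simpa using (h1.isBigO.trans_tendsto h2).add_const e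

/-- Near the past limit the sink continues to a local pullback attractor, whose graph in the
compactified phase space is the unstable manifold of `(e, -1)`. -/
theorem exists_pullbackAttractor (hf : ContDiff ℝ 1 (fun p : Vec n × Vec d => f p.1 p.2))
    (hΛ : ContDiff ℝ 1 Λ) (hexp : IsExpBiAsymptoticallyConstant Λ ρ lm lp) (hα : 0 < α)
    (hαρ : α < ρ) (he : IsHyperbolicSink f lm e) :
    ∃ τ₀ : ℝ, ∀ r > 0, ∃ x : ℝ → Vec n,
      IsLocalPullbackAttractor f Λ r τ₀ x ∧ Tendsto x atBot (𝓝 e) ∧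
      (∀ τ₁ ≤ τ₀, ∀ y : ℝ → Vec n, IsSol f Λ r (Iio τ₁) y →
        Tendsto y atBot (𝓝 e) → ∀ τ < τ₁, y τ = x τ) ∧
      IsSaddle (compField f Λ lm lp α r) (e, -1) ∧
      IsCurveOverTime (unstableManifold (compField f Λ lm lp α r) (e, -1)) ∧
      ∀ τ < τ₀, ∀ y : Vec n,
        (y, compTime α τ) ∈ unstableManifold (compField f Λ lm lp α r) (e, -1) ↔ y = x τ := by
  obtain ⟨L, hL⟩ := hexp.exists_bound hΛ.continuous
  obtain ⟨b, k, m, ε, C, q, τ₀, h⟩ := he.exists_isPastBlock hf hexp.tendsto_past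
  obtain ⟨F, hF, K, M, hT⟩ := exists_tame hf (‖e‖ + ε) L
  have hFf : ∀ v l, ‖v - e‖ ≤ ε → F v l = f v l := fun v l hv => hF v l (by
    calc ‖v‖ = ‖e + (v - e)‖ := by congr 1; abel
      _ ≤ ‖e‖ + ‖v - e‖ := norm_add_le _ _
      _ ≤ _ := by linarith)
  have hF' := h.congr hFf
  refine ⟨τ₀, fun r hr => ?_⟩
  obtain ⟨x, hx, hxq⟩ := hF'.exists_isSol hT hΛ.continuous hL hr
  have hxf : IsSol f Λ r (Iic τ₀) x := (hx.mono (subset_univ _)).congr_field fun t ht =>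
    (hFf _ _ (h.norm_le (hxq t ht))).symm
  have hxe := h.tendsto hf hΛ hexp hα hαρ he.1 hr hxf hxq
  refine ⟨x, hF'.isLocalPullbackAttractor hT hFf hΛ.continuous hL hr hx hxq hxe, hxe,
    fun τ₁ hτ₁ y hy hye τ hτ => ?_,
    isSaddle_of_sink hf (hasDerivAt_compInput_neg_one hΛ hexp hα hαρ) hα hr he,
    isCurveOverTime_unstableManifold hf hΛ hexp hα hαρ hr he ⟨τ₀, x, hxf, hxe⟩, fun τ hτ v => ?_⟩
  · exact IsSol.eqOn_of_tendsto_sink hf hΛ.continuous hexp.tendsto_past hr he ordConnected_Iio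
      subset_rfl hy (hxf.mono fun t ht => (mem_Iio.1 ht).le.trans hτ₁) hye hxe hτ
  · rw [mem_unstableManifold_past_iff hα]
    have hxτ := hxf.mono (Iic_subset_Iic.2 hτ.le)
    constructor
    · rintro ⟨y, hy, hye, rfl⟩
      exact IsSol.eqOn_of_tendsto_sink hf hΛ.continuous hexp.tendsto_past hr he ordConnected_Iic
        Iio_subset_Iic_self hy hxτ hye hxe self_mem_Iic
    · rintro rfl
      exact ⟨x, hxτ, hxe, rfl⟩

end PastManifold

/-! ### Bounded solutions of inhomogeneous linear equations -/

section BoundedSolutions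

open scoped BoundedContinuousFunction
open MeasureTheory

variable {V : Type*} [NormedAddCommGroup V] [NormedSpace ℝ V]

/-- The bounded solution of an unstable scalar equation, by variation of constants from `+∞`. -/
lemma exists_bounded_scalar {μ : ℝ} (hμ : 0 < μ) {h : ℝ → ℝ} (hh : Continuous h) {M : ℝ}
    (hM : ∀ t, |h t| ≤ M) :
    ∃ v : ℝ → ℝ, (∀ t, HasDerivAt v (μ * v t + h t) t) ∧ ∀ t, |v t| ≤ M / μ := by
  have hint : ∀ a, IntegrableOn (fun s => Real.exp (-μ * s) * h s) (Ioi a) := fun a => by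
    refine ((integrableOn_exp_mul_Ioi (neg_lt_zero.2 hμ) a).bdd_mul
      (c := M) hh.aestronglyMeasurable (.of_forall fun s => hM s)).congr (.of_forall fun s => ?_)
    simp [mul_comm]
  have hcont : Continuous fun s => Real.exp (-μ * s) * h s := by fun_prop
  refine ⟨fun t => Real.exp (μ * t) * -∫ s in Ioi t, Real.exp (-μ * s) * h s, fun t => ?_,
    fun t => ?_⟩
  · have h1 : ∀ t, -∫ s in Ioi t, Real.exp (-μ * s) * h s =
        (∫ s in (0 : ℝ)..t, Real.exp (-μ * s) * h s) - ∫ s in Ioi 0, Real.exp (-μ * s) * h s := by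
      intro t
      have := intervalIntegral.integral_interval_add_Ioi (hint 0) (hint t)
      linarith
    have h2 : HasDerivAt (fun t => -∫ s in Ioi t, Real.exp (-μ * s) * h s)
        (Real.exp (-μ * t) * h t) t := by
      simp only [h1]
      exact (intervalIntegral.integral_hasDerivAt_right (hcont.intervalIntegrable _ _)
        (hcont.stronglyMeasurableAtFilter _ _) hcont.continuousAt).sub_const _
    have h3 : HasDerivAt (fun t => Real.exp (μ * t)) (Real.exp (μ * t) * μ) t := by
      simpa using ((hasDerivAt_id t).const_mul μ).exp
    refine (h3.mul h2).congr_deriv ?_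
    have h4 : Real.exp (μ * t) * Real.exp (-μ * t) = 1 := by rw [← Real.exp_add]; simp
    calc _ = μ * (Real.exp (μ * t) * -∫ s in Ioi t, Real.exp (-μ * s) * h s) +
          (Real.exp (μ * t) * Real.exp (-μ * t)) * h t := by ring
      _ = _ := by rw [h4, one_mul]
  · have h1 : |∫ s in Ioi t, Real.exp (-μ * s) * h s| ≤ Real.exp (-μ * t) / μ * M := by
      have h2 : ∫ s in Ioi t, Real.exp (-μ * s) * M = Real.exp (-μ * t) / μ * M := by
        rw [integral_mul_const, integral_exp_mul_Ioi (neg_lt_zero.2 hμ)]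
        ring
      rw [← h2, ← Real.norm_eq_abs]
      refine norm_integral_le_of_norm_le
        ((integrableOn_exp_mul_Ioi (neg_lt_zero.2 hμ) t).mul_const M) (.of_forall fun s => ?_)
      rw [norm_mul, Real.norm_eq_abs, Real.norm_eq_abs, Real.abs_exp]
      exact mul_le_mul_of_nonneg_left (hM s) (Real.exp_pos _).le
    rw [abs_mul, Real.abs_exp, abs_neg]
    calc _ ≤ Real.exp (μ * t) * (Real.exp (-μ * t) / μ * M) := by gcongr
      _ = (Real.exp (μ * t) * Real.exp (-μ * t)) * (M / μ) := by ring
      _ = M / μ := by rw [← Real.exp_add]; simp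

/-- Variation of constants. -/
lemma exists_hasDerivAt_linear [CompleteSpace V] (A : V →L[ℝ] V) {g : ℝ → V} (hg : Continuous g)
    (ξ : V) : ∃ u : ℝ → V, u 0 = ξ ∧ ∀ t, HasDerivAt u (A (u t) + g t) t := by
  have he : ∀ t : ℝ, HasDerivAt (fun t : ℝ => NormedSpace.exp (t • A))
      (A * NormedSpace.exp (t • A)) t := fun t => hasDerivAt_exp_smul_const' A t
  have hc : Continuous fun s : ℝ => NormedSpace.exp ((-s) • A) (g s) := by
    have : Continuous fun s : ℝ => NormedSpace.exp ((-s) • A) :=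
      (continuous_iff_continuousAt.2 fun t => (he t).continuousAt).comp continuous_neg
    exact this.clm_apply hg
  refine ⟨fun t => NormedSpace.exp (t • A) (ξ + ∫ s in (0 : ℝ)..t, NormedSpace.exp ((-s) • A) (g s)),
    by simp, fun t => ?_⟩
  have h2 : HasDerivAt (fun t => ξ + ∫ s in (0 : ℝ)..t, NormedSpace.exp ((-s) • A) (g s))
      (NormedSpace.exp ((-t) • A) (g t)) t :=
    (intervalIntegral.integral_hasDerivAt_right (hc.intervalIntegrable _ _)
      (hc.stronglyMeasurableAtFilter _ _) hc.continuousAt).const_add _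
  refine ((he t).clm_apply h2).congr_deriv ?_
  have h3 : NormedSpace.exp (t • A) * NormedSpace.exp ((-t) • A) = 1 := by
    let _ : NormedAlgebra ℚ (V →L[ℝ] V) := NormedAlgebra.restrictScalars ℚ ℝ _
    rw [← NormedSpace.exp_add_of_commute]
    · simp
    · exact ((Commute.refl A).smul_left t).smul_right (-t)
  have h4 := congrArg (fun T : V →L[ℝ] V => T (g t)) h3
  simp only [mul_apply_eq_comp, one_apply_eq_self] at h4 ⊢
  rw [h4]

variable {A : V →L[ℝ] V} {μ c : ℝ} {ℓ : V →L[ℝ] ℝ} {w : V} {B : V →L[ℝ] V →L[ℝ] ℝ} {m : ℝ}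

lemma projKer_of_mem (ℓ : V →L[ℝ] ℝ) (w : V) {x : V} (hx : ℓ x = 0) : projKer ℓ w x = x := by
  simp [hx]

lemma IsEdgeSplitting.ell_projKer (h : IsEdgeSplitting A μ c ℓ w B m) (x : V) :
    ℓ (projKer ℓ w x) = 0 := by
  simp [h.ell_w]

/-- `y` solves `y' = A y + g` for positive times, its component along the stable space starts at
that of `ξ`, and it is extended by a constant to negative times. -/
structure IsHalfSol (A : V →L[ℝ] V) (ℓ : V →L[ℝ] ℝ) (w ξ : V) (g y : ℝ → V) : Prop where
  deriv : ∀ t ∈ Ici (0 : ℝ), HasDerivWithinAt y (A (y t) + g t) (Ici 0) t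
  start : projKer ℓ w (y 0) = projKer ℓ w ξ
  const : ∀ t ≤ 0, y t = y 0

lemma IsHalfSol.add_smul {ξ₁ ξ₂ : V} {g₁ g₂ y₁ y₂ : ℝ → V} (h₁ : IsHalfSol A ℓ w ξ₁ g₁ y₁)
    (h₂ : IsHalfSol A ℓ w ξ₂ g₂ y₂) (a : ℝ) :
    IsHalfSol A ℓ w (ξ₁ + a • ξ₂) (fun t => g₁ t + a • g₂ t) (fun t => y₁ t + a • y₂ t) := by
  refine ⟨fun t ht => ?_, ?_, fun t ht => ?_⟩
  · refine ((h₁.deriv t ht).add ((h₂.deriv t ht).const_smul a)).congr_deriv ?_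
    rw [map_add, map_smul]; module
  · rw [map_add, map_add, map_smul, map_smul, h₁.start, h₂.start]
  · rw [h₁.const t ht, h₂.const t ht]

/-- A bounded solution of the homogeneous equation with vanishing stable component at time `0` is
zero: boundedness excludes the unstable component, and the stable component stays zero. -/
lemma IsEdgeSplitting.eq_zero_of_bounded (h : IsEdgeSplitting A μ c ℓ w B m) {y : ℝ → V} {M : ℝ}
    (hy : IsHalfSol A ℓ w 0 (fun _ => 0) y) (hM : ∀ t ≥ 0, ‖y t‖ ≤ M) : ∀ t, y t = 0 := by
  have hμ := h.mu_pos
  have hc := h.c_pos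
  have hm := h.m_pos
  have hyd : ∀ t ∈ Ici (0 : ℝ), HasDerivWithinAt y (A (y t)) (Ici 0) t := fun t ht => by
    simpa using hy.deriv t ht
  have hℓ : ∀ t ∈ Ici (0 : ℝ), ℓ (y t) = 0 := by
    have := nonpos_of_le_deriv_of_bddAbove (T := 0) (k := μ) (M := (‖ℓ‖ * M) ^ 2) hμ
      (w := fun t => ℓ (y t) ^ 2) (w' := fun t => 2 * ℓ (y t) * (μ * ℓ (y t))) (fun t ht => ?_)
      (fun t ht => ?_) (fun t ht => ?_)
    · intro t ht
      exact pow_eq_zero_iff two_ne_zero |>.1 (le_antisymm (this t ht) (sq_nonneg _))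
    · have h1 := ℓ.hasFDerivAt.comp_hasDerivWithinAt t (hyd t ht)
      rw [h.ell_A] at h1
      exact (h1.pow 2).congr_deriv (by simp)
    · nlinarith [sq_nonneg (ℓ (y t))]
    · have h1 := (ℓ.le_opNorm (y t)).trans
        (mul_le_mul_of_nonneg_left (hM t ht) (norm_nonneg ℓ))
      rw [Real.norm_eq_abs] at h1
      exact sq_le_sq' (by linarith [neg_abs_le (ℓ (y t))]) (le_of_abs_le h1)
  have hy0 : y 0 = 0 := by
    have := hy.start
    rwa [projKer_of_mem ℓ w (hℓ 0 self_mem_Ici), map_zero] at this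
  intro t
  rcases le_total t 0 with ht | ht
  · rw [hy.const t ht, hy0]
  · have h1 := le_exp_mul_of_deriv_le (convex_Ici 0) (k := 2 * c) (w := fun t => B (y t) (y t))
      (fun t ht => hasDerivWithinAt_form h.B_symm (hyd t ht)) (fun t ht => ?_) self_mem_Ici ht ht
    · have h2 := h.B_coercive (y t)
      simp only [hy0, map_zero, mul_zero] at h1
      have h3 : ‖y t‖ ^ 2 ≤ 0 := by
        by_contra h5
        have := mul_pos hm (not_le.1 h5)
        linarith
      exact norm_eq_zero.1 (pow_eq_zero_iff two_ne_zero |>.1 (le_antisymm h3 (sq_nonneg _)))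
    · have := h.B_le (y t)
      rw [hℓ t ht] at this
      simp only [mul_zero, zero_smul, sub_zero] at this
      linarith

/-- The unstable component is found by integration from `+∞`. The stable component solves the
equation with the reflected linear map, which is dissipative and agrees with `A` on the stable
space. -/
theorem IsEdgeSplitting.exists_isHalfSol [CompleteSpace V] (h : IsEdgeSplitting A μ c ℓ w B m) :
    ∃ K > 0, ∀ (ξ : V) (g : ℝ →ᵇ V), ∃ y : ℝ →ᵇ V, IsHalfSol A ℓ w ξ g y ∧
      ‖y‖ ≤ K * (‖ξ‖ + ‖g‖) := by
  have hμ := h.mu_pos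
  have hc := h.c_pos
  have hm := h.m_pos
  set P := projKer ℓ w with hP
  -- bounds for the stable component: `a` for the homogeneous and `e` for the forced part
  set a := √((‖B‖ * ‖P‖ ^ 2 + 1) / m) with ha
  set e := ‖B‖ * ‖P‖ / (c * m) with he
  have ha2 : m * a ^ 2 = ‖B‖ * ‖P‖ ^ 2 + 1 := by
    rw [ha, Real.sq_sqrt (by positivity)]; field_simp
  have ha0 : 0 ≤ a := Real.sqrt_nonneg _
  have he0 : 0 ≤ e := by positivity
  refine ⟨a + e + ‖ℓ‖ / μ * ‖w‖ + 1, by positivity, fun ξ g => ?_⟩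
  obtain ⟨v, hv, hvM⟩ := exists_bounded_scalar hμ (h := fun t => ℓ (g t)) (by fun_prop)
    (M := ‖ℓ‖ * ‖g‖) (fun t => (ℓ.le_opNorm _).trans (by gcongr; exact g.norm_coe_le_norm t))
  obtain ⟨u, hu0, hu⟩ := exists_hasDerivAt_linear (A - (2 * μ) • ℓ.smulRight w)
    (g := fun t => P (g t)) (by fun_prop) (P ξ)
  -- the stable component stays in `ker ℓ`
  have hℓu : ∀ t ≥ 0, ℓ (u t) = 0 := by
    intro t ht
    have h1 := le_exp_mul_of_deriv_le (convex_Ici 0) (k := 2 * μ) (w := fun t => ℓ (u t) ^ 2)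
      (w' := fun t => 2 * ℓ (u t) * (-μ * ℓ (u t)))
      (fun t _ => by
        have h1 := (ℓ.hasFDerivAt.comp_hasDerivAt t (hu t)).hasDerivWithinAt (s := Ici 0)
        have h2 : ℓ ((A - (2 * μ) • ℓ.smulRight w) (u t) + P (g t)) = -μ * ℓ (u t) := by
          rw [map_add, hP, h.ell_projKer]
          simp [h.ell_A, h.ell_w]
          ring
        rw [h2] at h1
        exact (h1.pow 2).congr_deriv (by simp))
      (fun t _ => by nlinarith [sq_nonneg (ℓ (u t))]) self_mem_Ici ht ht
    have h2 : ℓ (u 0) = 0 := by rw [hu0]; exact h.ell_projKer ξ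
    simp only [h2] at h1
    have h3 : ℓ (u t) ^ 2 ≤ 0 := by simpa using h1
    exact pow_eq_zero_iff two_ne_zero |>.1 (le_antisymm h3 (sq_nonneg _))
  -- `D` is the level of `B` above which the dissipation outweighs the forcing
  have huM : ∀ t ≥ 0, ‖u t‖ ≤ a * ‖ξ‖ + e * ‖g‖ := by
    intro t ht
    set D := (‖B‖ * ‖P‖ * ‖g‖) ^ 2 / (c ^ 2 * m) with hD
    have h1 := le_exp_mul_of_deriv_le (convex_Ici 0) (k := c) (w := fun t => B (u t) (u t) - D)
      (fun t _ => ((hasDerivWithinAt_form h.B_symm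
        (hu t).hasDerivWithinAt).sub_const D)) (fun t ht => ?_) self_mem_Ici ht ht
    · have h2 := h.B_coercive (u t)
      have h3 : B (u 0) (u 0) ≤ ‖B‖ * (‖P‖ * ‖ξ‖) ^ 2 := by
        have := B.le_opNorm₂ (u 0) (u 0)
        rw [Real.norm_eq_abs] at this
        calc B (u 0) (u 0) ≤ ‖B‖ * ‖u 0‖ * ‖u 0‖ := (le_abs_self _).trans this
          _ = ‖B‖ * ‖u 0‖ ^ 2 := by ring
          _ ≤ _ := by gcongr; rw [hu0]; exact P.le_opNorm ξ
      have hE : Real.exp (-(c * (t - 0))) ≤ 1 := Real.exp_le_one_iff.2 (by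
        have : 0 ≤ c * (t - 0) := mul_nonneg hc.le (by simpa using ht)
        linarith)
      have hE0 := Real.exp_pos (-(c * (t - 0)))
      have hB0 : 0 ≤ B (u 0) (u 0) := le_trans (by positivity) (h.B_coercive (u 0))
      have hD0 : 0 ≤ D := by positivity
      have h4 : B (u t) (u t) ≤ B (u 0) (u 0) + D := by
        have h1' : B (u t) (u t) - D ≤
            Real.exp (-(c * (t - 0))) * (B (u 0) (u 0) - D) := h1
        nlinarith
      have h5 : D = m * (e * ‖g‖) ^ 2 := by rw [hD, he]; field_simp
      have h6 : m * ‖u t‖ ^ 2 ≤ m * (a * ‖ξ‖ + e * ‖g‖) ^ 2 := by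
        have h7 : 0 ≤ m * (2 * (a * ‖ξ‖) * (e * ‖g‖)) := by positivity
        have h8 : m * (a * ‖ξ‖) ^ 2 = (‖B‖ * ‖P‖ ^ 2 + 1) * ‖ξ‖ ^ 2 := by rw [← ha2]; ring
        nlinarith [sq_nonneg ‖ξ‖]
      exact (sq_le_sq₀ (norm_nonneg _) (by positivity)).1 (le_of_mul_le_mul_left h6 hm)
    · have h2 := h.B_le (u t)
      have h3 := h.B_coercive (u t)
      have h4 : B (P (g t)) (u t) ≤ ‖B‖ * ‖P‖ * ‖g‖ * ‖u t‖ := by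
        have := B.le_opNorm₂ (P (g t)) (u t)
        rw [Real.norm_eq_abs] at this
        refine (le_abs_self _).trans (this.trans ?_)
        have h5 : ‖P (g t)‖ ≤ ‖P‖ * ‖g‖ :=
          (P.le_opNorm _).trans (by gcongr; exact g.norm_coe_le_norm t)
        calc ‖B‖ * ‖P (g t)‖ * ‖u t‖ ≤ ‖B‖ * (‖P‖ * ‖g‖) * ‖u t‖ := by gcongr
          _ = _ := by ring
      have h5 : B ((A - (2 * μ) • ℓ.smulRight w) (u t) + P (g t)) (u t) =
          B (A (u t) - (2 * μ * ℓ (u t)) • w) (u t) + B (P (g t)) (u t) := by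
        rw [map_add, add_apply]
        congr 2
        simp [smul_smul]
      rw [h5]
      set S := ‖B‖ * ‖P‖ * ‖g‖
      have h6 : 2 * (S * ‖u t‖) ≤ c * (m * ‖u t‖ ^ 2) + c * D := by
        have h7 : c * (m * ‖u t‖ ^ 2) + c * D - 2 * (S * ‖u t‖) =
            (c * m * ‖u t‖ - S) ^ 2 / (c * m) := by
          rw [hD]; field_simp; ring
        have h8 : 0 ≤ (c * m * ‖u t‖ - S) ^ 2 / (c * m) := by positivity
        linarith
      have h9 : c * (m * ‖u t‖ ^ 2) ≤ c * B (u t) (u t) := by gcongr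
      linarith
  have hpos : ∀ t : ℝ, 0 ≤ max t 0 := fun t => le_max_right _ _
  have hyc : Continuous fun t => u (max t 0) + v (max t 0) • w := by
    have h1 : Continuous u := continuous_iff_continuousAt.2 fun t => (hu t).continuousAt
    have h2 : Continuous v := continuous_iff_continuousAt.2 fun t => (hv t).continuousAt
    fun_prop
  have hyM : ∀ t, ‖u (max t 0) + v (max t 0) • w‖ ≤
      (a + e + ‖ℓ‖ / μ * ‖w‖ + 1) * (‖ξ‖ + ‖g‖) := by
    intro t
    have h1 := huM _ (hpos t)
    have h2 := hvM (max t 0)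
    have h3 : ‖v (max t 0) • w‖ ≤ ‖ℓ‖ * ‖g‖ / μ * ‖w‖ := by
      rw [norm_smul, Real.norm_eq_abs]; gcongr
    have h4 : ‖ℓ‖ * ‖g‖ / μ * ‖w‖ = ‖ℓ‖ / μ * ‖w‖ * ‖g‖ := by ring
    refine (norm_add_le _ _).trans ?_
    have h5 : 0 ≤ (e + ‖ℓ‖ / μ * ‖w‖ + 1) * ‖ξ‖ := by positivity
    have h6 : 0 ≤ (a + 1) * ‖g‖ := by positivity
    nlinarith
  refine ⟨BoundedContinuousFunction.ofNormedAddCommGroup _ hyc _ hyM, ⟨fun t ht => ?_, ?_,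
    fun t ht => ?_⟩, BoundedContinuousFunction.norm_ofNormedAddCommGroup_le _ (by positivity) hyM⟩
  · have h1 : HasDerivWithinAt (fun t => u t + v t • w)
        (A (u t + v t • w) + g t) (Ici 0) t := by
      refine ((hu t).add ((hv t).smul_const w)).hasDerivWithinAt.congr_deriv ?_
      have := hℓu t ht
      simp [this, hP, h.A_w, smul_smul]
      module
    have heq : ∀ s ∈ Ici (0 : ℝ), u (max s 0) + v (max s 0) • w = u s + v s • w := fun s hs => by
      rw [max_eq_left (mem_Ici.1 hs)]
    have := h1.congr heq (heq t ht)
    simpa [max_eq_left (mem_Ici.1 ht)] using this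
  · simp only [BoundedContinuousFunction.coe_ofNormedAddCommGroup, max_self]
    rw [hu0, map_add, map_smul, ← hP]
    have h1 : P w = 0 := by simp [hP, h.ell_w]
    have h2 : P (P ξ) = P ξ := projKer_of_mem ℓ w (h.ell_projKer ξ)
    rw [h1, h2]; simp
  · simp [max_eq_right ht]

end BoundedSolutions

/-! ### Superposition operators on bounded continuous functions -/

section Superposition

open scoped BoundedContinuousFunction

variable {E F : Type*} [NormedAddCommGroup E] [NormedAddCommGroup F]

/-- The superposition (Nemytskii) operator `Z ↦ Φ ∘ Z`. -/
def superpose [ProperSpace E] (Φ : C(E, F)) (Z : ℝ →ᵇ E) : ℝ →ᵇ F where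
  toFun t := Φ (Z t)
  continuous_toFun := Φ.continuous.comp Z.continuous
  map_bounded' := by
    have h1 : Bornology.IsBounded (Φ '' Metric.closedBall 0 ‖Z‖) :=
      ((isCompact_closedBall _ _).image Φ.continuous).isBounded
    obtain ⟨C, hC⟩ := Metric.isBounded_iff.1 h1
    have hZ : ∀ t, Z t ∈ Metric.closedBall (0 : E) ‖Z‖ := fun t => by
      simpa using Z.norm_coe_le_norm t
    exact ⟨C, fun s t => hC ⟨_, hZ s, rfl⟩ ⟨_, hZ t, rfl⟩⟩

@[simp] lemma superpose_apply [ProperSpace E] (Φ : C(E, F)) (Z : ℝ →ᵇ E) (t : ℝ) : superpose Φ Z t = Φ (Z t) := rfl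

lemma continuous_superpose [ProperSpace E] (Φ : C(E, F)) : Continuous (superpose Φ) := by
  rw [Metric.continuous_iff]
  intro Z ε hε
  obtain ⟨δ, hδ, H⟩ := Metric.uniformContinuousOn_iff.1
    ((isCompact_closedBall (0 : E) (‖Z‖ + 1)).uniformContinuousOn_of_continuous
      Φ.continuous.continuousOn) (ε / 2) (by positivity)
  refine ⟨min δ 1, by positivity, fun Y hY => ?_⟩
  have h1 : dist (superpose Φ Y) (superpose Φ Z) ≤ ε / 2 := by
    refine (BoundedContinuousFunction.dist_le (by positivity)).2 fun t => ?_
    have h2 : dist (Y t) (Z t) < min δ 1 :=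
      (BoundedContinuousFunction.dist_coe_le_dist t).trans_lt hY
    have h3 : ‖Z t‖ ≤ ‖Z‖ := Z.norm_coe_le_norm t
    have h4 : ‖Y t‖ ≤ ‖Z t‖ + dist (Y t) (Z t) := by
      rw [dist_eq_norm]
      calc ‖Y t‖ = ‖Z t + (Y t - Z t)‖ := by congr 1; abel
        _ ≤ _ := norm_add_le _ _
    refine (H (Y t) ?_ (Z t) ?_ (h2.trans_le (min_le_left _ _))).le
    · have := h2.trans_le (min_le_right _ _)
      simp only [Metric.mem_closedBall, dist_zero_right]
      linarith
    · simp only [Metric.mem_closedBall, dist_zero_right]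
      linarith
  linarith

lemma norm_pairInput_le (c : ℝ) (p : (ℝ →ᵇ E) × ℝ) (t : ℝ) :
    ‖(p.1 t, p.2 * Real.exp (-(|c| * max t 0)))‖ ≤ ‖p‖ := by
  rw [Prod.norm_def, Prod.norm_def]
  refine max_le_max (p.1.norm_coe_le_norm t) ?_
  rw [norm_mul]
  refine mul_le_of_le_one_right (norm_nonneg _) ?_
  rw [Real.norm_eq_abs, Real.abs_exp, Real.exp_le_one_iff]
  have := mul_nonneg (abs_nonneg c) (le_max_right t 0)
  linarith

variable [NormedSpace ℝ E] [NormedSpace ℝ F]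

/-- Pointwise application of a bounded family of operators. -/
def pointwiseApply : (ℝ →ᵇ (E →L[ℝ] F)) →L[ℝ] (ℝ →ᵇ E) →L[ℝ] (ℝ →ᵇ F) :=
  LinearMap.mkContinuous₂
    (LinearMap.mk₂ ℝ (fun (T : ℝ →ᵇ (E →L[ℝ] F)) (Z : ℝ →ᵇ E) =>
      BoundedContinuousFunction.ofNormedAddCommGroup (fun t => T t (Z t))
        (T.continuous.clm_apply Z.continuous) (‖T‖ * ‖Z‖) (fun t => by
          refine ((T t).le_opNorm (Z t)).trans ?_
          gcongr
          · exact T.norm_coe_le_norm t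
          · exact Z.norm_coe_le_norm t))
      (fun _ _ _ => by ext; simp) (fun _ _ _ => by ext; simp)
      (fun _ _ _ => by ext; simp) (fun _ _ _ => by ext; simp)) 1
    (fun T Z => by
      rw [one_mul]
      refine (BoundedContinuousFunction.norm_le (by positivity)).2 fun t => ?_
      refine ((T t).le_opNorm (Z t)).trans ?_
      gcongr
      · exact T.norm_coe_le_norm t
      · exact Z.norm_coe_le_norm t)

@[simp] lemma pointwiseApply_apply (T : ℝ →ᵇ (E →L[ℝ] F)) (Z : ℝ →ᵇ E) (t : ℝ) :
    pointwiseApply T Z t = T t (Z t) := rfl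

/-- The superposition operator of a `C¹` function is `C¹`, with pointwise derivative. -/
theorem hasFDerivAt_superpose [ProperSpace E] {G : E → F} (hG : ContDiff ℝ 1 G) (Z : ℝ →ᵇ E) :
    HasFDerivAt (superpose ⟨G, hG.continuous⟩)
      (pointwiseApply (superpose ⟨fderiv ℝ G, hG.continuous_fderiv one_ne_zero⟩ Z)) Z := by
  rw [hasFDerivAt_iff_isLittleO_nhds_zero, Asymptotics.isLittleO_iff]
  intro ε hε
  obtain ⟨δ, hδ, H⟩ := Metric.uniformContinuousOn_iff.1
    ((isCompact_closedBall (0 : E) (‖Z‖ + 1)).uniformContinuousOn_of_continuous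
      (hG.continuous_fderiv one_ne_zero).continuousOn) ε hε
  filter_upwards [Metric.ball_mem_nhds (0 : ℝ →ᵇ E) (lt_min hδ one_pos)] with h hh
  rw [mem_ball_zero_iff] at hh
  refine (BoundedContinuousFunction.norm_le (by positivity)).2 fun t => ?_
  have h1 : ‖h t‖ ≤ ‖h‖ := h.norm_coe_le_norm t
  have h3 : ‖Z t‖ ≤ ‖Z‖ := Z.norm_coe_le_norm t
  have hb : ∀ v ∈ Metric.closedBall (Z t) ‖h t‖,
      ‖fderiv ℝ G v - fderiv ℝ G (Z t)‖ ≤ ε := by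
    intro v hv
    rw [mem_closedBall_iff_norm] at hv
    have h4 : ‖v‖ ≤ ‖Z t‖ + ‖v - Z t‖ := by
      calc ‖v‖ = ‖Z t + (v - Z t)‖ := by congr 1; abel
        _ ≤ _ := norm_add_le _ _
    have h5 : ‖h‖ < 1 := hh.trans_le (min_le_right _ _)
    have h6 : ‖h‖ < δ := hh.trans_le (min_le_left _ _)
    rw [← dist_eq_norm]
    refine (H v ?_ (Z t) ?_ ?_).le
    · simp only [Metric.mem_closedBall, dist_zero_right]; linarith
    · simp only [Metric.mem_closedBall, dist_zero_right]; linarith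
    · rw [dist_eq_norm]; linarith
  have h7 := (convex_closedBall (Z t) ‖h t‖).norm_image_sub_le_of_norm_hasFDerivWithin_le'
    (f := G) (f' := fderiv ℝ G) (φ := fderiv ℝ G (Z t))
    (fun v _ => (hG.differentiable one_ne_zero v).hasFDerivAt.hasFDerivWithinAt) hb
    (x := Z t) (y := Z t + h t) (by simp) (by simp)
  simp only [add_sub_cancel_left] at h7
  refine le_trans ?_ (h7.trans (mul_le_mul_of_nonneg_left h1 hε.le))
  simp

lemma contDiff_superpose [ProperSpace E] {G : E → F} (hG : ContDiff ℝ 1 G) :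
    ContDiff ℝ 1 (superpose ⟨G, hG.continuous⟩) :=
  contDiff_one_iff_hasFDerivAt.2 ⟨_, pointwiseApply.continuous.comp (continuous_superpose _),
    hasFDerivAt_superpose hG⟩

/-- The pair of a function and a decaying scalar input `σ e^{-ct}`, frozen for negative times. -/
def pairInput (c : ℝ) : (ℝ →ᵇ E) × ℝ →L[ℝ] (ℝ →ᵇ (E × ℝ)) :=
  LinearMap.mkContinuous
    { toFun := fun p => BoundedContinuousFunction.ofNormedAddCommGroup
        (fun t => (p.1 t, p.2 * Real.exp (-(|c| * max t 0)))) (by fun_prop) ‖p‖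
        (norm_pairInput_le c p)
      map_add' := fun p q => by ext t <;> simp [add_mul]
      map_smul' := fun a p => by ext t <;> simp [mul_assoc] } 1
    (fun p => by
      rw [one_mul]
      exact (BoundedContinuousFunction.norm_le (norm_nonneg _)).2 (norm_pairInput_le c p))

@[simp] lemma pairInput_apply (c : ℝ) (p : (ℝ →ᵇ E) × ℝ) (t : ℝ) :
    pairInput c p t = (p.1 t, p.2 * Real.exp (-(|c| * max t 0))) := rfl

end Superposition

section Resolvent

open scoped BoundedContinuousFunction

variable {V : Type*} [NormedAddCommGroup V] [NormedSpace ℝ V]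
  {A : V →L[ℝ] V} {μ c : ℝ} {ℓ : V →L[ℝ] ℝ} {w : V} {B : V →L[ℝ] V →L[ℝ] ℝ} {m : ℝ}

/-- The bounded solution is determined by the inhomogeneity and the stable component at time `0`.
-/
lemma IsEdgeSplitting.eq_of_isHalfSol (h : IsEdgeSplitting A μ c ℓ w B m) {ξ : V} {g y z : ℝ → V}
    {M : ℝ} (hy : IsHalfSol A ℓ w ξ g y) (hz : IsHalfSol A ℓ w ξ g z)
    (hyM : ∀ t ≥ 0, ‖y t‖ ≤ M) (hzM : ∀ t ≥ 0, ‖z t‖ ≤ M) : y = z := by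
  have h1 := hy.add_smul hz (-1)
  have h2 : IsHalfSol A ℓ w 0 (fun _ => 0) (fun t => y t + (-1 : ℝ) • z t) := by
    refine ⟨fun t ht => by simpa using h1.deriv t ht, ?_, h1.const⟩
    have := h1.start
    simpa using this
  have h3 := h.eq_zero_of_bounded h2 (M := 2 * M) fun t ht => by
    refine (norm_add_le _ _).trans ?_
    rw [norm_smul]
    simp only [norm_neg, norm_one, one_mul]
    linarith [hyM t ht, hzM t ht]
  ext1 t
  have := h3 t
  rw [neg_one_smul, ← sub_eq_add_neg, sub_eq_zero] at this
  exact this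

/-- The bounded solution of `y' = A y + g` with prescribed stable component at time `0` depends
linearly and boundedly on the data. -/
theorem IsEdgeSplitting.exists_resolvent [CompleteSpace V] (h : IsEdgeSplitting A μ c ℓ w B m) :
    ∃ K > 0, ∃ 𝒦 : V × (ℝ →ᵇ V) →L[ℝ] (ℝ →ᵇ V), (∀ ξ (g : ℝ →ᵇ V), IsHalfSol A ℓ w ξ g (𝒦 (ξ, g))) ∧
      (∀ ξ g, ‖𝒦 (ξ, g)‖ ≤ K * (‖ξ‖ + ‖g‖)) ∧
      ∀ ξ (g y : ℝ →ᵇ V), IsHalfSol A ℓ w ξ g y → y = 𝒦 (ξ, g) := by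
  obtain ⟨K, hK, H⟩ := h.exists_isHalfSol
  choose S hS hSK using H
  have huniq : ∀ ξ (g y : ℝ →ᵇ V), IsHalfSol A ℓ w ξ g y → y = S ξ g := by
    intro ξ g y hy
    refine DFunLike.coe_injective (h.eq_of_isHalfSol hy (hS ξ g) (M := max ‖y‖ ‖S ξ g‖) ?_ ?_)
    · exact fun t _ => (y.norm_coe_le_norm t).trans (le_max_left _ _)
    · exact fun t _ => ((S ξ g).norm_coe_le_norm t).trans (le_max_right _ _)
  have hlin : ∀ ξ₁ g₁ ξ₂ g₂ (a : ℝ), S (ξ₁ + a • ξ₂) (g₁ + a • g₂) = S ξ₁ g₁ + a • S ξ₂ g₂ :=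
    fun ξ₁ g₁ ξ₂ g₂ a => (huniq _ _ _ ((hS ξ₁ g₁).add_smul (hS ξ₂ g₂) a)).symm
  have h0 : S 0 0 = 0 := by
    have := hlin 0 0 0 0 1
    simpa using this
  let L : V × (ℝ →ᵇ V) →ₗ[ℝ] (ℝ →ᵇ V) :=
    { toFun := fun p => S p.1 p.2
      map_add' := fun p q => by simpa using hlin p.1 p.2 q.1 q.2 1
      map_smul' := fun a p => by simpa [h0] using hlin 0 0 p.1 p.2 a }
  refine ⟨K, hK, L.mkContinuous (2 * K) (fun p => ?_), fun ξ g => hS ξ g, fun ξ g => hSK ξ g,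
    huniq⟩
  refine (hSK p.1 p.2).trans ?_
  have h1 := norm_fst_le p
  have h2 := norm_snd_le p
  nlinarith

end Resolvent

/-! ### The Lyapunov–Perron construction of the stable manifold -/

section LyapunovPerron

open scoped BoundedContinuousFunction

variable {V : Type*} [NormedAddCommGroup V] [NormedSpace ℝ V] [FiniteDimensional ℝ V]
  {A : V →L[ℝ] V} {μ c : ℝ} {ℓ : V →L[ℝ] ℝ} {w : V} {B : V →L[ℝ] V →L[ℝ] ℝ} {m : ℝ}

/-- The stable manifold as a graph over the stable space and the (decaying) input: `φ` is the
unstable component of the initial states of the solutions of `y' = A y + G (y, σ e^{-ct})` that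
stay in the ball of radius `R`. The size of the domain does not depend on the decay rate `c`. -/
theorem IsEdgeSplitting.exists_stableGraph (h : IsEdgeSplitting A μ c ℓ w B m) :
    ∃ K > 0, ∀ (G : V × ℝ → V) (R σ₀ a : ℝ), ContDiff ℝ 1 G → 0 < R → 0 < σ₀ → 0 ≤ a →
      (∀ z σ, ‖z‖ ≤ R → σ ≤ σ₀ →
        ‖(fderiv ℝ G (z, σ)).comp (ContinuousLinearMap.inl ℝ V ℝ)‖ ≤ 1 / (4 * K)) →
      (∀ σ ≤ σ₀, ‖G (0, σ)‖ ≤ R / (4 * K)) →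
      ∃ φ : V × ℝ → ℝ, ContDiffOn ℝ 1 φ {p | ‖p.1‖ < R / (4 * K) ∧ p.2 < σ₀} ∧
        ∀ ξ σ, ‖ξ‖ < R / (4 * K) → σ < σ₀ →
          (∃ y : ℝ → V, IsHalfSol A ℓ w ξ (fun t => G (y t, σ * Real.exp (-(a * max t 0)))) y ∧
            (∀ t, ‖y t‖ ≤ R) ∧ ℓ (y 0) = φ (ξ, σ)) ∧
          ∀ y : ℝ → V, IsHalfSol A ℓ w ξ (fun t => G (y t, σ * Real.exp (-(a * max t 0)))) y →
            (∀ t, ‖y t‖ ≤ R) → ℓ (y 0) = φ (ξ, σ) := by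
  have : CompleteSpace V := FiniteDimensional.complete ℝ V
  have : ProperSpace V := FiniteDimensional.proper ℝ V
  obtain ⟨K, hK, 𝒦, h𝒦, h𝒦K, h𝒦u⟩ := h.exists_resolvent
  refine ⟨K, hK, fun G R σ₀ a hG hR hσ₀ ha hδ hG0 => ?_⟩
  let N : (ℝ →ᵇ V) × ℝ → (ℝ →ᵇ V) := fun p => superpose ⟨G, hG.continuous⟩ (pairInput a p)
  have hN : ContDiff ℝ 1 N := by
    have h1 : ContDiff ℝ 1 (pairInput (E := V) a) := ContinuousLinearMap.contDiff _
    exact (contDiff_superpose hG).comp h1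
  have hNt : ∀ y σ t, N (y, σ) t = G (y t, σ * Real.exp (-(a * max t 0))) := fun y σ t => by
    simp only [N, superpose_apply, pairInput_apply, abs_of_nonneg ha]; rfl
  have hσt : ∀ σ < σ₀, ∀ t, σ * Real.exp (-(a * max t 0)) ≤ σ₀ := by
    intro σ hσ t
    have h1 : Real.exp (-(a * max t 0)) ≤ 1 := Real.exp_le_one_iff.2 (by
      have := mul_nonneg ha (le_max_right t 0); linarith)
    have h2 := Real.exp_pos (-(a * max t 0))
    rcases le_total σ 0 with h | h <;> nlinarith
  have hK4 : 0 < 1 / (4 * K) := by positivity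
  -- `G` is a contraction in the first variable
  have hGlip : ∀ z z' σ, ‖z‖ ≤ R → ‖z'‖ ≤ R → σ ≤ σ₀ →
      ‖G (z, σ) - G (z', σ)‖ ≤ 1 / (4 * K) * ‖z - z'‖ := by
    intro z z' σ hz hz' hσ
    refine (convex_closedBall (0 : V) R).norm_image_sub_le_of_norm_hasFDerivWithin_le
      (f := fun z => G (z, σ))
      (f' := fun z => (fderiv ℝ G (z, σ)).comp (ContinuousLinearMap.inl ℝ V ℝ))
      (fun v _ => ?_) (fun v hv => hδ v σ (by simpa using hv) hσ) (by simpa using hz')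
      (by simpa using hz)
    exact ((hG.differentiable one_ne_zero (v, σ)).hasFDerivAt.comp v
      (hasFDerivAt_prodMk_left v σ)).hasFDerivWithinAt
  have hNlip : ∀ (y z : ℝ →ᵇ V) σ, ‖y‖ ≤ R → ‖z‖ ≤ R → σ < σ₀ →
      ‖N (y, σ) - N (z, σ)‖ ≤ 1 / (4 * K) * ‖y - z‖ := by
    intro y z σ hy hz hσ
    refine (BoundedContinuousFunction.norm_le (by positivity)).2 fun t => ?_
    rw [BoundedContinuousFunction.sub_apply, hNt, hNt]
    refine (hGlip _ _ _ ((y.norm_coe_le_norm t).trans hy) ((z.norm_coe_le_norm t).trans hz)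
      (hσt σ hσ t)).trans ?_
    gcongr
    exact (y - z).norm_coe_le_norm t
  have hN0 : ∀ σ < σ₀, ‖N (0, σ)‖ ≤ R / (4 * K) := fun σ hσ =>
    (BoundedContinuousFunction.norm_le (by positivity)).2 fun t => by
      rw [hNt]; exact hG0 _ (hσt σ hσ t)
  have hsub : ∀ ξ (g g' : ℝ →ᵇ V), ‖𝒦 (ξ, g) - 𝒦 (ξ, g')‖ ≤ K * ‖g - g'‖ := by
    intro ξ g g'
    rw [← map_sub, Prod.mk_sub_mk, sub_self]
    simpa using h𝒦K 0 (g - g')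
  let T : V → ℝ → (ℝ →ᵇ V) → (ℝ →ᵇ V) := fun ξ σ y => 𝒦 (ξ, N (y, σ))
  have hTlip : ∀ ξ σ, σ < σ₀ → ∀ y z : ℝ →ᵇ V, ‖y‖ ≤ R → ‖z‖ ≤ R →
      ‖T ξ σ y - T ξ σ z‖ ≤ 1 / 4 * ‖y - z‖ := by
    intro ξ σ hσ y z hy hz
    calc ‖T ξ σ y - T ξ σ z‖ ≤ K * ‖N (y, σ) - N (z, σ)‖ := hsub _ _ _
      _ ≤ K * (1 / (4 * K) * ‖y - z‖) := by gcongr; exact hNlip y z σ hy hz hσ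
      _ = _ := by field_simp
  have hTbound : ∀ ξ σ, ‖ξ‖ < R / (4 * K) → σ < σ₀ → ∀ y : ℝ →ᵇ V, ‖y‖ ≤ R →
      ‖T ξ σ y‖ < R := by
    intro ξ σ hξ hσ y hy
    have h1 : ‖N (y, σ)‖ ≤ R / (4 * K) + 1 / (4 * K) * R := by
      calc ‖N (y, σ)‖ = ‖N (0, σ) + (N (y, σ) - N (0, σ))‖ := by congr 1; abel
        _ ≤ ‖N (0, σ)‖ + ‖N (y, σ) - N (0, σ)‖ := norm_add_le _ _
        _ ≤ R / (4 * K) + 1 / (4 * K) * ‖y - 0‖ :=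
          add_le_add (hN0 σ hσ) (hNlip y 0 σ hy (by simpa using hR.le) hσ)
        _ ≤ _ := by rw [sub_zero]; gcongr
    calc ‖T ξ σ y‖ ≤ K * (‖ξ‖ + ‖N (y, σ)‖) := h𝒦K _ _
      _ ≤ K * (R / (4 * K) + (R / (4 * K) + 1 / (4 * K) * R)) := by gcongr
      _ = 3 / 4 * R := by field_simp; ring
      _ < R := by linarith
  have hfix : ∀ ξ σ, ‖ξ‖ < R / (4 * K) → σ < σ₀ → ∃ y : ℝ →ᵇ V, ‖y‖ ≤ R ∧ T ξ σ y = y := by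
    intro ξ σ hξ hσ
    have hmaps : MapsTo (T ξ σ) (Metric.closedBall 0 R) (Metric.closedBall 0 R) := fun y hy => by
      rw [mem_closedBall_zero_iff] at hy ⊢
      exact (hTbound ξ σ hξ hσ y hy).le
    have hcon : ContractingWith (1 / 4) (hmaps.restrict (T ξ σ) _ _) := by
      refine ⟨by norm_num [← NNReal.coe_lt_coe], LipschitzWith.of_dist_le_mul fun y z => ?_⟩
      have := hTlip ξ σ hσ y z (mem_closedBall_zero_iff.1 y.2)
        (mem_closedBall_zero_iff.1 z.2)
      simpa [Subtype.dist_eq, dist_eq_norm] using this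
    obtain ⟨y, hy, hyf, -⟩ := hcon.exists_fixedPoint' Metric.isClosed_closedBall.isComplete hmaps
      (x := 0) (by simpa using hR.le) (edist_ne_top _ _)
    exact ⟨y, by simpa using hy, hyf⟩
  have huniq : ∀ ξ σ, σ < σ₀ → ∀ y z : ℝ →ᵇ V, ‖y‖ ≤ R → ‖z‖ ≤ R → T ξ σ y = y → T ξ σ z = z →
      y = z := by
    intro ξ σ hσ y z hy hz hyT hzT
    have h1 := hTlip ξ σ hσ y z hy hz
    rw [hyT, hzT] at h1
    have h2 := norm_nonneg (y - z)
    rw [← sub_eq_zero, ← norm_eq_zero]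
    linarith
  choose! Y hYR hYT using hfix
  -- the fixed point depends smoothly on the data
  have hYc : ∀ p ∈ {p : V × ℝ | ‖p.1‖ < R / (4 * K) ∧ p.2 < σ₀},
      ContDiffAt ℝ 1 (fun p => Y p.1 p.2) p := by
    rintro ⟨ξ, σ⟩ ⟨hξ, hσ⟩
    simp only at hξ hσ
    set y₀ := Y ξ σ with hy₀
    have hy₀R : ‖y₀‖ ≤ R := hYR ξ σ hξ hσ
    have hy₀T : T ξ σ y₀ = y₀ := hYT ξ σ hξ hσ
    have hy₀R' : ‖y₀‖ < R := by rw [← hy₀T]; exact hTbound ξ σ hξ hσ y₀ hy₀R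
    let Φ : (V × ℝ) × (ℝ →ᵇ V) → (ℝ →ᵇ V) := fun q => q.2 - 𝒦 (q.1.1, N (q.2, q.1.2))
    have hΦ : ContDiff ℝ 1 Φ := by
      refine contDiff_snd.sub (𝒦.contDiff.comp ?_)
      exact (contDiff_fst.comp contDiff_fst).prodMk
        (hN.comp (contDiff_snd.prodMk (contDiff_snd.comp contDiff_fst)))
    have hcdf : ContDiffAt ℝ 1 Φ ((ξ, σ), y₀) := hΦ.contDiffAt
    let S : (ℝ →ᵇ V) →L[ℝ] (ℝ →ᵇ V) := (𝒦.comp (ContinuousLinearMap.inr ℝ V (ℝ →ᵇ V))).comp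
      ((fderiv ℝ N (y₀, σ)).comp (ContinuousLinearMap.inl ℝ (ℝ →ᵇ V) ℝ))
    -- the partial derivative of `Φ` in the bounded function is `1 - S` with `‖S‖ ≤ 1 / 4`, hence
    -- invertible
    have hS : ‖S‖ < 1 := by
      refine lt_of_le_of_lt (S.opNorm_le_bound (M := 1 / 4) (by norm_num) fun v => ?_) (by norm_num)
      have h1 : ‖fderiv ℝ N (y₀, σ) (v, 0)‖ ≤ 1 / (4 * K) * ‖v‖ := by
        have h0 : HasFDerivAt (pairInput (E := V) a) (pairInput a) (y₀, σ) :=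
          ContinuousLinearMap.hasFDerivAt _
        have h2 : HasFDerivAt N _ (y₀, σ) :=
          (hasFDerivAt_superpose hG (pairInput a (y₀, σ))).comp (y₀, σ) h0
        rw [h2.fderiv]
        refine (BoundedContinuousFunction.norm_le (by positivity)).2 fun t => ?_
        have h3 : (fderiv ℝ G (y₀ t, σ * Real.exp (-(a * max t 0)))).comp
            (ContinuousLinearMap.inl ℝ V ℝ) (v t) =
            fderiv ℝ G (y₀ t, σ * Real.exp (-(a * max t 0))) (v t, 0) := rfl
        have h4 := (ContinuousLinearMap.le_of_opNorm_le _ (hδ (y₀ t) _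
          ((y₀.norm_coe_le_norm t).trans hy₀R) (hσt σ hσ t)) (v t))
        rw [h3] at h4
        refine le_trans (le_of_eq ?_) (h4.trans (mul_le_mul_of_nonneg_left
          (v.norm_coe_le_norm t) hK4.le))
        simp [abs_of_nonneg ha]
      have h2 := h𝒦K 0 (fderiv ℝ N (y₀, σ) (v, 0))
      rw [norm_zero, zero_add] at h2
      calc ‖S v‖ ≤ K * ‖fderiv ℝ N (y₀, σ) (v, 0)‖ := h2
        _ ≤ K * (1 / (4 * K) * ‖v‖) := by gcongr
        _ = _ := by field_simp
    have hΦ' : (fderiv ℝ Φ ((ξ, σ), y₀)).comp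
        (ContinuousLinearMap.inr ℝ (V × ℝ) (ℝ →ᵇ V)) = 1 - S := by
      have h1 : HasFDerivAt (fun y => Φ ((ξ, σ), y)) ((fderiv ℝ Φ ((ξ, σ), y₀)).comp
          (ContinuousLinearMap.inr ℝ (V × ℝ) (ℝ →ᵇ V))) y₀ :=
        (hΦ.differentiable one_ne_zero ((ξ, σ), y₀)).hasFDerivAt.comp y₀
          (hasFDerivAt_prodMk_right (ξ, σ) y₀)
      have h2 : HasFDerivAt (fun y => N (y, σ))
          ((fderiv ℝ N (y₀, σ)).comp (ContinuousLinearMap.inl ℝ (ℝ →ᵇ V) ℝ)) y₀ := by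
        have ha : HasFDerivAt (fun y : ℝ →ᵇ V => (y, σ)) (ContinuousLinearMap.inl ℝ (ℝ →ᵇ V) ℝ) y₀ :=
          hasFDerivAt_prodMk_left y₀ σ
        have hb : HasFDerivAt N (fderiv ℝ N (y₀, σ)) (y₀, σ) :=
          (hN.differentiable one_ne_zero (y₀, σ)).hasFDerivAt
        exact hb.comp y₀ ha
      have h3 : HasFDerivAt (fun y => 𝒦 (ξ, N (y, σ))) S y₀ := by
        have ha : HasFDerivAt (fun g : ℝ →ᵇ V => (ξ, g)) (ContinuousLinearMap.inr ℝ V (ℝ →ᵇ V))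
          (N (y₀, σ)) := hasFDerivAt_prodMk_right ξ (N (y₀, σ))
        have hb : HasFDerivAt 𝒦 𝒦 (ξ, N (y₀, σ)) := ContinuousLinearMap.hasFDerivAt _
        exact (hb.comp (N (y₀, σ)) ha).comp y₀ h2
      exact h1.unique ((hasFDerivAt_id y₀).sub h3)
    have hinv : ((fderiv ℝ Φ ((ξ, σ), y₀)).comp
        (ContinuousLinearMap.inr ℝ (V × ℝ) (ℝ →ᵇ V))).IsInvertible := by
      rw [hΦ']
      obtain ⟨u, hu⟩ := isUnit_one_sub_of_norm_lt_one hS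
      exact ⟨ContinuousLinearEquiv.unitsEquiv ℝ _ u, by rw [← hu]; rfl⟩
    have hΦ0 : Φ ((ξ, σ), y₀) = 0 := by
      simp only [Φ]
      exact sub_eq_zero.2 hy₀T.symm
    have hψc := hcdf.contDiffAt_implicitFunction one_ne_zero hinv
    have hψ0 := hcdf.implicitFunction_apply_self one_ne_zero hinv
    have hψe := hcdf.eventually_apply_implicitFunction one_ne_zero hinv
    set ψ := hcdf.implicitFunction one_ne_zero hinv
    refine hψc.congr_of_eventuallyEq ?_
    have hψR : ∀ᶠ p in 𝓝 (ξ, σ), ‖ψ p‖ < R := by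
      have h1 : ‖ψ (ξ, σ)‖ < R := lt_of_eq_of_lt (congrArg norm hψ0) hy₀R'
      exact hψc.continuousAt.norm.eventually_lt_const h1
    have hopen : ∀ᶠ p : V × ℝ in 𝓝 (ξ, σ), ‖p.1‖ < R / (4 * K) ∧ p.2 < σ₀ :=
      ((continuous_fst.norm.tendsto ((ξ, σ) : V × ℝ)).eventually_lt_const hξ).and
        ((continuous_snd.tendsto ((ξ, σ) : V × ℝ)).eventually_lt_const hσ)
    filter_upwards [hψe, hψR, hopen] with p hp hpR hpO
    -- the implicit function is a fixed point in the ball, so it is the one chosen above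
    refine huniq p.1 p.2 hpO.2 _ _ (hYR _ _ hpO.1 hpO.2) hpR.le (hYT _ _ hpO.1 hpO.2) ?_
    rw [hΦ0] at hp
    exact (sub_eq_zero.1 hp).symm
  have hsol : ∀ ξ σ (y : ℝ →ᵇ V), T ξ σ y = y →
      IsHalfSol A ℓ w ξ (fun t => G (y t, σ * Real.exp (-(a * max t 0)))) y := by
    intro ξ σ y hy
    have h1 := h𝒦 ξ (N (y, σ))
    rw [show 𝒦 (ξ, N (y, σ)) = y from hy] at h1
    rwa [show (N (y, σ) : ℝ → V) = fun t => G (y t, σ * Real.exp (-(a * max t 0))) from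
      funext fun t => hNt y σ t] at h1
  refine ⟨fun p => ℓ (Y p.1 p.2 0), fun p hp => ?_, fun ξ σ hξ hσ => ⟨⟨Y ξ σ, ?_, fun t => ?_, rfl⟩,
    fun y hy hyR => ?_⟩⟩
  · have h1 := hYc p hp
    have h2 : ContDiffAt ℝ 1 (fun p => BoundedContinuousFunction.evalCLM ℝ (0 : ℝ) (Y p.1 p.2)) p :=
      ContDiffAt.comp p (ContinuousLinearMap.contDiff _).contDiffAt h1
    exact (ℓ.contDiff.contDiffAt.comp p h2).contDiffWithinAt
  · exact hsol ξ σ _ (hYT ξ σ hξ hσ)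
  · exact ((Y ξ σ).norm_coe_le_norm t).trans (hYR ξ σ hξ hσ)
  · have hyc : Continuous y := by
      have h1 : ContinuousOn y (Ici 0) := fun t ht => (hy.deriv t ht).continuousWithinAt
      have h2 : y = fun t => y (max t 0) := by
        ext1 t
        rcases le_total t 0 with ht | ht
        · rw [max_eq_right ht, hy.const t ht]
        · rw [max_eq_left ht]
      rw [h2]
      exact h1.comp_continuous (by fun_prop) fun t => mem_Ici.2 (le_max_right t 0)
    let Z : ℝ →ᵇ V := BoundedContinuousFunction.ofNormedAddCommGroup y hyc R hyR
    have hZR : ‖Z‖ ≤ R := (BoundedContinuousFunction.norm_le hR.le).2 hyR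
    have hZ : IsHalfSol A ℓ w ξ (N (Z, σ)) Z := by
      have : (N (Z, σ) : ℝ → V) = fun t => G (y t, σ * Real.exp (-(a * max t 0))) :=
        funext fun t => hNt Z σ t
      rw [this]; exact hy
    have := huniq ξ σ hσ Z (Y ξ σ) hZR (hYR ξ σ hξ hσ) (h𝒦u ξ _ Z hZ).symm (hYT ξ σ hξ hσ)
    change ℓ (Z 0) = ℓ (Y ξ σ 0)
    rw [this]

end LyapunovPerron

/-! ### Trajectories near the future endpoint -/

section TailInput

variable {f : Vec n → Vec d → Vec n} {Λ : ℝ → Vec d} {lm lp : Vec d} {α r : ℝ} {I : Set ℝ}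

/-- The input seen from a state with `(1 - s) / (1 + s) = σ` in the compactified phase space. -/
def tailInput (Λ : ℝ → Vec d) (lp : Vec d) (α σ : ℝ) : ℝ → Vec d :=
  fun t => glueInput Λ lp α (σ * Real.exp (-(α * t)))

lemma tailInput_exp (hα : 0 < α) (τ : ℝ) :
    tailInput Λ lp α (Real.exp (-(α * τ))) = fun t => Λ (t + τ) := by
  ext1 t
  rw [tailInput, ← Real.exp_add, ← glueInput_exp (Λ := Λ) (l := lp) hα (t + τ)]
  congr 2
  ring

lemma tailInput_zero : tailInput Λ lp α 0 = fun _ => lp := by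
  ext1 t
  simp [tailInput, glueInput]

lemma tendsto_tailInput (hΛ : Continuous Λ) (hα : 0 < α) (hl : Tendsto Λ atTop (𝓝 lp)) (σ : ℝ) :
    Tendsto (tailInput Λ lp α σ) atTop (𝓝 lp) := by
  have h1 : Tendsto (fun t => σ * Real.exp (-(α * t))) atTop (𝓝 (σ * 0)) := by
    refine Tendsto.const_mul σ (Real.tendsto_exp_atBot.comp ?_)
    exact tendsto_neg_atTop_atBot.comp (tendsto_id.const_mul_atTop hα)
  rw [mul_zero] at h1
  have h2 := ((continuous_glueInput hΛ hα hl).tendsto 0).comp h1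
  rwa [show glueInput Λ lp α 0 = lp by simp [glueInput]] at h2

/-- Along a trajectory with `s > -1` the quantity `(1 - s) / (1 + s)` decays like `exp (-(α t))`,
which turns the first component into a solution driven by the tail input. -/
lemma IsTrajectory.isSol_tailInput (hα : 0 < α) (hI : I.OrdConnected) {γ : ℝ → Vec n × ℝ}
    (h : IsTrajectory (compField f Λ lm lp α r) I γ) (ha : (0 : ℝ) ∈ I) (h0 : -1 < (γ 0).2) :
    (∀ t ∈ I, -1 < (γ t).2 ∧ (1 - (γ t).2) / (1 + (γ t).2) =
      (1 - (γ 0).2) / (1 + (γ 0).2) * Real.exp (-(α * t))) ∧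
      IsSol f (tailInput Λ lp α ((1 - (γ 0).2) / (1 + (γ 0).2))) r I (fun t => (γ t).1) := by
  rcases eq_endpoint_or_compTime hα (h 0 ha).1 with h1 | h1 | ⟨τ, h1⟩
  · rw [h1] at h0; exact absurd h0 (lt_irrefl _)
  · obtain ⟨h2, h3⟩ := h.isSol_of_one hI ha h1
    rw [h1]
    refine ⟨fun t ht => by rw [h2 t ht]; norm_num, ?_⟩
    rw [sub_self, zero_div, tailInput_zero]
    exact h3
  · obtain ⟨h2, h3⟩ := h.isSol_of_compTime hα hI ha h1
    rw [h1, one_sub_compTime_div, tailInput_exp hα]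
    refine ⟨fun t ht => ?_, h3⟩
    rw [h2 t ht, one_sub_compTime_div, ← Real.exp_add]
    exact ⟨(compTime_mem _ _).1, by ring_nf⟩

lemma exists_isTrajectory_tailInput (hα : 0 < α) {x : ℝ → Vec n} {s : ℝ}
    (hs : s ∈ Ioc (-1 : ℝ) 1)
    (hx : IsSol f (tailInput Λ lp α ((1 - s) / (1 + s))) r I x) :
    ∃ γ, IsTrajectory (compField f Λ lm lp α r) I γ ∧ γ 0 = (x 0, s) ∧ (∀ t, (γ t).1 = x t) ∧
      Tendsto (fun t => (γ t).2) atTop (𝓝 1) := by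
  rcases eq_endpoint_or_compTime hα ⟨hs.1.le, hs.2⟩ with rfl | rfl | ⟨τ, rfl⟩
  · exact absurd hs.1 (lt_irrefl _)
  · rw [sub_self, zero_div, tailInput_zero] at hx
    exact ⟨_, isTrajectory_one hx, rfl, fun _ => rfl, tendsto_const_nhds⟩
  · rw [one_sub_compTime_div, tailInput_exp hα] at hx
    refine ⟨_, isTrajectory_compTime hα hx, by simp, fun _ => rfl, ?_⟩
    exact (tendsto_compTime_atTop hα).comp (tendsto_atTop_add_const_right _ _ tendsto_id)

lemma IsTrajectory.comp_add {F : Vec n × ℝ → Vec n × ℝ} {γ : ℝ → Vec n × ℝ}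
    (h : IsTrajectory F I γ) (a : ℝ) :
    IsTrajectory F ((fun t => t + a) ⁻¹' I) (fun t => γ (t + a)) := by
  refine fun t ht => ⟨(h (t + a) ht).1, ?_⟩
  have h1 := (h (t + a) ht).2.scomp t ((hasDerivWithinAt_id t ((fun t => t + a) ⁻¹' I)).add_const a)
    (fun s hs => hs)
  simpa [Function.comp_def] using h1

lemma localStableManifold_forward {F : Vec n × ℝ → Vec n × ℝ} {γ : ℝ → Vec n × ℝ} {p : Vec n × ℝ}
    {N : Set (Vec n × ℝ)} (hγ : IsTrajectory F (Ici 0) γ) (hN : ∀ t ≥ 0, γ t ∈ N)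
    (hlim : Tendsto γ atTop (𝓝 p)) {a : ℝ} (ha : 0 ≤ a) : γ a ∈ localStableManifold F p N := by
  refine ⟨fun t => γ (t + a), fun t ht => ?_, by simp, fun t ht => hN _ (add_nonneg ht ha),
    hlim.comp (tendsto_atTop_add_const_right _ _ tendsto_id)⟩
  have hsub : Ici (0 : ℝ) ⊆ (fun t => t + a) ⁻¹' Ici 0 := fun s hs => add_nonneg (mem_Ici.1 hs) ha
  exact ⟨((hγ.comp_add a) t (hsub ht)).1, ((hγ.comp_add a) t (hsub ht)).2.mono hsub⟩

end TailInput

/-! ### The isolating block of an edge state -/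

section FutureBlock

variable {f : Vec n → Vec d → Vec n} {Λ u : ℝ → Vec d} {lp : Vec d} {η : Vec n}
  {p b : Vec n →L[ℝ] Vec n →L[ℝ] ℝ} {k m ε C q r α σ₀ : ℝ} {x : ℝ → Vec n} {T : ℝ}

/-- For `σ ≤ σ₀` the input `glueInput Λ lp α σ` is so close to its limit that
`{p (x - η) ≤ q, b (x - η) ≤ q}` is an isolating block, at every rate. -/
structure IsFutureBlock (f : Vec n → Vec d → Vec n) (Λ : ℝ → Vec d) (lp : Vec d) (η : Vec n)
    (p b : Vec n →L[ℝ] Vec n →L[ℝ] ℝ) (k m ε C q α σ₀ : ℝ) : Prop where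
  dich : IsLocalDichotomy f lp η p b k m ε C
  q_pos : 0 < q
  q_le : 2 * q ≤ m * ε ^ 2
  σ₀_pos : 0 < σ₀
  input : ∀ σ ≤ σ₀, ‖glueInput Λ lp α σ - lp‖ ≤ ε
  drift : ∀ σ ≤ σ₀, C * ‖f η (glueInput Λ lp α σ)‖ ^ 2 ≤ k * q / 2

/-- A solution that stays near the equilibrium and starts with `b < q` stays in the interior of
the block. -/
lemma IsLocalDichotomy.cone_bounds (h : IsLocalDichotomy f lp η p b k m ε C) (hr : 0 < r)
    (hq : 0 < q) (hx : IsSol f u r (Ici T) x) (hxε : ∀ t ≥ T, ‖x t - η‖ ≤ ε)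
    (hu : ∀ t ≥ T, ‖u t - lp‖ ≤ ε) (hC : ∀ t ≥ T, C * ‖f η (u t)‖ ^ 2 ≤ k * q / 2)
    (hb : b (x T - η) (x T - η) < q) :
    ∀ t ≥ T, p (x t - η) (x t - η) < q ∧ b (x t - η) (x t - η) < q := by
  have hk := h.k_pos
  have hκ : 0 < 2 * r⁻¹ * k := by positivity
  obtain ⟨h1, h2⟩ := eventually_le_of_cone_ineq (T := T) (k := 2 * r⁻¹ * k) (M := ‖p‖ * ε ^ 2) hκ
    (p := fun t => p (x t - η) (x t - η)) (b := fun t => b (x t - η) (x t - η))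
    (β := fun t => 2 * r⁻¹ * C * ‖f η (u t)‖ ^ 2) (β₀ := 2 * r⁻¹ * (k * q / 2))
    (fun t ht => hx.hasDerivWithinAt_form_sub_const h.p_symm η ht)
    (fun t ht => hx.hasDerivWithinAt_form_sub_const h.b_symm η ht)
    (fun t _ => h.p_nonneg _) (fun t _ => h.b_nonneg _)
    (fun t ht => (form_le p _).trans (by gcongr; exact hxε t ht))
    (fun t ht => h.p_rate_equilibrium hr (hxε t ht) (hu t ht))
    (fun t ht => h.b_rate_equilibrium hr (hxε t ht) (hu t ht))
    (fun t ht => by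
      rw [mul_assoc _ C]
      exact mul_le_mul_of_nonneg_left (hC t ht) (by positivity))
  have e1 : 2 * r⁻¹ * (k * q / 2) / (2 * r⁻¹ * k) = q / 2 := by field_simp
  have e2 : 4 * (2 * r⁻¹ * (k * q / 2)) / (3 * (2 * r⁻¹ * k)) = 2 / 3 * q := by field_simp; norm_num
  intro t ht
  have h3 := h1 t ht
  have h4 := h2 t ht
  simp only [e1, e2] at h3 h4
  have hbt : b (x t - η) (x t - η) < q := by
    have hE : Real.exp (-(3 * (2 * r⁻¹ * k) / 2 * (t - T))) ≤ 1 := Real.exp_le_one_iff.2 (by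
      have : 0 ≤ 3 * (2 * r⁻¹ * k) / 2 * (t - T) := mul_nonneg (by positivity) (sub_nonneg.2 ht)
      linarith)
    have hE0 := Real.exp_pos (-(3 * (2 * r⁻¹ * k) / 2 * (t - T)))
    rcases le_total (b (x T - η) (x T - η) - 2 / 3 * q) 0 with h5 | h5 <;> nlinarith
  exact ⟨by linarith, hbt⟩

/-- A solution that stays near the equilibrium converges to it when the input converges. -/
lemma IsLocalDichotomy.tendsto (h : IsLocalDichotomy f lp η p b k m ε C) (hr : 0 < r)
    (hf : ContDiff ℝ 1 (fun p : Vec n × Vec d => f p.1 p.2)) (hη : f η lp = 0)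
    (hx : IsSol f u r (Ici T) x) (hxε : ∀ t ≥ T, ‖x t - η‖ ≤ ε)
    (hu : ∀ t ≥ T, ‖u t - lp‖ ≤ ε) (hul : Tendsto u atTop (𝓝 lp)) :
    Tendsto x atTop (𝓝 η) := by
  have hk := h.k_pos
  have hm := h.m_pos
  have hκ : 0 < 2 * r⁻¹ * k := by positivity
  have hβ : Tendsto (fun t => 2 * r⁻¹ * C * ‖f η (u t)‖ ^ 2) atTop (𝓝 0) := by
    have h1 : Tendsto (fun t => f η (u t)) atTop (𝓝 (f η lp)) :=
      ((hf.continuous.comp (Continuous.prodMk_right η)).tendsto lp).comp hul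
    have := (h1.norm.pow 2).const_mul (2 * r⁻¹ * C)
    simpa [hη] using this
  obtain ⟨h1, h2⟩ := tendsto_zero_of_cone_ineq (T := T) (k := 2 * r⁻¹ * k) (M := ‖p‖ * ε ^ 2) hκ
    (p := fun t => p (x t - η) (x t - η)) (b := fun t => b (x t - η) (x t - η))
    (β := fun t => 2 * r⁻¹ * C * ‖f η (u t)‖ ^ 2)
    (fun t ht => hx.hasDerivWithinAt_form_sub_const h.p_symm η ht)
    (fun t ht => hx.hasDerivWithinAt_form_sub_const h.b_symm η ht)
    (fun t _ => h.p_nonneg _) (fun t _ => h.b_nonneg _)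
    (fun t ht => (form_le p _).trans (by gcongr; exact hxε t ht))
    (fun t ht => h.p_rate_equilibrium hr (hxε t ht) (hu t ht))
    (fun t ht => h.b_rate_equilibrium hr (hxε t ht) (hu t ht)) hβ
  have h3 : Tendsto (fun t => ‖x t - η‖ ^ 2) atTop (𝓝 0) := by
    have h4 : Tendsto (fun t => m⁻¹ * (p (x t - η) (x t - η) + b (x t - η) (x t - η))) atTop
        (𝓝 0) := by simpa using (h1.add h2).const_mul m⁻¹
    refine squeeze_zero (fun t => sq_nonneg _) (fun t => ?_) h4
    rw [inv_mul_eq_div, le_div_iff₀ hm, mul_comm]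
    exact h.coercive _
  rw [tendsto_iff_norm_sub_tendsto_zero]
  have h5 := h3.sqrt
  simpa [Real.sqrt_sq (norm_nonneg _)] using h5

/-- The bound `δ` on the drift is required separately for the construction of the stable manifold.
-/
lemma exists_isFutureBlock (hf : ContDiff ℝ 1 (fun p : Vec n × Vec d => f p.1 p.2))
    (hη : f η lp = 0) (hΛ : Continuous Λ) (hα : 0 < α) (hl : Tendsto Λ atTop (𝓝 lp))
    (h : IsLocalDichotomy f lp η p b k m ε C) (hq : 0 < q) (hqε : 2 * q ≤ m * ε ^ 2) {δ : ℝ}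
    (hδ : 0 < δ) : ∃ σ₀, IsFutureBlock f Λ lp η p b k m ε C q α σ₀ ∧
      ∀ σ ≤ σ₀, ‖f η (glueInput Λ lp α σ)‖ ≤ δ := by
  have hg := continuous_glueInput (l := lp) hΛ hα hl
  have hg0 : ∀ σ ≤ 0, glueInput Λ lp α σ = lp := fun σ hσ => by simp [glueInput, hσ]
  have hd : Tendsto (fun σ => f η (glueInput Λ lp α σ)) (𝓝 0) (𝓝 0) := by
    have := ((hf.continuous.comp (Continuous.prodMk_right η)).comp hg).tendsto 0
    simpa [Function.comp_def, hg0 0 le_rfl, hη] using this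
  have hd' : Tendsto (fun σ => C * ‖f η (glueInput Λ lp α σ)‖ ^ 2) (𝓝 0) (𝓝 0) := by
    simpa using (hd.norm.pow 2).const_mul C
  have hk := h.k_pos
  have h1 : 0 < k * q / 2 := by positivity
  have h2 : Tendsto (glueInput Λ lp α) (𝓝 0) (𝓝 lp) := by
    have := hg.tendsto 0
    rwa [hg0 0 le_rfl] at this
  have hd0 : Tendsto (fun σ => ‖f η (glueInput Λ lp α σ)‖) (𝓝 0) (𝓝 0) := by simpa using hd.norm
  obtain ⟨σ₁, hσ₁, H⟩ := Metric.eventually_nhds_iff.1 (((eventually_norm_sub_le h2 h.ε_pos).and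
    (hd'.eventually_le_const h1)).and (hd0.eventually_le_const hδ))
  have H' : ∀ σ : ℝ, |σ| < σ₁ → (‖glueInput Λ lp α σ - lp‖ ≤ ε ∧
      C * ‖f η (glueInput Λ lp α σ)‖ ^ 2 ≤ k * q / 2) ∧ ‖f η (glueInput Λ lp α σ)‖ ≤ δ :=
    fun σ hσ => H (by rwa [Real.dist_eq, sub_zero])
  have key : ∀ σ ≤ σ₁ / 2, (‖glueInput Λ lp α σ - lp‖ ≤ ε ∧
      C * ‖f η (glueInput Λ lp α σ)‖ ^ 2 ≤ k * q / 2) ∧ ‖f η (glueInput Λ lp α σ)‖ ≤ δ := by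
    intro σ hσ
    rcases le_total σ 0 with h0 | h0
    · have h3 := H' 0 (by simpa using hσ₁)
      rw [hg0 0 le_rfl] at h3
      rw [hg0 σ h0]
      exact h3
    · exact H' σ (by rw [abs_of_nonneg h0]; linarith)
  exact ⟨σ₁ / 2, ⟨h, hq, hqε, by positivity, fun σ hσ => (key σ hσ).1.1,
    fun σ hσ => (key σ hσ).1.2⟩, fun σ hσ => (key σ hσ).2⟩

lemma IsFutureBlock.norm_le (h : IsFutureBlock f Λ lp η p b k m ε C q α σ₀) {z : Vec n}
    (hp : p z z ≤ q) (hb : b z z ≤ q) : ‖z‖ ≤ ε :=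
  h.dich.norm_le h.q_le hp hb

lemma IsFutureBlock.tail_le (h : IsFutureBlock f Λ lp η p b k m ε C q α σ₀) (hα : 0 < α) {σ t : ℝ}
    (hσ : σ ≤ σ₀) (ht : 0 ≤ t) : σ * Real.exp (-(α * t)) ≤ σ₀ := by
  have h1 : Real.exp (-(α * t)) ≤ 1 := Real.exp_le_one_iff.2 (by
    have := mul_nonneg hα.le ht; linarith)
  have h2 := Real.exp_pos (-(α * t))
  have h3 := h.σ₀_pos
  rcases le_total σ 0 with h | h <;> nlinarith

/-- A solution that stays near the edge state stays in the interior of the block and converges. -/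
lemma IsFutureBlock.stays_and_tendsto (h : IsFutureBlock f Λ lp η p b k m ε C q α σ₀)
    (hf : ContDiff ℝ 1 (fun p : Vec n × Vec d => f p.1 p.2)) (hη : f η lp = 0)
    (hΛ : Continuous Λ) (hα : 0 < α) (hl : Tendsto Λ atTop (𝓝 lp)) (hr : 0 < r) {σ : ℝ}
    (hσ : σ ≤ σ₀) (hx : IsSol f (tailInput Λ lp α σ) r (Ici 0) x)
    (hxε : ∀ t ≥ 0, ‖x t - η‖ ≤ ε) (hb : b (x 0 - η) (x 0 - η) < q) :
    (∀ t ≥ 0, p (x t - η) (x t - η) < q ∧ b (x t - η) (x t - η) < q) ∧ Tendsto x atTop (𝓝 η) := by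
  have hin : ∀ t ≥ 0, ‖tailInput Λ lp α σ t - lp‖ ≤ ε := fun t ht => h.input _ (h.tail_le hα hσ ht)
  exact ⟨h.dich.cone_bounds hr h.q_pos hx hxε hin (fun t ht => h.drift _ (h.tail_le hα hσ ht)) hb,
    h.dich.tendsto hr hf hη hx hxε hin (tendsto_tailInput hΛ hα hl σ)⟩

end FutureBlock

section EdgeBlock

variable {f : Vec n → Vec d → Vec n} {Λ : ℝ → Vec d} {lp : Vec d} {η : Vec n}
  {k m m' ε C q r α σ₀ μ c σ : ℝ} {ℓ : Vec n →L[ℝ] ℝ} {w : Vec n} {B : Vec n →L[ℝ] Vec n →L[ℝ] ℝ}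
  {A : Vec n →L[ℝ] Vec n} {x y : ℝ → Vec n}

lemma exists_fderiv_inl_sub_le (hf : ContDiff ℝ 1 (fun p : Vec n × Vec d => f p.1 p.2))
    (lp : Vec d) (η : Vec n) {δ : ℝ} (hδ : 0 < δ) :
    ∃ ε > 0, ∀ x l, ‖x - η‖ ≤ ε → ‖l - lp‖ ≤ ε →
      ‖fderiv ℝ (fun x => f x l) x - fderiv ℝ (fun x => f x lp) η‖ ≤ δ := by
  have h1 : Continuous fun p : Vec n × Vec d => fderiv ℝ (fun x => f x p.2) p.1 := by
    have h2 : (fun p : Vec n × Vec d => fderiv ℝ (fun x => f x p.2) p.1) = fun p =>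
        (fderiv ℝ (fun p : Vec n × Vec d => f p.1 p.2) p).comp
          (ContinuousLinearMap.inl ℝ (Vec n) (Vec d)) :=
      funext fun p => (hasFDerivAt_section hf p.2 p.1).fderiv
    rw [h2]
    exact (hf.continuous_fderiv one_ne_zero).clm_comp continuous_const
  obtain ⟨ε, hε, H⟩ := Metric.continuousAt_iff.1 (h1.continuousAt (x := (η, lp))) δ hδ
  refine ⟨ε / 2, by positivity, fun x l hx hl => ?_⟩
  have := H (x := (x, l)) (by
    rw [Prod.dist_eq]
    simp only [dist_eq_norm]
    exact max_lt (by linarith) (by linarith))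
  rw [dist_eq_norm] at this
  exact this.le

/-- Rescaling time by `r` turns a solution on a half-line into a half solution of the
inhomogeneous linear equation at the edge state. -/
lemma IsSol.isHalfSol (h : IsEdgeSplitting A μ c ℓ w B m) (hr : 0 < r)
    (hx : IsSol f (tailInput Λ lp α σ) r (Ici 0) x) :
    IsHalfSol A ℓ w (projKer ℓ w (x 0 - η))
      (fun t => f (x (r * max t 0)) (glueInput Λ lp α (σ * Real.exp (-(α * r * max t 0)))) -
        A (x (r * max t 0) - η)) (fun t => x (r * max t 0) - η) := by
  refine ⟨fun t ht => ?_, ?_, fun t ht => by simp [max_eq_right ht]⟩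
  · have h1 := (hx.comp_affine r 0).mono (J := Ici 0) fun s hs => by
      simpa using mul_nonneg hr.le (mem_Ici.1 hs)
    have h2 := (h1 t ht).sub_const η
    have heq : ∀ s ∈ Ici (0 : ℝ), x (r * max s 0) - η = x (r * s + 0) - η := fun s hs => by
      rw [max_eq_left (mem_Ici.1 hs), add_zero]
    refine (h2.congr heq (heq t ht)).congr_deriv ?_
    simp only [tailInput]
    rw [div_self hr.ne', inv_one, one_smul, max_eq_left (mem_Ici.1 ht), add_zero,
      add_sub_cancel, mul_assoc]
  · simp only [max_self, mul_zero]
    exact (projKer_of_mem ℓ w (h.ell_projKer _)).symm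

/-- Undoing the rescaling of time: a half-line solution `y` of the Lyapunov–Perron problem gives
the solution `η + y (t / r)` of the nonautonomous system with the tail input. -/
lemma IsHalfSol.isSol {ξ : Vec n} (hr : 0 < r)
    (hy : IsHalfSol A ℓ w ξ (fun t => f (η + y t)
      (glueInput Λ lp α (σ * Real.exp (-(α * r * max t 0)))) - A (y t)) y) :
    IsSol f (tailInput Λ lp α σ) r (Ici 0) (fun t => η + y (r⁻¹ * t)) := by
  intro t ht
  have h1 : HasDerivWithinAt (fun t => r⁻¹ * t) r⁻¹ (Ici 0) t := by
    simpa using ((hasDerivAt_id t).const_mul r⁻¹).hasDerivWithinAt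
  have hmaps : MapsTo (fun t : ℝ => r⁻¹ * t) (Ici 0) (Ici 0) := fun s hs =>
    mul_nonneg (inv_pos.2 hr).le (mem_Ici.1 hs)
  have h2 := ((hy.deriv (r⁻¹ * t) (hmaps ht)).scomp t h1 hmaps).const_add η
  refine h2.congr_deriv ?_
  rw [max_eq_left (mem_Ici.1 (hmaps ht)), add_sub_cancel, tailInput]
  congr 4
  field_simp

/-- The data at an edge state that do not depend on the rate: an isolating block in the tail, in
which the states whose forward solution stays are, at every rate, the zeros of `ℓ - φ` for a `C¹`
function `φ` of the stable component and the input. -/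
structure IsEdgeBlock (f : Vec n → Vec d → Vec n) (Λ : ℝ → Vec d) (lp : Vec d) (η : Vec n)
    (ℓ : Vec n →L[ℝ] ℝ) (w : Vec n) (b : Vec n →L[ℝ] Vec n →L[ℝ] ℝ) (k m ε C q α σ₀ : ℝ) : Prop where
  block : IsFutureBlock f Λ lp η (unstableForm ℓ) b k m ε C q α σ₀
  ell_w : ℓ w = 1
  b_w : ∀ z (t : ℝ), b (z + t • w) (z + t • w) = b z z
  graph : ∀ r > 0, ∃ φ : Vec n × ℝ → ℝ, ContDiffOn ℝ 1 φ {p | b p.1 p.1 < q ∧ p.2 < σ₀} ∧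
    (∀ z (t σ : ℝ), φ (z + t • w, σ) = φ (z, σ)) ∧
    ∀ z σ, b z z < q → σ < σ₀ →
      ((∃ x, IsSol f (tailInput Λ lp α σ) r (Ici 0) x ∧ x 0 = η + z ∧ ∀ t ≥ 0, ‖x t - η‖ ≤ ε) ↔
        ℓ z = φ (z, σ))

/-- The stable graph for the field written as its linearization plus a remainder, in the time `τ /
r`: only the decay of the input is affected by this rescaling, and the size of the graph does not
depend on it. -/
theorem IsEquilibriumRegularEdgeState.exists_isEdgeBlock
    (hf : ContDiff ℝ 1 (fun p : Vec n × Vec d => f p.1 p.2)) (hΛ : ContDiff ℝ 1 Λ)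
    (hα : 0 < α) (hl : Tendsto Λ atTop (𝓝 lp))
    (hd : Tendsto (fun τ => Real.exp (α * τ) • deriv Λ τ) atTop (𝓝 0))
    (he : IsEquilibriumRegularEdgeState f lp η) :
    ∃ ℓ w b k m ε C q σ₀, IsEdgeBlock f Λ lp η ℓ w b k m ε C q α σ₀ := by
  obtain ⟨hη, he0, he1⟩ := he
  set A := fderiv ℝ (fun x => f x lp) η with hA
  obtain ⟨μ, c, ℓ, w, B, mB, hs⟩ := exists_isEdgeSplitting A he0 he1
  obtain ⟨k, m, hdich⟩ := hs.exists_isDichotomy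
  obtain ⟨ε₀, hε₀, C, hC⟩ := hdich.exists_isLocalDichotomy hf
  obtain ⟨K, hK, hgraph⟩ := hs.exists_stableGraph
  obtain ⟨ε₁, hε₁, hfd⟩ := exists_fderiv_inl_sub_le hf lp η (δ := 1 / (4 * K)) (by positivity)
  set ε := min ε₀ ε₁ with hε
  have hε0 : 0 < ε := lt_min hε₀ hε₁
  have hmB := hs.m_pos
  have hm := hdich.m_pos
  -- the first bound puts the block in the ball of the cone estimates, the second puts the stable
  -- components of its points in the domain of the graph
  set q := min (m * ε ^ 2 / 2) (mB * (ε / (4 * K)) ^ 2) with hq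
  have hq0 : 0 < q := by positivity
  have hqε : 2 * q ≤ m * ε ^ 2 := by
    have : q ≤ m * ε ^ 2 / 2 := min_le_left _ _
    linarith
  obtain ⟨σ₀, hblock, hdrift⟩ := exists_isFutureBlock hf hη hΛ.continuous hα hl
    (hC ε hε0 (min_le_left _ _)) hq0 hqε (δ := ε / (4 * K)) (by positivity)
  have hPsmall : ∀ z, stableForm ℓ w B z z < q → ‖projKer ℓ w z‖ < ε / (4 * K) := by
    intro z hz
    have h1 := hs.B_coercive (projKer ℓ w z)
    have h2 : mB * ‖projKer ℓ w z‖ ^ 2 < mB * (ε / (4 * K)) ^ 2 :=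
      (h1.trans_lt hz).trans_le (min_le_right _ _)
    exact lt_of_pow_lt_pow_left₀ 2 (by positivity) (lt_of_mul_lt_mul_left h2 hmB.le)
  have hPw : ∀ z (t : ℝ), projKer ℓ w (z + t • w) = projKer ℓ w z := fun z t => by
    simp only [projKer_apply, map_add, map_smul, hs.ell_w]
    module
  refine ⟨ℓ, w, stableForm ℓ w B, k, m, ε, C, q, σ₀, hblock, hs.ell_w, fun z t => ?_,
    fun r hr => ?_⟩
  · rw [stableForm_apply, stableForm_apply, hPw]
  have hg : ContDiff ℝ 1 (glueInput Λ lp α) := contDiff_glueInput hΛ hα hl hd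
  let G : Vec n × ℝ → Vec n := fun p => f (η + p.1) (glueInput Λ lp α p.2) - A p.1
  have hG : ContDiff ℝ 1 G := by
    refine ContDiff.sub ?_ (A.contDiff.comp contDiff_fst)
    exact hf.comp ((contDiff_const.add contDiff_fst).prodMk (hg.comp contDiff_snd))
  have hGz : ∀ z σ, ‖z‖ ≤ ε → σ ≤ σ₀ →
      ‖(fderiv ℝ G (z, σ)).comp (ContinuousLinearMap.inl ℝ (Vec n) ℝ)‖ ≤ 1 / (4 * K) := by
    intro z σ hz hσ
    have h1 : HasFDerivAt (fun z => G (z, σ))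
        ((fderiv ℝ G (z, σ)).comp (ContinuousLinearMap.inl ℝ (Vec n) ℝ)) z := by
      have ha : HasFDerivAt (fun z : Vec n => (z, σ)) (ContinuousLinearMap.inl ℝ (Vec n) ℝ) z :=
        hasFDerivAt_prodMk_left z σ
      exact (hG.differentiable one_ne_zero (z, σ)).hasFDerivAt.comp z ha
    have h2 : HasFDerivAt (fun z => G (z, σ))
        (fderiv ℝ (fun x => f x (glueInput Λ lp α σ)) (η + z) - A) z := by
      have hb := (hasFDerivAt_section hf (glueInput Λ lp α σ) (η + z)).differentiableAt.hasFDerivAt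
      have hc := hb.comp z ((hasFDerivAt_id z).const_add η)
      exact hc.sub A.hasFDerivAt
    rw [h1.unique h2]
    refine hfd _ _ ?_ ((hblock.input σ hσ).trans (min_le_right _ _))
    rw [add_sub_cancel_left]
    exact hz.trans (min_le_right _ _)
  have hG0 : ∀ σ ≤ σ₀, ‖G (0, σ)‖ ≤ ε / (4 * K) := by
    intro σ hσ
    simpa [G] using hdrift σ hσ
  -- in the time `τ / r` the variable `σ` decays at the rate `α r`
  obtain ⟨φ, hφ, hφsol⟩ := hgraph G ε σ₀ (α * r) hG hε0 hblock.σ₀_pos (by positivity) hGz hG0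
  refine ⟨fun p => φ (projKer ℓ w p.1, p.2), ?_, fun z t σ => ?_, fun z σ hz hσ => ?_⟩
  · refine hφ.comp ?_ fun p hp => ⟨hPsmall _ hp.1, hp.2⟩
    exact (((projKer ℓ w).contDiff.comp contDiff_fst).prodMk contDiff_snd).contDiffOn
  · simp only [hPw]
  · obtain ⟨⟨y, hy, hyR, hyφ⟩, huniq⟩ := hφsol _ _ (hPsmall z hz) hσ
    constructor
    · rintro ⟨x, hx, hx0, hxε⟩
      have h1 := hx.isHalfSol (η := η) hs hr
      have hzx : x 0 - η = z := by rw [hx0, add_sub_cancel_left]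
      rw [hzx] at h1
      have h2 := huniq (fun t => x (r * max t 0) - η) (by
        simpa only [G, add_sub_cancel] using h1) fun t =>
          hxε _ (mul_nonneg hr.le (le_max_right _ _))
      simp only [max_self, mul_zero, hzx] at h2
      exact h2
    · intro hz'
      have hy0 : y 0 = z := by
        have h1 := hy.start
        rw [projKer_of_mem ℓ w (hs.ell_projKer z)] at h1
        simp only [projKer_apply] at h1
        have h2 : ℓ (y 0) = ℓ z := by rw [hyφ, hz']
        rw [h2] at h1
        exact sub_left_injective h1
      exact ⟨_, hy.isSol hr, by simp [hy0], fun t _ => by simpa using hyR _⟩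

end EdgeBlock

/-! ### Hypersurfaces -/

section Hypersurface

/-- A level set of a `C¹` function that increases at unit speed in a fixed direction `w` is a
hypersurface, oriented by the normalized gradient. -/
lemma isEmbeddedOrientableHypersurface_of_level {O : Set (Vec n)} (hO : IsOpen O)
    {h : Vec n → ℝ} (hh : ContDiffOn ℝ 1 h O) {w : Vec n} (hw : ∀ x ∈ O, fderiv ℝ h x w = 1) :
    IsEmbeddedOrientableHypersurface {x | x ∈ O ∧ h x = 0} := by
  have hne : ∀ x ∈ O, fderiv ℝ h x ≠ 0 := fun x hx h0 => by
    have := hw x hx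
    rw [h0] at this
    simp at this
  let g : Vec n → Vec n := fun x => (InnerProductSpace.toDual ℝ (Vec n)).symm (fderiv ℝ h x)
  have hg : ContinuousOn g O :=
    (LinearIsometryEquiv.continuous _).comp_continuousOn
      (hh.continuousOn_fderiv_of_isOpen hO le_rfl)
  have hg0 : ∀ x ∈ O, ‖g x‖ ≠ 0 := fun x hx => by
    simpa [g] using hne x hx
  refine ⟨fun x => ‖g x‖⁻¹ • g x, ?_, fun x hx => ⟨?_, O, hO, hx.1, h, hh, hne x hx.1, ?_, ?_⟩⟩
  · exact ((hg.norm.inv₀ hg0).smul hg).mono fun x hx => hx.1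
  · rw [norm_smul, norm_inv, norm_norm, inv_mul_cancel₀ (hg0 x hx.1)]
  · ext y
    simp only [mem_inter_iff, mem_ofPred_eq]
    tauto
  · intro v hv
    rw [inner_smul_left]
    simp [g, InnerProductSpace.toDual_symm_apply, hv]

/-- The version in the extended phase space: that `w` lies in the slices makes the gradient, hence
the normal, have a nonzero component along the slices. -/
lemma isTransverseHypersurface_of_level {O : Set (Vec n × ℝ)} (hO : IsOpen O)
    {h : Vec n × ℝ → ℝ} (hh : ContDiffOn ℝ 1 h O) {w : Vec n}
    (hw : ∀ p ∈ O, fderiv ℝ h p (w, 0) = 1) :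
    IsTransverseHypersurface {p | p ∈ O ∧ p ∈ extPhase n ∧ h p = 0} := by
  let D : Vec n × ℝ → Vec n →L[ℝ] ℝ := fun p =>
    (fderiv ℝ h p).comp (ContinuousLinearMap.inl ℝ (Vec n) ℝ)
  let g : Vec n × ℝ → Vec n := fun p => (InnerProductSpace.toDual ℝ (Vec n)).symm (D p)
  let a : Vec n × ℝ → ℝ := fun p => fderiv ℝ h p (0, 1)
  have hc := hh.continuousOn_fderiv_of_isOpen hO le_rfl
  have hg : ContinuousOn g O :=
    (LinearIsometryEquiv.continuous _).comp_continuousOn (hc.clm_comp continuousOn_const)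
  have ha : ContinuousOn a O := hc.clm_apply continuousOn_const
  have hD0 : ∀ p ∈ O, D p ≠ 0 := fun p hp h0 => by
    have h1 : D p w = 1 := hw p hp
    rw [h0] at h1
    simp at h1
  have hg0 : ∀ p ∈ O, g p ≠ 0 := fun p hp => by simpa [g] using hD0 p hp
  let N : Vec n × ℝ → ℝ := fun p => √(‖g p‖ ^ 2 + a p ^ 2)
  have hN2 : ∀ p ∈ O, 0 < ‖g p‖ ^ 2 + a p ^ 2 := fun p hp => by
    have := norm_pos_iff.2 (hg0 p hp)
    positivity
  have hN0 : ∀ p ∈ O, N p ≠ 0 := fun p hp => (Real.sqrt_pos.2 (hN2 p hp)).ne'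
  have hN : ContinuousOn N O := ((hg.norm.pow 2).add (ha.pow 2)).sqrt
  refine ⟨fun p => ((N p)⁻¹ • g p, (N p)⁻¹ * a p), ?_, fun p hp => ⟨?_, ?_, O, hO, hp.1, h, hh,
    ?_, ?_, ?_⟩⟩
  · exact (((hN.inv₀ hN0).smul hg).prodMk ((hN.inv₀ hN0).mul ha)).mono fun p hp => hp.1
  · simp only [norm_smul, norm_inv, mul_pow, inv_pow, Real.norm_eq_abs, sq_abs]
    rw [← mul_add, Real.sq_sqrt (hN2 p hp.1).le, inv_mul_cancel₀ (hN2 p hp.1).ne']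
  · exact smul_ne_zero (inv_ne_zero (hN0 p hp.1)) (hg0 p hp.1)
  · intro h0
    exact hD0 p hp.1 (by simp [D, h0])
  · ext y
    simp only [mem_inter_iff, mem_ofPred_eq]
    tauto
  · intro v hv
    have h1 : fderiv ℝ h p v = D p v.1 + a p * v.2 := by
      have h2 : v = (v.1, (0 : ℝ)) + v.2 • ((0 : Vec n), (1 : ℝ)) := by ext <;> simp
      conv_lhs => rw [h2, map_add, map_smul]
      simp [D, a, mul_comm]
    have h3 : inner ℝ (g p) v.1 = D p v.1 := by simp [g, InnerProductSpace.toDual_symm_apply]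
    simp only [inner_smul_left, h3, RCLike.conj_to_real]
    rw [mul_assoc, ← mul_add, ← h1, hv, mul_zero]

end Hypersurface

/-! ### Regular thresholds anchored at an edge state -/

section Threshold

variable {f : Vec n → Vec d → Vec n} {Λ : ℝ → Vec d} {lm lp : Vec d} {η : Vec n}
  {k m ε C q r α ρ σ₀ τ₀ : ℝ} {ℓ : Vec n →L[ℝ] ℝ} {w : Vec n} {b : Vec n →L[ℝ] Vec n →L[ℝ] ℝ}

lemma fderiv_apply_eq_of_line {E : Type*} [NormedAddCommGroup E] [NormedSpace ℝ E] {h : E → ℝ}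
    {p v : E} {a : ℝ} (hd : DifferentiableAt ℝ h p) (hl : ∀ t : ℝ, h (p + t • v) = h p + t * a) :
    fderiv ℝ h p v = a := by
  have h1 : HasDerivAt (fun t : ℝ => h (p + t • v)) (fderiv ℝ h p v) 0 :=
    hd.hasFDerivAt.hasLineDerivAt v
  have h2 : HasDerivAt (fun t : ℝ => h (p + t • v)) a 0 := by
    simp only [hl]
    simpa using ((hasDerivAt_id (0 : ℝ)).mul_const a).const_add (h p)
  exact h1.unique h2

lemma ratio_lt_iff {s s' : ℝ} (hs : -1 < s) (hs' : -1 < s') :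
    (1 - s) / (1 + s) < (1 - s') / (1 + s') ↔ s' < s := by
  rw [div_lt_div_iff₀ (by linarith) (by linarith)]
  constructor <;> intro h <;> nlinarith

/-- The part of the block with `s > compTime α τ₀`. -/
def blockNhd (η : Vec n) (ℓ : Vec n →L[ℝ] ℝ) (b : Vec n →L[ℝ] Vec n →L[ℝ] ℝ) (q α τ₀ : ℝ) :
    Set (Vec n × ℝ) :=
  {p | unstableForm ℓ (p.1 - η) (p.1 - η) < q ∧ b (p.1 - η) (p.1 - η) < q ∧ compTime α τ₀ < p.2}

lemma isOpen_blockNhd (α : ℝ) : IsOpen (blockNhd η ℓ b q α τ₀) := by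
  have h1 : Continuous fun p : Vec n × ℝ => unstableForm ℓ (p.1 - η) (p.1 - η) := by fun_prop
  have h2 : Continuous fun p : Vec n × ℝ => b (p.1 - η) (p.1 - η) := by fun_prop
  exact (isOpen_lt h1 continuous_const).inter
    ((isOpen_lt h2 continuous_const).inter (isOpen_lt continuous_const continuous_snd))

/-- The local stable manifold of `(η, 1)` in the block is the zero set of `ℓ - φ`, as staying in
the block already implies convergence. -/
lemma mem_localStableManifold_iff (hf : ContDiff ℝ 1 (fun p : Vec n × Vec d => f p.1 p.2))
    (hη : f η lp = 0) (hΛ : Continuous Λ) (hl : Tendsto Λ atTop (𝓝 lp)) (hα : 0 < α) (hr : 0 < r)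
    (hE : IsFutureBlock f Λ lp η (unstableForm ℓ) b k m ε C q α σ₀)
    (hτ₀ : Real.exp (-(α * τ₀)) = σ₀) {φ : Vec n × ℝ → ℝ}
    (hφ : ∀ z σ, b z z < q → σ < σ₀ →
      ((∃ x, IsSol f (tailInput Λ lp α σ) r (Ici 0) x ∧ x 0 = η + z ∧ ∀ t ≥ 0, ‖x t - η‖ ≤ ε) ↔
        ℓ z = φ (z, σ))) (v : Vec n) (s : ℝ) :
    (v, s) ∈ localStableManifold (compField f Λ lm lp α r) (η, 1) (blockNhd η ℓ b q α τ₀) ↔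
      (b (v - η) (v - η) < q ∧ compTime α τ₀ < s) ∧ (v, s) ∈ extPhase n ∧
        ℓ (v - η) - φ (v - η, (1 - s) / (1 + s)) = 0 := by
  have hs₀ := (compTime_mem α τ₀).1
  have hσs : ∀ s, -1 < s → ((1 - s) / (1 + s) < σ₀ ↔ compTime α τ₀ < s) := fun s hs => by
    rw [← ratio_lt_iff hs hs₀, one_sub_compTime_div, hτ₀]
  constructor
  · rintro ⟨γ, hγ, h0, hN, -⟩
    have h1 := hN 0 le_rfl
    rw [h0] at h1
    obtain ⟨-, hb, hs⟩ := h1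
    refine ⟨⟨hb, hs⟩, by have := (hγ 0 self_mem_Ici).1; rwa [h0] at this, ?_⟩
    rw [sub_eq_zero, ← hφ _ _ hb ((hσs s (hs₀.trans hs)).2 hs)]
    obtain ⟨-, h2⟩ := hγ.isSol_tailInput hα ordConnected_Ici self_mem_Ici
      (by rw [h0]; exact hs₀.trans hs)
    rw [h0] at h2
    exact ⟨_, h2, by simp [h0], fun t ht => hE.norm_le (hN t ht).1.le (hN t ht).2.1.le⟩
  · rintro ⟨⟨hb, hs⟩, hext, hz⟩
    have hσ := (hσs s (hs₀.trans hs)).2 hs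
    rw [sub_eq_zero, ← hφ _ _ hb hσ] at hz
    obtain ⟨x, hx, hx0, hxε⟩ := hz
    rw [add_sub_cancel] at hx0
    obtain ⟨hst, hlim⟩ := hE.stays_and_tendsto hf hη hΛ hα hl hr hσ.le hx hxε (by rwa [hx0])
    obtain ⟨γ, hγ, hγ0, hγx, hγs⟩ := exists_isTrajectory_tailInput (lm := lm) hα
      ⟨hs₀.trans hs, hext.2⟩ hx
    refine ⟨γ, hγ, by rw [hγ0, hx0], fun t ht => ?_, ?_⟩
    · obtain ⟨h1, -⟩ := hγ.isSol_tailInput hα ordConnected_Ici self_mem_Ici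
        (by rw [hγ0]; exact hs₀.trans hs)
      obtain ⟨h2, h3⟩ := h1 t ht
      refine ⟨by rw [hγx]; exact (hst t ht).1, by rw [hγx]; exact (hst t ht).2, ?_⟩
      rw [← hσs _ h2, h3, hγ0]
      refine lt_of_le_of_lt (mul_le_of_le_one_right ?_ ?_) hσ
      · have := hext.2
        have h4 := hext.1
        simp only at this h4 ⊢
        exact div_nonneg (by linarith) (by linarith)
      · rw [Real.exp_le_one_iff]
        have := mul_nonneg hα.le ht
        linarith
    · have h1 : Tendsto (fun t => ((γ t).1, (γ t).2)) atTop (𝓝 (η, 1)) := by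
        simp only [hγx]
        exact hlim.prodMk_nhds hγs
      exact h1

/-- The threshold consists of the sections of the local stable manifold in the block, a zero set
of `ℓ - φ`; both are hypersurfaces because `ℓ` grows and `φ` is constant in the direction `w`. -/
theorem exists_threshold (hf : ContDiff ℝ 1 (fun p : Vec n × Vec d => f p.1 p.2))
    (hΛ : ContDiff ℝ 1 Λ) (hexp : IsExpBiAsymptoticallyConstant Λ ρ lm lp) (hα : 0 < α)
    (hαρ : α < ρ) (he : IsEquilibriumRegularEdgeState f lp η) :
    ∃ τ₀ : ℝ, ∀ r > 0, ∃ Θ : ℝ → Set (Vec n), IsRTippingThreshold f Λ r η τ₀ Θ ∧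
      ∃ N : Set (Vec n × ℝ), IsOpen N ∧ (η, 1) ∈ N ∧
        IsTransverseHypersurface (localStableManifold (compField f Λ lm lp α r) (η, 1) N) ∧
        ∀ τ > τ₀, Θ τ = {y | (y, compTime α τ) ∈
          localStableManifold (compField f Λ lm lp α r) (η, 1) N} := by
  obtain ⟨ℓ, w, b, k, m, ε, C, q, σ₀, hE⟩ := he.exists_isEdgeBlock hf hΛ hα hexp.tendsto_future
    (hexp.tendsto_exp_smul_deriv hαρ)
  have hσ₀ := hE.block.σ₀_pos
  obtain ⟨τ₀, hτ₀⟩ : ∃ τ₀, Real.exp (-(α * τ₀)) = σ₀ :=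
    ⟨-Real.log σ₀ / α, by
      rw [show -(α * (-Real.log σ₀ / α)) = Real.log σ₀ by field_simp, Real.exp_log hσ₀]⟩
  refine ⟨τ₀, fun r hr => ?_⟩
  obtain ⟨φ, hφc, hφw, hφ⟩ := hE.graph r hr
  have key := mem_localStableManifold_iff (lm := lm) hf he.1 hΛ.continuous hexp.tendsto_future hα hr
    hE.block hτ₀ hφ
  set N := blockNhd η ℓ b q α τ₀ with hN
  set W := localStableManifold (compField f Λ lm lp α r) (η, 1) N with hW
  have hbw : ∀ v (t : ℝ), b (v + t • w - η) (v + t • w - η) = b (v - η) (v - η) := fun v t => by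
    rw [add_sub_right_comm, hE.b_w]
  have hs₀ := (compTime_mem α τ₀).1
  have hbO : IsOpen {v : Vec n | b (v - η) (v - η) < q} :=
    isOpen_lt (by fun_prop) continuous_const
  refine ⟨fun τ => {y | (y, compTime α τ) ∈ W}, ⟨fun τ hτ => ?_, fun τ hτ => ?_,
    fun τ₁ hτ₁ x₀ hx₀ => ?_⟩, N, isOpen_blockNhd α, ?_, ?_, fun τ _ => rfl⟩
  · -- the point of the graph over the edge state itself
    have hσ : Real.exp (-(α * τ)) < σ₀ := by
      rw [← hτ₀]
      exact Real.exp_lt_exp.2 (neg_lt_neg (mul_lt_mul_of_pos_left hτ hα))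
    refine ⟨η + φ (0, Real.exp (-(α * τ))) • w, ?_⟩
    rw [mem_ofPred_eq, key, one_sub_compTime_div]
    refine ⟨⟨?_, compTime_strictMono hα hτ⟩, ⟨(compTime_mem _ _).1.le, (compTime_mem _ _).2.le⟩, ?_⟩
    · rw [hbw, sub_self]
      simpa using hE.block.q_pos
    · have h1 := hφw 0 (φ (0, Real.exp (-(α * τ)))) (Real.exp (-(α * τ)))
      rw [zero_add] at h1
      rw [add_sub_cancel_left, h1, map_smul, hE.ell_w]
      simp
  · have hσ : Real.exp (-(α * τ)) < σ₀ := by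
      rw [← hτ₀]
      exact Real.exp_lt_exp.2 (neg_lt_neg (mul_lt_mul_of_pos_left hτ hα))
    have hh : ContDiffOn ℝ 1 (fun v => ℓ (v - η) - φ (v - η, Real.exp (-(α * τ))))
        {v : Vec n | b (v - η) (v - η) < q} := by
      refine (ℓ.contDiff.comp (contDiff_id.sub contDiff_const)).contDiffOn.sub ?_
      exact hφc.comp ((contDiff_id.sub contDiff_const).prodMk contDiff_const).contDiffOn
        fun v hv => ⟨hv, hσ⟩
    have h1 := isEmbeddedOrientableHypersurface_of_level hbO hh (w := w) fun v hv => by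
      refine fderiv_apply_eq_of_line ((hh.differentiableOn one_ne_zero).differentiableAt
        (hbO.mem_nhds hv)) fun t => ?_
      rw [add_sub_right_comm, hφw, map_add, map_smul, hE.ell_w, smul_eq_mul]
      ring
    convert h1 using 1
    ext v
    rw [mem_ofPred_eq, key, one_sub_compTime_div]
    exact ⟨fun h => ⟨h.1.1, h.2.2⟩, fun h => ⟨⟨h.1, compTime_strictMono hα hτ⟩,
      ⟨(compTime_mem _ _).1.le, (compTime_mem _ _).2.le⟩, h.2⟩⟩
  · obtain ⟨γ, hγ, h0, hγN, hlim⟩ := hx₀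
    obtain ⟨h1, h2⟩ := hγ.isSol_of_compTime hα ordConnected_Ici self_mem_Ici (by rw [h0])
    refine ⟨fun t => (γ (t + -τ₁)).1, ?_, by simp [h0], fun τ hτ => ?_, ?_⟩
    · have := h2.comp_add (-τ₁)
      simp only [neg_add_cancel_right] at this
      exact this.mono fun t ht => by simpa using ht
    · have ht : 0 ≤ τ + -τ₁ := by linarith
      have h3 := localStableManifold_forward hγ hγN hlim ht
      have h4 : γ (τ + -τ₁) = ((γ (τ + -τ₁)).1, compTime α τ) := by
        have := h1 _ ht
        rw [neg_add_cancel_right] at this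
        exact Prod.ext rfl this
      rw [h4] at h3
      exact h3
    · exact ((continuous_fst.tendsto _).comp hlim).comp
        (tendsto_atTop_add_const_right _ _ tendsto_id)
  · refine ⟨?_, ?_, (compTime_mem _ _).2⟩ <;> simpa using hE.block.q_pos
  · set O : Set (Vec n × ℝ) := {p | b (p.1 - η) (p.1 - η) < q ∧ compTime α τ₀ < p.2} with hOdef
    have hbc : Continuous fun p : Vec n × ℝ => b (p.1 - η) (p.1 - η) := by fun_prop
    have hO : IsOpen O :=
      (isOpen_lt hbc continuous_const).inter (isOpen_lt continuous_const continuous_snd)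
    have hh : ContDiffOn ℝ 1 (fun p : Vec n × ℝ => ℓ (p.1 - η) -
        φ (p.1 - η, (1 - p.2) / (1 + p.2))) O := by
      refine (ℓ.contDiff.comp (contDiff_fst.sub contDiff_const)).contDiffOn.sub ?_
      refine hφc.comp ((contDiff_fst.sub contDiff_const).contDiffOn.prodMk
        ((contDiff_const.sub contDiff_snd).contDiffOn.div
          (contDiff_const.add contDiff_snd).contDiffOn fun p hp => ?_)) fun p hp => ⟨hp.1, ?_⟩
      · have := hs₀.trans hp.2
        linarith
      · have h1 := (ratio_lt_iff (hs₀.trans hp.2) hs₀).2 hp.2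
        rwa [one_sub_compTime_div, hτ₀] at h1
    have h1 := isTransverseHypersurface_of_level hO hh (w := w) fun p hp => by
      refine fderiv_apply_eq_of_line ((hh.differentiableOn one_ne_zero).differentiableAt
        (hO.mem_nhds hp)) fun t => ?_
      simp only [Prod.fst_add, Prod.snd_add, Prod.smul_fst, Prod.smul_snd, smul_zero, add_zero]
      rw [add_sub_right_comm, hφw, map_add, map_smul, hE.ell_w, smul_eq_mul]
      ring
    convert h1 using 1
    ext ⟨v, s⟩
    rw [key]
    rfl

end Threshold

/-! ### Leaving the block of an edge state -/

section Exit

variable {f : Vec n → Vec d → Vec n} {u : ℝ → Vec d} {l : Vec d} {η : Vec n}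
  {p b : Vec n →L[ℝ] Vec n →L[ℝ] ℝ} {k m ε C q r T : ℝ} {x y : ℝ → Vec n} {t s : ℝ}

/-- The first time at which a continuous function reaches a level. -/
lemma exists_first_hit {g : ℝ → ℝ} {a q : ℝ} (hg : ContinuousOn g (Ici a)) (ha : g a < q)
    (h : ∃ t ≥ a, q ≤ g t) : ∃ t > a, g t = q ∧ ∀ s ∈ Ico a t, g s < q := by
  obtain ⟨t₀, ht₀, hq⟩ := h
  set S := {t ∈ Icc a t₀ | q ≤ g t} with hS
  have hgc : ContinuousOn g (Icc a t₀) := hg.mono Icc_subset_Ici_self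
  have hcl : IsClosed S := hgc.preimage_isClosed_of_isClosed isClosed_Icc isClosed_Ici
  have hne : S.Nonempty := ⟨t₀, ⟨ht₀, le_rfl⟩, hq⟩
  have hbd : BddBelow S := ⟨a, fun t ht => ht.1.1⟩
  have hmem := hcl.csInf_mem hne hbd
  set c := sInf S with hc
  have hlt : ∀ s ∈ Ico a c, g s < q := fun s hs => by
    by_contra hcon
    exact absurd (csInf_le hbd ⟨⟨hs.1, hs.2.le.trans hmem.1.2⟩, not_lt.1 hcon⟩) (not_le.2 hs.2)
  have hac : a < c := lt_of_le_of_ne hmem.1.1 fun h => by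
    have := hmem.2
    rw [← h] at this
    linarith
  refine ⟨c, hac, le_antisymm ?_ hmem.2, hlt⟩
  have h1 : Tendsto g (𝓝[<] c) (𝓝 (g c)) :=
    (hgc c hmem.1).mono_left (by
      rw [nhdsWithin_le_iff]
      filter_upwards [Ioo_mem_nhdsLT hac] with s hs
      exact ⟨hs.1.le, hs.2.le.trans hmem.1.2⟩)
  refine le_of_tendsto h1 ?_
  filter_upwards [Ioo_mem_nhdsLT hac] with s hs
  exact (hlt s ⟨hs.1.le, hs.2⟩).le

lemma continuousOn_form {g : Vec n →L[ℝ] Vec n →L[ℝ] ℝ} {I : Set ℝ} (hx : ContinuousOn x I) :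
    ContinuousOn (fun t => g (x t - η) (x t - η)) I := by
  have h1 : Continuous fun v : Vec n => g (v - η) (v - η) := by fun_prop
  exact h1.comp_continuousOn hx

/-- A solution that leaves the block does so through the face `p = q`. -/
lemma IsLocalDichotomy.exists_exit (h : IsLocalDichotomy f l η p b k m ε C) (hr : 0 < r)
    (hq : 0 < q) (hqε : 2 * q ≤ m * ε ^ 2) (hx : IsSol f u r (Ici T) x)
    (hu : ∀ t ≥ T, ‖u t - l‖ ≤ ε) (hC : ∀ t ≥ T, C * ‖f η (u t)‖ ^ 2 ≤ k * q / 2)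
    (hpT : p (x T - η) (x T - η) < q) (hbT : b (x T - η) (x T - η) < q)
    (hex : ∃ t ≥ T, q ≤ max (p (x t - η) (x t - η)) (b (x t - η) (x t - η))) :
    ∃ t > T, p (x t - η) (x t - η) = q ∧
      ∀ s ∈ Icc T t, p (x s - η) (x s - η) ≤ q ∧ b (x s - η) (x s - η) ≤ q := by
  have hk := h.k_pos
  obtain ⟨t, htT, htq, hlt⟩ := exists_first_hit
    (g := fun t => max (p (x t - η) (x t - η)) (b (x t - η) (x t - η)))
    ((continuousOn_form hx.continuousOn).sup (continuousOn_form hx.continuousOn))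
    (max_lt hpT hbT) hex
  have hle : ∀ s ∈ Icc T t, p (x s - η) (x s - η) ≤ q ∧ b (x s - η) (x s - η) ≤ q := by
    intro s hs
    rcases eq_or_lt_of_le hs.2 with rfl | h1
    · exact max_le_iff.1 htq.le
    · have := max_lt_iff.1 (hlt s ⟨hs.1, h1⟩)
      exact ⟨this.1.le, this.2.le⟩
  refine ⟨t, htT, ?_, hle⟩
  have hsub : Icc T t ⊆ Ici T := Icc_subset_Ici_self
  -- as long as `p ≤ q` the quantity `b - 3 q / 4` decays, so that `b < q` at the exit time
  have h1 := le_exp_mul_of_deriv_le (convex_Icc T t) (k := 4 * r⁻¹ * k)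
    (w := fun t => b (x t - η) (x t - η) - 3 / 4 * q)
    (fun s hs => (((hx.mono hsub).hasDerivWithinAt_form_sub_const h.b_symm η hs).sub_const _))
    (fun s hs => ?_) (left_mem_Icc.2 htT.le) (right_mem_Icc.2 htT.le) htT.le
  · have hE : Real.exp (-(4 * r⁻¹ * k * (t - T))) ≤ 1 := Real.exp_le_one_iff.2 (by
      have : 0 ≤ 4 * r⁻¹ * k * (t - T) := mul_nonneg (by positivity) (sub_nonneg.2 htT.le)
      linarith)
    have hE0 := Real.exp_pos (-(4 * r⁻¹ * k * (t - T)))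
    have hbt : b (x t - η) (x t - η) < q := by
      have h1' : b (x t - η) (x t - η) - 3 / 4 * q ≤ Real.exp (-(4 * r⁻¹ * k * (t - T))) *
        (b (x T - η) (x T - η) - 3 / 4 * q) := h1
      rcases le_total (b (x T - η) (x T - η) - 3 / 4 * q) 0 with h5 | h5 <;> nlinarith
    rcases max_choice (p (x t - η) (x t - η)) (b (x t - η) (x t - η)) with h2 | h2
    · rw [← h2]; exact htq
    · exfalso
      have : max (p (x t - η) (x t - η)) (b (x t - η) (x t - η)) = q := htq
      rw [h2] at this
      linarith
  · have h2 := h.b_rate_equilibrium hr (h.norm_le hqε (hle s hs).1 (hle s hs).2) (hu s (hsub hs))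
    have h3 : 2 * r⁻¹ * C * ‖f η (u s)‖ ^ 2 ≤ 2 * r⁻¹ * (k * q / 2) := by
      rw [mul_assoc _ C]
      exact mul_le_mul_of_nonneg_left (hC s (hsub hs)) (by positivity)
    have h4 : 2 * r⁻¹ * k * p (x s - η) (x s - η) ≤ 2 * r⁻¹ * k * q :=
      mul_le_mul_of_nonneg_left (hle s hs).1 (by positivity)
    linarith

/-- Solutions that stay near the edge state in backward time differ mostly in the unstable
direction. -/
lemma IsLocalDichotomy.le_of_past (h : IsLocalDichotomy f l η p b k m ε C) (hr : 0 < r)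
    (hx : IsSol f u r (Iic T) x) (hy : IsSol f u r (Iic T) y) (hxε : ∀ t ≤ T, ‖x t - η‖ ≤ ε)
    (hyε : ∀ t ≤ T, ‖y t - η‖ ≤ ε) (hu : ∀ t ≤ T, ‖u t - l‖ ≤ ε) :
    ∀ t ≤ T, b (x t - y t) (x t - y t) ≤ p (x t - y t) (x t - y t) := by
  have hk := h.k_pos
  -- the difference `b - p` contracts forwards and is bounded above backwards
  have h1 := nonpos_of_deriv_le_of_bddAbove (T := T) (k := 2 * r⁻¹ * k) (M := ‖b‖ * (2 * ε) ^ 2)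
    (by positivity)
    (w := fun t => b (x t - y t) (x t - y t) - p (x t - y t) (x t - y t))
    (fun t ht => (IsSol.hasDerivWithinAt_form_sub h.b_symm hx hy ht).sub
      (IsSol.hasDerivWithinAt_form_sub h.p_symm hx hy ht)) (fun t ht => ?_) (fun t ht => ?_)
  · intro t ht
    have := h1 t ht
    linarith
  · have h2 := h.b_rate hr (hxε t ht) (hyε t ht) (hu t ht)
    have h3 := h.p_rate hr (hxε t ht) (hyε t ht) (hu t ht)
    have h4 : 0 ≤ 2 * r⁻¹ * k * p (x t - y t) (x t - y t) :=
      mul_nonneg (by positivity) (h.p_nonneg _)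
    linarith
  · have h2 := form_le b (x t - y t)
    have h3 : ‖x t - y t‖ ≤ 2 * ε := by
      calc ‖x t - y t‖ = ‖(x t - η) - (y t - η)‖ := by congr 1; abel
        _ ≤ ‖x t - η‖ + ‖y t - η‖ := norm_sub_le _ _
        _ ≤ 2 * ε := by linarith [hxε t ht, hyε t ht]
    have h4 : ‖b‖ * ‖x t - y t‖ ^ 2 ≤ ‖b‖ * (2 * ε) ^ 2 := by gcongr
    have h5 := h.p_nonneg (x t - y t)
    linarith

/-- In the unstable cone the unstable part determines the vector to be zero. -/
lemma IsLocalDichotomy.eq_zero (h : IsLocalDichotomy f l η p b k m ε C) {z : Vec n}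
    (hb : b z z ≤ p z z) (hp : p z z = 0) : z = 0 := by
  have h1 := h.coercive z
  have h2 : m * ‖z‖ ^ 2 ≤ 0 := by linarith
  have h3 : ‖z‖ ^ 2 ≤ 0 := by
    by_contra h5
    have := mul_pos h.m_pos (not_le.1 h5)
    linarith
  exact norm_eq_zero.1 (pow_eq_zero_iff two_ne_zero |>.1 (le_antisymm h3 (sq_nonneg _)))

lemma isSol_const {I : Set ℝ} (hη : f η l = 0) : IsSol f (fun _ => l) r I fun _ => η := fun t _ => by
  simpa [hη] using hasDerivWithinAt_const t I η

/-- Backward in time the unstable part decays exponentially along an orbit of the frozen system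
that stays near the edge state. -/
lemma IsLocalDichotomy.decay_past (h : IsLocalDichotomy f l η p b k m ε C) (hr : 0 < r)
    (hη : f η l = 0) (hx : IsSol f (fun _ => l) r (Iic T) x) (hxε : ∀ t ≤ T, ‖x t - η‖ ≤ ε)
    (ht : t ≤ T) (hst : s ≤ t) :
    p (x s - η) (x s - η) ≤ Real.exp (-(2 * r⁻¹ * k * (t - s))) * p (x t - η) (x t - η) := by
  have hε := h.ε_pos
  have hc := h.le_of_past hr hx (isSol_const hη) hxε (fun t _ => by simpa using hε.le)
    (fun t _ => by simpa using hε.le)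
  have h1 := le_exp_mul_of_deriv_le (convex_Iic T) (k := -(2 * r⁻¹ * k))
    (w := fun t => -p (x t - η) (x t - η))
    (fun s hs => (hx.hasDerivWithinAt_form_sub_const h.p_symm η hs).neg) (fun s hs => ?_)
    (hst.trans ht) ht hst
  · simp only [neg_mul, neg_neg] at h1
    have h2 : Real.exp (-(2 * r⁻¹ * k * (t - s))) * Real.exp (2 * r⁻¹ * k * (t - s)) = 1 := by
      rw [← Real.exp_add]; simp
    calc p (x s - η) (x s - η) = (Real.exp (-(2 * r⁻¹ * k * (t - s))) *
          Real.exp (2 * r⁻¹ * k * (t - s))) * p (x s - η) (x s - η) := by rw [h2, one_mul]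
      _ = Real.exp (-(2 * r⁻¹ * k * (t - s))) *
          (Real.exp (2 * r⁻¹ * k * (t - s)) * p (x s - η) (x s - η)) := by ring
      _ ≤ _ := by gcongr; linarith
  · have h2 := h.p_rate hr (y := η) (hxε s hs) (by simpa using hε.le) (l' := l) (by simpa using hε.le)
    rw [hη, sub_zero] at h2
    have h3 : 2 * r⁻¹ * k * b (x s - η) (x s - η) ≤ 2 * r⁻¹ * k * p (x s - η) (x s - η) :=
      mul_le_mul_of_nonneg_left (hc s hs) (by have := h.k_pos; positivity)
    linarith

/-- An orbit of the frozen system that stays near the edge state backwards in time belongs to its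
unstable manifold. -/
lemma IsLocalDichotomy.tendsto_past (h : IsLocalDichotomy f l η p b k m ε C) (hr : 0 < r)
    (hη : f η l = 0) (hx : IsSol f (fun _ => l) r (Iic T) x) (hxε : ∀ t ≤ T, ‖x t - η‖ ≤ ε) :
    Tendsto x atBot (𝓝 η) := by
  have hε := h.ε_pos
  have hm := h.m_pos
  have hk := h.k_pos
  have hc := h.le_of_past hr hx (isSol_const hη) hxε (fun t _ => by simpa using hε.le)
    (fun t _ => by simpa using hε.le)
  have hlim : Tendsto (fun s => m⁻¹ * (2 * (Real.exp (-(2 * r⁻¹ * k * (T - s))) *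
      p (x T - η) (x T - η)))) atBot (𝓝 (m⁻¹ * (2 * (0 * p (x T - η) (x T - η))))) := by
    refine ((Tendsto.mul_const _ (Real.tendsto_exp_atBot.comp ?_)).const_mul 2).const_mul m⁻¹
    have : (fun s => -(2 * r⁻¹ * k * (T - s))) = fun s => 2 * r⁻¹ * k * s + -(2 * r⁻¹ * k * T) := by
      ext; ring
    rw [this]
    exact tendsto_atBot_add_const_right _ _ (tendsto_id.const_mul_atBot (by positivity))
  simp only [zero_mul, mul_zero] at hlim
  have h3 : Tendsto (fun t => ‖x t - η‖ ^ 2) atBot (𝓝 0) := by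
    refine tendsto_of_tendsto_of_tendsto_of_le_of_le' tendsto_const_nhds hlim
      (.of_forall fun t => sq_nonneg _) ?_
    filter_upwards [eventually_le_atBot T] with t ht
    rw [inv_mul_eq_div, le_div_iff₀ hm, mul_comm]
    have h4 := h.coercive (x t - η)
    have h5 := hc t ht
    have h6 := h.decay_past hr hη hx hxε le_rfl ht
    linarith
  rw [tendsto_iff_norm_sub_tendsto_zero]
  have h5 := h3.sqrt
  simpa [Real.sqrt_sq (norm_nonneg _)] using h5

/-- Solutions that have spent longer and longer times in a compact set accumulate, at time `0`, at
a state whose backward orbit under the limit system stays in this set. -/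
lemma exists_past_limit (hf : ContDiff ℝ 1 (fun p : Vec n × Vec d => f p.1 p.2)) {D : Set (Vec n)}
    (hD : IsCompact D) {v : ℝ → Vec d} (hv : Continuous v) {L : ℝ} (hL : ∀ t, ‖v t‖ ≤ L) {rs : ℕ → ℝ} (hrs : Tendsto (fun j => (rs j)⁻¹) atTop (𝓝 r⁻¹))
    {us : ℕ → ℝ → Vec d} (hus : ∀ j, Continuous (us j)) {Ts : ℕ → ℝ} (hTs : Tendsto Ts atTop atTop)
    (hul : ∀ S ≤ 0, TendstoUniformlyOn us v atTop (Icc S 0)) {xs : ℕ → ℝ → Vec n}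
    (hxs : ∀ j, IsSol f (us j) (rs j) (Icc (-(Ts j)) 0) (xs j))
    (hin : ∀ j, ∀ t ∈ Icc (-(Ts j)) 0, xs j t ∈ D) (hTs0 : ∀ j, 0 ≤ Ts j) :
    ∃ (x : ℝ → Vec n) (φ : ℕ → ℕ), StrictMono φ ∧ Tendsto (fun j => xs (φ j) 0) atTop (𝓝 (x 0)) ∧
      IsSol f v r (Iic 0) x ∧ ∀ t ≤ 0, x t ∈ D := by
  obtain ⟨R, hR⟩ := hD.isBounded.exists_norm_le
  obtain ⟨F, hF, K, M, hT⟩ := exists_tame hf R L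
  obtain ⟨P, hP, φ, hφ, hlim⟩ := hD.tendsto_subseq (x := fun j => xs j 0)
    fun j => hin j 0 ⟨by simpa using hTs0 j, le_rfl⟩
  obtain ⟨x, hx, hx0⟩ := hT.exists_isSol hv hL r 0 P
  have hxD : ∀ t ≤ 0, x t ∈ D := by
    intro t ht
    have hev : ∀ᶠ j in atTop, -(Ts (φ j)) ≤ t := by
      filter_upwards [(hTs.comp hφ.tendsto_atTop).eventually_ge_atTop (-t)] with j hj
      simp only [Function.comp] at hj
      linarith
    have h1 : Tendsto (fun j => xs (φ j) t) atTop (𝓝 (x t)) := by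
      refine IsSol.tendsto_left hT.contDiff hv ht
        (hx.mono (subset_univ _)) (r' := fun j => rs (φ j)) (Λ' := fun j => us (φ j)) ?_
        (fun j => hus _) (hrs.comp hφ.tendsto_atTop) ?_ (by rw [hx0]; exact hlim)
        (left_mem_Icc.2 ht)
      · filter_upwards [hev] with j hj
        exact ((hxs (φ j)).congr_field fun s hs => hF _ _ (hR _ (hin _ s hs))).mono
          (Icc_subset_Icc hj le_rfl)
      · exact fun N hN => hφ.tendsto_atTop.eventually (hul t ht N hN)
    refine hD.isClosed.mem_of_tendsto h1 ?_
    filter_upwards [hev] with j hj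
    exact hin _ t ⟨hj, ht⟩
  refine ⟨x, φ, hφ, by rw [hx0]; exact hlim, ?_, hxD⟩
  exact (hx.mono (subset_univ _)).congr_field fun t ht => (hF _ _ (hR _ (hxD t ht))).symm

end Exit

/-! ### The branches of the unstable manifold -/

section Orbits

variable {f : Vec n → Vec d → Vec n} {Λ : ℝ → Vec d} {lm lp l : Vec d} {η v y z : Vec n} {α r : ℝ}

/-- `y` lies on the forward orbit of `v` under the system frozen at `l`. -/
def Reaches (f : Vec n → Vec d → Vec n) (l : Vec d) (r : ℝ) (v y : Vec n) : Prop :=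
  ∃ t ≥ 0, ∃ x, IsSol f (fun _ => l) r (Icc 0 t) x ∧ x 0 = v ∧ x t = y

lemma reaches_of_isSol {I : Set ℝ} (hI : I.OrdConnected) {x : ℝ → Vec n}
    (hx : IsSol f (fun _ => l) r I x) {s t : ℝ} (hs : s ∈ I) (ht : t ∈ I) (hst : s ≤ t) :
    Reaches f l r (x s) (x t) := by
  refine ⟨t - s, sub_nonneg.2 hst, fun a => x (a + s), (hx.comp_add s).mono fun a ha => ?_, by simp,
    by simp⟩
  exact hI.out hs ht ⟨by linarith [ha.1], by linarith [ha.2]⟩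

lemma Reaches.trans (h1 : Reaches f l r v y) (h2 : Reaches f l r y z) : Reaches f l r v z := by
  obtain ⟨t₁, ht₁, x₁, hx₁, rfl, rfl⟩ := h1
  obtain ⟨t₂, ht₂, x₂, hx₂, h0, rfl⟩ := h2
  have h3 : IsSol f (fun _ => l) r (Icc t₁ (t₁ + t₂)) (fun a => x₂ (a + -t₁)) :=
    (hx₂.comp_add (-t₁)).mono fun a ha => ⟨by linarith [ha.1], by linarith [ha.2]⟩
  obtain ⟨x, hx, e1, e2⟩ := hx₁.glue (b := t₁) (fun a ha => ha.2) (fun a ha => ha.1)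
    (right_mem_Icc.2 ht₁) (left_mem_Icc.2 (by linarith)) h3 (by simp [h0])
  rw [Icc_union_Icc_eq_Icc ht₁ (by linarith)] at hx
  refine ⟨t₁ + t₂, by linarith, x, hx, e1 (left_mem_Icc.2 ht₁), ?_⟩
  rw [e2 (right_mem_Icc.2 (by linarith))]
  simp

/-- States on the same forward orbit are comparable. -/
lemma Reaches.total_of_source (hf : ContDiff ℝ 1 (fun p : Vec n × Vec d => f p.1 p.2))
    (h1 : Reaches f l r v y) (h2 : Reaches f l r v z) : Reaches f l r y z ∨ Reaches f l r z y := by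
  have key : ∀ {y z t₁ t₂} {x₁ x₂ : ℝ → Vec n}, 0 ≤ t₁ → t₁ ≤ t₂ →
      IsSol f (fun _ => l) r (Icc 0 t₁) x₁ → x₁ 0 = v → x₁ t₁ = y →
      IsSol f (fun _ => l) r (Icc 0 t₂) x₂ → x₂ 0 = v → x₂ t₂ = z → Reaches f l r y z := by
    intro y z t₁ t₂ x₁ x₂ ht₁ ht hx₁ h1 h1' hx₂ h2 h2'
    have h3 := IsSol.eqOn hf continuous_const ordConnected_Icc hx₁
      (hx₂.mono (Icc_subset_Icc le_rfl ht)) (left_mem_Icc.2 ht₁) (h1.trans h2.symm)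
      (right_mem_Icc.2 ht₁)
    rw [← h1', ← h2', h3]
    exact reaches_of_isSol ordConnected_Icc hx₂ ⟨ht₁, ht⟩ (right_mem_Icc.2 (ht₁.trans ht)) ht
  obtain ⟨t₁, ht₁, x₁, hx₁, h1, h1'⟩ := h1
  obtain ⟨t₂, ht₂, x₂, hx₂, h2, h2'⟩ := h2
  rcases le_total t₁ t₂ with h | h
  · exact Or.inl (key ht₁ h hx₁ h1 h1' hx₂ h2 h2')
  · exact Or.inr (key ht₂ h hx₂ h2 h2' hx₁ h1 h1')

/-- States with a common future are comparable, by backward uniqueness. -/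
lemma Reaches.total_of_target (hf : ContDiff ℝ 1 (fun p : Vec n × Vec d => f p.1 p.2))
    (h1 : Reaches f l r y v) (h2 : Reaches f l r z v) : Reaches f l r y z ∨ Reaches f l r z y := by
  have key : ∀ {y z t₁ t₂} {x₁ x₂ : ℝ → Vec n}, 0 ≤ t₁ → t₁ ≤ t₂ →
      IsSol f (fun _ => l) r (Icc 0 t₁) x₁ → x₁ 0 = y → x₁ t₁ = v →
      IsSol f (fun _ => l) r (Icc 0 t₂) x₂ → x₂ 0 = z → x₂ t₂ = v → Reaches f l r z y := by
    intro y z t₁ t₂ x₁ x₂ ht₁ ht hx₁ h1 h1' hx₂ h2 h2'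
    have h3 := IsSol.eqOn hf continuous_const ordConnected_Icc hx₁
      ((hx₂.comp_add (t₂ - t₁)).mono (J := Icc 0 t₁) fun a ha =>
        ⟨by linarith [ha.1], by linarith [ha.2]⟩) (right_mem_Icc.2 ht₁)
      (by simp only [add_sub_cancel]; exact h1'.trans h2'.symm) (left_mem_Icc.2 ht₁)
    simp only [zero_add] at h3
    rw [← h1, ← h2, h3]
    exact reaches_of_isSol ordConnected_Icc hx₂ (left_mem_Icc.2 (ht₁.trans ht))
      ⟨by linarith, by linarith⟩ (by linarith)
  obtain ⟨t₁, ht₁, x₁, hx₁, h1, h1'⟩ := h1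
  obtain ⟨t₂, ht₂, x₂, hx₂, h2, h2'⟩ := h2
  rcases le_total t₁ t₂ with h | h
  · exact Or.inr (key ht₁ h hx₁ h1 h1' hx₂ h2 h2')
  · exact Or.inl (key ht₂ h hx₂ h2 h2' hx₁ h1 h1')

/-- Orbits in the slice `s = 1` are the two-sided orbits of the future limit system. -/
lemma mem_orbit_one_iff {q' : Vec n × ℝ} :
    q' ∈ orbit (compField f Λ lm lp α r) (v, 1) ↔
      q'.2 = 1 ∧ (Reaches f lp r v q'.1 ∨ Reaches f lp r q'.1 v) := by
  constructor
  · rintro ⟨t, γ, hγ, h0, rfl⟩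
    obtain ⟨h1, h2⟩ := hγ.isSol_of_one ordConnected_uIcc left_mem_uIcc (by rw [h0])
    refine ⟨h1 t right_mem_uIcc, ?_⟩
    rcases le_total 0 t with ht | ht
    · have := reaches_of_isSol ordConnected_uIcc h2 left_mem_uIcc right_mem_uIcc ht
      rw [h0] at this
      exact Or.inl this
    · have := reaches_of_isSol ordConnected_uIcc h2 right_mem_uIcc left_mem_uIcc ht
      rw [h0] at this
      exact Or.inr this
  · obtain ⟨y, s⟩ := q'
    rintro ⟨h, ⟨t, ht, x, hx, h0, h1⟩ | ⟨t, ht, x, hx, h0, h1⟩⟩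
    · simp only at h h0 h1
      subst h h0 h1
      exact ⟨t, _, isTrajectory_one (by rwa [uIcc_of_le ht]), rfl, rfl⟩
    · simp only at h h0 h1
      subst h h0 h1
      refine ⟨-t, _, isTrajectory_one ((hx.comp_add t).mono fun a ha => ?_), by simp, by simp⟩
      rw [uIcc_of_ge (by linarith)] at ha
      exact ⟨by linarith [ha.1], by linarith [ha.2]⟩

/-- Orbits in the slice `s = 1` through comparable states coincide. -/
lemma orbit_one_eq (hf : ContDiff ℝ 1 (fun p : Vec n × Vec d => f p.1 p.2))
    (h : Reaches f lp r v y ∨ Reaches f lp r y v) :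
    orbit (compField f Λ lm lp α r) (v, 1) = orbit (compField f Λ lm lp α r) (y, 1) := by
  have key : ∀ {v y z : Vec n}, (Reaches f lp r v y ∨ Reaches f lp r y v) →
      (Reaches f lp r v z ∨ Reaches f lp r z v) → (Reaches f lp r y z ∨ Reaches f lp r z y) := by
    rintro v y z (h1 | h1) (h2 | h2)
    · exact h1.total_of_source hf h2
    · exact Or.inr (h2.trans h1)
    · exact Or.inl (h1.trans h2)
    · exact h1.total_of_target hf h2
  ext q'
  rw [mem_orbit_one_iff, mem_orbit_one_iff]
  exact and_congr_right fun _ => ⟨key h, key h.symm⟩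

/-- The unstable manifold of `(η, 1)` lies in the slice `s = 1`: all other trajectories tend to
the slice `s = -1` backwards in time. -/
lemma mem_unstableManifold_future_iff (hα : 0 < α) {s : ℝ} :
    (v, s) ∈ unstableManifold (compField f Λ lm lp α r) (η, 1) ↔
      s = 1 ∧ ∃ x, IsSol f (fun _ => lp) r (Iic 0) x ∧ x 0 = v ∧ Tendsto x atBot (𝓝 η) := by
  constructor
  · rintro ⟨γ, hγ, h0, hlim⟩
    have h2 : Tendsto (fun t => (γ t).2) atBot (𝓝 1) := (continuous_snd.tendsto _).comp hlim
    have hs := (hγ 0 self_mem_Iic).1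
    rw [h0] at hs
    rcases eq_endpoint_or_compTime hα hs with h1 | h1 | ⟨τ, h1⟩
    · exfalso
      obtain ⟨h3, -⟩ := hγ.isSol_of_neg_one ordConnected_Iic self_mem_Iic (by rw [h0]; exact h1)
      have h4 : Tendsto (fun t => (γ t).2) atBot (𝓝 (-1)) := tendsto_const_nhds.congr' (by
        filter_upwards [eventually_le_atBot 0] with t ht using (h3 t ht).symm)
      have := tendsto_nhds_unique h2 h4
      norm_num at this
    · obtain ⟨-, h3⟩ := hγ.isSol_of_one ordConnected_Iic self_mem_Iic (by rw [h0]; exact h1)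
      exact ⟨h1, _, h3, by simp [h0], (continuous_fst.tendsto _).comp hlim⟩
    · exfalso
      obtain ⟨h3, -⟩ := hγ.isSol_of_compTime hα ordConnected_Iic self_mem_Iic
        (by rw [h0]; exact h1)
      have h4 : Tendsto (fun t => (γ t).2) atBot (𝓝 (-1)) :=
        ((tendsto_compTime_atBot hα).comp
          (tendsto_atBot_add_const_right _ τ tendsto_id)).congr' (by
          filter_upwards [eventually_le_atBot 0] with t ht using (h3 t ht).symm)
      have := tendsto_nhds_unique h2 h4
      norm_num at this
  · rintro ⟨rfl, x, hx, rfl, hlim⟩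
    exact ⟨_, isTrajectory_one hx, rfl, hlim.prodMk_nhds tendsto_const_nhds⟩

end Orbits

section ExitLimit

variable {f : Vec n → Vec d → Vec n} {u : ℝ → Vec d} {l : Vec d} {η : Vec n}
  {p b : Vec n →L[ℝ] Vec n →L[ℝ] ℝ} {k m ε C q r : ℝ} {x : ℝ → Vec n}
  {rs τs : ℕ → ℝ} {zs : ℕ → ℝ → Vec n}

/-- Solutions that start closer and closer to a solution staying inside the block leave the block
later and later. -/
lemma tendsto_exit_time (hf : ContDiff ℝ 1 (fun p : Vec n × Vec d => f p.1 p.2))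
    (hu : Continuous u) (hx : IsSol f u r (Ici 0) x)
    (hin : ∀ t ≥ 0, p (x t - η) (x t - η) < q)
    (hrs : Tendsto (fun j => (rs j)⁻¹) atTop (𝓝 r⁻¹))
    (h0 : Tendsto (fun j => zs j 0) atTop (𝓝 (x 0))) (hτ : ∀ j, 0 ≤ τs j)
    (hzs : ∀ j, IsSol f u (rs j) (Icc 0 (τs j)) (zs j))
    (hq : ∀ j, p (zs j (τs j) - η) (zs j (τs j) - η) = q) : Tendsto τs atTop atTop := by
  rw [tendsto_atTop]
  intro S
  have hS : 0 ≤ max S 0 := le_max_right _ _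
  have hx' : IsSol f u r (Icc 0 (max S 0)) x := hx.mono Icc_subset_Ici_self
  have hcont : Continuous fun v : Vec n => p (v - η) (v - η) := by fun_prop
  have hopen : IsOpen {v : Vec n | p (v - η) (v - η) < q} := isOpen_lt hcont continuous_const
  have hK : IsCompact (x '' Icc 0 (max S 0)) := isCompact_Icc.image_of_continuousOn hx'.continuousOn
  obtain ⟨δ, hδ, hsub⟩ := hK.exists_thickening_subset_open hopen (by
    rintro _ ⟨t, ht, rfl⟩
    exact hin t ht.1)
  obtain ⟨δ', hδ', H⟩ := hx'.exists_near hf hu hS hδ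
  filter_upwards [Metric.tendsto_nhds.1 hrs δ' hδ', Metric.tendsto_nhds.1 h0 δ' hδ'] with j h1 h2
  by_contra hlt
  have hle : τs j ≤ max S 0 := (not_le.1 hlt).le.trans (le_max_left _ _)
  obtain ⟨z, hz, hz0, hzx⟩ := H (rs j) u (zs j 0) hu (by simpa [Real.dist_eq] using h1)
    (fun t _ => by simpa using hδ') (by rwa [← dist_eq_norm])
  have heq := IsSol.eqOn hf hu ordConnected_Icc (hzs j) (hz.mono (Icc_subset_Icc le_rfl hle))
    (left_mem_Icc.2 (hτ j)) hz0.symm (right_mem_Icc.2 (hτ j))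
  have hmem : zs j (τs j) ∈ {v : Vec n | p (v - η) (v - η) < q} := by
    refine hsub (Metric.mem_thickening_iff.2 ⟨_, mem_image_of_mem _ ⟨hτ j, hle⟩, ?_⟩)
    rw [heq, dist_eq_norm]
    exact hzx _ ⟨hτ j, hle⟩
  exact absurd (hq j) (ne_of_lt hmem)

lemma tendstoUniformlyOn_shift (hul : Tendsto u atTop (𝓝 l)) (hτs : Tendsto τs atTop atTop)
    (a c : ℝ) : TendstoUniformlyOn (fun j t => u (t + τs j)) (fun _ => l) atTop (Icc a c) := by
  rw [Metric.tendstoUniformlyOn_iff]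
  intro δ hδ
  obtain ⟨A, hA⟩ := eventually_atTop.1 (Metric.tendsto_nhds.1 hul δ hδ)
  filter_upwards [hτs.eventually_ge_atTop (A - a)] with j hj t ht
  rw [dist_comm]
  exact hA _ (by linarith [ht.1])

/-- States at which solutions leave the block after longer and longer times accumulate on the
unstable manifold of the edge state of the limit system. -/
lemma IsLocalDichotomy.exists_exit_limit (h : IsLocalDichotomy f l η p b k m ε C)
    (hf : ContDiff ℝ 1 (fun p : Vec n × Vec d => f p.1 p.2)) (hη : f η l = 0) (hr : 0 < r)
    (hqε : 2 * q ≤ m * ε ^ 2) (hu : Continuous u) (hul : Tendsto u atTop (𝓝 l))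
    (hrs : Tendsto (fun j => (rs j)⁻¹) atTop (𝓝 r⁻¹)) (hτ : ∀ j, 0 ≤ τs j)
    (hτs : Tendsto τs atTop atTop) (hzs : ∀ j, IsSol f u (rs j) (Icc 0 (τs j)) (zs j))
    (hq : ∀ j, p (zs j (τs j) - η) (zs j (τs j) - η) = q)
    (hin : ∀ j, ∀ t ∈ Icc 0 (τs j), p (zs j t - η) (zs j t - η) ≤ q ∧
      b (zs j t - η) (zs j t - η) ≤ q) :
    ∃ (x : ℝ → Vec n) (φ : ℕ → ℕ), StrictMono φ ∧
      Tendsto (fun j => zs (φ j) (τs (φ j))) atTop (𝓝 (x 0)) ∧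
      IsSol f (fun _ => l) r (Iic 0) x ∧
      (∀ t ≤ 0, p (x t - η) (x t - η) ≤ q ∧ b (x t - η) (x t - η) ≤ q) ∧
      p (x 0 - η) (x 0 - η) = q ∧ Tendsto x atBot (𝓝 η) := by
  have hcp : Continuous fun v : Vec n => p (v - η) (v - η) := by fun_prop
  have hcb : Continuous fun v : Vec n => b (v - η) (v - η) := by fun_prop
  set D : Set (Vec n) := {v | p (v - η) (v - η) ≤ q ∧ b (v - η) (v - η) ≤ q} with hD
  have hDc : IsCompact D := by
    refine (isCompact_closedBall η ε).of_isClosed_subset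
      ((isClosed_le hcp continuous_const).inter (isClosed_le hcb continuous_const)) fun v hv => ?_
    rw [mem_closedBall_iff_norm]
    exact h.norm_le hqε hv.1 hv.2
  obtain ⟨x, φ, hφ, hlim, hx, hxD⟩ := exists_past_limit hf hDc (v := fun _ => l)
    continuous_const (fun _ => le_rfl) hrs
    (us := fun j t => u (t + τs j)) (fun j => hu.comp (by fun_prop)) hτs
    (fun S _ => tendstoUniformlyOn_shift hul hτs S 0)
    (xs := fun j t => zs j (t + τs j))
    (fun j => ((hzs j).comp_add (τs j)).mono fun t ht =>
      ⟨by linarith [ht.1], by linarith [ht.2]⟩)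
    (fun j t ht => hin j _ ⟨by linarith [ht.1], by linarith [ht.2]⟩) hτ
  simp only [zero_add] at hlim
  refine ⟨x, φ, hφ, hlim, hx, hxD, ?_, ?_⟩
  · exact tendsto_nhds_unique ((hcp.tendsto _).comp hlim) (tendsto_const_nhds.congr fun j =>
      (hq _).symm)
  · exact h.tendsto_past hr hη hx fun t ht => h.norm_le hqε (hxD t ht).1 (hxD t ht).2

/-- Forward in time the unstable part grows exponentially along an orbit of the frozen system that
starts in the unstable cone, as long as it stays near the edge state. -/
lemma IsLocalDichotomy.expand (h : IsLocalDichotomy f l η p b k m ε C) (hr : 0 < r)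
    (hη : f η l = 0) {T : ℝ} (hx : IsSol f (fun _ => l) r (Icc 0 T) x)
    (hxε : ∀ t ∈ Icc 0 T, ‖x t - η‖ ≤ ε) (h0 : b (x 0 - η) (x 0 - η) ≤ p (x 0 - η) (x 0 - η)) :
    ∀ t ∈ Icc 0 T, Real.exp (2 * r⁻¹ * k * t) * p (x 0 - η) (x 0 - η) ≤ p (x t - η) (x t - η) := by
  have hk := h.k_pos
  have hε := h.ε_pos
  have hP : ∀ s ∈ Icc 0 T, _ := fun s hs =>
    h.p_rate hr (y := η) (hxε s hs) (by simpa using hε.le) (l' := l) (by simpa using hε.le)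
  have hB : ∀ s ∈ Icc 0 T, _ := fun s hs =>
    h.b_rate hr (y := η) (hxε s hs) (by simpa using hε.le) (l' := l) (by simpa using hε.le)
  simp only [hη, sub_zero] at hP hB
  have hc : ∀ t ∈ Icc 0 T, b (x t - η) (x t - η) ≤ p (x t - η) (x t - η) := by
    intro t ht
    have h1 := le_exp_mul_of_deriv_le (convex_Icc 0 T) (k := 2 * r⁻¹ * k)
      (w := fun t => b (x t - η) (x t - η) - p (x t - η) (x t - η))
      (fun s hs => (hx.hasDerivWithinAt_form_sub_const h.b_symm η hs).sub
        (hx.hasDerivWithinAt_form_sub_const h.p_symm η hs)) (fun s hs => ?_)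
      (left_mem_Icc.2 (ht.1.trans ht.2)) ht ht.1
    · have h2 : Real.exp (-(2 * r⁻¹ * k * (t - 0))) *
          (b (x 0 - η) (x 0 - η) - p (x 0 - η) (x 0 - η)) ≤ 0 :=
        mul_nonpos_of_nonneg_of_nonpos (Real.exp_pos _).le (sub_nonpos.2 h0)
      exact sub_nonpos.1 (h1.trans h2)
    · have h2 := hP s hs
      have h3 := hB s hs
      have h4 : 0 ≤ 2 * r⁻¹ * k * p (x s - η) (x s - η) :=
        mul_nonneg (by positivity) (h.p_nonneg _)
      linarith
  intro t ht
  have h1 := le_exp_mul_of_deriv_le (convex_Icc 0 T) (k := -(2 * r⁻¹ * k))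
    (w := fun t => -p (x t - η) (x t - η))
    (fun s hs => (hx.hasDerivWithinAt_form_sub_const h.p_symm η hs).neg) (fun s hs => ?_)
    (left_mem_Icc.2 (ht.1.trans ht.2)) ht ht.1
  · simp only [neg_mul, neg_neg, sub_zero] at h1
    linarith
  · have h2 := hP s hs
    have h3 : 2 * r⁻¹ * k * b (x s - η) (x s - η) ≤ 2 * r⁻¹ * k * p (x s - η) (x s - η) :=
      mul_le_mul_of_nonneg_left (hc s hs) (by positivity)
    linarith

end ExitLimit

section Branches

variable {f : Vec n → Vec d → Vec n} {Λ : ℝ → Vec d} {lm lp : Vec d} {η w : Vec n}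
  {ℓ : Vec n →L[ℝ] ℝ} {b : Vec n →L[ℝ] Vec n →L[ℝ] ℝ} {k m ε C q r c : ℝ}

/-- A half of the local unstable manifold, from the edge state to the face `ℓ = c` of the block: it
is a limit of solutions that start on the unstable axis closer and closer to the edge state. -/
lemma IsLocalDichotomy.exists_branch (h : IsLocalDichotomy f lp η (unstableForm ℓ) b k m ε C)
    (hf : ContDiff ℝ 1 (fun p : Vec n × Vec d => f p.1 p.2)) (hη : f η lp = 0) (hr : 0 < r)
    (hqε : 2 * c ^ 2 ≤ m * ε ^ 2) (hc : c ≠ 0) (hw : ℓ w = 1)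
    (hbw : ∀ t : ℝ, b (t • w) (t • w) = 0) :
    ∃ x, IsSol f (fun _ => lp) r (Iic 0) x ∧ (∀ t ≤ 0, ‖x t - η‖ ≤ ε) ∧ ℓ (x 0 - η) = c ∧
      Tendsto x atBot (𝓝 η) := by
  have hk := h.k_pos
  have hq : 0 < c ^ 2 := by positivity
  obtain ⟨F, hF, K, M, hT⟩ := exists_tame hf (‖η‖ + ε) ‖lp‖
  have hFball : ∀ v l', ‖v - η‖ ≤ ε → F v l' = f v l' := fun v l' hv => hF v l' (by
    have := norm_add_le (v - η) η
    rw [sub_add_cancel] at this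
    linarith)
  have hFη : F η lp = 0 := by rw [hFball η lp (by simpa using h.ε_pos.le), hη]
  have hG : IsLocalDichotomy F lp η (unstableForm ℓ) b k m ε C := h.congr hFball
  -- the starting points lie strictly between the edge state and the face, and tend to the edge
  -- state
  have hstart : ∀ j : ℕ, ∃ z, IsSol F (fun _ => lp) r univ z ∧
      z 0 = η + (c / (j + 2)) • w := fun j =>
    hT.exists_isSol (Λ := fun _ => lp) continuous_const (fun _ => le_rfl) r 0 _
  choose z hz hz0 using hstart
  have hc2 : ∀ j : ℕ, 0 < (c / (j + 2)) ^ 2 ∧ (c / (j + 2)) ^ 2 < c ^ 2 := fun j => by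
    have hj : (0 : ℝ) ≤ j := j.cast_nonneg
    refine ⟨by positivity, ?_⟩
    rw [div_pow, div_lt_iff₀ (by positivity)]
    exact lt_mul_of_one_lt_right hq (by nlinarith)
  have hp0 : ∀ j, unstableForm ℓ (z j 0 - η) (z j 0 - η) = (c / (j + 2)) ^ 2 := fun j => by
    rw [hz0, add_sub_cancel_left, unstableForm_apply, map_smul, hw, smul_eq_mul, mul_one, sq]
  have hb0 : ∀ j, b (z j 0 - η) (z j 0 - η) = 0 := fun j => by
    rw [hz0, add_sub_cancel_left, hbw]
  have hgrow : ∀ j T, (∀ t ∈ Icc 0 T, ‖z j t - η‖ ≤ ε) → ∀ t ∈ Icc 0 T,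
      Real.exp (2 * r⁻¹ * k * t) * (c / (j + 2)) ^ 2 ≤
        unstableForm ℓ (z j t - η) (z j t - η) := fun j T hε t ht => by
    rw [← hp0 j]
    exact hG.expand hr hFη ((hz j).mono (subset_univ _)) hε
      (by rw [hp0, hb0]; exact (hc2 j).1.le) t ht
  have hexit : ∀ j, ∃ t > 0, unstableForm ℓ (z j t - η) (z j t - η) = c ^ 2 ∧
      ∀ s ∈ Icc 0 t, unstableForm ℓ (z j s - η) (z j s - η) ≤ c ^ 2 ∧
        b (z j s - η) (z j s - η) ≤ c ^ 2 := fun j => by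
    refine hG.exists_exit hr hq hqε ((hz j).mono (subset_univ _))
      (fun t _ => by simpa using h.ε_pos.le) (fun t _ => by rw [hFη]; simp; positivity)
      (by rw [hp0]; exact (hc2 j).2) (by rw [hb0]; exact hq) ?_
    by_contra! hcon
    have hin : ∀ t ≥ 0, unstableForm ℓ (z j t - η) (z j t - η) < c ^ 2 ∧
        b (z j t - η) (z j t - η) < c ^ 2 := fun t ht => max_lt_iff.1 (hcon t ht)
    have hlim : Tendsto (fun t => Real.exp (2 * r⁻¹ * k * t) * (c / (j + 2)) ^ 2) atTop atTop :=
      (Real.tendsto_exp_atTop.comp (tendsto_id.const_mul_atTop (by positivity))).atTop_mul_const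
        (hc2 j).1
    obtain ⟨t, ht, ht0⟩ := ((hlim.eventually_ge_atTop (c ^ 2)).and (eventually_ge_atTop 0)).exists
    have h1 := hgrow j t (fun s hs => h.norm_le hqε (hin s hs.1).1.le (hin s hs.1).2.le) t
      (right_mem_Icc.2 ht0)
    linarith [(hin t ht0).1]
  choose τ hτ hτq hτin using hexit
  have hzf : ∀ j, IsSol f (fun _ => lp) r (Icc 0 (τ j)) (z j) := fun j =>
    ((hz j).mono (subset_univ _)).congr_field fun t ht =>
      (hFball _ _ (h.norm_le hqε (hτin j t ht).1 (hτin j t ht).2)).symm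
  have hz0lim : Tendsto (fun j => z j 0) atTop (𝓝 η) := by
    simp only [hz0]
    have h1 : Tendsto (fun j : ℕ => c / ((j : ℝ) + 2)) atTop (𝓝 0) :=
      tendsto_const_nhds.div_atTop
        (tendsto_atTop_add_const_right _ _ tendsto_natCast_atTop_atTop)
    have h2 := (h1.smul_const w).const_add η
    simpa using h2
  have hτlim := tendsto_exit_time (rs := fun _ => r) hf continuous_const (isSol_const (r := r) hη)
    (fun t _ => by simpa using hq) tendsto_const_nhds hz0lim (fun j => (hτ j).le) hzf hτq
  obtain ⟨x, φ, hφ, hlim, hx, hxD, -, hxη⟩ := h.exists_exit_limit (rs := fun _ => r) hf hη hr hqε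
    continuous_const tendsto_const_nhds tendsto_const_nhds (fun j => (hτ j).le) hτlim hzf hτq hτin
  refine ⟨x, hx, fun t ht => h.norm_le hqε (hxD t ht).1 (hxD t ht).2, ?_, hxη⟩
  -- `ℓ` cannot change sign before the exit since its square grows, so the solutions leave through
  -- the face on the side of `c`
  have hsign : ∀ j, ℓ (z j (τ j) - η) = c := fun j => by
    have hτj := (hτ j).le
    have hcont : ContinuousOn (fun t => c * ℓ (z j t - η)) (Icc 0 (τ j)) := by
      have h1 : Continuous fun v : Vec n => c * ℓ (v - η) := by fun_prop
      exact h1.comp_continuousOn (hzf j).continuousOn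
    have hpos : 0 < c * ℓ (z j 0 - η) := by
      have hj : (0 : ℝ) ≤ j := j.cast_nonneg
      rw [hz0, add_sub_cancel_left, map_smul, hw, smul_eq_mul, mul_one, mul_div_assoc', ← sq]
      positivity
    have hne : ∀ t ∈ Icc 0 (τ j), c * ℓ (z j t - η) ≠ 0 := fun t ht h0 => by
      have h1 := hgrow j (τ j) (fun s hs => h.norm_le hqε (hτin j s hs).1 (hτin j s hs).2) t ht
      rw [unstableForm_apply, (mul_eq_zero.1 h0).resolve_left hc] at h1
      have := mul_pos (Real.exp_pos (2 * r⁻¹ * k * t)) (hc2 j).1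
      linarith
    have hpos' : 0 < c * ℓ (z j (τ j) - η) := by
      by_contra hneg
      obtain ⟨t, ht, ht0⟩ := intermediate_value_Icc' hτj hcont ⟨not_lt.1 hneg, hpos.le⟩
      exact hne t ht ht0
    have hsq := hτq j
    rw [unstableForm_apply, ← sq, sq_eq_sq_iff_eq_or_eq_neg] at hsq
    refine hsq.resolve_right fun h1 => ?_
    rw [h1] at hpos'
    linarith [sq c]
  have hℓ : Continuous fun v : Vec n => ℓ (v - η) := by fun_prop
  exact tendsto_nhds_unique ((hℓ.tendsto _).comp hlim)
    (tendsto_const_nhds.congr fun j => (hsign _).symm)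

/-- Every nontrivial backward orbit asymptotic to the edge state enters the block along one of two
given halves of the local unstable manifold. -/
lemma IsLocalDichotomy.exists_reaches (h : IsLocalDichotomy f lp η (unstableForm ℓ) b k m ε C)
    (hf : ContDiff ℝ 1 (fun p : Vec n × Vec d => f p.1 p.2)) (hη : f η lp = 0) (hr : 0 < r)
    (hqε : 2 * c ^ 2 ≤ m * ε ^ 2) (hc : c ≠ 0) {xs : ℝ → ℝ → Vec n}
    (hxs : ∀ a, a ^ 2 = c ^ 2 → IsSol f (fun _ => lp) r (Iic 0) (xs a) ∧
      (∀ t ≤ 0, ‖xs a t - η‖ ≤ ε) ∧ ℓ (xs a 0 - η) = a ∧ Tendsto (xs a) atBot (𝓝 η))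
    {x : ℝ → Vec n} (hx : IsSol f (fun _ => lp) r (Iic 0) x) (hxη : Tendsto x atBot (𝓝 η))
    (hx0 : x 0 ≠ η) :
    ∃ a, (a = c ∨ a = -c) ∧ ∃ T ≤ 0, ∃ t ≤ 0, xs a t = x T := by
  have hq : 0 < c ^ 2 := by positivity
  have hℓ : Continuous fun v : Vec n => ℓ (v - η) := by fun_prop
  have hev : ∀ᶠ v in 𝓝 η, ‖v - η‖ ≤ ε ∧ (ℓ (v - η)) ^ 2 ≤ c ^ 2 := by
    refine (eventually_norm_sub_le tendsto_id h.ε_pos).and ?_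
    have h1 : Tendsto (fun v => (ℓ (v - η)) ^ 2) (𝓝 η) (𝓝 0) := by
      have := (hℓ.tendsto η).pow 2
      simpa using this
    exact h1.eventually_le_const hq
  obtain ⟨T, hT⟩ := eventually_atBot.1 ((hxη.eventually hev).and (eventually_le_atBot 0))
  have hT0 : T ≤ 0 := (hT T le_rfl).2
  have hT1 : ∀ t ≤ T, ‖x t - η‖ ≤ ε := fun t ht => (hT t ht).1.1
  have hεc : ∀ t ≤ (0 : ℝ), ‖(fun _ => lp : ℝ → Vec d) t - lp‖ ≤ ε := fun _ _ => by
    simpa using h.ε_pos.le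
  have hxT : IsSol f (fun _ => lp) r (Iic 0) (fun t => x (t + T)) :=
    (hx.comp_add T).mono fun t ht => by
      change t + T ≤ 0
      linarith [mem_Iic.1 ht]
  have hxTε : ∀ t ≤ 0, ‖x (t + T) - η‖ ≤ ε := fun t ht => hT1 _ (by linarith)
  -- a point of the unstable cone with vanishing unstable part is the edge state itself
  have hℓ0 : ℓ (x T - η) ≠ 0 := fun h0 => by
    have h1 := h.le_of_past hr hxT (isSol_const hη) hxTε (fun t _ => by simpa using h.ε_pos.le)
      hεc 0 le_rfl
    have h2 := h.eq_zero h1 (by simp [unstableForm_apply, h0])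
    refine hx0 (IsSol.eqOn hf continuous_const ordConnected_Iic hx (isSol_const hη) hT0 ?_
      self_mem_Iic)
    simpa [sub_eq_zero] using h2
  obtain ⟨a, ha, haℓ⟩ : ∃ a, (a = c ∨ a = -c) ∧ 0 < a * ℓ (x T - η) := by
    rcases lt_or_gt_of_ne (mul_ne_zero hc hℓ0) with h1 | h1
    · exact ⟨-c, Or.inr rfl, by linarith⟩
    · exact ⟨c, Or.inl rfl, h1⟩
  have ha2 : a ^ 2 = c ^ 2 := by rcases ha with rfl | rfl <;> ring
  obtain ⟨hy, hyε, hy0, hyη⟩ := hxs a ha2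
  refine ⟨a, ha, T, hT0, ?_⟩
  have hle : a * ℓ (x T - η) ≤ a * ℓ (xs a 0 - η) := by
    rw [hy0]
    have h1 := (hT T le_rfl).1.2
    nlinarith [sq_nonneg (a - ℓ (x T - η))]
  have hlim : Tendsto (fun t => a * ℓ (xs a t - η)) atBot (𝓝 0) := by
    have := ((hℓ.const_mul a).tendsto η).comp hyη
    simpa [Function.comp_def] using this
  obtain ⟨S, hS, hS0⟩ := ((hlim.eventually_lt_const haℓ).and (eventually_le_atBot 0)).exists
  have hcont : ContinuousOn (fun t => a * ℓ (xs a t - η)) (Icc S 0) :=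
    (hℓ.const_mul a).comp_continuousOn (hy.continuousOn.mono Icc_subset_Iic_self)
  obtain ⟨t, ht, hta⟩ := intermediate_value_Icc hS0 hcont ⟨hS.le, hle⟩
  refine ⟨t, ht.2, ?_⟩
  have ha0 : a ≠ 0 := fun h0 => by simp [h0] at haℓ
  have hta' : ℓ (xs a t - η) = ℓ (x T - η) := mul_left_cancel₀ ha0 hta
  have hyt : IsSol f (fun _ => lp) r (Iic 0) (fun s => xs a (s + t)) :=
    (hy.comp_add t).mono fun s hs => by
      change s + t ≤ 0
      linarith [mem_Iic.1 hs, ht.2]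
  -- two orbits of the unstable manifold with the same `ℓ`-coordinate at one time coincide by the
  -- backward cone estimate
  have h1 := h.le_of_past hr hyt hxT (fun s hs => hyε _ (by linarith [ht.2])) hxTε hεc 0 le_rfl
  have h2 := h.eq_zero h1 (by
    have h3 : ℓ (xs a (0 + t) - x (0 + T)) = 0 := by
      rw [zero_add, zero_add, ← sub_sub_sub_cancel_right _ _ η, map_sub, hta', sub_self]
    rw [unstableForm_apply, h3, mul_zero])
  simpa [sub_eq_zero] using h2

/-- The halves of the local unstable manifold on the two sides of the edge state lie on different
orbits. -/
lemma IsLocalDichotomy.not_reaches (h : IsLocalDichotomy f lp η (unstableForm ℓ) b k m ε C)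
    (hf : ContDiff ℝ 1 (fun p : Vec n × Vec d => f p.1 p.2)) (hη : f η lp = 0) (hr : 0 < r)
    (hc : c ≠ 0) {x y : ℝ → Vec n} (hx0 : ℓ (x 0 - η) = c)
    (hy : IsSol f (fun _ => lp) r (Iic 0) y) (hyε : ∀ t ≤ 0, ‖y t - η‖ ≤ ε)
    (hy0 : ℓ (y 0 - η) = -c) : ¬ Reaches f lp r (x 0) (y 0) := by
  rintro ⟨t, ht, z, hz, hz0, hzt⟩
  have h1 : x 0 = y (-t) := by
    have h2 := IsSol.eqOn hf continuous_const ordConnected_Icc hz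
      ((hy.comp_add (-t)).mono fun s hs => by
        change s + -t ≤ 0
        linarith [hs.2]) (right_mem_Icc.2 ht) (by simpa using hzt)
      (left_mem_Icc.2 ht)
    simpa [hz0] using h2
  -- otherwise `y` would have passed `x 0` earlier, where the unstable part has the same size as
  -- at `y 0`, contrary to its strict growth
  have h2 := h.decay_past hr hη hy hyε le_rfl (neg_nonpos.2 ht)
  have hq : 0 < c ^ 2 := by positivity
  rw [← h1, unstableForm_apply, unstableForm_apply, hx0, hy0] at h2
  have h3 : 1 ≤ Real.exp (-(2 * r⁻¹ * k * (0 - -t))) := by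
    by_contra hcon
    nlinarith
  have hk := h.k_pos
  rw [Real.one_le_exp_iff] at h3
  have ht0 : t = 0 := by
    by_contra hne
    have h4 : 0 < t := lt_of_le_of_ne ht (Ne.symm hne)
    have : 0 < 2 * r⁻¹ * k * t := by positivity
    linarith
  rw [ht0, neg_zero] at h1
  rw [h1, hy0] at hx0
  exact hc (by linarith)

/-- The two branches are the orbits through the points where the local unstable manifold meets the
faces `ℓ = √q` and `ℓ = -√q` of the block. -/
theorem ncard_isUnstableBranch {α : ℝ} {σ₀ : ℝ} (hE : IsEdgeBlock f Λ lp η ℓ w b k m ε C q α σ₀)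
    (hf : ContDiff ℝ 1 (fun p : Vec n × Vec d => f p.1 p.2)) (hη : f η lp = 0) (hα : 0 < α)
    (hr : 0 < r) : {B | IsUnstableBranch (compField f Λ lm lp α r) (η, 1) B}.ncard = 2 := by
  have h := hE.block.dich
  set c := √q with hcdef
  have hc : c ≠ 0 := (Real.sqrt_pos.2 hE.block.q_pos).ne'
  have hcq : c ^ 2 = q := Real.sq_sqrt hE.block.q_pos.le
  have hqε : 2 * c ^ 2 ≤ m * ε ^ 2 := by rw [hcq]; exact hE.block.q_le
  have hbw : ∀ t : ℝ, b (t • w) (t • w) = 0 := fun t => by simpa using hE.b_w 0 t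
  have hex : ∀ a : ℝ, ∃ x, a ^ 2 = c ^ 2 → IsSol f (fun _ => lp) r (Iic 0) x ∧
      (∀ t ≤ 0, ‖x t - η‖ ≤ ε) ∧ ℓ (x 0 - η) = a ∧ Tendsto x atBot (𝓝 η) := fun a => by
    by_cases ha : a ^ 2 = c ^ 2
    · have ha0 : a ≠ 0 := fun h0 => hc (by simpa [h0] using ha.symm)
      obtain ⟨x, hx⟩ := h.exists_branch hf hη hr (c := a) (by rw [ha]; exact hqε) ha0 hE.ell_w hbw
      exact ⟨x, fun _ => hx⟩
    · exact ⟨fun _ => 0, fun h1 => absurd h1 ha⟩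
  choose xs hxs using hex
  obtain ⟨h1, h1ε, h10, h1η⟩ := hxs c rfl
  obtain ⟨h2, h2ε, h20, h2η⟩ := hxs (-c) (by ring)
  have hne : ∀ a : ℝ, a ≠ 0 → ℓ (xs a 0 - η) = a → xs a 0 ≠ η := fun a ha h0 heq => by
    rw [heq, sub_self, map_zero] at h0
    exact ha h0.symm
  have hset : {B | IsUnstableBranch (compField f Λ lm lp α r) (η, 1) B} =
      {orbit (compField f Λ lm lp α r) (xs c 0, 1),
        orbit (compField f Λ lm lp α r) (xs (-c) 0, 1)} := by
    ext B
    simp only [mem_ofPred_eq, mem_insert_iff, mem_singleton_iff]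
    constructor
    · rintro ⟨⟨v, s⟩, hv, hvne, rfl⟩
      obtain ⟨rfl, x, hx, rfl, hxη⟩ := (mem_unstableManifold_future_iff hα).1 hv
      obtain ⟨a, ha, T, hT, t, ht, heq⟩ := h.exists_reaches hf hη hr hqε hc hxs hx hxη
        (fun h0 => hvne (by rw [h0]))
      have ha2 : a ^ 2 = c ^ 2 := by rcases ha with rfl | rfl <;> ring
      have e1 : orbit (compField f Λ lm lp α r) (x 0, 1) =
          orbit (compField f Λ lm lp α r) (x T, 1) :=
        orbit_one_eq hf (Or.inr (reaches_of_isSol ordConnected_Iic hx hT self_mem_Iic hT))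
      have e2 : orbit (compField f Λ lm lp α r) (xs a 0, 1) =
          orbit (compField f Λ lm lp α r) (xs a t, 1) :=
        orbit_one_eq hf (Or.inr (reaches_of_isSol ordConnected_Iic (hxs a ha2).1 ht self_mem_Iic
          ht))
      rw [e1, ← heq, ← e2]
      rcases ha with rfl | rfl
      · exact Or.inl rfl
      · exact Or.inr rfl
    · rintro (rfl | rfl)
      · refine ⟨_, (mem_unstableManifold_future_iff hα).2 ⟨rfl, _, h1, rfl, h1η⟩, fun h0 => ?_, rfl⟩
        exact hne c hc h10 (congrArg Prod.fst h0)
      · refine ⟨_, (mem_unstableManifold_future_iff hα).2 ⟨rfl, _, h2, rfl, h2η⟩, fun h0 => ?_, rfl⟩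
        exact hne (-c) (neg_ne_zero.2 hc) h20 (congrArg Prod.fst h0)
  rw [hset]
  refine ncard_pair fun heq => ?_
  have hmem : (xs c 0, (1 : ℝ)) ∈ orbit (compField f Λ lm lp α r) (xs (-c) 0, 1) := by
    rw [← heq, mem_orbit_one_iff]
    exact ⟨rfl, Or.inl (reaches_of_isSol ordConnected_Iic h1 self_mem_Iic self_mem_Iic le_rfl)⟩
  rcases (mem_orbit_one_iff.1 hmem).2 with h3 | h3
  · exact h.not_reaches hf hη hr (neg_ne_zero.2 hc) h20 h1 h1ε (by rw [h10, neg_neg]) h3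
  · exact h.not_reaches hf hη hr hc h10 h2 h2ε h20 h3

/-- The states of a threshold converge to `η` by definition, and the compactified time tends to
`1`. -/
lemma IsRTippingThreshold.embedThreshold_subset {α τ₁ : ℝ} {Θ : ℝ → Set (Vec n)} (hα : 0 < α)
    (h : IsRTippingThreshold f Λ r η τ₁ Θ) :
    embedThreshold α τ₁ Θ ⊆ stableManifold (compField f Λ lm lp α r) (η, 1) := by
  rintro ⟨v, s⟩ ⟨τ, hτ, hv, hs⟩
  simp only at hv hs
  subst hs
  obtain ⟨z, hz, rfl, -, hlim⟩ := h.invariant_and_stable τ hτ v hv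
  refine ⟨_, isTrajectory_compTime hα (x := fun t => z (t + τ)) (τ := τ)
    ((hz.comp_add τ).mono fun t ht => ?_), by simp, ?_⟩
  · change τ ≤ t + τ
    linarith [mem_Ici.1 ht]
  · have h1 : Tendsto (fun t => t + τ) atTop atTop := tendsto_atTop_add_const_right _ _ tendsto_id
    exact (hlim.comp h1).prodMk_nhds ((tendsto_compTime_atTop hα).comp h1)

/-- The equilibrium `(η, 1)` of the compactified system is a saddle whose unstable manifold has two
branches and whose stable manifold contains every threshold anchored by `η`. -/
theorem isSaddle_and_branches (hf : ContDiff ℝ 1 (fun p : Vec n × Vec d => f p.1 p.2))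
    (hΛ : ContDiff ℝ 1 Λ) {ρ α : ℝ} (hexp : IsExpBiAsymptoticallyConstant Λ ρ lm lp) (hα : 0 < α)
    (hαρ : α < ρ) (he : IsEquilibriumRegularEdgeState f lp η) (hr : 0 < r) :
    IsSaddle (compField f Λ lm lp α r) (η, 1) ∧
      {B | IsUnstableBranch (compField f Λ lm lp α r) (η, 1) B}.ncard = 2 ∧
      ∀ (τ₁ : ℝ) (Θ : ℝ → Set (Vec n)), IsRTippingThreshold f Λ r η τ₁ Θ →
        embedThreshold α τ₁ Θ ⊆ stableManifold (compField f Λ lm lp α r) (η, 1) := by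
  have hd : HasDerivAt (compInput Λ lm lp α) 0 1 := hasDerivAt_compInput_one hΛ hexp hα hαρ
  obtain ⟨ℓ, w, b, k, m, ε, C, q, σ₀, hE⟩ := he.exists_isEdgeBlock hf hΛ hα hexp.tendsto_future
    (hexp.tendsto_exp_smul_deriv hαρ)
  exact ⟨isSaddle_of_edge hf hd hα hr he, ncard_isUnstableBranch hE hf he.1 hα hr,
    fun τ₁ Θ h => h.embedThreshold_subset hα⟩

end Branches

/-! ### Dependence of the solutions `x^[r]` on the rate -/

section Rates

variable {f : Vec n → Vec d → Vec n} {Λ : ℝ → Vec d} {lm lp : Vec d} {e η : Vec n}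
  {r rc τ T ρ α : ℝ} {o : Origin n} {v : Vec n} {w x y : ℝ → Vec n} {J : Set ℝ}

lemma Origin.Ici_subset_times (hτ : τ ∈ o.times) : Ici τ ⊆ o.times := by
  cases o with
  | point x₀ τ₀ => exact Ici_subset_Ici.2 hτ
  | past e => exact subset_univ _

lemma Origin.Starts.congr (hτ : τ ∈ o.times) (hy : o.Starts y) (h : EqOn x y (o.times ∩ Iic τ)) :
    o.Starts x := by
  cases o with
  | point x₀ τ₀ => exact (h ⟨self_mem_Ici, hτ⟩).trans hy
  | past e =>
    refine Tendsto.congr' ?_ hy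
    filter_upwards [eventually_le_atBot τ] with t ht using (h ⟨mem_univ _, ht⟩).symm

/-- A solution from the state `x^[r](τ)` continues `x^[r]`. -/
lemma Origin.Value.glue (hv : o.Value f Λ r τ v) (hJ : J ⊆ Ici 0) (h0 : (0 : ℝ) ∈ J)
    (hw : IsSol f (fun t => Λ (t + τ)) r J w) (hw0 : w 0 = v) :
    ∃ x, IsSol f Λ r (o.times ∩ Iic τ ∪ (fun t => t + -τ) ⁻¹' J) x ∧ o.Starts x ∧
      ∀ t ∈ J, x (t + τ) = w t := by
  obtain ⟨hτ, y, hy, hys, rfl⟩ := hv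
  have hw' : IsSol f Λ r ((fun t => t + -τ) ⁻¹' J) (fun t => w (t + -τ)) := by
    simpa using hw.comp_add (-τ)
  obtain ⟨x, hx, e1, e2⟩ := hy.glue (b := τ) inter_subset_right
    (fun t ht => by
      have := mem_Ici.1 (hJ ht)
      exact mem_Ici.2 (by linarith)) ⟨hτ, self_mem_Iic⟩ (by simpa using h0) hw' (by simp [hw0])
  refine ⟨x, hx, hys.congr hτ e1, fun t ht => ?_⟩
  rw [e2 (show t + τ + -τ ∈ J by simpa using ht)]
  simp

/-- A solution from the state `x^[r](τ)` on a finite interval gives later values of `x^[r]`. -/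
lemma Origin.Value.extend (hv : o.Value f Λ r τ v) {t : ℝ} (ht : 0 ≤ t)
    (hw : IsSol f (fun t => Λ (t + τ)) r (Icc 0 t) w) (hw0 : w 0 = v) :
    o.Value f Λ r (τ + t) (w t) := by
  obtain ⟨x, hx, hxs, h⟩ := hv.glue (fun s hs => hs.1) (left_mem_Icc.2 ht) hw hw0
  refine ⟨Origin.Ici_subset_times hv.1 (by simpa using ht), x, hx.mono fun s hs => ?_, hxs, ?_⟩
  · rcases le_total s τ with h1 | h1
    · exact Or.inl ⟨hs.1, h1⟩
    · exact Or.inr ⟨by linarith, by linarith [mem_Iic.1 hs.2]⟩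
  · rw [add_comm]
    exact h t (right_mem_Icc.2 ht)

/-- If the solution from the state `x^[r](τ)` converges to `η`, so does `x^[r]`. -/
lemma Origin.Value.converges (hv : o.Value f Λ r τ v)
    (hw : IsSol f (fun t => Λ (t + τ)) r (Ici 0) w) (hw0 : w 0 = v)
    (hlim : Tendsto w atTop (𝓝 η)) : o.Converges f Λ r η := by
  obtain ⟨x, hx, hxs, h⟩ := hv.glue subset_rfl self_mem_Ici hw hw0
  refine ⟨x, hx.mono fun s hs => ?_, hxs, ?_⟩
  · rcases le_total s τ with h1 | h1
    · exact Or.inl ⟨hs, h1⟩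
    · exact Or.inr (by simpa using h1)
  · refine (hlim.comp (tendsto_atTop_add_const_right _ (-τ) tendsto_id)).congr' ?_
    filter_upwards [eventually_ge_atTop τ] with t ht
    have h1 := h (t + -τ) (by simpa using ht)
    simpa using h1.symm

/-- The solution that limits to a sink depends continuously on the rate at one time, hence at all
later times: the solutions at nearby rates stay in the same block in the past, so that they
accumulate only on solutions with this property, and there is only one. -/
lemma exists_past_near (hf : ContDiff ℝ 1 (fun p : Vec n × Vec d => f p.1 p.2))
    (hΛ : ContDiff ℝ 1 Λ) (hexp : IsExpBiAsymptoticallyConstant Λ ρ lm lp) (hα : 0 < α)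
    (hαρ : α < ρ) (he : IsHyperbolicSink f lm e) (hrc : 0 < rc) (T : ℝ)
    (hx : IsSol f Λ rc (Iic T) x) (hxe : Tendsto x atBot (𝓝 e)) :
    ∃ τ₀ ≤ T, ∀ U ∈ 𝓝 (x τ₀), ∀ᶠ r in 𝓝 rc, ∃ y, IsSol f Λ r (Iic τ₀) y ∧
      Tendsto y atBot (𝓝 e) ∧ y τ₀ ∈ U := by
  obtain ⟨L, hL⟩ := hexp.exists_bound hΛ.continuous
  obtain ⟨b, k, m, ε, C, q, τ₁, h'⟩ := he.exists_isPastBlock hf hexp.tendsto_past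
  set τ₀ := min τ₁ T with hτ₀
  have h : IsPastBlock f Λ lm e b k m ε C q τ₀ := ⟨h'.dich, h'.q_pos, h'.q_le,
    fun t ht => h'.input t (ht.trans (min_le_left _ _)),
    fun t ht => h'.drift t (ht.trans (min_le_left _ _))⟩
  obtain ⟨F, hF, K, M, hT⟩ := exists_tame hf (‖e‖ + ε) L
  have hFf : ∀ v l, ‖v - e‖ ≤ ε → F v l = f v l := fun v l hv => hF v l (by
    have := norm_add_le (v - e) e
    rw [sub_add_cancel] at this
    linarith)
  have hex : ∀ r, ∃ y, 0 < r → IsSol f Λ r (Iic τ₀) y ∧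
      (∀ t ≤ τ₀, b (y t - e) (y t - e) ≤ q) ∧ Tendsto y atBot (𝓝 e) := fun r => by
    by_cases hr : 0 < r
    · obtain ⟨y, hy, hyq⟩ := (h.congr hFf).exists_isSol hT hΛ.continuous hL hr
      have hyf : IsSol f Λ r (Iic τ₀) y := (hy.mono (subset_univ _)).congr_field fun t ht =>
        (hFf _ _ (h.norm_le (hyq t ht))).symm
      exact ⟨y, fun _ => ⟨hyf, hyq, h.tendsto hf hΛ hexp hα hαρ he.1 hr hyf hyq⟩⟩
    · exact ⟨0, fun h1 => absurd h1 hr⟩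
  choose Y hY using hex
  have hYx : EqOn (Y rc) x (Iic τ₀) := IsSol.eqOn_of_tendsto_sink hf hΛ.continuous
    hexp.tendsto_past hrc he ordConnected_Iic Iio_subset_Iic_self (hY rc hrc).1
    (hx.mono (Iic_subset_Iic.2 (min_le_right _ _))) (hY rc hrc).2.2 hxe
  have hxε : ∀ t ≤ τ₀, ‖x t - e‖ ≤ ε := fun t ht => by
    rw [← hYx ht]
    exact h.norm_le ((hY rc hrc).2.1 t ht)
  have hlim : Tendsto (fun r => Y r τ₀) (𝓝 rc) (𝓝 (x τ₀)) := by
    refine tendsto_of_seq_tendsto fun rs hrs => ?_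
    -- every sequence of rates has a subsequence along which the values converge to a limit, and
    -- by uniqueness this is the value at `rc`
    refine tendsto_of_subseq_tendsto fun ns hns => ?_
    obtain ⟨N, hN⟩ := eventually_atTop.1 ((hrs.comp hns).eventually (lt_mem_nhds hrc))
    have hshift : Tendsto (fun j => rs (ns (j + N))) atTop (𝓝 rc) :=
      (hrs.comp hns).comp (tendsto_add_atTop_nat N)
    have hpos : ∀ j, 0 < rs (ns (j + N)) := fun j => hN _ (Nat.le_add_left _ _)
    have hin : ∀ j, ∀ t ≤ 0, Y (rs (ns (j + N))) (t + τ₀) ∈ Metric.closedBall e ε := fun j t ht => by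
      rw [mem_closedBall_iff_norm]
      exact h.norm_le ((hY _ (hpos j)).2.1 _ (by linarith))
    obtain ⟨x', φ, hφ, hlim, hx', hx'D⟩ := exists_past_limit (r := rc)
      (us := fun _ t => Λ (t + τ₀)) (xs := fun j t => Y (rs (ns (j + N))) (t + τ₀))
      (Ts := fun j => (j : ℝ)) hf (isCompact_closedBall e ε)
      (hΛ.continuous.comp (continuous_add_const τ₀)) (fun t => hL _) (hshift.inv₀ hrc.ne')
      (fun _ => hΛ.continuous.comp (continuous_add_const τ₀)) tendsto_natCast_atTop_atTop
      (fun S _ V hV => .of_forall fun j t _ => refl_mem_uniformity hV)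
      (fun j => ((hY _ (hpos j)).1.comp_add τ₀).mono fun t ht => by
        change t + τ₀ ≤ τ₀
        linarith [ht.2]) (fun j t ht => hin j t ht.2) (fun j => j.cast_nonneg)
    have heq : x' 0 = x (0 + τ₀) := h.dich.eq_of_past hrc hx' ((hx.comp_add τ₀).mono fun t ht => by
        change t + τ₀ ≤ T
        linarith [mem_Iic.1 ht, min_le_right τ₁ T]) (fun t ht => mem_closedBall_iff_norm.1 (hx'D t ht))
        (fun t ht => hxε (t + τ₀) (by linarith [mem_Iic.1 ht]))
        (fun t ht => h.input (t + τ₀) (by linarith [mem_Iic.1 ht]))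
    refine ⟨fun j => φ j + N, ?_⟩
    simpa [heq] using hlim
  refine ⟨τ₀, min_le_right _ _, fun U hU => ?_⟩
  filter_upwards [hlim hU, lt_mem_nhds hrc] with r h1 h2
  exact ⟨Y r, (hY r h2).1, (hY r h2).2.2, h1⟩

/-- The state `x^[r](T)` exists for `r` near `rc` and is continuous at `rc`. -/
lemma Origin.Value.eventually_near (hf : ContDiff ℝ 1 (fun p : Vec n × Vec d => f p.1 p.2))
    (hΛ : ContDiff ℝ 1 Λ) (hexp : IsExpBiAsymptoticallyConstant Λ ρ lm lp) (hα : 0 < α)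
    (hαρ : α < ρ) (ho : o.Admissible f lm) (hrc : 0 < rc) (hv : o.Value f Λ rc T v) {ε : ℝ}
    (hε : 0 < ε) : ∀ᶠ r in 𝓝 rc, ∃ v', o.Value f Λ r T v' ∧ ‖v' - v‖ < ε := by
  obtain ⟨hT, x, hx, hxs, rfl⟩ := hv
  have hinv : Tendsto (fun r : ℝ => r⁻¹) (𝓝 rc) (𝓝 rc⁻¹) := tendsto_inv₀ hrc.ne'
  cases o with
  | point x₀ τ₀ =>
    simp only [Origin.times, Ici_inter_Iic] at hx
    obtain ⟨δ, hδ, H⟩ := hx.exists_near hf hΛ.continuous hT hε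
    filter_upwards [Metric.tendsto_nhds.1 hinv δ hδ] with r hr
    obtain ⟨z, hz, hz0, hzx⟩ := H r Λ x₀ hΛ.continuous (by simpa [Real.dist_eq] using hr)
      (fun t _ => by simpa using hδ) (by rw [show x τ₀ = x₀ from hxs]; simpa using hδ)
    exact ⟨z T, ⟨hT, z, by simpa only [Origin.times, Ici_inter_Iic] using hz, hz0, rfl⟩,
      hzx T (right_mem_Icc.2 hT)⟩
  | past e =>
    simp only [Origin.times, univ_inter] at hx
    obtain ⟨τ₀, hτ₀, H₀⟩ := exists_past_near hf hΛ hexp hα hαρ ho hrc T hx hxs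
    obtain ⟨δ, hδ, H⟩ := (hx.mono (Icc_subset_Iic_self (a := τ₀))).exists_near hf hΛ.continuous
      hτ₀ hε
    filter_upwards [Metric.tendsto_nhds.1 hinv δ hδ, H₀ _ (Metric.ball_mem_nhds _ hδ)]
      with r hr ⟨y, hy, hye, hyx⟩
    obtain ⟨z, hz, hz0, hzx⟩ := H r Λ (y τ₀) hΛ.continuous (by simpa [Real.dist_eq] using hr)
      (fun t _ => by simpa using hδ) (by simpa [dist_eq_norm] using hyx)
    have hval : (Origin.past e).Value f Λ r τ₀ (y τ₀) :=
      ⟨mem_univ _, y, by simpa only [Origin.times, univ_inter] using hy, hye, rfl⟩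
    have h1 := hval.extend (sub_nonneg.2 hτ₀) (w := fun t => z (t + τ₀))
      ((hz.comp_add τ₀).mono fun t ht => ⟨by linarith [ht.1], by linarith [ht.2]⟩) (by simp [hz0])
    simp only [add_sub_cancel, sub_add_cancel] at h1
    exact ⟨z T, h1, hzx T (right_mem_Icc.2 hτ₀)⟩

end Rates

/-! ### Edge tails -/

section EdgeTail

variable {f : Vec n → Vec d → Vec n} {Λ : ℝ → Vec d} {lm lp : Vec d} {η : Vec n}
  {r rc T ρ α : ℝ} {o : Origin n} {v y : Vec n}

/-- What the solutions `x^[r_j]` pass at later and later times as `r_j → rc` accumulates on whole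
orbits of the future limit system. -/
lemma exists_value_near (hf : ContDiff ℝ 1 (fun p : Vec n × Vec d => f p.1 p.2))
    (hΛ : Continuous Λ) (hl : Tendsto Λ atTop (𝓝 lp)) {rs : ℕ → ℝ}
    (hrs : Tendsto (fun j => (rs j)⁻¹) atTop (𝓝 rc⁻¹)) {ts : ℕ → ℝ} (hts : Tendsto ts atTop atTop)
    {zs : ℕ → ℝ → Vec n} (hzs : ∀ j, IsSol f (fun t => Λ (t + T)) (rs j) (Icc 0 (ts j)) (zs j))
    (hval : ∀ j, o.Value f Λ (rs j) T (zs j 0)) (ht0 : ∀ j, 0 ≤ ts j)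
    (hlim : Tendsto (fun j => zs j (ts j)) atTop (𝓝 v))
    (hy : Reaches f lp rc v y ∨ Reaches f lp rc y v) {ε : ℝ} (hε : 0 < ε) :
    ∃ a, ∀ᶠ j in atTop, ∃ y', o.Value f Λ (rs j) (T + ts j + a) y' ∧ dist y y' < ε := by
  have hΛT : Continuous fun t => Λ (t + T) := hΛ.comp (continuous_add_const T)
  have hlT : Tendsto (fun t => Λ (t + T)) atTop (𝓝 lp) :=
    hl.comp (tendsto_atTop_add_const_right _ T tendsto_id)
  have hshift : ∀ j, IsSol f (fun t => Λ (t + ts j + T)) (rs j) (Icc (-ts j) 0)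
      (fun t => zs j (t + ts j)) := fun j =>
    ((hzs j).comp_add (ts j)).mono fun t ht => ⟨by linarith [ht.1], by linarith [ht.2]⟩
  have hvalt : ∀ j, ∀ t ∈ Icc 0 (ts j), o.Value f Λ (rs j) (T + t) (zs j t) := fun j t ht =>
    (hval j).extend ht.1 ((hzs j).mono (Icc_subset_Icc le_rfl ht.2)) rfl
  rcases hy with ⟨t, ht, w, hw, hw0, rfl⟩ | ⟨t, ht, w, hw, rfl, hwt⟩
  · obtain ⟨δ, hδ, H⟩ := hw.exists_near hf continuous_const ht hε
    refine ⟨t, ?_⟩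
    filter_upwards [Metric.tendsto_nhds.1 hrs δ hδ, Metric.tendsto_nhds.1 hlim δ hδ,
      Metric.tendstoUniformlyOn_iff.1 (tendstoUniformlyOn_shift hlT hts 0 t) δ hδ] with j h1 h2 h3
    obtain ⟨z, hz, hz0, hzw⟩ := H (rs j) (fun s => Λ (s + ts j + T)) (zs j (ts j))
      (hΛT.comp (continuous_add_const (ts j))) (by simpa [Real.dist_eq] using h1)
      (fun s hs => by rw [← dist_eq_norm, dist_comm]; exact h3 s hs)
      (by rw [hw0, ← dist_eq_norm]; exact h2)
    refine ⟨z t, (hvalt j (ts j) (right_mem_Icc.2 (ht0 j))).extend ht ?_ hz0, ?_⟩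
    · refine hz.congr_input fun s _ => ?_
      simp only
      congr 1
      ring
    · rw [dist_comm, dist_eq_norm]
      exact hzw t (right_mem_Icc.2 ht)
  · have hwl : IsSol f (fun _ => lp) rc (Icc (-t) 0) (fun s => w (s + t)) :=
      (hw.comp_add t).mono fun s hs => ⟨by linarith [hs.1], by linarith [hs.2]⟩
    have h1 := IsSol.tendsto_left hf continuous_const (neg_nonpos.2 ht) hwl
      (z := fun j s => zs j (s + ts j)) (Λ' := fun j s => Λ (s + ts j + T)) (𝓕 := atTop) (r' := rs)
      (by
        filter_upwards [hts.eventually_ge_atTop t] with j hj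
        exact (hshift j).mono (Icc_subset_Icc (neg_le_neg hj) le_rfl))
      (fun j => hΛT.comp (continuous_add_const (ts j))) hrs
      (tendstoUniformlyOn_shift hlT hts _ _) (by simpa [hwt] using hlim)
      (left_mem_Icc.2 (neg_nonpos.2 ht))
    simp only [neg_add_cancel] at h1
    refine ⟨-t, ?_⟩
    filter_upwards [Metric.tendsto_nhds.1 h1 ε hε, hts.eventually_ge_atTop t] with j h2 h3
    refine ⟨zs j (-t + ts j), ?_, by rw [dist_comm]; exact h2⟩
    rw [add_assoc, add_comm (ts j)]
    exact hvalt j _ ⟨by linarith, by linarith⟩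

/-- Along rates `r ∈ S`, `r → rc`, the solutions `x^[r]` follow the critical solution into the
block, but since they do not converge they leave it, later and later; their exit points accumulate
on the unstable manifold of the edge state. -/
theorem exists_branch_subset_closure (hf : ContDiff ℝ 1 (fun p : Vec n × Vec d => f p.1 p.2))
    (hΛ : ContDiff ℝ 1 Λ) (hexp : IsExpBiAsymptoticallyConstant Λ ρ lm lp) (hα : 0 < α)
    (hαρ : α < ρ) (he : IsEquilibriumRegularEdgeState f lp η) (ho : o.Admissible f lm)
    (hc : IsCriticalRate f Λ o η rc) {S : Set ℝ} (hS : rc ∉ S) (hne : (𝓝[S] rc).NeBot) :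
    ∃ B, IsUnstableBranch (compField f Λ lm lp α rc) (η, 1) B ∧
      ∀ p ∈ B, p.2 = 1 ∧ ∀ T, ∀ δ > 0,
        p.1 ∈ closure {y | ∃ τ > T, ∃ r ∈ S, |r - rc| < δ ∧ o.Value f Λ r τ y} := by
  obtain ⟨ℓ, w, b, k, m, ε, C, q, σ₀, hE⟩ := he.exists_isEdgeBlock hf hΛ hα hexp.tendsto_future
    (hexp.tendsto_exp_smul_deriv hαρ)
  have hB := hE.block
  have h := hB.dich
  set p := unstableForm ℓ with hp
  obtain ⟨hrc, ⟨x, hx, hxs, hxη⟩, δ₀, hδ₀, hnc⟩ := hc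
  have hcp : Continuous fun v : Vec n => p (v - η) (v - η) := by fun_prop
  have hcb : Continuous fun v : Vec n => b (v - η) (v - η) := by fun_prop
  have hopen : IsOpen {v : Vec n | p (v - η) (v - η) < q ∧ b (v - η) (v - η) < q} :=
    (isOpen_lt hcp continuous_const).inter (isOpen_lt hcb continuous_const)
  have hηin : η ∈ {v : Vec n | p (v - η) (v - η) < q ∧ b (v - η) (v - η) < q} := by
    simpa using hB.q_pos
  have htimes : ∀ᶠ t in atTop, t ∈ o.times := by
    cases o with
    | point x₀ τ₀ => exact eventually_ge_atTop τ₀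
    | past e => exact .of_forall mem_univ
  have hσ : Tendsto (fun t => Real.exp (-(α * t))) atTop (𝓝 0) :=
    Real.tendsto_exp_atBot.comp (tendsto_neg_atTop_atBot.comp (tendsto_id.const_mul_atTop hα))
  obtain ⟨T, hT⟩ := eventually_atTop.1 (((hxη.eventually (hopen.mem_nhds hηin)).and htimes).and
    (hσ.eventually_le_const hB.σ₀_pos))
  have hTt : T ∈ o.times := (hT T le_rfl).1.2
  set u : ℝ → Vec d := fun t => Λ (t + T) with hu
  have huT : u = tailInput Λ lp α (Real.exp (-(α * T))) := (tailInput_exp hα T).symm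
  have huc : Continuous u := hΛ.continuous.comp (continuous_add_const T)
  have hul : Tendsto u atTop (𝓝 lp) :=
    hexp.tendsto_future.comp (tendsto_atTop_add_const_right _ T tendsto_id)
  have huin : ∀ t ≥ 0, ‖u t - lp‖ ≤ ε := fun t ht => by
    rw [huT]
    exact hB.input _ (hB.tail_le hα (hT T le_rfl).2 ht)
  have hudr : ∀ t ≥ 0, C * ‖f η (u t)‖ ^ 2 ≤ k * q / 2 := fun t ht => by
    rw [huT]
    exact hB.drift _ (hB.tail_le hα (hT T le_rfl).2 ht)
  have hxT : IsSol f u rc (Ici 0) (fun t => x (t + T)) := (hx.comp_add T).mono fun t ht =>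
    Origin.Ici_subset_times hTt (by simpa using ht)
  have hxv : o.Value f Λ rc T (x T) :=
    ⟨hTt, x, hx.mono inter_subset_left, hxs, rfl⟩
  obtain ⟨L, hL⟩ := hexp.exists_bound hΛ.continuous
  obtain ⟨F, hF, K, M, hTF⟩ := exists_tame hf (‖η‖ + ε) L
  have hFf : ∀ v l', ‖v - η‖ ≤ ε → F v l' = f v l' := fun v l' hv => hF v l' (by
    have := norm_add_le (v - η) η
    rw [sub_add_cancel] at this
    linarith)
  have hG : IsLocalDichotomy F lp η p b k m ε C := h.congr hFf
  have hrate : ∀ j : ℕ, ∃ r ∈ S, 0 < r ∧ |r - rc| < 1 / ((j : ℝ) + 1) ∧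
      ¬ o.Converges f Λ r η ∧ ∃ v, o.Value f Λ r T v ∧ ‖v - x T‖ < 1 / ((j : ℝ) + 1) ∧
        p (v - η) (v - η) < q ∧ b (v - η) (v - η) < q := by
    intro j
    have hj : (0 : ℝ) < 1 / ((j : ℝ) + 1) := by positivity
    obtain ⟨ε', hε', hball⟩ := Metric.isOpen_iff.1 hopen (x T) (hT T le_rfl).1.1
    have h1 := hxv.eventually_near hf hΛ hexp hα hαρ ho hrc (lt_min hj hε')
    have h2 : ∀ᶠ r in 𝓝 rc, |r - rc| < min (1 / ((j : ℝ) + 1)) δ₀ :=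
      Metric.ball_mem_nhds rc (lt_min hj hδ₀)
    have hSmem : ∀ᶠ r in 𝓝[S] rc, r ∈ S := self_mem_nhdsWithin
    have h3 := (h1.and (h2.and (lt_mem_nhds hrc))).filter_mono
      (nhdsWithin_le_nhds (s := S))
    obtain ⟨r, ⟨⟨v, hv, hvx⟩, h2, h3⟩, hrS⟩ := (h3.and hSmem).exists
    have hne : r - rc ≠ 0 := fun h0 => hS (by rwa [sub_eq_zero.1 h0] at hrS)
    refine ⟨r, hrS, h3, h2.trans_le (min_le_left _ _),
      hnc r h3 (abs_pos.2 hne) (h2.trans_le (min_le_right _ _)), v, hv,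
      hvx.trans_le (min_le_left _ _), ?_⟩
    exact hball (by rw [mem_ball_iff_norm]; exact hvx.trans_le (min_le_right _ _))
  choose rs hrS hr0 hrj hrn vs hvs hvx hvp hvb using hrate
  have hzero : Tendsto (fun j : ℕ => 1 / ((j : ℝ) + 1)) atTop (𝓝 0) :=
    tendsto_one_div_add_atTop_nhds_zero_nat
  have hrslim : Tendsto rs atTop (𝓝 rc) := by
    rw [tendsto_iff_norm_sub_tendsto_zero]
    exact squeeze_zero (fun _ => norm_nonneg _) (fun j => (hrj j).le) hzero
  have hvslim : Tendsto vs atTop (𝓝 (x T)) := by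
    rw [tendsto_iff_norm_sub_tendsto_zero]
    exact squeeze_zero (fun _ => norm_nonneg _) (fun j => (hvx j).le) hzero
  have hrinv : Tendsto (fun j => (rs j)⁻¹) atTop (𝓝 rc⁻¹) := hrslim.inv₀ hrc.ne'
  -- solutions of the tame system from the states `x^[r_j](T)`, which solve the original system as
  -- long as they stay in the block
  choose z hz hz0 using fun j => hTF.exists_isSol (Λ := u) huc (fun t => hL _) (rs j) 0 (vs j)
  have hexit : ∀ j, ∃ t > 0, p (z j t - η) (z j t - η) = q ∧ ∀ s ∈ Icc 0 t,
      p (z j s - η) (z j s - η) ≤ q ∧ b (z j s - η) (z j s - η) ≤ q := fun j => by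
    refine hG.exists_exit (hr0 j) hB.q_pos hB.q_le ((hz j).mono (subset_univ _)) huin
      (fun t ht => ?_) (by rw [hz0]; exact hvp j) (by rw [hz0]; exact hvb j) ?_
    · rw [hFf η _ (by simpa using h.ε_pos.le)]
      exact hudr t ht
    · -- a solution that never leaves the block would converge to `η`
      by_contra! hcon
      have hin : ∀ t ≥ 0, ‖z j t - η‖ ≤ ε := fun t ht =>
        hB.norm_le (max_lt_iff.1 (hcon t ht)).1.le (max_lt_iff.1 (hcon t ht)).2.le
      have hzf : IsSol f u (rs j) (Ici 0) (z j) :=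
        ((hz j).mono (subset_univ _)).congr_field fun t ht => (hFf _ _ (hin t ht)).symm
      exact hrn j ((hvs j).converges hzf (hz0 j)
        (h.tendsto (hr0 j) hf he.1 hzf hin huin hul))
  choose ts ht0 htq htin using hexit
  have hzf : ∀ j, IsSol f u (rs j) (Icc 0 (ts j)) (z j) := fun j =>
    ((hz j).mono (subset_univ _)).congr_field fun t ht =>
      (hFf _ _ (hB.norm_le (htin j t ht).1 (htin j t ht).2)).symm
  have hts : Tendsto ts atTop atTop := tendsto_exit_time (η := η) hf huc hxT
    (fun t ht => (hT (t + T) (by linarith)).1.1.1) hrinv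
    (by simpa [hz0] using hvslim) (fun j => (ht0 j).le) hzf htq
  obtain ⟨X, φ, hφ, hXlim, hX, -, hXq, hXη⟩ := h.exists_exit_limit hf he.1 hrc hB.q_le huc hul hrinv
    (fun j => (ht0 j).le) hts hzf htq htin
  have hXne : X 0 ≠ η := fun h0 => by
    rw [h0] at hXq
    simp only [sub_self, map_zero] at hXq
    exact hB.q_pos.ne hXq
  refine ⟨_, ⟨(X 0, 1), (mem_unstableManifold_future_iff hα).2 ⟨rfl, X, hX, rfl, hXη⟩,
    fun h0 => hXne (congrArg Prod.fst h0), rfl⟩, fun P hP => ?_⟩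
  obtain ⟨hP1, hPr⟩ := mem_orbit_one_iff.1 hP
  refine ⟨hP1, fun T' δ hδ => Metric.mem_closure_iff.2 fun ε' hε' => ?_⟩
  have hφt := hφ.tendsto_atTop
  obtain ⟨a, ha⟩ := exists_value_near (o := o) (T := T) hf hΛ.continuous hexp.tendsto_future
    (hrinv.comp hφt) (hts.comp hφt) (zs := fun j => z (φ j)) (fun j => hzf (φ j))
    (fun j => by rw [hz0]; exact hvs (φ j)) (fun j => (ht0 (φ j)).le) hXlim hPr hε'
  obtain ⟨j, ⟨⟨y', hy', hd⟩, h1⟩, h2⟩ := ((ha.and ((hts.comp hφt).eventually_gt_atTop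
    (T' - T - a))).and ((hrslim.comp hφt).eventually (Metric.ball_mem_nhds rc hδ))).exists
  simp only [Function.comp] at h1 h2 hy'
  exact ⟨y', ⟨_, by linarith, _, hrS _, h2, hy'⟩, hd⟩

/-- Each edge tail contains a branch of the unstable manifold of the edge state. -/
theorem exists_branch_subset_edgeTails (hf : ContDiff ℝ 1 (fun p : Vec n × Vec d => f p.1 p.2))
    (hΛ : ContDiff ℝ 1 Λ) (hexp : IsExpBiAsymptoticallyConstant Λ ρ lm lp) (hα : 0 < α)
    (hαρ : α < ρ) (he : IsEquilibriumRegularEdgeState f lp η) (ho : o.Admissible f lm)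
    (hc : IsCriticalRate f Λ o η rc) :
    (∃ B, IsUnstableBranch (compField f Λ lm lp α rc) (η, 1) B ∧
      B ⊆ embedFuture (upperEdgeTail f Λ o rc)) ∧
    (∃ B, IsUnstableBranch (compField f Λ lm lp α rc) (η, 1) B ∧
      B ⊆ embedFuture (lowerEdgeTail f Λ o rc)) := by
  constructor
  · obtain ⟨B, hB, H⟩ := exists_branch_subset_closure hf hΛ hexp hα hαρ he ho hc
      (S := Ioi rc) self_notMem_Ioi inferInstance
    refine ⟨B, hB, fun P hP => ⟨?_, (H P hP).1⟩⟩
    simp only [upperEdgeTail, mem_iInter]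
    intro T _ δ hδ
    refine closure_mono ?_ ((H P hP).2 T δ hδ)
    rintro y ⟨τ, hτ, r, hr, hrδ, hy⟩
    exact ⟨τ, hτ, r, ⟨hr, by linarith [(abs_lt.1 hrδ).2]⟩, hy⟩
  · obtain ⟨B, hB, H⟩ := exists_branch_subset_closure hf hΛ hexp hα hαρ he ho hc
      (S := Iio rc) self_notMem_Iio inferInstance
    refine ⟨B, hB, fun P hP => ⟨?_, (H P hP).1⟩⟩
    simp only [lowerEdgeTail, mem_iInter]
    intro T _ δ hδ
    refine closure_mono ?_ ((H P hP).2 T δ hδ)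
    rintro y ⟨τ, hτ, r, hr, hrδ, hy⟩
    exact ⟨τ, hτ, r, ⟨by linarith [(abs_lt.1 hrδ).1], hr⟩, hy⟩

end EdgeTail

end RTip

end

theorem mainTheorem5 {n d : ℕ} (f : RTip.Vec n → RTip.Vec d → RTip.Vec n)
    (hf : ContDiff ℝ 1 (fun p : RTip.Vec n × RTip.Vec d => f p.1 p.2))
    (Λ : ℝ → RTip.Vec d) (hΛ : ContDiff ℝ 1 Λ) (lm lp : RTip.Vec d) (ρ α : ℝ)
    (hexp : RTip.IsExpBiAsymptoticallyConstant Λ ρ lm lp) (hα : 0 < α) (hαρ : α < ρ) :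
    -- part (a)
    (∀ e : RTip.Vec n, RTip.IsHyperbolicSink f lm e →
      ∃ τ₀ : ℝ, ∀ r > 0, ∃ x : ℝ → RTip.Vec n,
        RTip.IsLocalPullbackAttractor f Λ r τ₀ x ∧ Tendsto x atBot (𝓝 e) ∧
        (∀ τ₁ ≤ τ₀, ∀ y : ℝ → RTip.Vec n, RTip.IsSol f Λ r (Iio τ₁) y →
          Tendsto y atBot (𝓝 e) → ∀ τ < τ₁, y τ = x τ) ∧
        RTip.IsSaddle (RTip.compField f Λ lm lp α r) (e, -1) ∧
        RTip.IsCurveOverTime (RTip.unstableManifold (RTip.compField f Λ lm lp α r) (e, -1)) ∧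
        ∀ τ < τ₀, ∀ y : RTip.Vec n,
          (y, RTip.compTime α τ) ∈
            RTip.unstableManifold (RTip.compField f Λ lm lp α r) (e, -1) ↔ y = x τ) ∧
    -- part (b)
    (∀ η : RTip.Vec n, RTip.IsEquilibriumRegularEdgeState f lp η →
      (∃ τ₀ : ℝ, ∀ r > 0, ∃ Θ : ℝ → Set (RTip.Vec n),
        RTip.IsRTippingThreshold f Λ r η τ₀ Θ ∧
        ∃ N : Set (RTip.Vec n × ℝ), IsOpen N ∧ (η, 1) ∈ N ∧
          RTip.IsTransverseHypersurface
            (RTip.localStableManifold (RTip.compField f Λ lm lp α r) (η, 1) N) ∧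
          ∀ τ > τ₀, Θ τ = {y | (y, RTip.compTime α τ) ∈
            RTip.localStableManifold (RTip.compField f Λ lm lp α r) (η, 1) N}) ∧
      (∀ r > 0, RTip.IsSaddle (RTip.compField f Λ lm lp α r) (η, 1) ∧
        {B | RTip.IsUnstableBranch (RTip.compField f Λ lm lp α r) (η, 1) B}.ncard = 2 ∧
        ∀ (τ₁ : ℝ) (Θ : ℝ → Set (RTip.Vec n)), RTip.IsRTippingThreshold f Λ r η τ₁ Θ →
          RTip.embedThreshold α τ₁ Θ ⊆
            RTip.stableManifold (RTip.compField f Λ lm lp α r) (η, 1)) ∧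
      ∀ o : RTip.Origin n, o.Admissible f lm → ∀ rc : ℝ, RTip.IsCriticalRate f Λ o η rc →
        (∃ B, RTip.IsUnstableBranch (RTip.compField f Λ lm lp α rc) (η, 1) B ∧
          B ⊆ RTip.embedFuture (RTip.upperEdgeTail f Λ o rc)) ∧
        (∃ B, RTip.IsUnstableBranch (RTip.compField f Λ lm lp α rc) (η, 1) B ∧
          B ⊆ RTip.embedFuture (RTip.lowerEdgeTail f Λ o rc))) := by
  exact ⟨fun e he => RTip.exists_pullbackAttractor hf hΛ hexp hα hαρ he,
    fun η hη => ⟨RTip.exists_threshold hf hΛ hexp hα hαρ hη,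
      fun r hr => RTip.isSaddle_and_branches hf hΛ hexp hα hαρ hη hr,
      fun o ho rc hc => RTip.exists_branch_subset_edgeTails hf hΛ hexp hα hαρ hη ho hc⟩⟩
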